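/- Let $M$ be a smooth manifold of real dimension $2n$ (Hausdorff, second countable, not necessarily compact) with a Kähler structure $(J,\bar g,\bar\omega)$, where $\bar\omega=\bar g(J\cdot,\cdot)$. Let $\overline{\mathrm{Ric}}$ be the Ricci tensor of $\bar g$ and $\bar\rho=\overline{\mathrm{Ric}}(J\cdot,\cdot)$ the Ricci form. Assume that $\overline{\mathrm{Ric}}$ is definite, i.e. positive definite at every point or negative definite at every point. Let $L$ be a compact smooth manifold of real dimension $n$ (without boundary; no orientation is needed). An immersion $\iota:L\to M$ is *totally real* if $\iota_*(T_pL)\cap J\iota_*(T_pL)=\{0\}$ for all $p\in L$. Its *$J$-volume* is $\mathrm{Vol}_J(\iota)=\int_L \mathrm{vol}_J[\iota]$, where $\mathrm{vol}_J[\iota](v_1,\dots,v_n)=\big(\det_{\mathbb C}\, h(\iota_*v_i,\iota_*v_j)\big)^{1/2}$ for a frame $v_1,\dots,v_n$ of $T_pL$, with $h=\bar g-i\bar\omega$. A totally real immersion is *$J$-minimal* if it is a critical point of $\mathrm{Vol}_J$. For a 2-form $\beta$ on $M$, an immersion $\iota:L\to M$ is *$\beta$-Lagrangian* if $\iota^*\beta=0$.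 Let $\iota:L\to M$ be a smooth $J$-minimal immersion. Let $I\subseteq\mathbb R$ be an interval containing $0$, and let $(J_t,\bar g_t,\bar\omega_t)_{t\in I}$ be a smooth curve of Kähler structures on $M$ (smooth jointly in $t$ and the point) which coincides with $(J,\bar g,\bar\omega)$ at $t=0$. Let $\bar\rho_t$ be the Ricci form of $(J_t,\bar g_t)$. 1. Assume that every $(J_t,\bar g_t,\bar\omega_t)$ is Kähler–Einstein, i.e. $\bar\rho_t=\lambda_t\bar\omega_t$ for a constant $\lambda_t\in\mathbb R$. Then there is a smooth curve of immersions $\iota_t:L\to M$ with $\iota_0=\iota$ such that each $\iota_t$ is $\bar\omega_t$-Lagrangian. 2. Assume that $J_t=J$ for all $t\in I$, that all $\bar\omega_t$ lie in the de Rham cohomology class of $\bar\omega$, and that the Ricci tensor of $\bar g_t$ (equivalently, $\bar\rho_t$) is definite for every $t\in I$. Then there is a smooth curve of immersions $\iota_t:L\to M$ with $\iota_0=\iota$ such that each $\iota_t$ is $\bar\rho_t$-Lagrangian. In both cases, if $M$ is compact, the curve $\iota_t$ is defined for all $t\in I$. If $M$ is not compact, it is defined for all $t$ in $I\cap U$ for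 some open interval $U\ni 0$. -/

import Mathlib

open scoped Manifold ContDiff

noncomputable section

namespace JMin

/-! Smooth `m`-manifolds are modelled on `EuclideanSpace ℝ (Fin m)` with model `𝓡 m`. Tensor fields
are handled through their components in the coordinate frames of the charts `extChartAt (𝓡 m) c`. -/

/-- The standard basis vectors of `ℝ^m`. -/
def stdVec (m : ℕ) (i : Fin m) : EuclideanSpace ℝ (Fin m) := EuclideanSpace.single i 1

/-- Partial derivative `∂_i f` on `ℝ^m`. -/
def pd {m : ℕ} (i : Fin m) (f : EuclideanSpace ℝ (Fin m) → ℝ) (y : EuclideanSpace ℝ (Fin m)) : ℝ :=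
  fderiv ℝ f y (stdVec m i)

section Tensors

variable {m : ℕ} {M : Type*} [TopologicalSpace M] [ChartedSpace (EuclideanSpace ℝ (Fin m)) M]

/-- The domain (in `ℝ^m`) of the coordinate parametrization of the chart centred at `c`. -/
def chartDom (m : ℕ) {M : Type*} [TopologicalSpace M]
    [ChartedSpace (EuclideanSpace ℝ (Fin m)) M] (c : M) : Set (EuclideanSpace ℝ (Fin m)) :=
  (extChartAt (𝓡 m) c).target

/-- The point of `M` with coordinates `y` in the chart centred at `c`. -/
def chartPt (c : M) (y : EuclideanSpace ℝ (Fin m)) : M := (extChartAt (𝓡 m) c).symm y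

/-- The coordinate vector `∂/∂y_i` of the chart centred at `c`, at the point with coordinates `y`. -/
def chartVec (c : M) (y : EuclideanSpace ℝ (Fin m)) (i : Fin m) :
    TangentSpace (𝓡 m) (chartPt c y) :=
  mfderiv (𝓡 m) (𝓡 m) (fun z => chartPt c z) y (stdVec m i)

/-- The `i`-th coordinate, in the chart centred at `c`, of a tangent vector `v` at `x`. -/
def vecCoord (c x : M) (v : TangentSpace (𝓡 m) x) (i : Fin m) : ℝ :=
  (show EuclideanSpace ℝ (Fin m) from
    mfderiv (𝓡 m) (𝓡 m) (extChartAt (𝓡 m) c) x v) i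

/-- Fields of covectors. -/
abbrev OneForm (m : ℕ) (M : Type*) [TopologicalSpace M]
    [ChartedSpace (EuclideanSpace ℝ (Fin m)) M] :=
  ∀ x : M, TangentSpace (𝓡 m) x →ₗ[ℝ] ℝ

/-- Fields of bilinear forms on the tangent spaces. -/
abbrev BilinField (m : ℕ) (M : Type*) [TopologicalSpace M]
    [ChartedSpace (EuclideanSpace ℝ (Fin m)) M] :=
  ∀ x : M, TangentSpace (𝓡 m) x →ₗ[ℝ] TangentSpace (𝓡 m) x →ₗ[ℝ] ℝ

/-- Fields of endomorphisms of the tangent spaces. -/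
abbrev EndField (m : ℕ) (M : Type*) [TopologicalSpace M]
    [ChartedSpace (EuclideanSpace ℝ (Fin m)) M] :=
  ∀ x : M, TangentSpace (𝓡 m) x →ₗ[ℝ] TangentSpace (𝓡 m) x

/-- Component `β_i` of a one-form in the chart centred at `c`. -/
def oneComp (β : OneForm m M) (c : M) (i : Fin m) (y : EuclideanSpace ℝ (Fin m)) : ℝ :=
  β (chartPt c y) (chartVec c y i)

/-- Component `B_{ij}` of a field of bilinear forms in the chart centred at `c`. -/
def bilinComp (B : BilinField m M) (c : M) (i j : Fin m) (y : EuclideanSpace ℝ (Fin m)) : ℝ :=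
  B (chartPt c y) (chartVec c y i) (chartVec c y j)

/-- Component `A^i_j` of a field of endomorphisms in the chart centred at `c`. -/
def endComp (A : EndField m M) (c : M) (i j : Fin m) (y : EuclideanSpace ℝ (Fin m)) : ℝ :=
  vecCoord c (chartPt c y) (A (chartPt c y) (chartVec c y j)) i

def OneForm.IsSmooth (β : OneForm m M) : Prop :=
  ∀ (c : M) (i : Fin m), ContDiffOn ℝ ∞ (oneComp β c i) (chartDom m c)

def BilinField.IsSmooth (B : BilinField m M) : Prop :=
  ∀ (c : M) (i j : Fin m), ContDiffOn ℝ ∞ (bilinComp B c i j) (chartDom m c)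

def EndField.IsSmooth (A : EndField m M) : Prop :=
  ∀ (c : M) (i j : Fin m), ContDiffOn ℝ ∞ (endComp A c i j) (chartDom m c)

/-- `dη = 0` for a two-form `η`. -/
def BilinField.IsClosed (η : BilinField m M) : Prop :=
  ∀ (c : M), ∀ y ∈ chartDom m c, ∀ i j k : Fin m,
    pd i (bilinComp η c j k) y + pd j (bilinComp η c k i) y + pd k (bilinComp η c i j) y = 0

/-- `η' - η = dβ` for some smooth one-form `β` on `M`: the two closed two-forms have the same
de Rham cohomology class. -/
def Cohomologous (η η' : BilinField m M) : Prop :=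
  ∃ β : OneForm m M, OneForm.IsSmooth β ∧
    ∀ (c : M), ∀ y ∈ chartDom m c, ∀ i j : Fin m,
      bilinComp η' c i j y - bilinComp η c i j y = pd i (oneComp β c j) y - pd j (oneComp β c i) y

/-- Vanishing of the Nijenhuis tensor
`N(X,Y) = [JX,JY] - J[JX,Y] - J[X,JY] - [X,Y]`, evaluated on coordinate vector fields. -/
def EndField.IsIntegrable (J : EndField m M) : Prop :=
  ∀ (c : M), ∀ y ∈ chartDom m c, ∀ i j k : Fin m,
    ∑ l, (endComp J c l i y * pd l (endComp J c k j) y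
        - endComp J c l j y * pd l (endComp J c k i) y
        + endComp J c k l y * pd j (endComp J c l i) y
        - endComp J c k l y * pd i (endComp J c l j) y) = 0

/-- The matrix `g_{ij}` in the chart centred at `c`. -/
def gram (g : BilinField m M) (c : M) (y : EuclideanSpace ℝ (Fin m)) : Matrix (Fin m) (Fin m) ℝ :=
  Matrix.of fun i j => bilinComp g c i j y

/-- Christoffel symbols `Γ^k_{ij}` of the Levi-Civita connection of `g` in the chart centred
at `c`. -/
def christoffel (g : BilinField m M) (c : M) (k i j : Fin m) (y : EuclideanSpace ℝ (Fin m)) : ℝ :=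
  (1 / 2) * ∑ l, (gram g c y)⁻¹ k l *
    (pd i (bilinComp g c j l) y + pd j (bilinComp g c i l) y - pd l (bilinComp g c i j) y)

/-- Components `Ric_{jk}` of the Ricci tensor of `g` in the chart centred at `c`. -/
def ricciComp (g : BilinField m M) (c : M) (j k : Fin m) (y : EuclideanSpace ℝ (Fin m)) : ℝ :=
  ∑ i, (pd i (christoffel g c i j k) y - pd j (christoffel g c i i k) y
    + ∑ p, (christoffel g c i i p y * christoffel g c p j k y
        - christoffel g c i j p y * christoffel g c p i k y))

/-- The Ricci tensor of `g` at the point `x`, computed in the chart centred at `x`. -/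
def ricci (g : BilinField m M) (x : M) (v w : TangentSpace (𝓡 m) x) : ℝ :=
  ∑ j, ∑ k, ricciComp g x j k (extChartAt (𝓡 m) x x) * vecCoord x x v j * vecCoord x x w k

end Tensors

/-- A Kähler structure `(J, g, ω)` on a smooth manifold of real dimension `2n`; the Kähler form is
`ω = g(J·,·)`, see `KahlerStructure.form`. -/
structure KahlerStructure (n : ℕ) (M : Type*) [TopologicalSpace M]
    [ChartedSpace (EuclideanSpace ℝ (Fin (2 * n))) M] where
  /-- the complex structure -/
  J : EndField (2 * n) M
  /-- the Riemannian metric -/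
  g : BilinField (2 * n) M
  smooth_J : EndField.IsSmooth J
  smooth_g : BilinField.IsSmooth g
  J_sq : ∀ x v, J x (J x v) = -v
  integrable : EndField.IsIntegrable J
  g_symm : ∀ x v w, g x v w = g x w v
  g_pos : ∀ x v, v ≠ 0 → 0 < g x v v
  g_J : ∀ x v w, g x (J x v) (J x w) = g x v w
  closed : BilinField.IsClosed (fun x => (g x).comp (J x))

namespace KahlerStructure

variable {n : ℕ} {M : Type*} [TopologicalSpace M] [ChartedSpace (EuclideanSpace ℝ (Fin (2 * n))) M]

/-- The Kähler form `ω(v,w) = g(Jv,w)`. -/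
def form (K : KahlerStructure n M) : BilinField (2 * n) M := fun x => (K.g x).comp (K.J x)

/-- The Ricci form `ρ(v,w) = Ric(Jv,w)`. -/
def ricciForm (K : KahlerStructure n M) (x : M) (v w : TangentSpace (𝓡 (2 * n)) x) : ℝ :=
  ricci K.g x (K.J x v) w

/-- `Ric` or `-Ric` is positive definite everywhere, i.e. `ρ` is a definite `(1,1)`-form. -/
def HasDefiniteRicci (K : KahlerStructure n M) : Prop :=
  (∀ x v, v ≠ 0 → 0 < ricci K.g x v v) ∨ (∀ x v, v ≠ 0 → ricci K.g x v v < 0)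

/-- Kähler–Einstein: `ρ = λ ω` for a real constant `λ`. -/
def IsKahlerEinstein (K : KahlerStructure n M) : Prop :=
  ∃ lam : ℝ, ∀ x v w, K.ricciForm x v w = lam * K.form x v w

end KahlerStructure

/-- A curve of Kähler structures is smooth on `S ⊆ ℝ` if the components of `J_t` and `g_t` are jointly
smooth in `t ∈ S` and the point. -/
def IsSmoothCurve {n : ℕ} {M : Type*} [TopologicalSpace M]
    [ChartedSpace (EuclideanSpace ℝ (Fin (2 * n))) M] (S : Set ℝ) (K : ℝ → KahlerStructure n M) :
    Prop :=
  ∀ (c : M) (i j : Fin (2 * n)),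
    ContDiffOn ℝ ∞ (fun p : ℝ × EuclideanSpace ℝ (Fin (2 * n)) => endComp (K p.1).J c i j p.2)
      (S ×ˢ chartDom (2 * n) c) ∧
    ContDiffOn ℝ ∞ (fun p : ℝ × EuclideanSpace ℝ (Fin (2 * n)) => bilinComp (K p.1).g c i j p.2)
      (S ×ˢ chartDom (2 * n) c)

section Immersions

variable {n : ℕ} {M : Type*} [TopologicalSpace M] [ChartedSpace (EuclideanSpace ℝ (Fin (2 * n))) M]
  {L : Type*} [TopologicalSpace L] [ChartedSpace (EuclideanSpace ℝ (Fin n)) L]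

/-- Smooth immersions of an `n`-manifold in a `2n`-manifold. -/
def IsSmoothImmersion (f : L → M) : Prop :=
  ContMDiff (𝓡 n) (𝓡 (2 * n)) ∞ f ∧
    ∀ p : L, Function.Injective (mfderiv (𝓡 n) (𝓡 (2 * n)) f p)

/-- Totally real immersions: `f_*(T_pL) ∩ J f_*(T_pL) = 0` for all `p`. -/
def IsTotallyReal (K : KahlerStructure n M) (f : L → M) : Prop :=
  IsSmoothImmersion (n := n) f ∧
    ∀ (p : L) (v w : TangentSpace (𝓡 n) p),
      mfderiv (𝓡 n) (𝓡 (2 * n)) f p v = K.J (f p) (mfderiv (𝓡 n) (𝓡 (2 * n)) f p w) →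
        mfderiv (𝓡 n) (𝓡 (2 * n)) f p v = 0

/-- `f^*B = 0` for a two-form `B` on `M`. -/
def IsLagrangian (B : ∀ x : M, TangentSpace (𝓡 (2 * n)) x → TangentSpace (𝓡 (2 * n)) x → ℝ)
    (f : L → M) : Prop :=
  ∀ (p : L) (v w : TangentSpace (𝓡 n) p),
    B (f p) (mfderiv (𝓡 n) (𝓡 (2 * n)) f p v) (mfderiv (𝓡 n) (𝓡 (2 * n)) f p w) = 0

/-- The density of the `J`-volume in the chart of `L` centred at `c`:
`vol_J(∂_1, …, ∂_n) = (det_ℂ h(f_*∂_i, f_*∂_j))^{1/2}` with `h = g - iω`. For a `g`-orthonormal frame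
this is the factor `ρ_J` between `vol_J` and the Riemannian volume; the matrix is Hermitian and
positive semi-definite, so its determinant is real and non-negative. -/
def jDensity (K : KahlerStructure n M) (f : L → M) (c : L) (y : EuclideanSpace ℝ (Fin n)) : ℝ :=
  Real.sqrt (Matrix.det (Matrix.of fun i j : Fin n =>
    let v := mfderiv (𝓡 n) (𝓡 (2 * n)) f (chartPt c y) (chartVec c y i)
    let w := mfderiv (𝓡 n) (𝓡 (2 * n)) f (chartPt c y) (chartVec c y j)
    ((K.g (f (chartPt c y)) v w : ℂ) - Complex.I * (K.form (f (chartPt c y)) v w : ℂ)))).re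

/-- A smooth partition of unity on `L`, subordinate to the chart domains. -/
def chartPartition (n : ℕ) (L : Type*) [TopologicalSpace L] [T2Space L] [CompactSpace L]
    [ChartedSpace (EuclideanSpace ℝ (Fin n)) L] [IsManifold (𝓡 n) ∞ L] :
    SmoothPartitionOfUnity L (𝓡 n) L Set.univ :=
  Classical.choose (SmoothPartitionOfUnity.exists_isSubordinate_chartAt_source (𝓡 n) L)

/-- The `J`-volume `Vol_J(f) = ∫_L vol_J[f]` of a map of a compact manifold `L`, the integral of the
density `vol_J[f]` over `L` being computed with a partition of unity subordinate to charts. -/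
def jVolume [T2Space L] [CompactSpace L] [IsManifold (𝓡 n) ∞ L] (K : KahlerStructure n M)
    (f : L → M) : ℝ :=
  ∑ᶠ c : L, ∫ y in chartDom n c, chartPartition n L c (chartPt c y) * jDensity K f c y

/-- `J`-minimal immersions: totally real immersions that are critical points of `Vol_J`, i.e. the
derivative of `Vol_J` vanishes along every smooth variation `F_s` of `f` (for small `s` the maps `F_s`
are automatically totally real immersions, as `L` is compact). -/
def IsJMinimal [T2Space L] [CompactSpace L] [IsManifold (𝓡 n) ∞ L] (K : KahlerStructure n M)
    (f : L → M) : Prop :=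
  IsTotallyReal K f ∧
    ∀ F : ℝ → L → M,
      ContMDiff (𝓘(ℝ, ℝ).prod (𝓡 n)) (𝓡 (2 * n)) ∞ (fun q : ℝ × L => F q.1 q.2) →
      F 0 = f → HasDerivAt (fun s => jVolume K (F s)) 0 0

/-- There is a smooth curve of immersions `F_t`, `t ∈ S`, with `F_0 = f` and `F_t^*B_t = 0`. -/
def HasLagrangianCurve (S : Set ℝ)
    (B : ℝ → ∀ x : M, TangentSpace (𝓡 (2 * n)) x → TangentSpace (𝓡 (2 * n)) x → ℝ)
    (f : L → M) : Prop :=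
  ∃ F : ℝ → L → M, F 0 = f ∧
    ContMDiffOn (𝓘(ℝ, ℝ).prod (𝓡 n)) (𝓡 (2 * n)) ∞ (fun q : ℝ × L => F q.1 q.2)
      (S ×ˢ Set.univ) ∧
    ∀ t ∈ S, IsSmoothImmersion (n := n) (F t) ∧ IsLagrangian (B t) (F t)

end Immersions

end JMin

end

set_option maxSynthPendingDepth 3
set_option linter.unusedSectionVars false
set_option linter.unusedSimpArgs false

noncomputable section

namespace JMin

/-! ### Connection forms and curvature -/

section Curvature

variable {P Q E : Type*} [NormedAddCommGroup P] [NormedSpace ℝ P] [NormedAddCommGroup Q]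
  [NormedSpace ℝ Q] [NormedAddCommGroup E] [NormedSpace ℝ E]

/-! The proof joins a first variation computation to a Moser argument; both are carried out with
connection forms in coordinates.

A `J`-minimal immersion ι is Lagrangian for the Ricci form. Along a totally real map the vectors
∂_iι, J∂_iι frame ι*TM, and since J is parallel (`IsKahlerOn.parallel_J`) the Levi-Civita connection
form A in this frame commutes with the standard complex structure J₀ (`IsTotRealOn.conn_comm`). Put
θ = tr(J₀A). Along a variation in the direction J ι_*W the determinant of the hermitian Gram matrix
changes at the relative rate θ(W) (`hasDerivAt_det_gramH`), so criticality tested with bump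
functions forces θ = 0. On the other hand ρ = tr(J R)/2 for a Kähler metric
(`KahlerCurv.ricci_form`), whence ι*ρ = tr(J₀(dA + A∧A))/2 = dθ/2, the quadratic term dropping out
by cyclicity of the trace (`IsTotRealOn.rho_eq_zero`). The result is `IsJMinimal.isLagrangian`.

Along a curve of Kähler structures the variation ∂_tΓ of the Christoffel symbols is a tensor, and
∂_tρ_t = dβ_t for the global one-form β_t = tr(J_t ∂_tΓ_t)/2, even if J_t moves
(`IsKahlerFamily.hasDerivWithinAt_rho`, `beta_eq`). As long as ρ_t is non-degenerate, ρ_t(X_t, ·) =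
-β_t determines a vector field X_t; as ρ_t is closed, its flow F_t satisfies ∂_t(F_t*ρ_t) =
F_t*(dβ_t + d(ρ_t(X_t, ·))) = 0. Hence F_t ∘ ι remains an immersion that is Lagrangian for ρ_t
(`exists_hasLagrangianCurve`). On a compact M the flow exists for all t in the interval; otherwise
X_t is cut off away from ι(L), and t is kept so small that the moving image stays where the cut-off
function is one. The smooth flow comes from `hasLocalFlow` and `IsTimeField.exists_flow`. This
settles the second statement.

For the first statement ρ_t = λ_t ω_t, so it suffices that λ_t ≠ 0, apart from trivial cases.
Definiteness gives λ_0 ≠ 0, and continuity of ρ_t gives λ_t ≠ 0 for small t. If M is compact and λ_b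
= 0, integrating β_t from 0 to b yields a primitive of ρ_b - ρ_0 = -λ_0 ω_0. The vector field dual
to this primitive under ω_0 would have constant non-zero divergence for the density |det ω_0|^{1/2},
contradicting the divergence theorem (`divergence_eq_zero`, `KahlerStructure.eq_zero_of_primitive`,
`einstein_ne_zero`). -/

/-- The curvature of the connection form `Γ`. -/
def curv (Γ : P → P →L[ℝ] Q →L[ℝ] Q) (y u v : P) : Q →L[ℝ] Q :=
  fderiv ℝ Γ y u v - fderiv ℝ Γ y v u + Γ y u * Γ y v - Γ y v * Γ y u

lemma clm_mul_apply (A B : Q →L[ℝ] Q) (q : Q) : (A * B) q = A (B q) := rfl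

lemma curv_swap (Γ : P → P →L[ℝ] Q →L[ℝ] Q) (y u v : P) : curv Γ y u v = -curv Γ y v u := by
  unfold curv; abel

lemma fderiv_fderiv_comm {F : P → E} {y : P} (hF : ContDiffAt ℝ 2 F y) (u v : P) :
    fderiv ℝ (fderiv ℝ F) y u v = fderiv ℝ (fderiv ℝ F) y v u :=
  (hF.isSymmSndFDerivAt (by simp)) u v

lemma hasFDerivAt_fderiv {F : P → E} {y : P} (hF : ContDiffAt ℝ 2 F y) :
    HasFDerivAt (fderiv ℝ F) (fderiv ℝ (fderiv ℝ F) y) y :=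
  ((hF.fderiv_right (m := 1) (by norm_num)).differentiableAt (by norm_num)).hasFDerivAt

/-- Behaviour of the curvature under pull-back and change of frame. -/
lemma curv_frame {Γ : E → E →L[ℝ] E →L[ℝ] E} {A : P → P →L[ℝ] Q →L[ℝ] Q} {φ : P → E}
    {Ψ : P → Q →L[ℝ] E} {y : P} (hΓ : DifferentiableAt ℝ Γ (φ y)) (hA : DifferentiableAt ℝ A y)
    (hφ : ContDiffAt ℝ 2 φ y) (hΨ : ContDiffAt ℝ 2 Ψ y)
    (h : ∀ᶠ z in nhds y, ∀ u, fderiv ℝ Ψ z u + (Γ (φ z) (fderiv ℝ φ z u)).comp (Ψ z) =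
      (Ψ z).comp (A z u)) (u v : P) (q : Q) :
    curv Γ (φ y) (fderiv ℝ φ y u) (fderiv ℝ φ y v) (Ψ y q) = Ψ y (curv A y u v q) := by
  have hφ1 : HasFDerivAt φ (fderiv ℝ φ y) y := (hφ.differentiableAt (by norm_num)).hasFDerivAt
  have hΨ1 : HasFDerivAt Ψ (fderiv ℝ Ψ y) y := (hΨ.differentiableAt (by norm_num)).hasFDerivAt
  have hφ2 := hasFDerivAt_fderiv hφ
  have hΨ2 := hasFDerivAt_fderiv hΨ
  have hΓ1 := HasFDerivAt.comp (g := Γ) y hΓ.hasFDerivAt hφ1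
  -- This is the relation `h` differentiated once more, in the direction `w`. In the difference of
  -- the instances for (v, u) and (u, v) the second derivatives of Ψ and φ cancel, and the
  -- curvatures remain.
  have key : ∀ u w : P, fderiv ℝ (fderiv ℝ Ψ) y w u q
      + (fderiv ℝ Γ (φ y) (fderiv ℝ φ y w) (fderiv ℝ φ y u) (Ψ y q)
        + Γ (φ y) (fderiv ℝ (fderiv ℝ φ) y w u) (Ψ y q)
        + Γ (φ y) (fderiv ℝ φ y u) (fderiv ℝ Ψ y w q))
      = fderiv ℝ Ψ y w (A y u q) + Ψ y (fderiv ℝ A y w u q) := by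
    intro u w
    have h1 := ((hΨ2.clm_apply (hasFDerivAt_const u y)).clm_apply (hasFDerivAt_const q y)).add
      ((hΓ1.clm_apply (hφ2.clm_apply (hasFDerivAt_const u y))).clm_apply
        (hΨ1.clm_apply (hasFDerivAt_const q y)))
    have h2 := hΨ1.clm_apply ((hA.hasFDerivAt.clm_apply (hasFDerivAt_const u y)).clm_apply
      (hasFDerivAt_const q y))
    have h3 := h1.congr_of_eventuallyEq (f₁ := fun z => Ψ z (A z u q)) (by
      filter_upwards [h] with z hz
      have := congrArg (fun T => T q) (hz u)
      simpa using this.symm)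
    have h4 := congrArg (fun T => T w) (h3.unique h2)
    simp at h4
    rw [← sub_eq_zero] at h4 ⊢
    rw [← h4]; abel
  have h0 : ∀ u q, fderiv ℝ Ψ y u q = Ψ y (A y u q) - Γ (φ y) (fderiv ℝ φ y u) (Ψ y q) := by
    intro u q
    have := congrArg (fun T => T q) (h.self_of_nhds u)
    rw [eq_sub_iff_add_eq]; simpa using this
  have k1 := key v u
  have k2 := key u v
  rw [fderiv_fderiv_comm hΨ u v, fderiv_fderiv_comm hφ u v] at k1
  simp only [h0] at k1 k2
  simp only [curv, map_sub, map_add, sub_apply, add_apply,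
    clm_mul_apply] at k1 k2 ⊢
  rw [← sub_eq_zero] at k1 k2 ⊢
  rw [← sub_eq_zero.2 (k1.trans k2.symm)]
  abel

variable {Γ : P → P →L[ℝ] Q →L[ℝ] Q} {y : P}

lemma hasFDerivAt_curv (hΓ : ContDiffAt ℝ 2 Γ y) (u v w : P) :
    HasFDerivAt (fun z => curv Γ z u v) (fderiv ℝ (fun z => curv Γ z u v) y) y ∧
    fderiv ℝ (fun z => curv Γ z u v) y w = fderiv ℝ (fderiv ℝ Γ) y w u v
      - fderiv ℝ (fderiv ℝ Γ) y w v u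
      + (fderiv ℝ Γ y w u * Γ y v + Γ y u * fderiv ℝ Γ y w v)
      - (fderiv ℝ Γ y w v * Γ y u + Γ y v * fderiv ℝ Γ y w u) := by
  have h1 : HasFDerivAt Γ (fderiv ℝ Γ y) y := (hΓ.differentiableAt (by norm_num)).hasFDerivAt
  have h2 := hasFDerivAt_fderiv hΓ
  have a := fun u => h1.clm_apply (hasFDerivAt_const u y)
  have b := fun u v => (h2.clm_apply (hasFDerivAt_const u y)).clm_apply (hasFDerivAt_const v y)
  have h := (((b u v).sub (b v u)).add ((a u).mul' (a v))).sub ((a v).mul' (a u))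
  have h' : HasFDerivAt (fun z => curv Γ z u v) _ y := h
  refine ⟨h'.differentiableAt.hasFDerivAt, ?_⟩
  rw [h'.fderiv]
  simp
  abel

/-- The second Bianchi identity. -/
lemma bianchi_two (hΓ : ContDiffAt ℝ 2 Γ y) (u v w : P) :
    (fderiv ℝ (fun z => curv Γ z u v) y w + (Γ y w * curv Γ y u v - curv Γ y u v * Γ y w))
    + (fderiv ℝ (fun z => curv Γ z v w) y u + (Γ y u * curv Γ y v w - curv Γ y v w * Γ y u))
    + (fderiv ℝ (fun z => curv Γ z w u) y v + (Γ y v * curv Γ y w u - curv Γ y w u * Γ y v)) = 0 := by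
  -- Once the second derivatives of Γ are matched by symmetry, only an identity between
  -- non-commuting polynomials is left.
  rw [(hasFDerivAt_curv hΓ u v w).2, (hasFDerivAt_curv hΓ v w u).2, (hasFDerivAt_curv hΓ w u v).2,
    fderiv_fderiv_comm hΓ w u, fderiv_fderiv_comm hΓ v u, fderiv_fderiv_comm hΓ w v]
  unfold curv
  noncomm_ring

/-- A parallel endomorphism commutes with the curvature. -/
lemma curv_comm_of_parallel {J : P → Q →L[ℝ] Q} (hΓ : DifferentiableAt ℝ Γ y)
    (hJ : ContDiffAt ℝ 2 J y)
    (h : ∀ᶠ z in nhds y, ∀ u, fderiv ℝ J z u = J z * Γ z u - Γ z u * J z) (u v : P) :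
    curv Γ y u v * J y = J y * curv Γ y u v := by
  have hJ1 : HasFDerivAt J (fderiv ℝ J y) y := (hJ.differentiableAt (by norm_num)).hasFDerivAt
  -- The integrability condition of ∇J = 0: differentiate the equation again and compare the two
  -- orders of differentiation.
  have key : ∀ u w, fderiv ℝ (fderiv ℝ J) y w u = fderiv ℝ J y w * Γ y u + J y * fderiv ℝ Γ y w u
      - (fderiv ℝ Γ y w u * J y + Γ y u * fderiv ℝ J y w) := by
    intro u w
    have a := hΓ.hasFDerivAt.clm_apply (hasFDerivAt_const u y)
    have h1 := ((hasFDerivAt_fderiv hJ).clm_apply (hasFDerivAt_const u y))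
    have h2 := (hJ1.mul' a).sub (a.mul' hJ1)
    have h3 := h2.congr_of_eventuallyEq (f₁ := fun z => fderiv ℝ J z u) (by
      filter_upwards [h] with z hz using hz u)
    have h4 := congrArg (fun T => T w) (h1.unique h3)
    simp at h4
    rw [h4]; abel
  have k1 := key u v
  rw [fderiv_fderiv_comm hJ, key v u] at k1
  simp only [h.self_of_nhds] at k1
  rw [← sub_eq_zero] at k1 ⊢
  rw [← neg_eq_zero, ← k1]
  unfold curv
  noncomm_ring

/-- A parallel symmetric form makes the curvature skew. -/
lemma curv_skew_of_parallel {g : P → Q →L[ℝ] Q →L[ℝ] ℝ} (hΓ : DifferentiableAt ℝ Γ y)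
    (hg : ContDiffAt ℝ 2 g y)
    (h : ∀ᶠ z in nhds y, ∀ u p q, fderiv ℝ g z u p q = g z (Γ z u p) q + g z p (Γ z u q)) (u v : P)
    (p q : Q) : g y (curv Γ y u v p) q + g y p (curv Γ y u v q) = 0 := by
  have hg1 : HasFDerivAt g (fderiv ℝ g y) y := (hg.differentiableAt (by norm_num)).hasFDerivAt
  have key : ∀ u w, fderiv ℝ (fderiv ℝ g) y w u p q =
      fderiv ℝ g y w (Γ y u p) q + g y (fderiv ℝ Γ y w u p) q
      + (fderiv ℝ g y w p (Γ y u q) + g y p (fderiv ℝ Γ y w u q)) := by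
    intro u w
    have a := fun q => (hΓ.hasFDerivAt.clm_apply (hasFDerivAt_const u y)).clm_apply
      (hasFDerivAt_const q y)
    have h1 := (((hasFDerivAt_fderiv hg).clm_apply (hasFDerivAt_const u y)).clm_apply
      (hasFDerivAt_const p y)).clm_apply (hasFDerivAt_const q y)
    have h2 := ((hg1.clm_apply (a p)).clm_apply (hasFDerivAt_const q y)).add
      ((hg1.clm_apply (hasFDerivAt_const p y)).clm_apply (a q))
    have h3 := h2.congr_of_eventuallyEq (f₁ := fun z => fderiv ℝ g z u p q) (by
      filter_upwards [h] with z hz using hz u p q)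
    have h4 := congrArg (fun T => T w) (h1.unique h3)
    simp at h4
    rw [h4]; ring
  have k1 := key u v
  rw [fderiv_fderiv_comm hg, key v u] at k1
  simp only [h.self_of_nhds] at k1
  simp only [curv, map_sub, map_add, sub_apply, add_apply,
    clm_mul_apply] 
  linarith

/-- The first Bianchi identity. -/
lemma bianchi_one {Γ : E → E →L[ℝ] E →L[ℝ] E} {y : E} (hΓ : DifferentiableAt ℝ Γ y)
    (h : ∀ᶠ z in nhds y, ∀ u v, Γ z u v = Γ z v u) (u v w : E) :
    curv Γ y u v w + curv Γ y v w u + curv Γ y w u v = 0 := by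
  have key : ∀ u v w, fderiv ℝ Γ y u v w = fderiv ℝ Γ y u w v := by
    intro u v w
    have a := fun v w => (hΓ.hasFDerivAt.clm_apply (hasFDerivAt_const v y)).clm_apply
      (hasFDerivAt_const w y)
    have h3 := (a v w).congr_of_eventuallyEq (f₁ := fun z => Γ z w v) (by
      filter_upwards [h] with z hz using hz w v)
    have h4 := congrArg (fun T => T u) ((a w v).unique h3)
    simpa using h4.symm
  simp only [curv, sub_apply, add_apply,
    clm_mul_apply, key u v w, key v w u, key w u v, h.self_of_nhds v u,
    h.self_of_nhds w u, h.self_of_nhds w v]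
  abel

end Curvature

/-! ### Linear algebra: traces, non-degenerate forms, Kähler curvature tensors -/

section LinearAlgebra

variable {E : Type*} [NormedAddCommGroup E] [NormedSpace ℝ E] [FiniteDimensional ℝ E]

/-- The trace, as a continuous linear functional. -/
def trL : (E →L[ℝ] E) →L[ℝ] ℝ :=
  LinearMap.toContinuousLinearMap (LinearMap.trace ℝ E ∘ₗ ContinuousLinearMap.coeLM ℝ)

lemma trL_apply (A : E →L[ℝ] E) : trL A = LinearMap.trace ℝ E (A : E →ₗ[ℝ] E) := rfl

lemma trL_mul_comm (A B : E →L[ℝ] E) : trL (A * B) = trL (B * A) :=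
  LinearMap.trace_mul_comm ℝ (A : E →ₗ[ℝ] E) (B : E →ₗ[ℝ] E)

/-- Conjugation invariance of the trace, in the form that moves traces from one chart or frame to
another. -/
lemma trL_conj {F : Type*} [NormedAddCommGroup F] [NormedSpace ℝ F] [FiniteDimensional ℝ F]
    {T : E →L[ℝ] F} (hT : T.IsInvertible) {A : E →L[ℝ] E} {B : F →L[ℝ] F}
    (h : ∀ x, T (A x) = B (T x)) : trL A = trL B := by
  obtain ⟨e, rfl⟩ := hT
  rw [trL_apply, trL_apply, ← LinearMap.trace_conj' (A : E →ₗ[ℝ] E) e.toLinearEquiv]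
  congr 1
  ext x
  simpa [LinearEquiv.conj_apply] using h (e.symm x)

lemma isInvertible_of_injective {F : Type*} [NormedAddCommGroup F] [NormedSpace ℝ F]
    [FiniteDimensional ℝ F] (T : E →L[ℝ] F) (hd : Module.finrank ℝ E = Module.finrank ℝ F)
    (h : ∀ u, T u = 0 → u = 0) : T.IsInvertible :=
  ⟨(LinearEquiv.ofInjectiveOfFinrankEq (T : E →ₗ[ℝ] F)
      ((injective_iff_map_eq_zero _).2 h) hd).toContinuousLinearEquiv, by ext; rfl⟩

lemma isInvertible_of_nondegenerate {B : E →L[ℝ] E →L[ℝ] ℝ}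
    (h : ∀ u, (∀ v, B u v = 0) → u = 0) : B.IsInvertible := by
  refine isInvertible_of_injective B ?_ fun u hu => h u fun v => by simp [hu]
  rw [← (LinearMap.toContinuousLinearMap (𝕜 := ℝ) (E := E) (F' := ℝ)).finrank_eq]
  exact Subspace.dual_finrank_eq.symm

/-- Read through the isomorphism from E to its dual given by g, the endomorphism becomes minus its
own transpose, so its trace equals its negative. -/
lemma trL_eq_zero_of_skew {g : E →L[ℝ] E →L[ℝ] ℝ} (hg : ∀ u, (∀ v, g u v = 0) → u = 0)
    {A : E →L[ℝ] E} (h : ∀ u v, g (A u) v + g u (A v) = 0) : trL A = 0 := by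
  obtain ⟨e, he⟩ := isInvertible_of_nondegenerate hg
  let e' : E ≃ₗ[ℝ] Module.Dual ℝ E := e.toLinearEquiv.trans LinearMap.toContinuousLinearMap.symm
  have h1 := LinearMap.trace_conj' (A : E →ₗ[ℝ] E) e'
  have h2 : e'.conj (A : E →ₗ[ℝ] E) = -Module.Dual.transpose (R := ℝ) (A : E →ₗ[ℝ] E) := by
    ext φ v
    obtain ⟨u, rfl⟩ := e'.surjective φ
    have h3 : ∀ u v, e' u v = g u v := by
      intro u v; rw [← he]; rfl
    simp [LinearEquiv.conj_apply, Module.Dual.transpose_apply, h3]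
    linarith [h u v]
  rw [h2, map_neg, LinearMap.trace_transpose'] at h1
  rw [trL_apply]; linarith

lemma ext_of_nondegenerate {g : E →L[ℝ] E →L[ℝ] ℝ} (hg : ∀ u, (∀ v, g u v = 0) → u = 0) {u u' : E}
    (h : ∀ v, g u v = g u' v) : u = u' :=
  sub_eq_zero.1 (hg _ fun v => by simp [h])

/-- Algebraic properties of the curvature tensor of a Kähler metric at a point. -/
structure KahlerCurv (g : E →L[ℝ] E →L[ℝ] ℝ) (J : E →L[ℝ] E) (R : E → E → E →L[ℝ] E) : Prop where
  symm : ∀ u v, g u v = g v u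
  nondeg : ∀ u, (∀ v, g u v = 0) → u = 0
  J_sq : J * J = -1
  g_J : ∀ u v, g (J u) (J v) = g u v
  swap : ∀ u v, R u v = -R v u
  bianchi : ∀ u v w, R u v w + R v w u + R w u v = 0
  skew : ∀ u v p q, g (R u v p) q + g p (R u v q) = 0
  comm : ∀ u v, R u v * J = J * R u v

namespace KahlerCurv

variable {g : E →L[ℝ] E →L[ℝ] ℝ} {J : E →L[ℝ] E} {R : E → E → E →L[ℝ] E} (h : KahlerCurv g J R)
include h

/-- The classical octahedron argument: four Bianchi identities are added, and the two skew
symmetries identify the terms. -/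
lemma pair_symm (u v w z : E) : g (R u v w) z = g (R w z u) v := by
  have b : ∀ u v w z, g (R u v w) z + g (R v w u) z + g (R w u v) z = 0 := by
    intro u v w z
    have := congrArg (fun x => g x z) (h.bianchi u v w)
    simpa using this
  have s : ∀ u v p q, g (R u v p) q = -g (R u v q) p := by
    intro u v p q; rw [h.symm (R u v q) p]; linarith [h.skew u v p q]
  have w' : ∀ u v p q, g (R u v p) q = -g (R v u p) q := by
    intro u v p q; rw [h.swap u v]; simp
  linarith [b u v w z, b v w z u, b w z u v, b z u v w, s u v w z, s v w u z, s w u v z, s v w z u,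
    s w z v u, s z v w u, s w z u v, s z u w v, s u w z v, s z u v w, s u v z w, s v z u w,
    w' u v w z, w' w z u v, w' v z u w, w' u w z v, w' z u v w, w' z v w u, w' w u v z]

/-- After exchanging the two pairs of arguments this says that R(w, z) commutes with the isometry J.
-/
lemma J_J (u v : E) : R (J u) (J v) = R u v := by
  ext w
  refine ext_of_nondegenerate h.nondeg fun z => ?_
  have c : R w z (J u) = J (R w z u) := congrArg (fun T => T u) (h.comm w z)
  rw [h.pair_symm, c, h.g_J, ← h.pair_symm]

lemma JJ_apply (u : E) : J (J u) = -u := by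
  have := congrArg (fun T => T u) h.J_sq
  simpa using this

/-- For a Kähler metric, `Ric(J v, w) = tr (J R(v, w)) / 2`. -/
lemma ricci_form {T : E → E → E →L[ℝ] E} (hT : ∀ u v w, T v w u = R u v w) (v w : E) :
    trL (T (J v) w) = (1 / 2) * trL (J * R v w) := by
  have tconj : ∀ A : E →L[ℝ] E, trL (J * A * J) = -trL A := by
    intro A; rw [trL_mul_comm, ← mul_assoc, h.J_sq]; simp
  have comm' : ∀ u v w, R u v (J w) = J (R u v w) := fun u v w =>
    congrArg (fun T => T w) (h.comm u v)
  have t0 : ∀ u v, trL (R u v) = 0 := fun u v => trL_eq_zero_of_skew h.nondeg (h.skew u v)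
  -- Symmetry of the Ricci tensor: by Bianchi the skew part of T is a multiple of R(v, w), which is
  -- skew for g and so has trace zero.
  have hsym : ∀ v w, trL (T v w) = trL (T w v) := by
    intro v w
    have : T v w - T w v = -R v w := by
      ext u
      have := h.bianchi u v w
      simp only [sub_apply, hT, neg_apply]
      rw [h.swap u w]
      rw [← sub_eq_zero, ← this]; simp; abel
    have := congrArg trL this
    rw [map_sub, map_neg, t0] at this
    linarith
  have e1 : ∀ v w, T (J v) (J w) = J * T (J v) w := by
    intro v w; ext u; simp [hT, clm_mul_apply, comm']
  have e2 : ∀ v w, T (J v) w * J = T v w := by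
    intro v w; ext u; simp [hT, clm_mul_apply, h.J_J]
  have hJJ : ∀ v w, trL (T (J v) (J w)) = trL (T v w) := by
    intro v w; rw [e1, trL_mul_comm, e2]
  have hanti : trL (T (J w) v) = -trL (T (J v) w) := by
    rw [hsym (J w) v, ← hJJ v (J w), h.JJ_apply]
    have : T (J v) (-w) = -T (J v) w := by ext u; simp [hT]
    rw [this, map_neg]
  have e3 : ∀ v w, trL (T (J v) w) = -trL (J * T v w) := by
    intro v w
    rw [← e2 v w, ← mul_assoc, tconj, neg_neg]
  -- By `e3` and `hanti` the two terms on the left have traces -Ric(Jv, w) and Ric(Jv, w), so the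
  -- trace of this identity is -2 Ric(Jv, w) = -tr(J R(v, w)).
  have e4 : J * T v w - J * T w v = -(J * R v w) := by
    ext u
    have := h.bianchi u v w
    simp only [sub_apply, hT, neg_apply, clm_mul_apply]
    rw [h.swap u w, ← map_sub, ← map_neg]
    congr 1
    rw [← sub_eq_zero, ← this]; simp; abel
  have := congrArg trL e4
  rw [map_sub, map_neg] at this
  have a := e3 v w
  have b := e3 w v
  linarith

end KahlerCurv

/-- If `S(u,v,w) = g((∇_u J)v, w)` comes from an integrable `J` with closed Kähler form, it vanishes. -/
lemma kahler_torsion_eq_zero {J : E →L[ℝ] E} {S : E → E → E → ℝ}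
    (hJ : ∀ u, J (J u) = -u) (neg2 : ∀ u v w, S u (-v) w = -S u v w)
    (skew : ∀ u v w, S u v w = -S u w v) (anti : ∀ u v w, S u (J v) w = S u v (J w))
    (closed : ∀ u v w, S u v w + S v w u + S w u v = 0)
    (int : ∀ u v w, S (J u) v w - S (J v) u w - S v u (J w) + S u v (J w) = 0) (u v w : E) :
    S u v w = 0 := by
  -- Closedness at (Ju, v, w) minus closedness at (Jv, u, w), simplified by integrability, leaves 2
  -- S(w, u, Jv). Since J is onto this suffices.
  have key : ∀ u v w, S w u (J v) = 0 := by
    intro u v w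
    linarith [closed (J u) v w, closed (J v) u w, int u v w, skew v w (J u), anti v u w,
      skew u w (J v), anti u v w, skew w v (J u), anti w u v, skew w u (J v), skew w (J u) v,
      skew w (J v) u, anti w v u, skew v (J u) w, skew u (J v) w, skew v u (J w), skew u v (J w)]
  have := key v (J w) u
  rw [hJ, skew, neg2] at this
  rw [skew]; linarith

end LinearAlgebra

/-! ### Levi-Civita connection in coordinates -/

section LeviCivita

variable {E : Type*} [NormedAddCommGroup E] [NormedSpace ℝ E] [FiniteDimensional ℝ E]

/-- The Koszul form `½ (D_u g(v,w) + D_v g(u,w) - D_w g(u,v))`. -/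
def koszul (g : E → E →L[ℝ] E →L[ℝ] ℝ) (y : E) : E →L[ℝ] E →L[ℝ] E →L[ℝ] ℝ :=
  (1 / 2 : ℝ) • (fderiv ℝ g y + (fderiv ℝ g y).flip -
    (((ContinuousLinearMap.flipₗᵢ ℝ E E ℝ : (E →L[ℝ] E →L[ℝ] ℝ) →L[ℝ] E →L[ℝ] E →L[ℝ] ℝ)).comp
      (fderiv ℝ g y).flip))

lemma koszul_apply (g : E → E →L[ℝ] E →L[ℝ] ℝ) (y u v w : E) : koszul g y u v w =
    (1 / 2) * (fderiv ℝ g y u v w + fderiv ℝ g y v u w - fderiv ℝ g y w u v) := by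
  simp [koszul]

/-- The Christoffel form of the Levi-Civita connection of `g`. -/
def lc (g : E → E →L[ℝ] E →L[ℝ] ℝ) (y : E) : E →L[ℝ] E →L[ℝ] E :=
  ((ContinuousLinearMap.compL ℝ E (E →L[ℝ] ℝ) E) (g y).inverse).comp (koszul g y)

lemma lc_apply (g : E → E →L[ℝ] E →L[ℝ] ℝ) (y u v : E) :
    lc g y u v = (g y).inverse (koszul g y u v) := rfl

/-- A Riemannian metric on the open set `U` in coordinates. -/
structure IsMetricOn (g : E → E →L[ℝ] E →L[ℝ] ℝ) (U : Set E) : Prop where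
  isOpen : IsOpen U
  smooth : ContDiffOn ℝ ∞ g U
  symm : ∀ y ∈ U, ∀ u v, g y u v = g y v u
  pos : ∀ y ∈ U, ∀ u, u ≠ 0 → 0 < g y u u

namespace IsMetricOn

variable {g : E → E →L[ℝ] E →L[ℝ] ℝ} {U : Set E} (h : IsMetricOn g U) {y : E} (hy : y ∈ U)
include h hy

lemma contDiffAt : ContDiffAt ℝ ∞ g y := h.smooth.contDiffAt (h.isOpen.mem_nhds hy)

lemma hasFDerivAt : HasFDerivAt g (fderiv ℝ g y) y :=
  ((h.contDiffAt hy).differentiableAt (by simp)).hasFDerivAt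

lemma nondeg (u : E) (hu : ∀ v, g y u v = 0) : u = 0 := by
  by_contra h'
  exact (h.pos y hy u h').ne' (hu u)

lemma isInvertible : (g y).IsInvertible := isInvertible_of_nondegenerate (h.nondeg hy)

lemma fderiv_symm (u v w : E) : fderiv ℝ g y u v w = fderiv ℝ g y u w v := by
  have a := fun v w => ((h.hasFDerivAt hy).clm_apply (hasFDerivAt_const v y)).clm_apply
      (hasFDerivAt_const w y)
  have h3 := (a v w).congr_of_eventuallyEq (f₁ := fun z => g z w v) (by
    filter_upwards [h.isOpen.mem_nhds hy] with z hz using h.symm z hz w v)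
  have h4 := congrArg (fun T => T u) ((a w v).unique h3)
  simpa using h4.symm

lemma g_lc (u v w : E) : g y (lc g y u v) w =
    (1 / 2) * (fderiv ℝ g y u v w + fderiv ℝ g y v u w - fderiv ℝ g y w u v) := by
  rw [lc_apply, (h.isInvertible hy).self_apply_inverse, koszul_apply]

lemma lc_symm (u v : E) : lc g y u v = lc g y v u := by
  refine ext_of_nondegenerate (h.nondeg hy) fun w => ?_
  rw [h.g_lc hy, h.g_lc hy, h.fderiv_symm hy w u v]; ring

lemma parallel (u v w : E) : fderiv ℝ g y u v w = g y (lc g y u v) w + g y v (lc g y u w) := by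
  rw [h.symm y hy v, h.g_lc hy, h.g_lc hy, h.fderiv_symm hy u w v, h.fderiv_symm hy v u w,
    h.fderiv_symm hy w u v, h.fderiv_symm hy v w u]; ring

/-- Symmetry and compatibility with the metric determine the Koszul formula. This is what yields the
transformation law of the Christoffel symbols below. -/
lemma lc_unique {Γ : E → E → E} (hs : ∀ u v, Γ u v = Γ v u)
    (hp : ∀ u v w, fderiv ℝ g y u v w = g y (Γ u v) w + g y v (Γ u w)) (u v : E) :
    Γ u v = lc g y u v := by
  refine ext_of_nondegenerate (h.nondeg hy) fun w => ?_
  rw [h.g_lc hy, hp u v w, hp v u w, hp w u v, hs w u, hs w v, hs v u, h.symm y hy u,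
    h.symm y hy v]; ring

lemma contDiffAt_lc : ContDiffAt ℝ ∞ (lc g) y := by
  have h1 : ContDiffAt ℝ ∞ (fun z => (g z).inverse) y :=
    (h.isInvertible hy).contDiffAt_map_inverse.comp y (h.contDiffAt hy)
  have h2 : ContDiffAt ℝ ∞ (fderiv ℝ g) y := (h.contDiffAt hy).fderiv_right (m := ∞) le_rfl
  have h3 : ContDiffAt ℝ ∞ (fun z => (fderiv ℝ g z).flip) y :=
    (ContinuousLinearMap.flipₗᵢ ℝ E E (E →L[ℝ] ℝ)).toContinuousLinearEquiv.contDiff.contDiffAt.comp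
      y h2
  have h4 : ContDiffAt ℝ ∞ (koszul g) y :=
    ((h2.add h3).sub (contDiffAt_const.clm_comp h3)).const_smul _
  exact (((ContinuousLinearMap.compL ℝ E (E →L[ℝ] ℝ) E).contDiff.contDiffAt.comp y h1).clm_comp h4)

end IsMetricOn

end LeviCivita

lemma two_le_infty : (2 : WithTop ℕ∞) ≤ ∞ := WithTop.coe_le_coe.2 (le_top : (2 : ℕ∞) ≤ ⊤)

/-! ### Smooth families over an interval -/

section Families

variable {E F : Type*} [NormedAddCommGroup E] [NormedSpace ℝ E] [NormedAddCommGroup F]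
  [NormedSpace ℝ F]

/-- A non-degenerate interval of parameters. -/
structure IsInterval (S : Set ℝ) : Prop where
  ord : S.OrdConnected
  nontrivial : S.Nontrivial

lemma IsInterval.interior_nonempty {S : Set ℝ} (hS : IsInterval S) : (interior S).Nonempty := by
  obtain ⟨a, ha, b, hb, hab⟩ := hS.nontrivial.exists_lt
  refine ⟨(a + b) / 2, mem_interior.2 ⟨Set.Ioo a b, ?_, isOpen_Ioo, ?_⟩⟩
  · exact Set.Ioo_subset_Icc_self.trans (hS.ord.out ha hb)
  · constructor <;> linarith

lemma IsInterval.uniqueDiffOn {S : Set ℝ} (hS : IsInterval S) : UniqueDiffOn ℝ S :=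
  uniqueDiffOn_convex hS.ord.convex hS.interior_nonempty

/-- Endpoints of the interval are limits of interior points; this gives symmetry of second
derivatives within S × U at the endpoints as well. -/
lemma IsInterval.subset_closure_interior {S : Set ℝ} (hS : IsInterval S) :
    S ⊆ closure (interior S) := by
  rw [Convex.closure_interior_eq_closure_of_nonempty_interior (𝕜 := ℝ) hS.ord.convex
    hS.interior_nonempty]
  exact subset_closure

/-- The derivative in the parameter of a family of maps. -/
def tD (S : Set ℝ) (G : ℝ → E → F) (t : ℝ) (y : E) : F := derivWithin (fun s => G s y) S t

variable {S : Set ℝ} {U : Set E} {G : ℝ → E → F} {n : WithTop ℕ∞} {t : ℝ} {y : E}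

lemma hasFDerivAt_of_family (hU : IsOpen U)
    (hG : ContDiffOn ℝ n (fun p : ℝ × E => G p.1 p.2) (S ×ˢ U)) (hn : n ≠ 0) (ht : t ∈ S)
    (hy : y ∈ U) : HasFDerivAt (G t) ((fderivWithin ℝ (fun p : ℝ × E => G p.1 p.2) (S ×ˢ U)
      (t, y)).comp (ContinuousLinearMap.inr ℝ ℝ E)) y := by
  have h1 := ((hG.differentiableOn hn) (t, y) ⟨ht, hy⟩).hasFDerivWithinAt
  have h2 : HasFDerivWithinAt (fun z : E => (t, z)) (ContinuousLinearMap.inr ℝ ℝ E) U y :=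
    (hasFDerivAt_prodMk_right t y).hasFDerivWithinAt
  exact (HasFDerivWithinAt.comp y h1 h2 (fun z hz => ⟨ht, hz⟩)).hasFDerivAt (hU.mem_nhds hy)

lemma hasDerivWithinAt_family_slice
    (hG : ContDiffOn ℝ n (fun p : ℝ × E => G p.1 p.2) (S ×ˢ U)) (hn : n ≠ 0) (ht : t ∈ S)
    (hy : y ∈ U) : HasDerivWithinAt (fun s => G s y) (fderivWithin ℝ (fun p : ℝ × E => G p.1 p.2)
      (S ×ˢ U) (t, y) (1, 0)) S t := by
  have h1 := ((hG.differentiableOn hn) (t, y) ⟨ht, hy⟩).hasFDerivWithinAt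
  have h2 : HasDerivWithinAt (fun s : ℝ => (s, y)) ((1 : ℝ), (0 : E)) S t :=
    (hasDerivWithinAt_id t S).prodMk (hasDerivWithinAt_const t S y)
  exact HasFDerivWithinAt.comp_hasDerivWithinAt (t := S ×ˢ U) t h1 h2 (fun s hs => ⟨hs, hy⟩)

lemma contDiffOn_slice (hG : ContDiffOn ℝ n (fun p : ℝ × E => G p.1 p.2) (S ×ˢ U)) (ht : t ∈ S) :
    ContDiffOn ℝ n (G t) U :=
  hG.comp (contDiff_prodMk_right t).contDiffOn (fun _ hz => ⟨ht, hz⟩)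

section

variable (hS : IsInterval S) (hU : IsOpen U)
  (hG : ContDiffOn ℝ ∞ (fun p : ℝ × E => G p.1 p.2) (S ×ˢ U))
include hS hU hG

lemma hasDerivWithinAt_family (ht : t ∈ S) (hy : y ∈ U) :
    HasDerivWithinAt (fun s => G s y) (tD S G t y) S t :=
  (hasDerivWithinAt_family_slice hG (by simp) ht hy).differentiableWithinAt.hasDerivWithinAt

lemma tD_eq (ht : t ∈ S) (hy : y ∈ U) :
    tD S G t y = fderivWithin ℝ (fun p : ℝ × E => G p.1 p.2) (S ×ˢ U) (t, y) (1, 0) :=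
  (hasDerivWithinAt_family_slice hG (by simp) ht hy).derivWithin (hS.uniqueDiffOn t ht)

lemma contDiffOn_fderivWithin_family : ContDiffOn ℝ ∞
    (fderivWithin ℝ (fun p : ℝ × E => G p.1 p.2) (S ×ˢ U)) (S ×ˢ U) :=
  hG.fderivWithin (hS.uniqueDiffOn.prod hU.uniqueDiffOn) (by simp)

lemma contDiffOn_tD : ContDiffOn ℝ ∞ (fun p : ℝ × E => tD S G p.1 p.2) (S ×ˢ U) :=
  ((contDiffOn_fderivWithin_family hS hU hG).clm_apply contDiffOn_const).congr
    fun _ hp => tD_eq hS hU hG hp.1 hp.2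

lemma contDiffOn_fderiv_family :
    ContDiffOn ℝ ∞ (fun p : ℝ × E => fderiv ℝ (G p.1) p.2) (S ×ˢ U) :=
  ((contDiffOn_fderivWithin_family hS hU hG).clm_comp contDiffOn_const).congr
    fun _ hp => (hasFDerivAt_of_family hU hG (by simp) hp.1 hp.2).fderiv

/-- Derivatives in the parameter and in the point commute. -/
lemma hasDerivWithinAt_fderiv_family (ht : t ∈ S) (hy : y ∈ U) :
    HasDerivWithinAt (fun s => fderiv ℝ (G s) y) (fderiv ℝ (tD S G t) y) S t := by
  set H := fun p : ℝ × E => G p.1 p.2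
  have hD := contDiffOn_fderivWithin_family hS hU hG
  have hW : UniqueDiffOn ℝ (S ×ˢ U) := hS.uniqueDiffOn.prod hU.uniqueDiffOn
  have h1 : HasDerivWithinAt (fun s => fderivWithin ℝ H (S ×ˢ U) (s, y)) _ S t :=
    hasDerivWithinAt_family_slice (G := fun s z => fderivWithin ℝ H (S ×ˢ U) (s, z)) hD (by simp)
      ht hy
  have h2 := h1.clm_comp (hasDerivWithinAt_const t S (ContinuousLinearMap.inr ℝ ℝ E))
  have h3 := h2.congr_of_mem (f₁ := fun s => fderiv ℝ (G s) y)
    (fun s hs => (hasFDerivAt_of_family hU hG (by simp) hs hy).fderiv) ht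
  refine h3.congr_deriv ?_
  have h4 := (hasFDerivAt_of_family (G := fun s z => fderivWithin ℝ H (S ×ˢ U) (s, z)) hU hD
    (by simp) ht hy).clm_apply (hasFDerivAt_const ((1 : ℝ), (0 : E)) y)
  have h5 := h4.congr_of_eventuallyEq (f₁ := tD S G t) (by
    filter_upwards [hU.mem_nhds hy] with z hz using tD_eq hS hU hG ht hz)
  rw [h5.fderiv]
  ext v
  -- Both expressions are mixed second derivatives of the joint function within S × U, taken in the
  -- directions (1, 0) and (0, v).
  have hsymm : IsSymmSndFDerivWithinAt ℝ H (S ×ˢ U) (t, y) := by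
    refine ContDiffWithinAt.isSymmSndFDerivWithinAt (n := ∞) (hG (t, y) ⟨ht, hy⟩) (by simpa using two_le_infty) hW ?_
      ⟨ht, hy⟩
    rw [interior_prod_eq, closure_prod_eq, hU.interior_eq]
    exact ⟨hS.subset_closure_interior ht, subset_closure hy⟩
  have := hsymm (1, 0) (0, v)
  simpa using this

end

end Families

/-! ### Kähler structures in coordinates -/

section KahlerLocal

variable {E : Type*} [NormedAddCommGroup E] [NormedSpace ℝ E] [FiniteDimensional ℝ E]

lemma fderiv_half_trL_mul {P : Type*} [NormedAddCommGroup P] [NormedSpace ℝ P]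
    {A B : P → E →L[ℝ] E} {A' B' : P →L[ℝ] E →L[ℝ] E} {y : P} (hA : HasFDerivAt A A' y)
    (hB : HasFDerivAt B B' y) (w : P) :
    fderiv ℝ (fun z => (1 / 2) * trL (A z * B z)) y w =
      (1 / 2) * trL (A' w * B y + A y * B' w) := by
  have h0 : HasFDerivAt (fun z => A z * B z) (fderiv ℝ (fun z => A z * B z) y) y :=
    (hA.mul' hB).differentiableAt.hasFDerivAt
  have e : fderiv ℝ (fun z => A z * B z) y w = A' w * B y + A y * B' w := by
    have h1 : HasFDerivAt (fun z => A z * B z) _ y := hA.mul' hB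
    rw [h1.fderiv]; simp [add_comm]
  rw [← e, (((hasFDerivAt_const trL y).clm_apply h0).const_mul (1 / 2)).fderiv]
  simp

/-- A Kähler structure on the open set `U` in coordinates. -/
structure IsKahlerOn (g : E → E →L[ℝ] E →L[ℝ] ℝ) (J : E → E →L[ℝ] E) (U : Set E) : Prop
    extends IsMetricOn g U where
  smooth_J : ContDiffOn ℝ ∞ J U
  J_sq : ∀ y ∈ U, J y * J y = -1
  g_J : ∀ y ∈ U, ∀ u v, g y (J y u) (J y v) = g y u v
  closed : ∀ y ∈ U, ∀ u v w, fderiv ℝ (fun z => (g z).comp (J z)) y u v w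
    + fderiv ℝ (fun z => (g z).comp (J z)) y v w u
    + fderiv ℝ (fun z => (g z).comp (J z)) y w u v = 0
  integrable : ∀ y ∈ U, ∀ u v, fderiv ℝ J y (J y u) v - fderiv ℝ J y (J y v) u
    + J y (fderiv ℝ J y v u) - J y (fderiv ℝ J y u v) = 0

/-- The endomorphism `u ↦ R(u,v)w`. -/
def ricEnd (Γ : E → E →L[ℝ] E →L[ℝ] E) (y v w : E) : E →L[ℝ] E :=
  ((fderiv ℝ Γ y).flip v).flip w - (fderiv ℝ Γ y v).flip w + (Γ y).flip (Γ y v w)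
    - (Γ y v).comp ((Γ y).flip w)

lemma ricEnd_apply (Γ : E → E →L[ℝ] E →L[ℝ] E) (y u v w : E) :
    ricEnd Γ y v w u = curv Γ y u v w := by
  simp [ricEnd, curv, clm_mul_apply]

/-- The Ricci tensor of the metric `g` in coordinates. -/
def ric (g : E → E →L[ℝ] E →L[ℝ] ℝ) (y v w : E) : ℝ := trL (ricEnd (lc g) y v w)

/-- The form `tr (J R(u,v)) / 2`, which is the Ricci form of a Kähler metric. -/
def rho (g : E → E →L[ℝ] E →L[ℝ] ℝ) (J : E → E →L[ℝ] E) (y : E) : E →L[ℝ] E →L[ℝ] ℝ :=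
  (ContinuousLinearMap.compL ℝ E (E →L[ℝ] E) ℝ
    ((1 / 2 : ℝ) • trL.comp (ContinuousLinearMap.mul ℝ (E →L[ℝ] E) (J y)))).comp
  (fderiv ℝ (lc g) y - (fderiv ℝ (lc g) y).flip
    + (ContinuousLinearMap.mul ℝ (E →L[ℝ] E)).bilinearComp (lc g y) (lc g y)
    - ((ContinuousLinearMap.mul ℝ (E →L[ℝ] E)).bilinearComp (lc g y) (lc g y)).flip)

lemma rho_apply (g : E → E →L[ℝ] E →L[ℝ] ℝ) (J : E → E →L[ℝ] E) (y u v : E) :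
    rho g J y u v = (1 / 2) * trL (J y * curv (lc g) y u v) := rfl

namespace IsKahlerOn

variable {g : E → E →L[ℝ] E →L[ℝ] ℝ} {J : E → E →L[ℝ] E} {U : Set E} (h : IsKahlerOn g J U) {y : E}
  (hy : y ∈ U)
include h hy

lemma contDiffAt_J : ContDiffAt ℝ ∞ J y := h.smooth_J.contDiffAt (h.isOpen.mem_nhds hy)

lemma hasFDerivAt_J : HasFDerivAt J (fderiv ℝ J y) y :=
  ((h.contDiffAt_J hy).differentiableAt (by simp)).hasFDerivAt

lemma J_J (u : E) : J y (J y u) = -u := by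
  have := congrArg (fun T => T u) (h.J_sq y hy)
  simpa using this

lemma g_J_skew (u v : E) : g y (J y u) v = -g y u (J y v) := by
  rw [← h.g_J y hy u, h.J_J hy]; simp

lemma fderiv_form (u v w : E) : fderiv ℝ (fun z => (g z).comp (J z)) y u v w =
    fderiv ℝ g y u (J y v) w + g y (fderiv ℝ J y u v) w := by
  have := ((h.hasFDerivAt hy).clm_comp (h.hasFDerivAt_J hy)).fderiv
  rw [this]; simp; ring

/-- The complex structure of a Kähler metric is parallel. -/
lemma parallel_J (u : E) : fderiv ℝ J y u = J y * lc g y u - lc g y u * J y := by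
  set Γ := lc g y with hΓ
  have hsym := h.lc_symm hy
  have hpar := h.parallel hy
  have hgs := h.symm y hy
  have hsk := h.g_J_skew hy
  have hJJ := h.J_J hy
  -- N(u, v) is (∇_u J)v. The five hypotheses of `kahler_torsion_eq_zero` hold for g(N(u, v), w):
  -- skewness comes from differentiating that of the Kähler form, the rule for J from
  -- differentiating J² = -1, and the last two from dω = 0 and the vanishing Nijenhuis tensor, where
  -- torsion-freeness cancels the Christoffel terms.
  let N : E → E → E := fun u v => fderiv ℝ J y u v - J y (Γ u v) + Γ u (J y v)
  have dJJ : ∀ u v, fderiv ℝ J y u (J y v) = -J y (fderiv ℝ J y u v) := by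
    intro u v
    have h1 := ((h.hasFDerivAt_J hy).mul' (h.hasFDerivAt_J hy)).congr_of_eventuallyEq
      (f₁ := fun _ => (-1 : E →L[ℝ] E)) (by
        filter_upwards [h.isOpen.mem_nhds hy] with z hz using (h.J_sq z hz).symm)
    have h2 := congrArg (fun T => T u v) (h1.unique (hasFDerivAt_const (-1 : E →L[ℝ] E) y))
    simp [clm_mul_apply] at h2
    rw [eq_neg_iff_add_eq_zero, add_comm]; exact h2
  have dskew : ∀ u v w, fderiv ℝ g y u (J y v) w + g y (fderiv ℝ J y u v) w =
      -(fderiv ℝ g y u (J y w) v + g y (fderiv ℝ J y u w) v) := by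
    intro u v w
    have a := fun v w => (((h.hasFDerivAt hy).clm_comp (h.hasFDerivAt_J hy)).clm_apply
      (hasFDerivAt_const v y)).clm_apply (hasFDerivAt_const w y)
    have h3 := (a w v).neg.congr_of_eventuallyEq (f₁ := fun z => (g z).comp (J z) v w) (by
      filter_upwards [h.isOpen.mem_nhds hy] with z hz
      simp [h.g_J_skew hz v w, h.symm z hz v])
    have h4 := congrArg (fun T => T u) ((a v w).unique h3)
    simp at h4
    linarith
  have key : ∀ u v w, g y (N u v) w = 0 := by
    intro u v w
    refine kahler_torsion_eq_zero (J := J y) (S := fun u v w => g y (N u v) w) hJJ ?_ ?_ ?_ ?_ ?_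
      u v w
    · intro u v w
      have : N u (-v) = -N u v := by simp only [N, map_neg]; abel
      simp [this]
    · intro u v w
      have := dskew u v w
      rw [hpar, hpar] at this
      have e1 := hsk (Γ u v) w
      have e2 := hsk (Γ u w) v
      simp only [N, map_sub, map_add, sub_apply, add_apply]
      linarith [hgs (Γ u v) (J y w), hgs (Γ u w) (J y v)]
    · intro u v w
      have : N u (J y v) = -J y (N u v) := by
        simp only [N, map_sub, map_add, map_neg, dJJ, hJJ]; abel
      rw [this, map_neg, neg_apply, hsk, neg_neg]
    · intro u v w
      have := h.closed y hy u v w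
      rw [h.fderiv_form hy, h.fderiv_form hy, h.fderiv_form hy, hpar, hpar, hpar] at this
      simp only [N, map_sub, map_add, sub_apply, add_apply]
      have e1 := hsk v (Γ u w)
      have e2 := hsk w (Γ v u)
      have e3 := hsk u (Γ w v)
      rw [hgs] at e1 e2 e3
      have c : ∀ u v w, g y v (J y (Γ u w)) = g y (J y (Γ w u)) v := by
        intro u v w; rw [hgs, hsym]
      rw [c] at e1 e2 e3
      rw [hgs] at e1 e2 e3
      linarith
    · intro u v w
      have := congrArg (fun x => g y x w) (h.integrable y hy u v)
      simp only [map_sub, map_add, sub_apply, add_apply, hsk (fderiv ℝ J y _ _)] at this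
      simp only [N, map_sub, map_add, sub_apply, add_apply, map_zero, zero_apply] at this ⊢
      have c1 : g y (J y (Γ (J y u) v)) w = - g y (Γ v (J y u)) (J y w) := by rw [hsk, hsym]
      have c2 : g y (J y (Γ (J y v) u)) w = - g y (Γ u (J y v)) (J y w) := by rw [hsk, hsym]
      have c3 : Γ (J y u) (J y v) = Γ (J y v) (J y u) := hsym _ _
      have c4 : Γ u v = Γ v u := hsym _ _
      rw [c1, c2, c3, c4]
      linarith
  ext v
  have : N u v = 0 := h.nondeg hy _ (key u v)
  simp only [sub_apply, clm_mul_apply]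
  rw [← sub_eq_zero, ← this]; simp only [N]; abel

lemma differentiableAt_lc : DifferentiableAt ℝ (lc g) y :=
  (h.contDiffAt_lc hy).differentiableAt (by simp)

lemma kahlerCurv : KahlerCurv (g y) (J y) (curv (lc g) y) where
  symm := h.symm y hy
  nondeg := h.nondeg hy
  J_sq := h.J_sq y hy
  g_J := h.g_J y hy
  swap := curv_swap _ _
  bianchi := bianchi_one (h.differentiableAt_lc hy) (by
    filter_upwards [h.isOpen.mem_nhds hy] with z hz using h.lc_symm hz)
  skew := curv_skew_of_parallel (h.differentiableAt_lc hy) ((h.contDiffAt hy).of_le two_le_infty) (by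
    filter_upwards [h.isOpen.mem_nhds hy] with z hz using h.parallel hz)
  comm := curv_comm_of_parallel (h.differentiableAt_lc hy) ((h.contDiffAt_J hy).of_le two_le_infty) (by
    filter_upwards [h.isOpen.mem_nhds hy] with z hz using h.parallel_J hz)

lemma ric_J (u v : E) : ric g y (J y u) v = rho g J y u v :=
  (h.kahlerCurv hy).ricci_form (fun _ _ _ => ricEnd_apply _ _ _ _ _) u v

lemma rho_swap (u v : E) : rho g J y u v = -rho g J y v u := by
  rw [rho_apply, rho_apply, curv_swap]; simp

/-- The Ricci form of a Kähler metric is closed. -/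
lemma rho_closed (u v w : E) : fderiv ℝ (fun z => rho g J z u v) y w
    + fderiv ℝ (fun z => rho g J z v w) y u + fderiv ℝ (fun z => rho g J z w u) y v = 0 := by
  have hΓ2 : ContDiffAt ℝ 2 (lc g) y := (h.contDiffAt_lc hy).of_le two_le_infty
  -- Because J is parallel, the derivative of tr(J R) is the trace of J times the covariant
  -- derivative of R; the cyclic sum of the latter is the second Bianchi identity.
  have key : ∀ u v w, fderiv ℝ (fun z => rho g J z u v) y w = (1 / 2) * trL (J y *
      (fderiv ℝ (fun z => curv (lc g) z u v) y w
        + (lc g y w * curv (lc g) y u v - curv (lc g) y u v * lc g y w))) := by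
    intro u v w
    have h1 := fderiv_half_trL_mul (h.hasFDerivAt_J hy) (hasFDerivAt_curv hΓ2 u v w).1 w
    rw [h.parallel_J hy] at h1
    refine h1.trans ?_
    have := trL_mul_comm (lc g y w) (J y * curv (lc g) y u v)
    simp only [mul_add, mul_sub, sub_mul, map_add, map_sub, mul_assoc] at this ⊢
    linarith
  rw [key, key, key, ← mul_add, ← mul_add, ← map_add, ← map_add, ← mul_add, ← mul_add,
    bianchi_two hΓ2]
  simp

end IsKahlerOn

end KahlerLocal

/-! ### Families of Kähler structures: variation of the Ricci form -/

section KahlerFamily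

variable {E : Type*} [NormedAddCommGroup E] [NormedSpace ℝ E] [FiniteDimensional ℝ E]

/-- A smooth family of Kähler structures in coordinates. -/
structure IsKahlerFamily (S : Set ℝ) (g : ℝ → E → E →L[ℝ] E →L[ℝ] ℝ) (J : ℝ → E → E →L[ℝ] E)
    (U : Set E) : Prop where
  kahler : ∀ t ∈ S, IsKahlerOn (g t) (J t) U
  smooth_g : ContDiffOn ℝ ∞ (fun p : ℝ × E => g p.1 p.2) (S ×ˢ U)
  smooth_J : ContDiffOn ℝ ∞ (fun p : ℝ × E => J p.1 p.2) (S ×ˢ U)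

/-- The one-form `tr (J ∂_tΓ(v)) / 2`, a primitive of the variation of the Ricci form. -/
def beta (S : Set ℝ) (g : ℝ → E → E →L[ℝ] E →L[ℝ] ℝ) (J : ℝ → E → E →L[ℝ] E) (t : ℝ) (y : E) :
    E →L[ℝ] ℝ :=
  ((1 / 2 : ℝ) • trL.comp (ContinuousLinearMap.mul ℝ (E →L[ℝ] E) (J t y))).comp
    (tD S (fun s => lc (g s)) t y)

lemma beta_apply (S : Set ℝ) (g : ℝ → E → E →L[ℝ] E →L[ℝ] ℝ) (J : ℝ → E → E →L[ℝ] E) (t : ℝ)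
    (y v : E) : beta S g J t y v = (1 / 2) * trL (J t y * tD S (fun s => lc (g s)) t y v) := rfl

/-- The vector field `X` with `ρ(X, ·) = -β`. -/
def moserField (S : Set ℝ) (g : ℝ → E → E →L[ℝ] E →L[ℝ] ℝ) (J : ℝ → E → E →L[ℝ] E) (t : ℝ)
    (y : E) : E := (rho (g t) (J t) y).inverse (-beta S g J t y)

namespace IsKahlerFamily

variable {S : Set ℝ} {g : ℝ → E → E →L[ℝ] E →L[ℝ] ℝ} {J : ℝ → E → E →L[ℝ] E} {U : Set E}
  (h : IsKahlerFamily S g J U) (hS : IsInterval S) (hU : IsOpen U)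
include h hS hU

lemma contDiffOn_lc : ContDiffOn ℝ ∞ (fun p : ℝ × E => lc (g p.1) p.2) (S ×ˢ U) := by
  have h2 := contDiffOn_fderiv_family hS hU h.smooth_g
  have h1 : ContDiffOn ℝ ∞ (fun p : ℝ × E => (g p.1 p.2).inverse) (S ×ˢ U) := fun p hp =>
    ContDiffAt.comp_contDiffWithinAt (g := ContinuousLinearMap.inverse) p
      ((h.kahler p.1 hp.1).isInvertible hp.2).contDiffAt_map_inverse (h.smooth_g p hp)
  have h3 : ContDiffOn ℝ ∞ (fun p : ℝ × E => (fderiv ℝ (g p.1) p.2).flip) (S ×ˢ U) :=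
    (ContinuousLinearMap.flipₗᵢ ℝ E E (E →L[ℝ] ℝ)).toContinuousLinearEquiv.contDiff.comp_contDiffOn
      h2
  have h4 : ContDiffOn ℝ ∞ (fun p : ℝ × E => koszul (g p.1) p.2) (S ×ˢ U) :=
    ((h2.add h3).sub (contDiffOn_const.clm_comp h3)).const_smul _
  exact (((ContinuousLinearMap.compL ℝ E (E →L[ℝ] ℝ) E).contDiff.comp_contDiffOn h1).clm_comp h4)

lemma contDiffOn_rho :
    ContDiffOn ℝ ∞ (fun p : ℝ × E => rho (g p.1) (J p.1) p.2) (S ×ˢ U) := by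
  have hΓ := h.contDiffOn_lc hS hU
  have h2 : ContDiffOn ℝ ∞ (fun p : ℝ × E => fderiv ℝ (lc (g p.1)) p.2) (S ×ˢ U) :=
    contDiffOn_fderiv_family (G := fun t => lc (g t)) hS hU hΓ
  have fl : ∀ {A : ℝ × E → E →L[ℝ] E →L[ℝ] (E →L[ℝ] E)}, ContDiffOn ℝ ∞ A (S ×ˢ U) →
      ContDiffOn ℝ ∞ (fun p => (A p).flip) (S ×ˢ U) := fun hA =>
    (ContinuousLinearMap.flipₗᵢ ℝ E E (E →L[ℝ] E)).toContinuousLinearEquiv.contDiff.comp_contDiffOn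
      hA
  have fl' : ∀ {A : ℝ × E → E →L[ℝ] (E →L[ℝ] E) →L[ℝ] (E →L[ℝ] E)}, ContDiffOn ℝ ∞ A (S ×ˢ U) →
      ContDiffOn ℝ ∞ (fun p => (A p).flip) (S ×ˢ U) := fun hA =>
    (ContinuousLinearMap.flipₗᵢ ℝ E (E →L[ℝ] E)
      (E →L[ℝ] E)).toContinuousLinearEquiv.contDiff.comp_contDiffOn hA
  have hm : ContDiffOn ℝ ∞ (fun p : ℝ × E => (ContinuousLinearMap.mul ℝ (E →L[ℝ] E)).bilinearComp
      (lc (g p.1) p.2) (lc (g p.1) p.2)) (S ×ˢ U) :=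
    fl ((fl' (contDiffOn_const.clm_comp hΓ)).clm_comp hΓ)
  have hJ : ContDiffOn ℝ ∞ (fun p : ℝ × E => (1 / 2 : ℝ) • (trL (E := E)).comp
      (ContinuousLinearMap.mul ℝ (E →L[ℝ] E) (J p.1 p.2))) (S ×ˢ U) :=
    (contDiffOn_const.clm_comp
      ((ContinuousLinearMap.mul ℝ (E →L[ℝ] E)).contDiff.comp_contDiffOn h.smooth_J)).const_smul _
  exact (((ContinuousLinearMap.compL ℝ E (E →L[ℝ] E) ℝ).contDiff.comp_contDiffOn hJ).clm_comp
    (((h2.sub (fl h2)).add hm).sub (fl hm)))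

lemma contDiffOn_beta :
    ContDiffOn ℝ ∞ (fun p : ℝ × E => beta S g J p.1 p.2) (S ×ˢ U) := by
  have hJ : ContDiffOn ℝ ∞ (fun p : ℝ × E => (1 / 2 : ℝ) • (trL (E := E)).comp
      (ContinuousLinearMap.mul ℝ (E →L[ℝ] E) (J p.1 p.2))) (S ×ˢ U) :=
    (contDiffOn_const.clm_comp
      ((ContinuousLinearMap.mul ℝ (E →L[ℝ] E)).contDiff.comp_contDiffOn h.smooth_J)).const_smul _
  exact hJ.clm_comp (contDiffOn_tD (G := fun t => lc (g t)) hS hU (h.contDiffOn_lc hS hU))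

lemma contDiffOn_moserField
    (hd : ∀ t ∈ S, ∀ y ∈ U, ∀ u, (∀ v, rho (g t) (J t) y u v = 0) → u = 0) :
    ContDiffOn ℝ ∞ (fun p : ℝ × E => moserField S g J p.1 p.2) (S ×ˢ U) := by
  have h1 : ContDiffOn ℝ ∞ (fun p : ℝ × E => (rho (g p.1) (J p.1) p.2).inverse) (S ×ˢ U) :=
    fun p hp => ContDiffAt.comp_contDiffWithinAt (g := ContinuousLinearMap.inverse) p
      (isInvertible_of_nondegenerate (hd p.1 hp.1 p.2 hp.2)).contDiffAt_map_inverse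
      (h.contDiffOn_rho hS hU p hp)
  exact h1.clm_apply (h.contDiffOn_beta hS hU).neg

variable {t : ℝ} (ht : t ∈ S) {y : E} (hy : y ∈ U)
include ht hy

/-- Differentiating J² = -1 shows that ∂_tJ anticommutes with J, so conjugation by J changes the
sign of the trace. Applied to the curvature, this removes the contribution of a moving complex
structure from the variation of the Ricci form. -/
lemma trL_tD_J_mul {R : E →L[ℝ] E} (hR : R * J t y = J t y * R) :
    trL (tD S J t y * R) = 0 := by
  have h1 := hasDerivWithinAt_family hS hU h.smooth_J ht hy
  have h2 : HasDerivWithinAt (fun s => J s y * J s y) _ S t := h1.mul h1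
  have h3 := h2.congr_of_mem (f₁ := fun _ => (-1 : E →L[ℝ] E))
    (fun s hs => ((h.kahler s hs).J_sq y hy).symm) ht
  have h4 := (hS.uniqueDiffOn t ht).eq_deriv _ h3 (hasDerivWithinAt_const t S _)
  set J' := tD S J t y
  set J0 := J t y
  have sq : J0 * J0 = -1 := (h.kahler t ht).J_sq y hy
  have e1 : trL (J' * R) = -trL (J0 * J' * (R * J0)) := by
    rw [trL_mul_comm (J0 * J'), mul_assoc, ← mul_assoc J0, sq, trL_mul_comm J']; simp
  have e2 : J0 * J' = -(J' * J0) := by rw [eq_neg_iff_add_eq_zero, add_comm]; exact h4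
  rw [e2, hR] at e1
  have e3 : J' * J0 * (J0 * R) = -(J' * R) := by
    rw [mul_assoc, ← mul_assoc J0, sq]; simp
  rw [neg_mul, e3] at e1
  simp at e1
  linarith

/-- The variation of the Ricci form is the differential of `beta`. -/
lemma hasDerivWithinAt_rho (u v : E) : HasDerivWithinAt (fun s => rho (g s) (J s) y u v)
    (fderiv ℝ (fun z => beta S g J t z v) y u - fderiv ℝ (fun z => beta S g J t z u) y v) S t := by
  have hK := h.kahler t ht
  have hΓ := h.contDiffOn_lc hS hU
  set Γ := fun s => lc (g s)
  have hΓ1 := hasDerivWithinAt_family (G := Γ) hS hU hΓ ht hy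
  have hΓ2 := hasDerivWithinAt_fderiv_family (G := Γ) hS hU hΓ ht hy
  have hΓ' : HasFDerivAt (tD S Γ t) (fderiv ℝ (tD S Γ t) y) y :=
    (((contDiffOn_slice (contDiffOn_tD (G := Γ) hS hU hΓ) ht).contDiffAt
      (hU.mem_nhds hy)).differentiableAt (by simp)).hasFDerivAt
  have hJ1 := hasDerivWithinAt_family hS hU h.smooth_J ht hy
  have c := fun u => hΓ1.clm_apply (hasDerivWithinAt_const t S u)
  have d := fun u v => (hΓ2.clm_apply (hasDerivWithinAt_const t S u)).clm_apply
    (hasDerivWithinAt_const t S v)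
  have hR : HasDerivWithinAt (fun s => curv (Γ s) y u v) _ S t :=
    (((d u v).sub (d v u)).add ((c u).mul (c v))).sub ((c v).mul (c u))
  have h0 : HasDerivWithinAt (fun s => J s y * curv (Γ s) y u v) _ S t := hJ1.mul hR
  have h1 := ((hasDerivWithinAt_const t S (trL (E := E))).clm_apply h0).const_mul (1 / 2)
  refine h1.congr_deriv ?_
  -- Here ∇J = 0 replaces the spatial derivative of J by a commutator with Γ. By cyclicity of the
  -- trace these commutators produce the terms quadratic in Γ and ∂_tΓ in the variation of the
  -- curvature.
  have hb : ∀ u v, fderiv ℝ (fun z => beta S g J t z v) y u = (1 / 2) *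
      trL ((J t y * Γ t y u - Γ t y u * J t y) * tD S Γ t y v
        + J t y * fderiv ℝ (tD S Γ t) y u v) := by
    intro u v
    have h2 := fderiv_half_trL_mul (hK.hasFDerivAt_J hy)
      (hΓ'.clm_apply (hasFDerivAt_const v y)) u
    rw [hK.parallel_J hy] at h2
    refine h2.trans ?_
    simp [Γ]
  rw [hb, hb]
  have t0 := h.trL_tD_J_mul hS hU ht hy ((hK.kahlerCurv hy).comm u v)
  have t1 := trL_mul_comm (Γ t y u) (J t y * tD S Γ t y v)
  have t2 := trL_mul_comm (Γ t y v) (J t y * tD S Γ t y u)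
  simp only [map_zero, zero_apply, zero_add, add_zero, map_add, map_sub, mul_add, mul_sub, sub_mul,
    mul_assoc] at t0 t1 t2 ⊢
  linarith

end IsKahlerFamily

end KahlerFamily

/-! ### Invariance under changes of coordinates -/

section Invariance

variable {E : Type*} [NormedAddCommGroup E] [NormedSpace ℝ E] [FiniteDimensional ℝ E]

/-- `φ` is a local isomorphism between Kähler structures in coordinates. -/
structure IsKahlerIso (g : E → E →L[ℝ] E →L[ℝ] ℝ) (J : E → E →L[ℝ] E) (U : Set E)
    (g' : E → E →L[ℝ] E →L[ℝ] ℝ) (J' : E → E →L[ℝ] E) (U' : Set E) (φ : E → E) : Prop where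
  source : IsKahlerOn g J U
  target : IsKahlerOn g' J' U'
  mapsTo : Set.MapsTo φ U U'
  smooth : ContDiffOn ℝ ∞ φ U
  invertible : ∀ y ∈ U, (fderiv ℝ φ y).IsInvertible
  g_eq : ∀ y ∈ U, ∀ u v, g y u v = g' (φ y) (fderiv ℝ φ y u) (fderiv ℝ φ y v)
  J_eq : ∀ y ∈ U, ∀ u, fderiv ℝ φ y (J y u) = J' (φ y) (fderiv ℝ φ y u)

namespace IsKahlerIso

variable {g : E → E →L[ℝ] E →L[ℝ] ℝ} {J : E → E →L[ℝ] E} {U : Set E}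
  {g' : E → E →L[ℝ] E →L[ℝ] ℝ} {J' : E → E →L[ℝ] E} {U' : Set E} {φ : E → E}
  (h : IsKahlerIso g J U g' J' U' φ) {y : E} (hy : y ∈ U)
include h hy

lemma contDiffAt : ContDiffAt ℝ ∞ φ y := h.smooth.contDiffAt (h.source.isOpen.mem_nhds hy)

/-- The connection transported back by φ is symmetric and compatible with the pulled back metric, so
uniqueness identifies it with the Levi-Civita connection. -/
lemma lc_eq (u v : E) : fderiv ℝ φ y (lc g y u v) = fderiv ℝ (fderiv ℝ φ) y u v
    + lc g' (φ y) (fderiv ℝ φ y u) (fderiv ℝ φ y v) := by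
  have hφ2 : ContDiffAt ℝ 2 φ y := (h.contDiffAt hy).of_le two_le_infty
  have hφ1 : HasFDerivAt φ (fderiv ℝ φ y) y := (hφ2.differentiableAt (by norm_num)).hasFDerivAt
  have hD := hasFDerivAt_fderiv hφ2
  have hy' := h.mapsTo hy
  have hinv := h.invertible y hy
  have key := h.source.lc_unique hy (Γ := fun u v => (fderiv ℝ φ y).inverse
    (fderiv ℝ (fderiv ℝ φ) y u v + lc g' (φ y) (fderiv ℝ φ y u) (fderiv ℝ φ y v))) ?_ ?_ u v
  · rw [← key, hinv.self_apply_inverse]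
  · intro u v
    rw [fderiv_fderiv_comm hφ2, h.target.lc_symm hy']
  · intro u v w
    rw [h.g_eq y hy, h.g_eq y hy, hinv.self_apply_inverse, hinv.self_apply_inverse]
    have h0 : HasFDerivAt (fun z => g' (φ z)) _ y :=
      HasFDerivAt.comp (g := g') y (h.target.hasFDerivAt hy') hφ1
    have h1 := (h0.clm_apply (hD.clm_apply (hasFDerivAt_const v y))).clm_apply
      (hD.clm_apply (hasFDerivAt_const w y))
    have h2 := ((h.source.hasFDerivAt hy).clm_apply (hasFDerivAt_const v y)).clm_apply
      (hasFDerivAt_const w y)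
    have hf := hD.clm_apply (hasFDerivAt_const v y)
    have h3 := h1.congr_of_eventuallyEq (f₁ := fun z => g z v w) (by
      filter_upwards [h.source.isOpen.mem_nhds hy] with z hz using h.g_eq z hz v w)
    have h4 := congrArg (fun T => T u) (h2.unique h3)
    simp at h4
    rw [h4, h.target.parallel hy']
    simp
    ring

lemma curv_eq (u v w : E) : curv (lc g') (φ y) (fderiv ℝ φ y u) (fderiv ℝ φ y v) (fderiv ℝ φ y w) =
    fderiv ℝ φ y (curv (lc g) y u v w) := by
  refine curv_frame (h.target.differentiableAt_lc (h.mapsTo hy)) (h.source.differentiableAt_lc hy)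
    ((h.contDiffAt hy).of_le two_le_infty)
    (((h.contDiffAt hy).fderiv_right (m := ∞) le_rfl).of_le two_le_infty) ?_ u v w
  filter_upwards [h.source.isOpen.mem_nhds hy] with z hz u
  ext v
  simp [h.lc_eq hz]

lemma rho_eq (u v : E) :
    rho g J y u v = rho g' J' (φ y) (fderiv ℝ φ y u) (fderiv ℝ φ y v) := by
  rw [rho_apply, rho_apply, trL_conj (h.invertible y hy)]
  intro x
  rw [clm_mul_apply, clm_mul_apply, h.curv_eq hy, h.J_eq y hy]

lemma ric_eq (u v : E) : ric g y u v = ric g' (φ y) (fderiv ℝ φ y u) (fderiv ℝ φ y v) := by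
  rw [ric, ric, trL_conj (h.invertible y hy)]
  intro x
  rw [ricEnd_apply, ricEnd_apply, h.curv_eq hy]

end IsKahlerIso

variable {S : Set ℝ} {g : ℝ → E → E →L[ℝ] E →L[ℝ] ℝ} {J : ℝ → E → E →L[ℝ] E} {U : Set E}
  {g' : ℝ → E → E →L[ℝ] E →L[ℝ] ℝ} {J' : ℝ → E → E →L[ℝ] E} {U' : Set E} {φ : E → E}
  {t : ℝ} {y : E}

/-- The inhomogeneous second-derivative term in the transformation law of Γ does not depend on t, so
∂_tΓ transforms as a tensor and β is a global one-form. -/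
lemma beta_eq (hS : IsInterval S) (h : IsKahlerFamily S g J U) (h' : IsKahlerFamily S g' J' U')
    (hφ : ∀ t ∈ S, IsKahlerIso (g t) (J t) U (g' t) (J' t) U' φ) (ht : t ∈ S) (hy : y ∈ U) (v : E) :
    beta S g J t y v = beta S g' J' t (φ y) (fderiv ℝ φ y v) := by
  have hU := (hφ t ht).source.isOpen
  have hU' := (hφ t ht).target.isOpen
  rw [beta_apply, beta_apply, trL_conj ((hφ t ht).invertible y hy)]
  intro x
  rw [clm_mul_apply, clm_mul_apply, (hφ t ht).J_eq y hy]
  congr 1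
  have c := fun u v => ((hasDerivWithinAt_family (G := fun s => lc (g s)) hS hU
    (h.contDiffOn_lc hS hU) ht hy).clm_apply (hasDerivWithinAt_const t S u)).clm_apply
    (hasDerivWithinAt_const t S v)
  have c' := fun u v => ((hasDerivWithinAt_family (G := fun s => lc (g' s)) hS hU'
    (h'.contDiffOn_lc hS hU') ht ((hφ t ht).mapsTo hy)).clm_apply
      (hasDerivWithinAt_const t S u)).clm_apply (hasDerivWithinAt_const t S v)
  have c1 := (hasDerivWithinAt_const t S (fderiv ℝ φ y)).clm_apply (c v x)
  have c2 := ((hasDerivWithinAt_const t S (fderiv ℝ (fderiv ℝ φ) y v x)).add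
    (c' (fderiv ℝ φ y v) (fderiv ℝ φ y x)))
  have c3 := c2.congr_of_mem (f₁ := fun s => fderiv ℝ φ y (lc (g s) y v x))
    (fun s hs => (hφ s hs).lc_eq hy v x) ht
  have := (hS.uniqueDiffOn t ht).eq_deriv _ c1 c3
  simpa using this

lemma moserField_eq (hS : IsInterval S) (h : IsKahlerFamily S g J U)
    (h' : IsKahlerFamily S g' J' U')
    (hφ : ∀ t ∈ S, IsKahlerIso (g t) (J t) U (g' t) (J' t) U' φ) (ht : t ∈ S) (hy : y ∈ U)
    (hd : ∀ u, (∀ v, rho (g t) (J t) y u v = 0) → u = 0)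
    (hd' : ∀ u, (∀ v, rho (g' t) (J' t) (φ y) u v = 0) → u = 0) :
    fderiv ℝ φ y (moserField S g J t y) = moserField S g' J' t (φ y) := by
  have e := (isInvertible_of_nondegenerate hd).self_apply_inverse (-beta S g J t y)
  have e' := (isInvertible_of_nondegenerate hd').self_apply_inverse (-beta S g' J' t (φ y))
  refine ext_of_nondegenerate hd' fun w => ?_
  obtain ⟨v, rfl⟩ := ((hφ t ht).invertible y hy).surjective w
  rw [← (hφ t ht).rho_eq hy, moserField, moserField, e, e', neg_apply, neg_apply,
    beta_eq hS h h' hφ ht hy]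

end Invariance

/-! ### Coordinates on manifolds -/

section Euclidean

variable {m : ℕ}

/-- The coordinate functionals of `ℝ^m`. -/
def coordL (i : Fin m) : EuclideanSpace ℝ (Fin m) →L[ℝ] ℝ := EuclideanSpace.proj i

@[simp] lemma coordL_apply (i : Fin m) (u : EuclideanSpace ℝ (Fin m)) : coordL i u = u i := rfl

lemma sum_stdVec (u : EuclideanSpace ℝ (Fin m)) : u = ∑ i, u i • stdVec m i := by
  ext j
  simp [stdVec, Finset.sum_apply, Pi.single_apply]

lemma stdVec_apply (i j : Fin m) : stdVec m i j = if j = i then 1 else 0 := by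
  simp [stdVec, Pi.single_apply]

lemma stdVec_induction {p : EuclideanSpace ℝ (Fin m) → Prop} (h0 : p 0)
    (hadd : ∀ u v, p u → p v → p (u + v)) (hsmul : ∀ (a : ℝ) u, p u → p (a • u))
    (h : ∀ i, p (stdVec m i)) (u : EuclideanSpace ℝ (Fin m)) : p u := by
  rw [sum_stdVec u]
  exact Finset.sum_induction _ p hadd h0 fun i _ => hsmul _ _ (h i)

lemma trL_eq_sum (A : EuclideanSpace ℝ (Fin m) →L[ℝ] EuclideanSpace ℝ (Fin m)) :
    trL A = ∑ i, A (stdVec m i) i := by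
  rw [trL_apply, LinearMap.trace_eq_matrix_trace ℝ (EuclideanSpace.basisFun (Fin m) ℝ).toBasis,
    Matrix.trace]
  simp [Matrix.diag, LinearMap.toMatrix_apply, stdVec]

end Euclidean

section Charts

variable {m : ℕ} {M : Type*} [TopologicalSpace M] [ChartedSpace (EuclideanSpace ℝ (Fin m)) M]

/-- The coordinates of tangent vectors at `x` in the chart centred at `c`. -/
def vecC (c x : M) : TangentSpace (𝓡 m) x →L[ℝ] EuclideanSpace ℝ (Fin m) :=
  mfderiv (𝓡 m) (𝓡 m) (extChartAt (𝓡 m) c) x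

lemma vecCoord_eq (c x : M) (v : TangentSpace (𝓡 m) x) (i : Fin m) :
    vecCoord c x v i = vecC c x v i := rfl

/-- Coordinate expression of a field of bilinear forms. -/
def bC (B : BilinField m M) (c : M) (y : EuclideanSpace ℝ (Fin m)) :
    EuclideanSpace ℝ (Fin m) →L[ℝ] EuclideanSpace ℝ (Fin m) →L[ℝ] ℝ :=
  ∑ i, ∑ j, bilinComp B c i j y •
    (coordL i).smulRight (coordL j)

/-- Coordinate expression of a field of endomorphisms. -/
def eC (A : EndField m M) (c : M) (y : EuclideanSpace ℝ (Fin m)) :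
    EuclideanSpace ℝ (Fin m) →L[ℝ] EuclideanSpace ℝ (Fin m) :=
  ∑ i, ∑ j, endComp A c i j y • (coordL j).smulRight (stdVec m i)

/-- The change of coordinates from the chart at `c` to the chart at `d`. -/
def trans (c d : M) (y : EuclideanSpace ℝ (Fin m)) : EuclideanSpace ℝ (Fin m) :=
  extChartAt (𝓡 m) d (chartPt c y)

/-- The domain of `trans c d`. -/
def transDom (c d : M) : Set (EuclideanSpace ℝ (Fin m)) :=
  chartDom m c ∩ chartPt c ⁻¹' (extChartAt (𝓡 m) d).source

lemma isOpen_chartDom (c : M) : IsOpen (chartDom m c) := isOpen_extChartAt_target c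

lemma chartPt_mem {c : M} {y : EuclideanSpace ℝ (Fin m)} (hy : y ∈ chartDom m c) :
    chartPt c y ∈ (extChartAt (𝓡 m) c).source := (extChartAt (𝓡 m) c).map_target hy

lemma ext_chartPt {c : M} {y : EuclideanSpace ℝ (Fin m)} (hy : y ∈ chartDom m c) :
    extChartAt (𝓡 m) c (chartPt c y) = y := (extChartAt (𝓡 m) c).right_inv hy

lemma chartPt_ext {c x : M} (hx : x ∈ (extChartAt (𝓡 m) c).source) :
    chartPt c (extChartAt (𝓡 m) c x) = x := (extChartAt (𝓡 m) c).left_inv hx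

lemma ext_mem {c x : M} (hx : x ∈ (extChartAt (𝓡 m) c).source) :
    extChartAt (𝓡 m) c x ∈ chartDom m c := (extChartAt (𝓡 m) c).map_source hx

lemma ext_mem_transDom {c d x : M} (hx : x ∈ (extChartAt (𝓡 m) c).source)
    (hx' : x ∈ (extChartAt (𝓡 m) d).source) : extChartAt (𝓡 m) c x ∈ transDom c d :=
  ⟨ext_mem hx, by rw [Set.mem_preimage, chartPt_ext hx]; exact hx'⟩

lemma trans_ext {c d x : M} (hx : x ∈ (extChartAt (𝓡 m) c).source) :
    trans c d (extChartAt (𝓡 m) c x) = extChartAt (𝓡 m) d x := by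
  rw [trans, chartPt_ext hx]

lemma isOpen_transDom (c d : M) : IsOpen (transDom (m := m) c d) :=
  (continuousOn_extChartAt_symm c).isOpen_inter_preimage (isOpen_chartDom c)
    (isOpen_extChartAt_source d)

lemma trans_mem {c d : M} {y : EuclideanSpace ℝ (Fin m)} (hy : y ∈ transDom c d) :
    trans c d y ∈ transDom d c :=
  ⟨ext_mem hy.2, by
    rw [Set.mem_preimage, trans, chartPt_ext hy.2]; exact chartPt_mem hy.1⟩

lemma trans_trans {c d : M} {y : EuclideanSpace ℝ (Fin m)} (hy : y ∈ transDom c d) :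
    trans d c (trans c d y) = y := by
  rw [trans, trans, chartPt_ext hy.2, ext_chartPt hy.1]

lemma bC_stdVec (B : BilinField m M) (c : M) (y : EuclideanSpace ℝ (Fin m)) (i j : Fin m) :
    bC B c y (stdVec m i) (stdVec m j) = bilinComp B c i j y := by
  simp [bC, stdVec_apply, Finset.sum_apply]

lemma eC_stdVec (A : EndField m M) (c : M) (y : EuclideanSpace ℝ (Fin m)) (i j : Fin m) :
    eC A c y (stdVec m j) i = endComp A c i j y := by
  simp [eC, stdVec_apply, Finset.sum_apply]

lemma contDiffOn_bC {B : BilinField m M} (hB : BilinField.IsSmooth B) (c : M) :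
    ContDiffOn ℝ ∞ (bC B c) (chartDom m c) :=
  ContDiffOn.sum fun i _ => ContDiffOn.sum fun j _ => (hB c i j).smul contDiffOn_const

lemma contDiffOn_eC {A : EndField m M} (hA : EndField.IsSmooth A) (c : M) :
    ContDiffOn ℝ ∞ (eC A c) (chartDom m c) :=
  ContDiffOn.sum fun i _ => ContDiffOn.sum fun j _ => (hA c i j).smul contDiffOn_const

variable [IsManifold (𝓡 m) ∞ M]

lemma mdifferentiableAt_chartPt {c : M} {y : EuclideanSpace ℝ (Fin m)} (hy : y ∈ chartDom m c) :
    MDifferentiableAt (𝓡 m) (𝓡 m) (fun z => chartPt c z) y :=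
  ((contMDiffOn_extChartAt_symm (n := ∞) c).contMDiffAt
    ((isOpen_chartDom c).mem_nhds hy)).mdifferentiableAt (by simp)

lemma mdifferentiableAt_ext {c x : M} (hx : x ∈ (extChartAt (𝓡 m) c).source) :
    MDifferentiableAt (𝓡 m) (𝓡 m) (extChartAt (𝓡 m) c) x :=
  (contMDiffAt_extChartAt' (n := ∞) (by simpa using hx)).mdifferentiableAt (by simp)

lemma vecC_bijective {c x : M} (hx : x ∈ (extChartAt (𝓡 m) c).source) :
    Function.Bijective (vecC (m := m) c x) := by
  have : IsManifold (𝓡 m) 1 M := IsManifold.of_le (n := ∞) (by simp)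
  exact (isInvertible_mfderiv_extChartAt hx).bijective

/-- The tangent space at x is the model space itself, identified through the preferred chart at x.
-/
lemma vecC_self (x : M) (v : TangentSpace (𝓡 m) x) : vecC x x v = v := by
  have : IsManifold (𝓡 m) 1 M := IsManifold.of_le (n := ∞) (by simp)
  rw [vecC, mfderiv_extChartAt_self]; rfl

lemma vecC_chartVec {c : M} {y : EuclideanSpace ℝ (Fin m)} (hy : y ∈ chartDom m c) (i : Fin m) :
    vecC c (chartPt c y) (chartVec c y i) = stdVec m i := by
  have h1 := mfderiv_comp (I := 𝓡 m) (I' := 𝓡 m) (I'' := 𝓡 m) y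
    (g := extChartAt (𝓡 m) c) (f := fun z => chartPt c z)
    (mdifferentiableAt_ext (chartPt_mem hy)) (mdifferentiableAt_chartPt hy)
  have h2 : mfderiv (𝓡 m) (𝓡 m) (extChartAt (𝓡 m) c ∘ fun z => chartPt c z) y =
      ContinuousLinearMap.id ℝ _ := by
    rw [← mfderiv_id]
    apply Filter.EventuallyEq.mfderiv_eq
    filter_upwards [(isOpen_chartDom c).mem_nhds hy] with z hz using ext_chartPt hz
  rw [h2] at h1
  exact (congrArg (fun T => T (stdVec m i)) h1).symm

lemma vecC_trans {c d x : M} (hx : x ∈ (extChartAt (𝓡 m) c).source)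
    (hx' : x ∈ (extChartAt (𝓡 m) d).source) (v : TangentSpace (𝓡 m) x) :
    vecC d x v = fderiv ℝ (trans c d) (extChartAt (𝓡 m) c x) (vecC c x v) := by
  have hy := ext_mem hx
  have e := chartPt_ext hx
  have h1 : MDifferentiableAt (𝓡 m) (𝓡 m) (trans c d) (extChartAt (𝓡 m) c x) :=
    MDifferentiableAt.comp (g := extChartAt (𝓡 m) d) _
      (mdifferentiableAt_ext (by rw [e]; exact hx')) (mdifferentiableAt_chartPt hy)
  have h2 := mfderiv_comp (I := 𝓡 m) (I' := 𝓡 m) (I'' := 𝓡 m) x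
    (g := trans c d) (f := extChartAt (𝓡 m) c) h1 (mdifferentiableAt_ext hx)
  have h3 : mfderiv (𝓡 m) (𝓡 m) (trans c d ∘ extChartAt (𝓡 m) c) x =
      mfderiv (𝓡 m) (𝓡 m) (extChartAt (𝓡 m) d) x := by
    apply Filter.EventuallyEq.mfderiv_eq
    filter_upwards [(isOpen_extChartAt_source (I := 𝓡 m) c).mem_nhds hx] with z hz
    simp only [Function.comp, trans_ext hz]
  rw [h3, mfderiv_eq_fderiv] at h2
  exact congrArg (fun T => T v) h2

lemma contDiffOn_trans (c d : M) : ContDiffOn ℝ ∞ (trans (m := m) c d) (transDom c d) := by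
  rw [← contMDiffOn_iff_contDiffOn]
  exact (contMDiffOn_extChartAt (n := ∞) (x := d)).comp
    ((contMDiffOn_extChartAt_symm (n := ∞) c).mono Set.inter_subset_left)
    (fun y hy => by simpa using hy.2)

lemma fderiv_trans_isInvertible {c d : M} {y : EuclideanSpace ℝ (Fin m)} (hy : y ∈ transDom c d) :
    (fderiv ℝ (trans c d) y).IsInvertible := by
  have h1 := (contDiffOn_trans c d).contDiffAt ((isOpen_transDom c d).mem_nhds hy)
  have h2 := (contDiffOn_trans d c).contDiffAt ((isOpen_transDom d c).mem_nhds (trans_mem hy))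
  have h3 : HasFDerivAt (fun z => trans d c (trans c d z)) _ y := HasFDerivAt.comp (g := trans d c) y
    (h2.differentiableAt (by simp)).hasFDerivAt (h1.differentiableAt (by simp)).hasFDerivAt
  have h4 := h3.congr_of_eventuallyEq (f₁ := id) (by
    filter_upwards [(isOpen_transDom c d).mem_nhds hy] with z hz using (trans_trans hz).symm)
  have h5 := h4.unique (hasFDerivAt_id y)
  refine isInvertible_of_injective _ rfl fun u hu => ?_
  have := congrArg (fun T => T u) h5
  simpa [hu] using this.symm

lemma chartVec_eq {c : M} {y : EuclideanSpace ℝ (Fin m)} (hy : y ∈ chartDom m c)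
    (v : TangentSpace (𝓡 m) (chartPt c y)) :
    v = ∑ i, vecC c (chartPt c y) v i • chartVec c y i := by
  apply (vecC_bijective (chartPt_mem hy)).1
  rw [map_sum]
  simp only [map_smul, vecC_chartVec hy]
  exact sum_stdVec _

lemma bC_apply (B : BilinField m M) {c x : M} (hx : x ∈ (extChartAt (𝓡 m) c).source)
    (v w : TangentSpace (𝓡 m) x) :
    bC B c (extChartAt (𝓡 m) c x) (vecC c x v) (vecC c x w) = B x v w := by
  obtain ⟨y, hy, rfl⟩ : ∃ y, y ∈ chartDom m c ∧ chartPt c y = x := ⟨_, ext_mem hx, chartPt_ext hx⟩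
  rw [ext_chartPt hy]
  conv_rhs => rw [chartVec_eq hy v, chartVec_eq hy w]
  conv_lhs => rw [sum_stdVec (vecC c (chartPt c y) v), sum_stdVec (vecC c (chartPt c y) w)]
  simp only [map_sum, map_smul, LinearMap.sum_apply, sum_apply,
    LinearMap.smul_apply, smul_apply, bC_stdVec]
  rfl

lemma eC_apply (A : EndField m M) {c x : M} (hx : x ∈ (extChartAt (𝓡 m) c).source)
    (v : TangentSpace (𝓡 m) x) :
    eC A c (extChartAt (𝓡 m) c x) (vecC c x v) = vecC c x (A x v) := by
  obtain ⟨y, hy, rfl⟩ : ∃ y, y ∈ chartDom m c ∧ chartPt c y = x := ⟨_, ext_mem hx, chartPt_ext hx⟩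
  rw [ext_chartPt hy]
  conv_rhs => rw [chartVec_eq hy v]
  conv_lhs => rw [sum_stdVec (vecC c (chartPt c y) v)]
  simp only [map_sum, map_smul]
  refine Finset.sum_congr rfl fun j _ => ?_
  congr 1
  ext i
  rw [eC_stdVec]
  rfl

/-- To compare coordinate expressions it suffices to test on tangent vectors. -/
lemma exists_vecC {c : M} {y : EuclideanSpace ℝ (Fin m)} (hy : y ∈ chartDom m c) :
    ∃ x, x ∈ (extChartAt (𝓡 m) c).source ∧ y = extChartAt (𝓡 m) c x ∧
      Function.Surjective (vecC (m := m) c x) :=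
  ⟨chartPt c y, chartPt_mem hy, (ext_chartPt hy).symm, (vecC_bijective (chartPt_mem hy)).2⟩

lemma pd_bilinComp {B : BilinField m M} (hB : BilinField.IsSmooth B) {c : M}
    {y : EuclideanSpace ℝ (Fin m)} (hy : y ∈ chartDom m c) (i j k : Fin m) :
    pd i (bilinComp B c j k) y = fderiv ℝ (bC B c) y (stdVec m i) (stdVec m j) (stdVec m k) := by
  have h := (((contDiffOn_bC hB c).contDiffAt ((isOpen_chartDom c).mem_nhds hy)).differentiableAt
    (by simp)).hasFDerivAt
  have h1 := (h.clm_apply (hasFDerivAt_const (stdVec m j) y)).clm_apply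
    (hasFDerivAt_const (stdVec m k) y)
  have h2 : bilinComp B c j k = fun z => bC B c z (stdVec m j) (stdVec m k) := by
    ext z; rw [bC_stdVec]
  rw [pd, h2, h1.fderiv]
  simp

lemma pd_endComp {A : EndField m M} (hA : EndField.IsSmooth A) {c : M}
    {y : EuclideanSpace ℝ (Fin m)} (hy : y ∈ chartDom m c) (i j k : Fin m) :
    pd i (endComp A c j k) y = fderiv ℝ (eC A c) y (stdVec m i) (stdVec m k) j := by
  have h := (((contDiffOn_eC hA c).contDiffAt ((isOpen_chartDom c).mem_nhds hy)).differentiableAt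
    (by simp)).hasFDerivAt
  have h1 := h.clm_apply (hasFDerivAt_const (stdVec m k) y)
  have h3 : HasFDerivAt (fun z => eC A c z (stdVec m k) j) _ y :=
    HasFDerivAt.comp (g := coordL j) y (coordL j).hasFDerivAt h1
  have h2 : endComp A c j k = fun z => eC A c z (stdVec m k) j := by
    ext z; rw [eC_stdVec]
  rw [pd, h2, h3.fderiv]
  simp

end Charts

/-! ### Kähler structures on manifolds in coordinates -/

section Bridge

variable {m : ℕ} {M : Type*} [TopologicalSpace M] [ChartedSpace (EuclideanSpace ℝ (Fin m)) M]
  [IsManifold (𝓡 m) ∞ M]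

/-- Both sides solve the linear system with the Gram matrix as coefficients and the Koszul
expression on the right; positivity of g makes that matrix invertible. -/
lemma christoffel_eq {g : BilinField m M} {c : M} (hg : BilinField.IsSmooth g)
    (h : IsMetricOn (bC g c) (chartDom m c)) {y : EuclideanSpace ℝ (Fin m)} (hy : y ∈ chartDom m c)
    (k i j : Fin m) :
    christoffel g c k i j y = lc (bC g c) y (stdVec m i) (stdVec m j) k := by
  have hG : ∀ a : Fin m → ℝ, (gram g c y).mulVec a =
      fun l => bC g c y (stdVec m l) (∑ i, a i • stdVec m i) := by
    intro a; ext l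
    simp [Matrix.mulVec, dotProduct, gram, bC_stdVec, mul_comm]
  have hinj : Function.Injective (gram g c y).mulVec := by
    intro a b hab
    have h0 : ∀ l, bC g c y (∑ i, (a i - b i) • stdVec m i) (stdVec m l) = 0 := by
      intro l
      have := congrFun hab l
      rw [hG, hG] at this
      rw [h.symm y hy]
      simp only [sub_smul, Finset.sum_sub_distrib, map_sub]
      rw [sub_eq_zero]; exact this
    have h1 := h.nondeg hy _ (stdVec_induction (by simp) (fun u v hu hv => by rw [map_add, hu, hv, add_zero])
      (fun a u hu => by rw [map_smul, hu, smul_zero]) h0)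
    ext l
    have := congrArg (coordL l) h1
    simp [stdVec_apply, Finset.sum_apply, sub_mul] at this
    linarith
  have hunit : IsUnit (gram g c y) := Matrix.mulVec_injective_iff_isUnit.1 hinj
  have hdet := (Matrix.isUnit_iff_isUnit_det _).1 hunit
  set v : Fin m → ℝ := fun l => lc (bC g c) y (stdVec m i) (stdVec m j) l with hv
  have h2 : (gram g c y).mulVec v = fun l => (1 / 2) * (pd i (bilinComp g c j l) y
      + pd j (bilinComp g c i l) y - pd l (bilinComp g c i j) y) := by
    rw [hG]
    ext l
    rw [hv]
    rw [← sum_stdVec, h.symm y hy, h.g_lc hy, pd_bilinComp hg hy, pd_bilinComp hg hy,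
      pd_bilinComp hg hy]
  have h3 : v = (gram g c y)⁻¹.mulVec fun l => (1 / 2) * (pd i (bilinComp g c j l) y
      + pd j (bilinComp g c i l) y - pd l (bilinComp g c i j) y) := by
    rw [← h2, Matrix.mulVec_mulVec, Matrix.nonsing_inv_mul _ hdet, Matrix.one_mulVec]
  change _ = v k
  rw [h3, christoffel, Matrix.mulVec, dotProduct, Finset.mul_sum]
  exact Finset.sum_congr rfl fun l _ => by ring

lemma ricciComp_eq {g : BilinField m M} {c : M} (hg : BilinField.IsSmooth g)
    (h : IsMetricOn (bC g c) (chartDom m c)) {y : EuclideanSpace ℝ (Fin m)} (hy : y ∈ chartDom m c)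
    (j k : Fin m) : ricciComp g c j k y = ric (bC g c) y (stdVec m j) (stdVec m k) := by
  have hΓ : HasFDerivAt (lc (bC g c)) (fderiv ℝ (lc (bC g c)) y) y :=
    ((h.contDiffAt_lc hy).differentiableAt (by simp)).hasFDerivAt
  have hpd : ∀ l i j k, pd l (christoffel g c k i j) y =
      fderiv ℝ (lc (bC g c)) y (stdVec m l) (stdVec m i) (stdVec m j) k := by
    intro l i j k
    have h1 : HasFDerivAt (fun z => lc (bC g c) z (stdVec m i) (stdVec m j) k) _ y :=
      HasFDerivAt.comp (g := coordL k) y (coordL k).hasFDerivAt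
        ((hΓ.clm_apply (hasFDerivAt_const (stdVec m i) y)).clm_apply
          (hasFDerivAt_const (stdVec m j) y))
    have h2 := h1.congr_of_eventuallyEq (f₁ := christoffel g c k i j) (by
      filter_upwards [(isOpen_chartDom c).mem_nhds hy] with z hz using christoffel_eq hg h hz k i j)
    rw [pd, h2.fderiv]
    simp
  have hΓΓ : ∀ i j k l, lc (bC g c) y (stdVec m i) (lc (bC g c) y (stdVec m j) (stdVec m k)) l =
      ∑ p, christoffel g c l i p y * christoffel g c p j k y := by
    intro i j k l
    conv_lhs => rw [sum_stdVec (lc (bC g c) y (stdVec m j) (stdVec m k))]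
    simp [christoffel_eq hg h hy, mul_comm]
  rw [ric, trL_eq_sum, ricciComp]
  refine Finset.sum_congr rfl fun i _ => ?_
  rw [ricEnd_apply, hpd, hpd, Finset.sum_sub_distrib, ← hΓΓ, ← hΓΓ]
  simp [curv, clm_mul_apply]
  ring

lemma ricci_eq_self {g : BilinField m M} {x : M} (hg : BilinField.IsSmooth g)
    (h : IsMetricOn (bC g x) (chartDom m x)) (v w : TangentSpace (𝓡 m) x) :
    ricci g x v w = ric (bC g x) (extChartAt (𝓡 m) x x) (vecC x x v) (vecC x x w) := by
  have hy : extChartAt (𝓡 m) x x ∈ chartDom m x := ext_mem (mem_extChartAt_source x)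
  rw [ricci]
  simp only [ricciComp_eq hg h hy, vecCoord_eq]
  conv_rhs => rw [sum_stdVec (vecC x x v), sum_stdVec (vecC x x w)]
  have hl : ∀ (y u v w : EuclideanSpace ℝ (Fin m)), ric (bC g x) y (u + v) w =
      ric (bC g x) y u w + ric (bC g x) y v w := by
    intro y u v w
    rw [ric, ric, ric, ← map_add]; congr 1; ext z; simp [ricEnd]; ring
  have hr : ∀ (y u v w : EuclideanSpace ℝ (Fin m)), ric (bC g x) y w (u + v) =
      ric (bC g x) y w u + ric (bC g x) y w v := by
    intro y u v w
    rw [ric, ric, ric, ← map_add]; congr 1; ext z; simp [ricEnd]; ring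
  have sl : ∀ (a : ℝ) (y u w : EuclideanSpace ℝ (Fin m)), ric (bC g x) y (a • u) w =
      a * ric (bC g x) y u w := by
    intro a y u w
    rw [ric, ric, ← smul_eq_mul, ← map_smul]; congr 1; ext z; simp [ricEnd]; ring
  have sr : ∀ (a : ℝ) (y u w : EuclideanSpace ℝ (Fin m)), ric (bC g x) y w (a • u) =
      a * ric (bC g x) y w u := by
    intro a y u w
    rw [ric, ric, ← smul_eq_mul, ← map_smul]; congr 1; ext z; simp [ricEnd]; ring
  let B : EuclideanSpace ℝ (Fin m) →ₗ[ℝ] EuclideanSpace ℝ (Fin m) →ₗ[ℝ] ℝ :=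
    LinearMap.mk₂ ℝ (fun u v => ric (bC g x) (extChartAt (𝓡 m) x x) u v)
      (fun u v w => hl _ _ _ _) (fun a u w => sl _ _ _ _) (fun u v w => hr _ _ _ _)
      (fun a u w => sr _ _ _ _)
  change _ = B _ _
  rw [LinearMap.map_sum₂]
  refine Finset.sum_congr rfl fun j _ => ?_
  rw [map_sum]
  refine Finset.sum_congr rfl fun k _ => ?_
  rw [LinearMap.map_smul₂, map_smul]
  change _ = _ * (_ * ric _ _ _ _)
  ring

end Bridge

/-! ### Coordinate expressions of Kähler structures, and their Ricci forms in arbitrary charts -/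

section KahlerBridge

lemma IsKahlerOn.mono {E : Type*} [NormedAddCommGroup E] [NormedSpace ℝ E] [FiniteDimensional ℝ E]
    {g : E → E →L[ℝ] E →L[ℝ] ℝ} {J : E → E →L[ℝ] E} {U V : Set E} (h : IsKahlerOn g J U)
    (hV : IsOpen V) (hVU : V ⊆ U) : IsKahlerOn g J V where
  isOpen := hV
  smooth := h.smooth.mono hVU
  symm y hy := h.symm y (hVU hy)
  pos y hy := h.pos y (hVU hy)
  smooth_J := h.smooth_J.mono hVU
  J_sq y hy := h.J_sq y (hVU hy)
  g_J y hy := h.g_J y (hVU hy)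
  closed y hy := h.closed y (hVU hy)
  integrable y hy := h.integrable y (hVU hy)

variable {n : ℕ} {M : Type*} [TopologicalSpace M] [ChartedSpace (EuclideanSpace ℝ (Fin (2 * n))) M]
  [IsManifold (𝓡 (2 * n)) ∞ M]

namespace KahlerStructure

variable (K : KahlerStructure n M) (c : M)

lemma bC_form_apply {x : M} (hx : x ∈ (extChartAt (𝓡 (2 * n)) c).source)
    (v w : TangentSpace (𝓡 (2 * n)) x) :
    (bC K.g c (extChartAt (𝓡 (2 * n)) c x)).comp (eC K.J c (extChartAt (𝓡 (2 * n)) c x)) (vecC c x v)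
      (vecC c x w) = K.form x v w := by
  rw [ContinuousLinearMap.comp_apply, eC_apply _ hx, bC_apply _ hx]; rfl

lemma bC_form {y : EuclideanSpace ℝ (Fin (2 * n))} (hy : y ∈ chartDom (2 * n) c) :
    bC K.form c y = (bC K.g c y).comp (eC K.J c y) := by
  obtain ⟨x, hx, rfl, hs⟩ := exists_vecC hy
  ext u v
  obtain ⟨u, rfl⟩ := hs u
  obtain ⟨v, rfl⟩ := hs v
  rw [bC_form_apply K c hx, bC_apply _ hx]

/-- The pointwise axioms are tested on coordinates of tangent vectors, which exhaust the model
space. Closedness and integrability are given on coordinate vectors and extend by linearity. -/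
lemma isKahlerOn : IsKahlerOn (bC K.g c) (eC K.J c) (chartDom (2 * n) c) where
  isOpen := isOpen_chartDom c
  smooth := contDiffOn_bC K.smooth_g c
  symm y hy u v := by
    obtain ⟨x, hx, rfl, hs⟩ := exists_vecC hy
    obtain ⟨u, rfl⟩ := hs u
    obtain ⟨v, rfl⟩ := hs v
    rw [bC_apply _ hx, bC_apply _ hx, K.g_symm]
  pos y hy u hu := by
    obtain ⟨x, hx, rfl, hs⟩ := exists_vecC hy
    obtain ⟨u, rfl⟩ := hs u
    rw [bC_apply _ hx]
    exact K.g_pos x u fun h => hu (by rw [h, map_zero])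
  smooth_J := contDiffOn_eC K.smooth_J c
  J_sq y hy := by
    obtain ⟨x, hx, rfl, hs⟩ := exists_vecC hy
    ext1 u
    obtain ⟨u, rfl⟩ := hs u
    rw [clm_mul_apply, eC_apply _ hx, eC_apply _ hx, K.J_sq]
    simp
  g_J y hy u v := by
    obtain ⟨x, hx, rfl, hs⟩ := exists_vecC hy
    obtain ⟨u, rfl⟩ := hs u
    obtain ⟨v, rfl⟩ := hs v
    rw [eC_apply _ hx, eC_apply _ hx, bC_apply _ hx, bC_apply _ hx, K.g_J]
  closed y hy := by
    have hsm : ContDiffOn ℝ ∞ (fun z => (bC K.g c z).comp (eC K.J c z)) (chartDom (2 * n) c) :=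
      (contDiffOn_bC K.smooth_g c).clm_comp (contDiffOn_eC K.smooth_J c)
    have hD := (((hsm.contDiffAt ((isOpen_chartDom c).mem_nhds hy))).differentiableAt
      (by simp)).hasFDerivAt
    have hpd : ∀ i j k, pd i (bilinComp K.form c j k) y =
        fderiv ℝ (fun z => (bC K.g c z).comp (eC K.J c z)) y (stdVec _ i) (stdVec _ j)
          (stdVec _ k) := by
      intro i j k
      have h1 := (hD.clm_apply (hasFDerivAt_const (stdVec _ j) y)).clm_apply
        (hasFDerivAt_const (stdVec _ k) y)
      have h2 := h1.congr_of_eventuallyEq (f₁ := bilinComp K.form c j k) (by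
        filter_upwards [(isOpen_chartDom c).mem_nhds hy] with z hz
        rw [← bC_stdVec, bC_form K c hz])
      rw [pd, h2.fderiv]; simp
    have h0 : ∀ i j k, fderiv ℝ (fun z => (bC K.g c z).comp (eC K.J c z)) y (stdVec _ i) (stdVec _ j)
        (stdVec _ k) + fderiv ℝ (fun z => (bC K.g c z).comp (eC K.J c z)) y (stdVec _ j) (stdVec _ k)
        (stdVec _ i) + fderiv ℝ (fun z => (bC K.g c z).comp (eC K.J c z)) y (stdVec _ k) (stdVec _ i)
        (stdVec _ j) = 0 := by
      intro i j k
      have := K.closed c y hy i j k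
      rw [← hpd, ← hpd, ← hpd]
      exact this
    generalize fderiv ℝ (fun z => (bC K.g c z).comp (eC K.J c z)) y = T at h0
    intro u v w
    refine stdVec_induction (p := fun u => T u v w + T v w u + T w u v = 0) (by simp)
      (fun u u' h h' => ?_) (fun a u h => ?_) (fun i => ?_) u
    · simp only [map_add, add_apply]; linarith
    · simp only [map_smul, smul_apply, ← smul_add, h, smul_zero]
    refine stdVec_induction (p := fun v => T (stdVec _ i) v w + T v w (stdVec _ i)
      + T w (stdVec _ i) v = 0) (by simp) (fun u u' h h' => ?_) (fun a u h => ?_) (fun j => ?_) v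
    · simp only [map_add, add_apply]; linarith
    · simp only [map_smul, smul_apply, ← smul_add, h, smul_zero]
    refine stdVec_induction (p := fun w => T (stdVec _ i) (stdVec _ j) w + T (stdVec _ j) w
      (stdVec _ i) + T w (stdVec _ i) (stdVec _ j) = 0) (by simp) (fun u u' h h' => ?_)
      (fun a u h => ?_) (fun k => h0 i j k) w
    · simp only [map_add, add_apply]; linarith
    · simp only [map_smul, smul_apply, ← smul_add, h, smul_zero]
  integrable y hy := by
    set T := fderiv ℝ (eC K.J c) y with hT
    set J := eC K.J c y with hJ
    have h0 : ∀ i j, T (J (stdVec _ i)) (stdVec _ j) - T (J (stdVec _ j)) (stdVec _ i)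
        + J (T (stdVec _ j) (stdVec _ i)) - J (T (stdVec _ i) (stdVec _ j)) = 0 := by
      intro i j
      ext k
      have h1 := K.integrable c y hy i j k
      have e1 : ∀ i j, T (J (stdVec _ i)) (stdVec _ j) k =
          ∑ l, endComp K.J c l i y * pd l (endComp K.J c k j) y := by
        intro i j
        conv_lhs => rw [sum_stdVec (J (stdVec _ i))]
        simp [pd_endComp K.smooth_J hy, ← eC_stdVec, ← hT, ← hJ]
      have e2 : ∀ i j, J (T (stdVec _ j) (stdVec _ i)) k =
          ∑ l, endComp K.J c k l y * pd j (endComp K.J c l i) y := by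
        intro i j
        conv_lhs => rw [sum_stdVec (T (stdVec _ j) (stdVec _ i))]
        simp [pd_endComp K.smooth_J hy, ← eC_stdVec, ← hT, ← hJ, mul_comm]
      simp only [Finset.sum_sub_distrib, Finset.sum_add_distrib, ← e1, ← e2] at h1
      simpa using h1
    intro u v
    refine stdVec_induction (p := fun u => T (J u) v - T (J v) u + J (T v u) - J (T u v) = 0)
      (by simp) (fun u u' h h' => ?_) (fun a u h => ?_) (fun i => ?_) u
    · rw [← add_zero (0 : EuclideanSpace ℝ (Fin (2 * n)))]
      nth_rewrite 1 [← h]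
      rw [← h']; simp only [map_add, add_apply]; abel
    · simp only [map_smul, smul_apply, ← smul_add, ← smul_sub, h, smul_zero]
    refine stdVec_induction (p := fun v => T (J (stdVec _ i)) v - T (J v) (stdVec _ i)
      + J (T v (stdVec _ i)) - J (T (stdVec _ i) v) = 0)
      (by simp) (fun u u' h h' => ?_) (fun a u h => ?_) (fun j => h0 i j) v
    · rw [← add_zero (0 : EuclideanSpace ℝ (Fin (2 * n)))]
      nth_rewrite 1 [← h]
      rw [← h']; simp only [map_add, add_apply]; abel
    · simp only [map_smul, smul_apply, ← smul_add, ← smul_sub, h, smul_zero]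

lemma isKahlerIso (d : M) : IsKahlerIso (bC K.g c) (eC K.J c) (transDom c d) (bC K.g d) (eC K.J d)
    (transDom d c) (trans c d) where
  source := (K.isKahlerOn c).mono (isOpen_transDom c d) Set.inter_subset_left
  target := (K.isKahlerOn d).mono (isOpen_transDom d c) Set.inter_subset_left
  mapsTo _ hy := trans_mem hy
  smooth := contDiffOn_trans c d
  invertible _ hy := fderiv_trans_isInvertible hy
  g_eq y hy u v := by
    obtain ⟨x, hx, rfl, hs⟩ := exists_vecC hy.1
    have hx' : x ∈ (extChartAt (𝓡 (2 * n)) d).source := by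
      have := hy.2
      rwa [Set.mem_preimage, chartPt_ext hx] at this
    obtain ⟨u, rfl⟩ := hs u
    obtain ⟨v, rfl⟩ := hs v
    rw [bC_apply _ hx, ← vecC_trans hx hx', ← vecC_trans hx hx', trans_ext hx, bC_apply _ hx']
  J_eq y hy u := by
    obtain ⟨x, hx, rfl, hs⟩ := exists_vecC hy.1
    have hx' : x ∈ (extChartAt (𝓡 (2 * n)) d).source := by
      have := hy.2
      rwa [Set.mem_preimage, chartPt_ext hx] at this
    obtain ⟨u, rfl⟩ := hs u
    rw [eC_apply _ hx, ← vecC_trans hx hx', ← vecC_trans hx hx', trans_ext hx, eC_apply _ hx']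

variable {c}

/-- The Ricci tensor at x is defined through the chart centred at x; invariance under the chart
transition, an isomorphism of Kähler structures, allows any chart around x. -/
lemma ricci_eq {x : M} (hx : x ∈ (extChartAt (𝓡 (2 * n)) c).source)
    (v w : TangentSpace (𝓡 (2 * n)) x) : ricci K.g x v w =
      ric (bC K.g c) (extChartAt (𝓡 (2 * n)) c x) (vecC c x v) (vecC c x w) := by
  have hx' := mem_extChartAt_source (I := 𝓡 (2 * n)) x
  rw [ricci_eq_self K.smooth_g (K.isKahlerOn x).toIsMetricOn,
    (K.isKahlerIso x c).ric_eq (ext_mem_transDom hx' hx), trans_ext hx', ← vecC_trans hx' hx,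
    ← vecC_trans hx' hx]

lemma ricciForm_eq {x : M} (hx : x ∈ (extChartAt (𝓡 (2 * n)) c).source)
    (v w : TangentSpace (𝓡 (2 * n)) x) : K.ricciForm x v w =
      rho (bC K.g c) (eC K.J c) (extChartAt (𝓡 (2 * n)) c x) (vecC c x v) (vecC c x w) := by
  rw [ricciForm, K.ricci_eq hx, ← eC_apply _ hx, (K.isKahlerOn c).ric_J (ext_mem hx)]

/-- Pair v with Jv: ρ(v, Jv) = Ric(Jv, Jv), which is non-zero for v ≠ 0. -/
lemma HasDefiniteRicci.nondegenerate {K : KahlerStructure n M} (h : K.HasDefiniteRicci) (x : M)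
    (v : TangentSpace (𝓡 (2 * n)) x) (hv : ∀ w, K.ricciForm x v w = 0) : v = 0 := by
  by_contra hne
  have h1 : K.J x v ≠ 0 := fun h0 => hne (by
    have := K.J_sq x v
    rw [h0, map_zero] at this
    exact neg_eq_zero.1 this.symm)
  have h2 := hv (K.J x v)
  rw [ricciForm] at h2
  rcases h with h | h
  · exact (h x _ h1).ne' h2
  · exact (h x _ h1).ne h2

end KahlerStructure

lemma IsSmoothCurve.isKahlerFamily {S : Set ℝ} {K : ℝ → KahlerStructure n M}
    (hK : IsSmoothCurve S K) (c : M) :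
    IsKahlerFamily S (fun t => bC (K t).g c) (fun t => eC (K t).J c) (chartDom (2 * n) c) where
  kahler t _ := (K t).isKahlerOn c
  smooth_g := ContDiffOn.sum fun i _ => ContDiffOn.sum fun j _ =>
    (hK c i j).2.smul contDiffOn_const
  smooth_J := ContDiffOn.sum fun i _ => ContDiffOn.sum fun j _ =>
    (hK c i j).1.smul contDiffOn_const

lemma IsKahlerFamily.mono {E : Type*} [NormedAddCommGroup E] [NormedSpace ℝ E]
    [FiniteDimensional ℝ E] {S : Set ℝ} {g : ℝ → E → E →L[ℝ] E →L[ℝ] ℝ} {J : ℝ → E → E →L[ℝ] E}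
    {U V : Set E} (h : IsKahlerFamily S g J U) (hV : IsOpen V) (hVU : V ⊆ U) :
    IsKahlerFamily S g J V where
  kahler t ht := (h.kahler t ht).mono hV hVU
  smooth_g := h.smooth_g.mono (Set.prod_mono_right hVU)
  smooth_J := h.smooth_J.mono (Set.prod_mono_right hVU)

end KahlerBridge

open scoped Topology
open Set Metric Filter

/-! ### Smooth dependence of solutions of differential equations on initial values -/

section Gronwall

variable {E : Type*} [NormedAddCommGroup E] [NormedSpace ℝ E]

/-- Requiring K ≥ 1 avoids the separate formula for K = 0 and absorbs the quotient ε / K. -/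
lemma gronwallBound_le {δ K ε x : ℝ} (hK : 1 ≤ K) (hε : 0 ≤ ε) (hx : 0 ≤ x) :
    gronwallBound δ K ε x ≤ (δ + ε) * Real.exp (K * x) := by
  rw [gronwallBound_of_K_ne_0 (by linarith)]
  have h1 : 1 ≤ Real.exp (K * x) := Real.one_le_exp (by positivity)
  have h2 : ε / K ≤ ε := div_le_self hε hK
  have h3 : ε / K * (Real.exp (K * x) - 1) ≤ ε * (Real.exp (K * x) - 1) :=
    mul_le_mul_of_nonneg_right h2 (by linarith)
  nlinarith

/-- Grönwall's inequality on an interval, in both directions of time. -/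
lemma gronwall_interval {T : Set ℝ} (hT : T.OrdConnected) {w w' : ℝ → E} {K ε : ℝ} (hK : 1 ≤ K)
    (hε : 0 ≤ ε) (hw : ∀ t ∈ T, HasDerivWithinAt w (w' t) T t)
    (hb : ∀ t ∈ T, ‖w' t‖ ≤ K * ‖w t‖ + ε) {s t : ℝ} (hs : s ∈ T) (ht : t ∈ T) :
    ‖w t‖ ≤ (‖w s‖ + ε) * Real.exp (K * |t - s|) := by
  rcases le_total s t with hst | hst
  · have hsub := hT.out hs ht
    have := norm_le_gronwallBound_of_norm_deriv_right_le (f := w) (f' := w') (δ := ‖w s‖) (K := K)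
      (ε := ε) (a := s) (b := t) (fun τ hτ => ((hw τ (hsub hτ)).mono hsub).continuousWithinAt)
      (fun τ hτ => ((hw τ (hsub ⟨hτ.1, hτ.2.le⟩)).mono hsub).mono_of_mem_nhdsWithin
        (Icc_mem_nhdsGE_of_mem hτ)) le_rfl (fun τ hτ => hb τ (hsub ⟨hτ.1, hτ.2.le⟩)) t
      ⟨hst, le_rfl⟩
    rw [abs_of_nonneg (sub_nonneg.2 hst)]
    exact this.trans (gronwallBound_le hK hε (sub_nonneg.2 hst))
  -- Backward in time: apply the forward estimate to τ ↦ w(-τ).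
  · have hsub := hT.out ht hs
    have hmaps : MapsTo Neg.neg (Icc (-s) (-t)) (Icc t s) := fun τ hτ =>
      ⟨le_neg.1 hτ.2, neg_le.1 hτ.1⟩
    have hd : ∀ τ ∈ Icc (-s) (-t), HasDerivWithinAt (fun τ => w (-τ)) (-w' (-τ)) (Icc (-s) (-t)) τ := by
      intro τ hτ
      have h1 := ((hw (-τ) (hsub (hmaps hτ))).mono hsub).scomp τ
        (hasDerivAt_neg τ).hasDerivWithinAt hmaps
      simpa [Function.comp_def] using h1
    have := norm_le_gronwallBound_of_norm_deriv_right_le (f := fun τ => w (-τ))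
      (f' := fun τ => -w' (-τ)) (δ := ‖w s‖) (K := K)
      (ε := ε) (a := -s) (b := -t) (fun τ hτ => (hd τ hτ).continuousWithinAt)
      (fun τ hτ => (hd τ ⟨hτ.1, hτ.2.le⟩).mono_of_mem_nhdsWithin
        (Icc_mem_nhdsGE_of_mem hτ)) (by simp)
      (fun τ hτ => by
        rw [norm_neg]; exact hb (-τ) (hsub (hmaps ⟨hτ.1, hτ.2.le⟩))) (-t)
      ⟨neg_le_neg hst, le_rfl⟩
    rw [abs_of_nonpos (sub_nonpos.2 hst)]
    simp only [neg_neg] at this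
    refine this.trans ((gronwallBound_le hK hε (by linarith)).trans (le_of_eq ?_))
    congr 3; ring

end Gronwall

/-! ### Relative neighbourhoods in intervals that may contain their endpoints -/

section Interval

/-- Relative neighbourhoods in an interval contain relative neighbourhoods that are compact
intervals. -/
lemma exists_Icc_nhd {S : Set ℝ} (hS : S.OrdConnected) {t₀ : ℝ} (ht₀ : t₀ ∈ S) {ε : ℝ}
    (hε : 0 < ε) : ∃ a b, t₀ ∈ Icc a b ∧ Icc a b ⊆ S ∧ b - a ≤ 2 * ε ∧ ∃ δ > 0,
      δ ≤ ε ∧ S ∩ ball t₀ δ ⊆ Icc a b := by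
  -- If t₀ is the last point of S, the compact interval ends at t₀ itself and any δ serves; the
  -- value 1 is arbitrary.
  have hb : ∃ b ∈ S, t₀ ≤ b ∧ b ≤ t₀ + ε ∧ ∃ δ > 0, ∀ t ∈ S, t < t₀ + δ → t ≤ b := by
    by_cases h : ∃ b ∈ S, t₀ < b
    · obtain ⟨b, hb, hlt⟩ := h
      have hm : t₀ < min b (t₀ + ε) := lt_min hlt (by linarith)
      refine ⟨min b (t₀ + ε), hS.out ht₀ hb ⟨hm.le, min_le_left _ _⟩, hm.le, min_le_right _ _,
        min b (t₀ + ε) - t₀, by linarith, fun t _ h => by linarith⟩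
    · push Not at h
      exact ⟨t₀, ht₀, le_rfl, by linarith, 1, one_pos, fun t ht _ => h t ht⟩
  have ha : ∃ a ∈ S, a ≤ t₀ ∧ t₀ - ε ≤ a ∧ ∃ δ > 0, ∀ t ∈ S, t₀ - δ < t → a ≤ t := by
    by_cases h : ∃ a ∈ S, a < t₀
    · obtain ⟨a, ha, hlt⟩ := h
      have hm : max a (t₀ - ε) < t₀ := max_lt hlt (by linarith)
      refine ⟨max a (t₀ - ε), hS.out ha ht₀ ⟨le_max_left _ _, hm.le⟩, hm.le, le_max_right _ _,
        t₀ - max a (t₀ - ε), by linarith, fun t _ h => by linarith⟩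
    · push Not at h
      exact ⟨t₀, ht₀, le_rfl, by linarith, 1, one_pos, fun t ht _ => h t ht⟩
  obtain ⟨b, hbS, hb1, hb2, δ₁, hδ₁, hb3⟩ := hb
  obtain ⟨a, haS, ha1, ha2, δ₂, hδ₂, ha3⟩ := ha
  refine ⟨a, b, ⟨ha1, hb1⟩, hS.out haS hbS, by linarith, min ε (min δ₁ δ₂), by positivity,
    min_le_left _ _, ?_⟩
  rintro t ⟨htS, ht⟩
  rw [mem_ball, Real.dist_eq, abs_lt] at ht
  have h1 := (min_le_right ε (min δ₁ δ₂)).trans (min_le_left δ₁ δ₂)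
  have h2 := (min_le_right ε (min δ₁ δ₂)).trans (min_le_right δ₁ δ₂)
  exact ⟨ha3 t htS (by linarith), hb3 t htS (by linarith)⟩

lemma hasDerivWithinAt_inter_ball {E : Type*} [NormedAddCommGroup E] [NormedSpace ℝ E] {f : ℝ → E}
    {f' : E} {S : Set ℝ} {t t₀ δ : ℝ} (ht : t ∈ ball t₀ δ) :
    HasDerivWithinAt f f' (S ∩ ball t₀ δ) t ↔ HasDerivWithinAt f f' S t :=
  hasDerivWithinAt_inter (isOpen_ball.mem_nhds ht)

lemma ordConnected_inter_ball {S : Set ℝ} (hS : S.OrdConnected) (t₀ δ : ℝ) :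
    (S ∩ ball t₀ δ).OrdConnected := by
  rw [Real.ball_eq_Ioo]; exact hS.inter ordConnected_Ioo

end Interval

/-! ### Differentiability of solutions in the initial value -/

section LocalFlow

variable {E : Type*} [NormedAddCommGroup E] [NormedSpace ℝ E]

/-- The increment is split through the point (s, x). The spatial part is controlled by the mean
value inequality and continuity of Y; for the part in time, differentiability at the single point
suffices. -/
lemma hasFDerivWithinAt_of_partial {T : Set ℝ} {B : Set E} (hB : IsOpen B) {Φ : ℝ → E → E}
    {Y : ℝ → E → E →L[ℝ] E} {X₀ : E} {t : ℝ} {x : E} (hx : x ∈ B)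
    (h1 : HasDerivWithinAt (fun s => Φ s x) X₀ T t)
    (h2 : ∀ s ∈ T, ∀ z ∈ B, HasFDerivAt (Φ s) (Y s z) z)
    (h3 : ContinuousWithinAt (fun p : ℝ × E => Y p.1 p.2) (T ×ˢ B) (t, x)) :
    HasFDerivWithinAt (fun p : ℝ × E => Φ p.1 p.2)
      ((ContinuousLinearMap.toSpanSingleton ℝ X₀).coprod (Y t x)) (T ×ˢ B) (t, x) := by
  have hl : 𝓝[T ×ˢ B] (t, x) = 𝓝[T] t ×ˢ 𝓝[B] x := nhdsWithin_prod_eq t x T B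
  have hB' : 𝓝[B] x = 𝓝 x := hB.nhdsWithin_eq hx
  have e2 : (fun p : ℝ × E => Φ p.1 p.2 - Φ p.1 x - Y t x (p.2 - x)) =o[𝓝[T ×ˢ B] (t, x)]
      (fun p => p.2 - x) := by
    rw [Asymptotics.isLittleO_iff]
    intro c hc
    obtain ⟨η, hη, hη'⟩ := Metric.continuousWithinAt_iff.1 h3 c hc
    obtain ⟨r, hr, hrB⟩ := Metric.isOpen_iff.1 hB x hx
    filter_upwards [self_mem_nhdsWithin, mem_nhdsWithin_of_mem_nhds
      (ball_mem_nhds (t, x) (lt_min hη hr))] with p hp hp'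
    rw [mem_ball, Prod.dist_eq, max_lt_iff] at hp'
    refine (convex_ball x (min η r)).norm_image_sub_le_of_norm_hasFDerivWithin_le' (f' := Y p.1)
      (fun z hz => (h2 p.1 hp.1 z (hrB (ball_subset_ball (min_le_right _ _) hz))).hasFDerivWithinAt)
      (fun z hz => ?_) (mem_ball_self (lt_min hη hr)) hp'.2
    rw [← dist_eq_norm]
    refine (hη' (x := (p.1, z)) ⟨hp.1, hrB (ball_subset_ball (min_le_right _ _) hz)⟩ ?_).le
    rw [Prod.dist_eq, max_lt_iff]
    exact ⟨hp'.1.trans_le (min_le_left _ _), (mem_ball.1 hz).trans_le (min_le_left _ _)⟩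
  have e3 : (fun p : ℝ × E => Φ p.1 x - Φ t x - (p.1 - t) • X₀) =o[𝓝[T ×ˢ B] (t, x)]
      (fun p => p.1 - t) := by
    have := (hasDerivWithinAt_iff_isLittleO.1 h1)
    refine this.comp_tendsto ?_
    rw [hl]; exact tendsto_fst
  rw [hasFDerivWithinAt_iff_isLittleO]
  have b2 : (fun p : ℝ × E => p.2 - x) =O[𝓝[T ×ˢ B] (t, x)] (fun p => p - (t, x)) :=
    Asymptotics.IsBigO.of_bound 1 (Eventually.of_forall fun p => by
      rw [one_mul]; exact norm_snd_le (p - (t, x)))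
  have b1 : (fun p : ℝ × E => p.1 - t) =O[𝓝[T ×ˢ B] (t, x)] (fun p => p - (t, x)) :=
    Asymptotics.IsBigO.of_bound 1 (Eventually.of_forall fun p => by
      rw [one_mul]; exact norm_fst_le (p - (t, x)))
  refine ((e2.trans_isBigO b2).add (e3.trans_isBigO b1)).congr_left fun p => ?_
  simp
  abel

/-- A solution depending continuously on the initial value is differentiable, the derivative being
given by the linearized equation. -/
lemma hasFDerivAt_flow {S : Set ℝ} {U B : Set E} (hS : S.OrdConnected) (hU : IsOpen U)
    (hB : IsOpen B) {X : ℝ → E → E} {A : ℝ → E → E →L[ℝ] E}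
    (hX : ∀ t ∈ S, ∀ x ∈ U, HasFDerivAt (X t) (A t x) x)
    (hA : ContinuousOn (fun p : ℝ × E => A p.1 p.2) (S ×ˢ U))
    {Φ : ℝ → E → E} {Y : ℝ → E → E →L[ℝ] E}
    (hΦ : ContinuousOn (fun p : ℝ × E => Φ p.1 p.2) (S ×ˢ B))
    (hΦU : ∀ t ∈ S, ∀ x ∈ B, Φ t x ∈ U)
    (hΦd : ∀ t ∈ S, ∀ x ∈ B, HasDerivWithinAt (fun s => Φ s x) (X t (Φ t x)) S t)
    (hYd : ∀ t ∈ S, ∀ x ∈ B, HasDerivWithinAt (fun s => Y s x) ((A t (Φ t x)).comp (Y t x)) S t)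
    {s : ℝ} (hs : s ∈ S) (hΦs : ∀ x ∈ B, Φ s x = x) (hYs : ∀ x ∈ B, Y s x = ContinuousLinearMap.id ℝ E)
    {t : ℝ} (ht : t ∈ S) {x : E} (hx : x ∈ B) : HasFDerivAt (Φ t) (Y t x) x := by
  set T := uIcc s t with hTdef
  have hTS : T ⊆ S := hS.uIcc_subset hs ht
  have hTc : IsCompact T := isCompact_uIcc
  have hTo : T.OrdConnected := ordConnected_uIcc
  have hsT : s ∈ T := left_mem_uIcc
  have htT : t ∈ T := right_mem_uIcc
  have hcurve : ContinuousOn (fun τ => Φ τ x) T := fun τ hτ =>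
    (hΦd τ (hTS hτ) x hx).continuousWithinAt.mono hTS
  have hAc : ContinuousOn (fun τ => A τ (Φ τ x)) T :=
    hA.comp (continuousOn_id.prodMk hcurve) fun τ hτ => ⟨hTS hτ, hΦU τ (hTS hτ) x hx⟩
  obtain ⟨M, hM⟩ := hTc.exists_bound_of_continuousOn hAc
  have cs : ∀ τ₀ ∈ T, ContinuousWithinAt (fun z : E × ℝ => Φ z.2 x) (univ ×ˢ T) (0, τ₀) :=
    fun τ₀ hτ₀ => ContinuousWithinAt.comp (f := fun z : E × ℝ => z.2) (g := fun τ => Φ τ x)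
      (x := ((0 : E), τ₀)) (hcurve τ₀ hτ₀) continuousWithinAt_snd (fun z hz => hz.2)
  -- By compactness of T, one radius η works along the whole reference solution for the ε-continuity
  -- of the linearization A.
  have tube : ∀ ε > 0, ∃ η > 0, ∀ τ ∈ T, ∀ y ∈ ball (Φ τ x) η,
      y ∈ U ∧ ‖A τ y - A τ (Φ τ x)‖ ≤ ε := by
    intro ε hε
    have : ∀ᶠ v in 𝓝 (0 : E), ∀ τ ∈ T, τ ∈ T → (Φ τ x + v ∈ U ∧
        ‖A τ (Φ τ x + v) - A τ (Φ τ x)‖ ≤ ε) := by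
      refine hTc.eventually_forall_of_forall_eventually fun τ₀ hτ₀ => ?_
      have c1 : ContinuousWithinAt (fun z : E × ℝ => Φ z.2 x + z.1) (univ ×ˢ T) (0, τ₀) :=
        (cs τ₀ hτ₀).add continuousWithinAt_fst
      have m1 : ∀ᶠ z in 𝓝[univ ×ˢ T] ((0 : E), τ₀), Φ z.2 x + z.1 ∈ U :=
        c1.eventually (hU.mem_nhds (by simpa using hΦU τ₀ (hTS hτ₀) x hx))
      have c2 : Tendsto (fun z : E × ℝ => (z.2, Φ z.2 x + z.1)) (𝓝[univ ×ˢ T] ((0 : E), τ₀))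
          (𝓝[S ×ˢ U] (τ₀, Φ τ₀ x)) := by
        refine tendsto_nhdsWithin_iff.2 ⟨?_, ?_⟩
        · have := (continuousWithinAt_snd (s := (univ : Set E) ×ˢ T) (p := ((0 : E), τ₀))).prodMk c1
          simpa [ContinuousWithinAt] using this
        · filter_upwards [m1, self_mem_nhdsWithin] with z hz hz' using ⟨hTS hz'.2, hz⟩
      have c3 : Tendsto (fun z : E × ℝ => A z.2 (Φ z.2 x + z.1)) (𝓝[univ ×ˢ T] ((0 : E), τ₀))
          (𝓝 (A τ₀ (Φ τ₀ x))) := (hA (τ₀, Φ τ₀ x) ⟨hTS hτ₀, hΦU τ₀ (hTS hτ₀) x hx⟩).tendsto.comp c2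
      have c4 : Tendsto (fun z : E × ℝ => A z.2 (Φ z.2 x)) (𝓝[univ ×ˢ T] ((0 : E), τ₀))
          (𝓝 (A τ₀ (Φ τ₀ x))) :=
        (ContinuousWithinAt.comp (f := fun z : E × ℝ => z.2) (g := fun τ => A τ (Φ τ x))
          (x := ((0 : E), τ₀)) (hAc τ₀ hτ₀) continuousWithinAt_snd (fun z hz => hz.2)).tendsto
      have c5 := (c3.sub c4).norm
      rw [sub_self, norm_zero] at c5
      have := (m1.and (c5.eventually (gt_mem_nhds hε)))
      rw [eventually_nhdsWithin_iff] at this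
      filter_upwards [this] with z hz hz'
      exact ⟨(hz ⟨mem_univ _, hz'⟩).1, (hz ⟨mem_univ _, hz'⟩).2.le⟩
    obtain ⟨η, hη, h⟩ := Metric.eventually_nhds_iff_ball.1 this
    refine ⟨η, hη, fun τ hτ y hy => ?_⟩
    have := h (y - Φ τ x) (by simpa [dist_eq_norm] using hy) τ hτ hτ
    simpa using this
  have close : ∀ η > 0, ∀ᶠ z in 𝓝 x, z ∈ B ∧ ∀ τ ∈ T, Φ τ z ∈ ball (Φ τ x) η := by
    intro η hη
    refine (hB.eventually_mem hx).and ?_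
    have : ∀ᶠ z in 𝓝 x, ∀ τ ∈ T, τ ∈ T → Φ τ z ∈ ball (Φ τ x) η := by
      refine hTc.eventually_forall_of_forall_eventually fun τ₀ hτ₀ => ?_
      have c1 : ContinuousWithinAt (fun z : E × ℝ => Φ z.2 z.1) (B ×ˢ T) (x, τ₀) :=
        ContinuousWithinAt.comp (g := fun p : ℝ × E => Φ p.1 p.2) (f := fun z : E × ℝ => (z.2, z.1))
          (x := (x, τ₀)) (hΦ (τ₀, x) ⟨hTS hτ₀, hx⟩)
          (continuous_snd.prodMk continuous_fst).continuousWithinAt (fun z hz => ⟨hTS hz.2, hz.1⟩)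
      have c2 : ContinuousWithinAt (fun z : E × ℝ => Φ z.2 x) (B ×ˢ T) (x, τ₀) :=
        ContinuousWithinAt.comp (f := fun z : E × ℝ => z.2) (g := fun τ => Φ τ x)
          (x := (x, τ₀)) (hcurve τ₀ hτ₀) continuousWithinAt_snd (fun z hz => hz.2)
      have c3 := (c1.tendsto.dist c2.tendsto)
      rw [dist_self] at c3
      have := c3.eventually (gt_mem_nhds hη)
      rw [eventually_nhdsWithin_iff] at this
      filter_upwards [this, (continuous_fst.tendsto (x, τ₀)).eventually (hB.mem_nhds hx)]
        with z hz hz1 hz'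
      exact hz ⟨hz1, hz'⟩
    filter_upwards [this] with z hz τ hτ using hz τ hτ hτ
  -- Chosen so that K - 1 bounds the linearization along the solution, with one unit left over for
  -- the error ε ≤ 1.
  set K : ℝ := |M| + 2 with hK
  have hK1 : 1 ≤ K := by have := abs_nonneg M; linarith
  have hAK : ∀ τ ∈ T, ‖A τ (Φ τ x)‖ ≤ K - 1 := fun τ hτ =>
    (hM τ hτ).trans (by have := le_abs_self M; linarith)
  set C := Real.exp (K * |t - s|)
  have hC : ∀ τ ∈ T, Real.exp (K * |τ - s|) ≤ C := by
    intro τ hτ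
    apply Real.exp_le_exp.2
    have : |τ - s| ≤ |t - s| := abs_sub_left_of_mem_uIcc hτ
    nlinarith
  rw [hasFDerivAt_iff_isLittleO, Asymptotics.isLittleO_iff]
  intro c hc
  have hCpos : 0 < C := Real.exp_pos _
  -- Grönwall's inequality is used twice, each time at the cost of a factor C.
  set ε := min 1 (c / (C * C)) with hεdef
  have hε : 0 < ε := by positivity
  obtain ⟨η, hη, hη'⟩ := tube ε hε
  filter_upwards [close η hη] with z hz
  have hTd : ∀ τ ∈ T, ∀ y ∈ B, HasDerivWithinAt (fun s => Φ s y) (X τ (Φ τ y)) T τ :=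
    fun τ hτ y hy => (hΦd τ (hTS hτ) y hy).mono hTS
  have mv : ∀ τ ∈ T, ‖X τ (Φ τ z) - X τ (Φ τ x) - A τ (Φ τ x) (Φ τ z - Φ τ x)‖ ≤
      ε * ‖Φ τ z - Φ τ x‖ := by
    intro τ hτ
    exact (convex_ball (Φ τ x) η).norm_image_sub_le_of_norm_hasFDerivWithin_le' (f' := A τ)
      (fun y hy => (hX τ (hTS hτ) y (hη' τ hτ y hy).1).hasFDerivWithinAt)
      (fun y hy => (hη' τ hτ y hy).2) (mem_ball_self hη) (hz.2 τ hτ)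
  have d1 : ∀ τ ∈ T, ‖Φ τ z - Φ τ x‖ ≤ ‖z - x‖ * C := by
    intro τ hτ
    have := gronwall_interval hTo (w := fun τ => Φ τ z - Φ τ x) hK1 le_rfl
      (fun τ hτ => (hTd τ hτ z hz.1).sub (hTd τ hτ x hx)) (fun τ hτ => by
        have h1 := mv τ hτ
        have h2 := (A τ (Φ τ x)).le_of_opNorm_le (hAK τ hτ) (Φ τ z - Φ τ x)
        have h3 := norm_sub_norm_le (X τ (Φ τ z) - X τ (Φ τ x)) (A τ (Φ τ x) (Φ τ z - Φ τ x))
        have h4 : ε * ‖Φ τ z - Φ τ x‖ ≤ 1 * ‖Φ τ z - Φ τ x‖ :=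
          mul_le_mul_of_nonneg_right (min_le_left _ _) (norm_nonneg _)
        linarith) hsT hτ
    rw [hΦs z hz.1, hΦs x hx, add_zero] at this
    exact this.trans (mul_le_mul_of_nonneg_left (hC τ hτ) (norm_nonneg _))
  -- The remainder of the first-order expansion solves the linearized equation up to an error at
  -- most ε C ‖z - x‖, and it vanishes at the time s.
  have d2 := gronwall_interval hTo (w := fun τ => Φ τ z - Φ τ x - Y τ x (z - x)) hK1
      (ε := ε * (‖z - x‖ * C)) (by positivity)
      (fun τ hτ => ((hTd τ hτ z hz.1).sub (hTd τ hτ x hx)).sub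
        (((hYd τ (hTS hτ) x hx).mono hTS).clm_apply (hasDerivWithinAt_const τ T (z - x))))
      (fun τ hτ => by
        have h1 := (mv τ hτ).trans (mul_le_mul_of_nonneg_left (d1 τ hτ) hε.le)
        have h2 := (A τ (Φ τ x)).le_of_opNorm_le (hAK τ hτ) (Φ τ z - Φ τ x - Y τ x (z - x))
        have h3 : X τ (Φ τ z) - X τ (Φ τ x) - (((A τ (Φ τ x)).comp (Y τ x)) (z - x) + Y τ x 0) =
            (X τ (Φ τ z) - X τ (Φ τ x) - A τ (Φ τ x) (Φ τ z - Φ τ x))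
            + A τ (Φ τ x) (Φ τ z - Φ τ x - Y τ x (z - x)) := by
          simp
        rw [h3]
        refine (norm_add_le _ _).trans ?_
        have := norm_nonneg (Φ τ z - Φ τ x - Y τ x (z - x))
        linarith) hsT htT
  rw [hΦs z hz.1, hΦs x hx, hYs x hx] at d2
  simp only [ContinuousLinearMap.id_apply, sub_self, norm_zero, zero_add] at d2
  refine d2.trans ?_
  have h5 : ε * (C * C) ≤ c := by
    have := min_le_right 1 (c / (C * C))
    rw [← hεdef, le_div_iff₀ (by positivity)] at this
    exact this
  have := mul_le_mul_of_nonneg_right h5 (norm_nonneg (z - x))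
  calc ε * (‖z - x‖ * C) * C = ε * (C * C) * ‖z - x‖ := by ring
    _ ≤ c * ‖z - x‖ := this

end LocalFlow

/-! ### Existence and finite differentiability of local flows -/

section LocalFlow

open ODE in
/-- The Picard-Lindelöf theorem, with a local flow confined to the ball on which the estimates
hold. -/
lemma exists_flow_of_isPicardLindelof {E : Type*} [NormedAddCommGroup E] [NormedSpace ℝ E]
    [CompleteSpace E] {f : ℝ → E → E} {a b : ℝ} {t₀ : Icc a b} {x₀ : E} {R r L K : NNReal}
    (hf : IsPicardLindelof f t₀ x₀ R r L K) :
    ∃ Φ : ℝ → E → E, ContinuousOn (fun p : ℝ × E => Φ p.1 p.2) (Icc a b ×ˢ closedBall x₀ r) ∧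
      ∀ x ∈ closedBall x₀ r, Φ t₀ x = x ∧ ∀ t ∈ Icc a b, Φ t x ∈ closedBall x₀ R ∧
        HasDerivWithinAt (fun s => Φ s x) (f t (Φ t x)) (Icc a b) t := by
  classical
  have ex (x) (hx : x ∈ closedBall x₀ r) := FunSpace.exists_isFixedPt_next hf hx
  choose α hα using ex
  set Φ : ℝ → E → E := fun t x => if hx : x ∈ closedBall x₀ r then (α x hx).compProj t else 0
    with hΦ
  have hΦx : ∀ x (hx : x ∈ closedBall x₀ r) t, Φ t x = (α x hx).compProj t := fun x hx t => by
    simp only [hΦ]; rw [dif_pos hx]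
  have main : ∀ x ∈ closedBall x₀ r, Φ t₀ x = x ∧ ∀ t ∈ Icc a b, Φ t x ∈ closedBall x₀ R ∧
        HasDerivWithinAt (fun s => Φ s x) (f t (Φ t x)) (Icc a b) t := by
    intro x hx
    simp only [hΦx x hx]
    refine ⟨?_, fun t ht => ⟨(α x hx).compProj_mem_closedBall hf.mul_max_le, ?_⟩⟩
    · rw [FunSpace.compProj_val, ← hα, FunSpace.next_apply₀]
    · apply hasDerivWithinAt_picard_Icc t₀.2 hf.continuousOn_uncurry
        (α x hx |>.continuous_compProj.continuousOn)
        (fun _ ht' ↦ α x hx |>.compProj_mem_closedBall hf.mul_max_le)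
        x ht |>.congr_of_mem _ ht
      intro t' ht'
      nth_rw 1 [← hα]
      rw [FunSpace.compProj_of_mem ht', FunSpace.next_apply]
  obtain ⟨L', h⟩ := FunSpace.exists_forall_closedBall_funSpace_dist_le_mul hf
  have lip : ∀ t ∈ Icc a b, LipschitzOnWith L' (fun x => Φ t x) (closedBall x₀ r) := by
    refine fun t ht => LipschitzOnWith.of_dist_le_mul fun x hx y hy ↦ ?_
    simp only [hΦx x hx, hΦx y hy]
    rw [FunSpace.compProj_apply, FunSpace.compProj_apply,
      ← FunSpace.toContinuousMap_apply_eq_apply, ← FunSpace.toContinuousMap_apply_eq_apply]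
    have : Nonempty (Icc a b) := ⟨t₀⟩
    apply ContinuousMap.dist_le_iff_of_nonempty.mp
    exact h x y hx hy (α x hx) (α y hy) (hα x hx) (hα y hy)
  refine ⟨Φ, ?_, main⟩
  have := continuousOn_prod_of_continuousOn_lipschitzOnWith (s := closedBall x₀ r)
    (t := Icc a b) (fun p : E × ℝ => Φ p.2 p.1) L'
    (fun x hx => HasDerivWithinAt.continuousOn fun t ht => ((main x hx).2 t ht).2) lip
  exact this.comp (f := fun p : ℝ × E => (p.2, p.1))
    (continuous_snd.prodMk continuous_fst).continuousOn fun p hp => ⟨hp.2, hp.1⟩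

universe u

/-- `X` has flows of class `C^k` near `(t₀, x₀)`, on a time interval that does not depend on the
initial time. -/
def HasLocalFlow {E : Type u} [NormedAddCommGroup E] [NormedSpace ℝ E] (k : ℕ) (S : Set ℝ)
    (U : Set E) (X : ℝ → E → E) (t₀ : ℝ) (x₀ : E) : Prop :=
  ∃ δ > 0, ∃ r > 0, ball x₀ r ⊆ U ∧ ∀ s ∈ S ∩ ball t₀ δ, ∃ Φ : ℝ → E → E,
    ContDiffOn ℝ k (fun p : ℝ × E => Φ p.1 p.2) ((S ∩ ball t₀ δ) ×ˢ ball x₀ r) ∧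
    ∀ x ∈ ball x₀ r, Φ s x = x ∧ ∀ t ∈ S ∩ ball t₀ δ, Φ t x ∈ U ∧
      HasDerivWithinAt (fun τ => Φ τ x) (X t (Φ t x)) S t

variable {E : Type u} [NormedAddCommGroup E] [NormedSpace ℝ E] [FiniteDimensional ℝ E]

/-- Initial values lie within ρ/2 of x₀, and the time interval has length at most ρ/(2C) for a bound
C on the speed, so solutions never leave the ball of radius ρ. These bounds do not involve the
initial time s, whence the uniform δ. -/
lemma hasLocalFlow_zero {S : Set ℝ} (hS : IsInterval S) {U : Set E} (hU : IsOpen U)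
    {X : ℝ → E → E} (hX : ContDiffOn ℝ ∞ (fun p : ℝ × E => X p.1 p.2) (S ×ˢ U)) {t₀ : ℝ}
    (ht₀ : t₀ ∈ S) {x₀ : E} (hx₀ : x₀ ∈ U) : HasLocalFlow 0 S U X t₀ x₀ := by
  obtain ⟨ρ, hρ, hρU⟩ := Metric.nhds_basis_closedBall.mem_iff.1 (hU.mem_nhds hx₀)
  obtain ⟨a₁, b₁, ht₁, hsub₁, -, δ₁, hδ₁, -, hδ₁'⟩ := exists_Icc_nhd hS.ord ht₀ one_pos
  have hc : IsCompact (Icc a₁ b₁ ×ˢ closedBall x₀ ρ) :=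
    isCompact_Icc.prod (isCompact_closedBall _ _)
  have hm : Icc a₁ b₁ ×ˢ closedBall x₀ ρ ⊆ S ×ˢ U := prod_mono hsub₁ hρU
  obtain ⟨C₁, hC₁⟩ := hc.exists_bound_of_continuousOn (hX.continuousOn.mono hm)
  obtain ⟨C₂, hC₂⟩ := hc.exists_bound_of_continuousOn
    ((contDiffOn_fderiv_family hS hU hX).continuousOn.mono hm)
  set C : ℝ := max 1 (max C₁ C₂) with hCdef
  have hC : 1 ≤ C := le_max_left _ _
  have h1C : C₁ ≤ C := (le_max_left _ _).trans (le_max_right _ _)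
  have h2C : C₂ ≤ C := (le_max_right _ _).trans (le_max_right _ _)
  obtain ⟨a, b, ht, hsub, hab, δ, hδ, -, hδ'⟩ := exists_Icc_nhd (S := Icc a₁ b₁) ordConnected_Icc ht₁
    (show 0 < ρ / (4 * C) by positivity)
  refine ⟨min δ δ₁, lt_min hδ hδ₁, ρ / 2, by linarith,
    (ball_subset_closedBall.trans (closedBall_subset_closedBall (by linarith))).trans hρU, ?_⟩
  have hT : S ∩ ball t₀ (min δ δ₁) ⊆ Icc a b := fun t ht => hδ' ⟨hδ₁' ⟨ht.1,
    ball_subset_ball (min_le_right _ _) ht.2⟩, ball_subset_ball (min_le_left _ _) ht.2⟩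
  intro s hs
  have hpl : IsPicardLindelof X ⟨s, hT hs⟩ x₀ ⟨ρ, hρ.le⟩ ⟨ρ / 2, by linarith⟩
      ⟨C, by linarith⟩ ⟨C, by linarith⟩ := by
    refine ⟨fun t ht => ?_, fun x hx => ?_, fun t ht x hx => ?_, ?_⟩
    · refine (convex_closedBall x₀ ρ).lipschitzOnWith_of_nnnorm_hasFDerivWithin_le
        (f' := fun x => fderiv ℝ (X t) x) (fun x hx => ?_) (fun x hx => ?_)
      · exact (((contDiffOn_slice hX (hsub₁ (hsub ht))).contDiffAt
          (hU.mem_nhds (hρU hx))).differentiableAt (by simp)).hasFDerivAt.hasFDerivWithinAt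
      · exact (hC₂ (t, x) ⟨hsub ht, hx⟩).trans h2C
    · exact hX.continuousOn.comp (continuousOn_id.prodMk continuousOn_const)
        fun t ht => ⟨hsub₁ (hsub ht), hρU hx⟩
    · exact (hC₁ (t, x) ⟨hsub ht, hx⟩).trans h1C
    · have h1 : max (b - s) (s - a) ≤ b - a :=
        max_le (by linarith [(hT hs).1]) (by linarith [(hT hs).2])
      show C * max (b - s) (s - a) ≤ ρ - ρ / 2
      calc C * max (b - s) (s - a) ≤ C * (2 * (ρ / (4 * C))) :=
            mul_le_mul_of_nonneg_left (h1.trans hab) (by linarith)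
        _ = ρ - ρ / 2 := by field_simp; ring
  obtain ⟨Φ, hΦ, h⟩ := exists_flow_of_isPicardLindelof hpl
  refine ⟨Φ, ?_, fun x hx => ⟨(h x (ball_subset_closedBall hx)).1, fun t ht => ?_⟩⟩
  · exact contDiffOn_zero.2 (hΦ.mono (prod_mono hT ball_subset_closedBall))
  · obtain ⟨h1, h2⟩ := (h x (ball_subset_closedBall hx)).2 t (hT ht)
    exact ⟨hρU h1, (hasDerivWithinAt_inter_ball ht.2).1 (h2.mono hT)⟩

/-- The flow together with its spatial derivative Y solves an augmented system. A flow of that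
system of class C^k makes both Y and the velocity X(Φ) of class C^k; by `hasFDerivAt_flow` these are
the partial derivatives of Φ, so Φ is C^{k+1}. -/
lemma hasLocalFlow_succ {k : ℕ} {S : Set ℝ} (hS : IsInterval S) {U : Set E} (hU : IsOpen U)
    {X : ℝ → E → E} (hX : ContDiffOn ℝ ∞ (fun p : ℝ × E => X p.1 p.2) (S ×ˢ U)) {t₀ : ℝ}
    {x₀ : E} (ih : HasLocalFlow k S (U ×ˢ (univ : Set (E →L[ℝ] E)))
      (fun t z => (X t z.1, (fderiv ℝ (X t) z.1).comp z.2)) t₀ (x₀, ContinuousLinearMap.id ℝ E)) :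
    HasLocalFlow (k + 1) S U X t₀ x₀ := by
  obtain ⟨δ, hδ, r, hr, hrU, h⟩ := ih
  have hball : ∀ x ∈ ball x₀ r, (x, ContinuousLinearMap.id ℝ E) ∈
      ball (x₀, ContinuousLinearMap.id ℝ E) r := fun x hx => by
    rw [mem_ball, Prod.dist_eq, dist_self]; exact max_lt hx hr
  refine ⟨δ, hδ, r, hr, fun x hx => (hrU (hball x hx)).1, fun s hs => ?_⟩
  obtain ⟨Ψ, hΨ, hΨ'⟩ := h s hs
  set T := S ∩ ball t₀ δ with hT
  have hTo : T.OrdConnected := ordConnected_inter_ball hS.ord t₀ δ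
  set Φ : ℝ → E → E := fun t x => (Ψ t (x, ContinuousLinearMap.id ℝ E)).1 with hΦ
  set Y : ℝ → E → E →L[ℝ] E := fun t x => (Ψ t (x, ContinuousLinearMap.id ℝ E)).2 with hY
  have hcomp : ContDiffOn ℝ k (fun p : ℝ × E => Ψ p.1 (p.2, ContinuousLinearMap.id ℝ E))
      (T ×ˢ ball x₀ r) :=
    hΨ.comp (f := fun p : ℝ × E => (p.1, (p.2, ContinuousLinearMap.id ℝ E)))
      (contDiff_fst.prodMk (contDiff_snd.prodMk contDiff_const)).contDiffOn
      fun p hp => ⟨hp.1, hball _ hp.2⟩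
  have hΦc : ContDiffOn ℝ k (fun p : ℝ × E => Φ p.1 p.2) (T ×ˢ ball x₀ r) := hcomp.fst
  have hYc : ContDiffOn ℝ k (fun p : ℝ × E => Y p.1 p.2) (T ×ˢ ball x₀ r) := hcomp.snd
  have hΦd : ∀ t ∈ T, ∀ x ∈ ball x₀ r, HasDerivWithinAt (fun τ => Φ τ x) (X t (Φ t x)) S t :=
    fun t ht x hx => ((hΨ' _ (hball x hx)).2 t ht).2.fst
  have hYd : ∀ t ∈ T, ∀ x ∈ ball x₀ r, HasDerivWithinAt (fun τ => Y τ x)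
      ((fderiv ℝ (X t) (Φ t x)).comp (Y t x)) S t :=
    fun t ht x hx => ((hΨ' _ (hball x hx)).2 t ht).2.snd
  have hΦU : ∀ t ∈ T, ∀ x ∈ ball x₀ r, Φ t x ∈ U :=
    fun t ht x hx => ((hΨ' _ (hball x hx)).2 t ht).1.1
  have hXT : ContDiffOn ℝ ∞ (fun p : ℝ × E => X p.1 p.2) (T ×ˢ U) :=
    hX.mono (prod_mono inter_subset_left le_rfl)
  have hderiv : ∀ t ∈ T, ∀ x ∈ ball x₀ r, HasFDerivAt (Φ t) (Y t x) x := by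
    intro t ht x hx
    refine hasFDerivAt_flow hTo hU isOpen_ball (X := X) (A := fun t x => fderiv ℝ (X t) x)
      (fun t ht x hx => (((contDiffOn_slice hXT ht).contDiffAt
        (hU.mem_nhds hx)).differentiableAt (by simp)).hasFDerivAt)
      ((contDiffOn_fderiv_family hS hU hX).continuousOn.mono
        (prod_mono inter_subset_left le_rfl)) hΦc.continuousOn hΦU
      (fun t ht x hx => (hΦd t ht x hx).mono inter_subset_left)
      (fun t ht x hx => (hYd t ht x hx).mono inter_subset_left) hs
      (fun x hx => congrArg Prod.fst (hΨ' _ (hball x hx)).1)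
      (fun x hx => congrArg Prod.snd (hΨ' _ (hball x hx)).1) ht hx
  refine ⟨Φ, ?_, fun x hx => ⟨congrArg Prod.fst (hΨ' _ (hball x hx)).1,
    fun t ht => ⟨hΦU t ht x hx, hΦd t ht x hx⟩⟩⟩
  push_cast
  rw [contDiffOn_succ_iff_hasFDerivWithinAt (by simp)]
  rintro ⟨t, x⟩ htx
  refine ⟨T ×ˢ ball x₀ r, by rw [insert_eq_of_mem htx]; exact self_mem_nhdsWithin, by simp,
    fun p => (ContinuousLinearMap.toSpanSingleton ℝ (X p.1 (Φ p.1 p.2))).coprod (Y p.1 p.2),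
    fun p hp => hasFDerivWithinAt_of_partial isOpen_ball hp.2
      ((hΦd p.1 hp.1 p.2 hp.2).mono inter_subset_left) hderiv (hYc.continuousOn p hp), ?_⟩
  have hXΦ : ContDiffOn ℝ k (fun p : ℝ × E => X p.1 (Φ p.1 p.2)) (T ×ˢ ball x₀ r) :=
    (hXT.of_le (by exact_mod_cast le_top)).comp (contDiff_fst.contDiffOn.prodMk hΦc)
      fun p hp => ⟨hp.1, hΦU _ hp.1 _ hp.2⟩
  have e : (fun p : ℝ × E => (ContinuousLinearMap.toSpanSingleton ℝ
      (X p.1 (Φ p.1 p.2))).coprod (Y p.1 p.2)) = fun p =>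
      (ContinuousLinearMap.smulRightL ℝ (ℝ × E) E (ContinuousLinearMap.fst ℝ ℝ E))
        (X p.1 (Φ p.1 p.2)) + (Y p.1 p.2).comp (ContinuousLinearMap.snd ℝ ℝ E) := by
    ext p <;> simp
  rw [e]
  exact (contDiffOn_const.clm_apply hXΦ).add (hYc.clm_comp contDiffOn_const)

/-- The space E is quantified inside the induction, because the inductive step enlarges it by its
endomorphisms. -/
theorem hasLocalFlow (k : ℕ) : ∀ {E : Type u} [NormedAddCommGroup E] [NormedSpace ℝ E]
    [FiniteDimensional ℝ E] {S : Set ℝ} (_ : IsInterval S) {U : Set E} (_ : IsOpen U)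
    {X : ℝ → E → E} (_ : ContDiffOn ℝ ∞ (fun p : ℝ × E => X p.1 p.2) (S ×ˢ U)) {t₀ : ℝ}
    (_ : t₀ ∈ S) {x₀ : E} (_ : x₀ ∈ U), HasLocalFlow k S U X t₀ x₀ := by
  induction k with
  | zero => exact fun hS _ hU _ hX _ ht₀ _ hx₀ => hasLocalFlow_zero hS hU hX ht₀ hx₀
  | succ k ih =>
    intro E _ _ _ S hS U hU X hX t₀ ht₀ x₀ hx₀
    refine hasLocalFlow_succ hS hU hX (ih hS (hU.prod isOpen_univ) ?_ ht₀ ⟨hx₀, mem_univ _⟩)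
    have hπ : ContDiffOn ℝ ∞ (fun p : ℝ × (E × (E →L[ℝ] E)) => (p.1, p.2.1))
        (S ×ˢ (U ×ˢ (univ : Set (E →L[ℝ] E)))) :=
      (contDiff_fst.prodMk (contDiff_fst.comp contDiff_snd)).contDiffOn
    refine (hX.comp hπ fun p hp => ⟨hp.1, hp.2.1⟩).prodMk ?_
    exact ((contDiffOn_fderiv_family hS hU hX).comp hπ fun p hp => ⟨hp.1, hp.2.1⟩).clm_comp
      (contDiff_snd.comp contDiff_snd).contDiffOn

end LocalFlow

/-! ### Flows of time dependent vector fields on manifolds -/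

section Flow

variable {m : ℕ} {M : Type*} [TopologicalSpace M] [ChartedSpace (EuclideanSpace ℝ (Fin m)) M]

/-- A smooth vector field on `M` depending on a time in `S`, given by its coordinate expressions. -/
structure IsTimeField (S : Set ℝ)
    (X : M → ℝ → EuclideanSpace ℝ (Fin m) → EuclideanSpace ℝ (Fin m)) : Prop where
  smooth : ∀ c, ContDiffOn ℝ ∞ (fun p : ℝ × EuclideanSpace ℝ (Fin m) => X c p.1 p.2)
    (S ×ˢ chartDom m c)
  compat : ∀ t ∈ S, ∀ c d : M, ∀ y ∈ transDom c d,
    X d t (trans c d y) = fderiv ℝ (trans c d) y (X c t y)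

/-- `γ` is an integral curve of `X` at the time `t`. -/
def IsSolAt (S : Set ℝ) (X : M → ℝ → EuclideanSpace ℝ (Fin m) → EuclideanSpace ℝ (Fin m))
    (γ : ℝ → M) (t : ℝ) : Prop :=
  ContinuousWithinAt γ S t ∧ ∀ c, γ t ∈ (extChartAt (𝓡 m) c).source →
    HasDerivWithinAt (fun s => extChartAt (𝓡 m) c (γ s)) (X c t (extChartAt (𝓡 m) c (γ t))) S t

variable {S : Set ℝ} {X : M → ℝ → EuclideanSpace ℝ (Fin m) → EuclideanSpace ℝ (Fin m)}
  {γ γ' : ℝ → M} {t : ℝ}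

lemma IsSolAt.congr (h : IsSolAt S X γ t) (ht : t ∈ S) (e : γ' =ᶠ[𝓝[S] t] γ) :
    IsSolAt S X γ' t := by
  have e' : γ' t = γ t := e.self_of_nhdsWithin ht
  refine ⟨h.1.congr_of_eventuallyEq e e', fun c hc => ?_⟩
  rw [e'] at hc ⊢
  exact (h.2 c hc).congr_of_eventuallyEq (e.mono fun s hs => by simp only [hs])
    (by simp only [e'])

lemma isSolAt_const {x : M} (h : ∀ c, x ∈ (extChartAt (𝓡 m) c).source →
    X c t (extChartAt (𝓡 m) c x) = 0) : IsSolAt S X (fun _ => x) t :=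
  ⟨continuousWithinAt_const, fun c hc => by rw [h c hc]; exact hasDerivWithinAt_const _ _ _⟩

variable [IsManifold (𝓡 m) ∞ M]

/-- The chain rule and the compatibility of the coordinate fields carry the equation from one chart
to all others. -/
lemma IsTimeField.isSolAt_of_chart (hX : IsTimeField S X) (ht : t ∈ S)
    (hγ : ContinuousWithinAt γ S t) {c : M} (hc : γ t ∈ (extChartAt (𝓡 m) c).source)
    (h : HasDerivWithinAt (fun s => extChartAt (𝓡 m) c (γ s)) (X c t (extChartAt (𝓡 m) c (γ t)))
      S t) : IsSolAt S X γ t := by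
  refine ⟨hγ, fun d hd => ?_⟩
  have hy := ext_mem_transDom hc hd
  have h1 := ((((contDiffOn_trans c d).contDiffAt ((isOpen_transDom c d).mem_nhds hy)
    ).differentiableAt (by simp)).hasFDerivAt.comp_hasDerivWithinAt t h)
  rw [← hX.compat t ht c d _ hy, trans_ext hc] at h1
  refine h1.congr_of_eventuallyEq ?_ (trans_ext hc).symm
  filter_upwards [hγ.eventually ((isOpen_extChartAt_source c).mem_nhds hc)] with s hs
    using (trans_ext hs).symm

lemma IsTimeField.isSolAt_chartPt (hX : IsTimeField S X) (ht : t ∈ S) {c : M}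
    {η : ℝ → EuclideanSpace ℝ (Fin m)} (hη : η t ∈ chartDom m c)
    (h : HasDerivWithinAt η (X c t (η t)) S t) : IsSolAt S X (fun s => chartPt c (η s)) t := by
  have hn := (isOpen_chartDom c).mem_nhds hη
  have hcont : ContinuousWithinAt (fun s => chartPt c (η s)) S t :=
    ((continuousOn_extChartAt_symm (I := 𝓡 m) c).continuousAt hn).comp_continuousWithinAt
      h.continuousWithinAt
  refine hX.isSolAt_of_chart ht hcont (c := c) (chartPt_mem hη) ?_
  rw [ext_chartPt hη]
  refine h.congr_of_eventuallyEq ?_ (ext_chartPt hη)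
  filter_upwards [h.continuousWithinAt.eventually hn] with s hs using ext_chartPt hs

lemma IsTimeField.exists_localFlow (hX : IsTimeField S X) (hS : IsInterval S) (k : ℕ) {t₀ : ℝ}
    (ht₀ : t₀ ∈ S) (x₀ : M) : ∃ δ > 0, ∃ W : Set M, IsOpen W ∧ x₀ ∈ W ∧ ∀ s ∈ S ∩ ball t₀ δ,
      ∃ Φ : ℝ → M → M, ContMDiffOn (𝓘(ℝ, ℝ).prod (𝓡 m)) (𝓡 m) k (fun p : ℝ × M => Φ p.1 p.2)
        ((S ∩ ball t₀ δ) ×ˢ W) ∧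
      ∀ x ∈ W, Φ s x = x ∧ ∀ t ∈ S ∩ ball t₀ δ, IsSolAt S X (fun τ => Φ τ x) t := by
  have hx₀ := mem_extChartAt_source (I := 𝓡 m) x₀
  obtain ⟨δ, hδ, r, hr, hrU, h⟩ := hasLocalFlow k hS (isOpen_chartDom x₀) (hX.smooth x₀) ht₀
    (ext_mem hx₀)
  refine ⟨δ, hδ, (extChartAt (𝓡 m) x₀).source ∩
    extChartAt (𝓡 m) x₀ ⁻¹' ball (extChartAt (𝓡 m) x₀ x₀) r,
    (continuousOn_extChartAt x₀).isOpen_inter_preimage (isOpen_extChartAt_source x₀) isOpen_ball,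
    ⟨hx₀, mem_ball_self hr⟩, fun s hs => ?_⟩
  obtain ⟨Φ, hΦ, hΦ'⟩ := h s hs
  refine ⟨fun t x => chartPt x₀ (Φ t (extChartAt (𝓡 m) x₀ x)), ?_, fun x hx => ⟨?_, fun t ht => ?_⟩⟩
  · have h1 : ContMDiffOn (𝓘(ℝ, ℝ).prod (𝓡 m)) (𝓘(ℝ, ℝ).prod (𝓡 m)) k
        (fun p : ℝ × M => (p.1, extChartAt (𝓡 m) x₀ p.2)) (univ ×ˢ (extChartAt (𝓡 m) x₀).source) :=
      contMDiffOn_fst.prodMk ((contMDiffOn_extChartAt (n := ∞) (x := x₀)).of_le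
        (by exact_mod_cast le_top) |>.comp contMDiffOn_snd fun p hp => by simpa using hp.2)
    have h2 : ContMDiffOn (𝓘(ℝ, ℝ).prod (𝓡 m)) (𝓡 m) k
        (fun p : ℝ × EuclideanSpace ℝ (Fin m) => Φ p.1 p.2)
        ((S ∩ ball t₀ δ) ×ˢ ball (extChartAt (𝓡 m) x₀ x₀) r) := by
      rw [← modelWithCornersSelf_prod, chartedSpaceSelf_prod]
      exact hΦ.contMDiffOn
    have h3 : ContMDiffOn (𝓘(ℝ, ℝ).prod (𝓡 m)) (𝓡 m) k
        (fun p : ℝ × M => Φ p.1 (extChartAt (𝓡 m) x₀ p.2))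
        ((S ∩ ball t₀ δ) ×ˢ ((extChartAt (𝓡 m) x₀).source ∩
          extChartAt (𝓡 m) x₀ ⁻¹' ball (extChartAt (𝓡 m) x₀ x₀) r)) := by
      refine h2.comp (f := fun p : ℝ × M => (p.1, extChartAt (𝓡 m) x₀ p.2)) (h1.mono
        (prod_mono (subset_univ _) inter_subset_left)) ?_
      intro p hp
      exact mem_prod.2 ⟨hp.1, hp.2.2⟩
    exact ((contMDiffOn_extChartAt_symm (n := ∞) x₀).of_le (by exact_mod_cast le_top)).comp h3
      fun p hp => ((hΦ' _ hp.2.2).2 p.1 hp.1).1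
  · show chartPt x₀ (Φ s (extChartAt (𝓡 m) x₀ x)) = x
    rw [(hΦ' _ hx.2).1, chartPt_ext hx.1]
  · obtain ⟨h1, h2⟩ := (hΦ' _ hx.2).2 t ht
    exact hX.isSolAt_chartPt ht.1 h1 h2

/-- For a short time both curves stay in a ball of one chart on which X is Lipschitz, and Grönwall's
inequality with zero initial difference forces them to agree. -/
lemma IsTimeField.eventually_eq (hX : IsTimeField S X) (hS : IsInterval S) (ht : t ∈ S)
    (h : ∀ᶠ s in 𝓝[S] t, IsSolAt S X γ s) (h' : ∀ᶠ s in 𝓝[S] t, IsSolAt S X γ' s)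
    (e : γ t = γ' t) : γ =ᶠ[𝓝[S] t] γ' := by
  obtain ⟨c, hc⟩ : ∃ c, γ t = c := ⟨_, rfl⟩
  have hc' : γ' t = c := e.symm.trans hc
  have hcs := mem_extChartAt_source (I := 𝓡 m) c
  obtain ⟨y₀, hy₀'⟩ : ∃ y₀, extChartAt (𝓡 m) c c = y₀ := ⟨_, rfl⟩
  have hy₀ : y₀ ∈ chartDom m c := hy₀' ▸ ext_mem hcs
  obtain ⟨ρ, hρ, hρU⟩ := Metric.nhds_basis_closedBall.mem_iff.1 ((isOpen_chartDom c).mem_nhds hy₀)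
  obtain ⟨a₁, b₁, ht₁, hsub₁, -, δ₁, hδ₁, -, hδ₁'⟩ := exists_Icc_nhd hS.ord ht one_pos
  have hcpt : IsCompact (Icc a₁ b₁ ×ˢ closedBall y₀ ρ) :=
    isCompact_Icc.prod (isCompact_closedBall _ _)
  obtain ⟨C₀, hC₀⟩ := hcpt.exists_bound_of_continuousOn
    ((contDiffOn_fderiv_family hS (isOpen_chartDom c) (hX.smooth c)).continuousOn.mono
      (prod_mono hsub₁ hρU))
  set C : ℝ := max 1 C₀
  have near : ∀ {η : ℝ → M}, IsSolAt S X η t → η t = c → ∀ᶠ s in 𝓝[S] t,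
      η s ∈ (extChartAt (𝓡 m) c).source ∧ extChartAt (𝓡 m) c (η s) ∈ ball y₀ ρ := by
    intro η hη hηc
    have h1 : η t ∈ (extChartAt (𝓡 m) c).source := by rw [hηc]; exact hcs
    refine (hη.1.eventually ((isOpen_extChartAt_source c).mem_nhds h1)).and ?_
    refine (hη.2 c h1).continuousWithinAt.eventually (isOpen_ball.mem_nhds ?_)
    simp only [hηc, hy₀']; exact mem_ball_self hρ
  have all := ((h.and h').and ((near (h.self_of_nhdsWithin ht) hc).and
    (near (h'.self_of_nhdsWithin ht) hc')))
  obtain ⟨δ₂, hδ₂, hall⟩ := Metric.mem_nhdsWithin_iff.1 all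
  set δ := min δ₁ δ₂
  have hδ : 0 < δ := lt_min hδ₁ hδ₂
  have hT : ∀ s ∈ S ∩ ball t δ, s ∈ Icc a₁ b₁ ∧ s ∈ ball t δ₂ ∩ S := fun s hs =>
    ⟨hδ₁' ⟨hs.1, ball_subset_ball (min_le_left _ _) hs.2⟩,
      ball_subset_ball (min_le_right _ _) hs.2, hs.1⟩
  refine Filter.eventually_iff.2 (Metric.mem_nhdsWithin_iff.2 ⟨δ, hδ, fun s hs => ?_⟩)
  have := gronwall_interval (ordConnected_inter_ball hS.ord t δ)
    (w := fun s => extChartAt (𝓡 m) c (γ s) - extChartAt (𝓡 m) c (γ' s)) (K := C) (ε := 0)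
    (le_max_left _ _) le_rfl
    (fun s hs => by
      obtain ⟨⟨h1, h2⟩, h3, h4⟩ := hall (hT s hs).2
      exact ((h1.2 c h3.1).mono inter_subset_left).sub ((h2.2 c h4.1).mono inter_subset_left))
    (fun s hs => by
      obtain ⟨-, h3, h4⟩ := hall (hT s hs).2
      rw [add_zero]
      refine (convex_ball y₀ ρ).norm_image_sub_le_of_norm_hasFDerivWithin_le
        (f := X c s) (f' := fun y => fderiv ℝ (X c s) y) (fun y hy => ?_) (fun y hy => ?_) h4.2 h3.2
      · exact (((contDiffOn_slice (hX.smooth c) hs.1).contDiffAt ((isOpen_chartDom c).mem_nhds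
          (hρU (ball_subset_closedBall hy)))).differentiableAt (by simp)).hasFDerivAt.hasFDerivWithinAt
      · exact (hC₀ (s, y) ⟨(hT s hs).1, ball_subset_closedBall hy⟩).trans (le_max_right _ _))
    ⟨ht, mem_ball_self hδ⟩ (t := s) ⟨hs.2, hs.1⟩
  rw [hc, hc', sub_self, norm_zero, add_zero, zero_mul] at this
  obtain ⟨-, h3, h4⟩ := hall (hT s ⟨hs.2, hs.1⟩).2
  exact (extChartAt (𝓡 m) c).injOn h3.1 h4.1 (sub_eq_zero.1 (norm_le_zero_iff.1 this))

/-- The continuity method on a connected set of times: a property whose truth is locally constant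
has the same truth value throughout. -/
lemma propagate {T : Set ℝ} (hT : T.OrdConnected) {P : ℝ → Prop} {s t : ℝ} (hs : s ∈ T)
    (ht : t ∈ T) (h : ∀ t₁ ∈ T, ∀ᶠ t in 𝓝[T] t₁, P t₁ ↔ P t) (hP : P s) : P t :=
  (hT.isPreconnected.induction₂ (fun s t => P s ↔ P t) h (fun _ _ _ _ _ _ h h' => h.trans h')
    (fun _ _ _ _ h => h.symm) hs ht).1 hP

variable [T2Space M]

/-- Agreement is an open condition by local uniqueness, and disagreement is open because M is
Hausdorff. -/
lemma IsTimeField.eqOn (hX : IsTimeField S X) (hS : IsInterval S) {T : Set ℝ} {O : Set ℝ}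
    (hO : IsOpen O) (hTO : T = S ∩ O) (hT : T.OrdConnected) (h : ∀ t ∈ T, IsSolAt S X γ t)
    (h' : ∀ t ∈ T, IsSolAt S X γ' t) {s : ℝ} (hs : s ∈ T) (e : γ s = γ' s) : EqOn γ γ' T := by
  intro t ht
  have hTS : T ⊆ S := hTO ▸ inter_subset_left
  refine propagate hT (P := fun t => γ t = γ' t) hs ht (fun t₁ ht₁ => ?_) e
  have hmem : T ∈ 𝓝[S] t₁ := by
    rw [hTO] at ht₁ ⊢; exact inter_mem self_mem_nhdsWithin (mem_nhdsWithin_of_mem_nhds (hO.mem_nhds ht₁.2))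
  have hle : 𝓝[T] t₁ ≤ 𝓝[S] t₁ := nhdsWithin_mono _ hTS
  by_cases e₁ : γ t₁ = γ' t₁
  · have := hX.eventually_eq hS (hTS ht₁) (mem_of_superset hmem h) (mem_of_superset hmem h') e₁
    filter_upwards [hle this] with t ht using ⟨fun _ => ht, fun _ => e₁⟩
  · obtain ⟨u, v, hu, hv, hxu, hxv, huv⟩ := t2_separation e₁
    filter_upwards [hle ((h t₁ ht₁).1.eventually (hu.mem_nhds hxu)),
      hle ((h' t₁ ht₁).1.eventually (hv.mem_nhds hxv))] with t h1 h2
    exact ⟨fun h => absurd h e₁, fun h => (disjoint_left.1 huv h1 (h ▸ h2)).elim⟩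

/-- Finitely many local flows cover C, which gives a common δ; at a point outside C the field
vanishes and the constant curve is a solution. -/
lemma IsTimeField.exists_uniform (hX : IsTimeField S X) (hS : IsInterval S) {C : Set M}
    (hC : IsCompact C) (hXC : ∀ t ∈ S, ∀ c, ∀ x ∈ (extChartAt (𝓡 m) c).source, x ∉ C →
      X c t (extChartAt (𝓡 m) c x) = 0) {t₁ : ℝ} (ht₁ : t₁ ∈ S) :
    ∃ δ > 0, ∀ x : M, ∀ s ∈ S ∩ ball t₁ δ, ∃ γ : ℝ → M, γ s = x ∧
      ∀ t ∈ S ∩ ball t₁ δ, IsSolAt S X γ t := by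
  have key : ∃ δ > 0, ∀ x ∈ C, ∀ s ∈ S ∩ ball t₁ δ, ∃ γ : ℝ → M, γ s = x ∧
      ∀ t ∈ S ∩ ball t₁ δ, IsSolAt S X γ t := by
    refine hC.induction_on (p := fun C => ∃ δ > 0, ∀ x ∈ C, ∀ s ∈ S ∩ ball t₁ δ, ∃ γ : ℝ → M,
      γ s = x ∧ ∀ t ∈ S ∩ ball t₁ δ, IsSolAt S X γ t) ⟨1, one_pos, by simp⟩ ?_ ?_ ?_
    · rintro A B hAB ⟨δ, hδ, h⟩
      exact ⟨δ, hδ, fun x hx => h x (hAB hx)⟩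
    · rintro A B ⟨δ, hδ, h⟩ ⟨δ', hδ', h'⟩
      have i1 : S ∩ ball t₁ (min δ δ') ⊆ S ∩ ball t₁ δ :=
        inter_subset_inter_right _ (ball_subset_ball (min_le_left _ _))
      have i2 : S ∩ ball t₁ (min δ δ') ⊆ S ∩ ball t₁ δ' :=
        inter_subset_inter_right _ (ball_subset_ball (min_le_right _ _))
      refine ⟨min δ δ', lt_min hδ hδ', fun x hx s hs => ?_⟩
      rcases hx with hx | hx
      · obtain ⟨γ, h1, h2⟩ := h x hx s (i1 hs)
        exact ⟨γ, h1, fun t ht => h2 t (i1 ht)⟩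
      · obtain ⟨γ, h1, h2⟩ := h' x hx s (i2 hs)
        exact ⟨γ, h1, fun t ht => h2 t (i2 ht)⟩
    · intro x hx
      obtain ⟨δ, hδ, W, hW, hxW, h⟩ := hX.exists_localFlow hS 0 ht₁ x
      refine ⟨W, mem_nhdsWithin_of_mem_nhds (hW.mem_nhds hxW), δ, hδ, fun z hz s hs => ?_⟩
      obtain ⟨Φ, -, hΦ⟩ := h s hs
      exact ⟨fun τ => Φ τ z, (hΦ z hz).1, fun t ht => (hΦ z hz).2 t ht⟩
  obtain ⟨δ, hδ, h⟩ := key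
  refine ⟨δ, hδ, fun x s hs => ?_⟩
  by_cases hx : x ∈ C
  · exact h x hx s hs
  · exact ⟨fun _ => x, rfl, fun t ht => isSolAt_const fun c hc => hXC t ht.1 c x hc hx⟩

/-- A solution that reaches any time within δ of t₁ can be extended over the whole δ-neighbourhood
of t₁, with δ independent of where the solution is. Hence the times reachable from 0 form a set that
is relatively open and closed. -/
lemma IsTimeField.exists_globalSol (hX : IsTimeField S X) (hS : IsInterval S) (h0 : (0 : ℝ) ∈ S)
    {C : Set M} (hC : IsCompact C) (hXC : ∀ t ∈ S, ∀ c, ∀ x ∈ (extChartAt (𝓡 m) c).source, x ∉ C →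
      X c t (extChartAt (𝓡 m) c x) = 0) (x : M) :
    ∃ γ : ℝ → M, γ 0 = x ∧ ∀ t ∈ S, IsSolAt S X γ t := by
  classical
  have nb : ∀ {O : Set ℝ}, IsOpen O → ∀ {τ : ℝ}, τ ∈ S ∩ O → S ∩ O ∈ 𝓝[S] τ := fun hO τ hτ =>
    inter_mem self_mem_nhdsWithin (mem_nhdsWithin_of_mem_nhds (hO.mem_nhds hτ.2))
  have loc : ∀ t ∈ S, ∃ O : Set ℝ, ∃ γ : ℝ → M, IsOpen O ∧ (S ∩ O).OrdConnected ∧ 0 ∈ O ∧ γ 0 = x ∧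
      (∀ t ∈ S ∩ O, IsSolAt S X γ t) ∧ t ∈ O := by
    have step : ∀ t₁ ∈ S, ∃ δ > 0, ∀ s ∈ S ∩ ball t₁ δ, ∀ t ∈ S ∩ ball t₁ δ,
        (∃ O : Set ℝ, ∃ γ : ℝ → M, IsOpen O ∧ (S ∩ O).OrdConnected ∧ 0 ∈ O ∧ γ 0 = x ∧
          (∀ t ∈ S ∩ O, IsSolAt S X γ t) ∧ s ∈ O) →
        ∃ O : Set ℝ, ∃ γ : ℝ → M, IsOpen O ∧ (S ∩ O).OrdConnected ∧ 0 ∈ O ∧ γ 0 = x ∧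
          (∀ t ∈ S ∩ O, IsSolAt S X γ t) ∧ t ∈ O := by
      intro t₁ ht₁
      obtain ⟨δ, hδ, hu⟩ := hX.exists_uniform hS hC hXC ht₁
      refine ⟨δ, hδ, ?_⟩
      rintro s hs t ht ⟨O, γ, hO, hOc, h0O, hγ0, hγ, hsO⟩
      obtain ⟨γ', hγ's, hγ'⟩ := hu (γ s) s hs
      have hBc := ordConnected_inter_ball hS.ord t₁ δ
      have agree : EqOn γ γ' (S ∩ (O ∩ ball t₁ δ)) := by
        refine hX.eqOn hS (hO.inter isOpen_ball) rfl ?_ (fun t ht => hγ t ⟨ht.1, ht.2.1⟩)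
          (fun t ht => hγ' t ⟨ht.1, ht.2.2⟩) (s := s) ⟨hs.1, hsO, hs.2⟩ hγ's.symm
        rw [inter_inter_distrib_left]
        exact hOc.inter hBc
      -- The old and the new solution agree on the overlap by uniqueness, so they glue; the union of
      -- the two domains is connected because both contain s.
      refine ⟨O ∪ ball t₁ δ, fun τ => if τ ∈ O then γ τ else γ' τ, hO.union isOpen_ball, ?_,
        Or.inl h0O, by simp [h0O, hγ0], ?_, Or.inr ht.2⟩
      · rw [inter_union_distrib_left]
        have hpre : IsPreconnected (S ∩ O ∪ S ∩ ball t₁ δ) :=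
          IsPreconnected.union s ⟨hs.1, hsO⟩ hs hOc.isPreconnected hBc.isPreconnected
        exact hpre.ordConnected
      · rintro τ ⟨hτS, hτ⟩
        by_cases hτO : τ ∈ O
        · refine (hγ τ ⟨hτS, hτO⟩).congr hτS ?_
          filter_upwards [nb hO ⟨hτS, hτO⟩] with r hr
          rw [if_pos hr.2]
        · have hτB : τ ∈ ball t₁ δ := hτ.resolve_left hτO
          refine (hγ' τ ⟨hτS, hτB⟩).congr hτS ?_
          filter_upwards [nb isOpen_ball ⟨hτS, hτB⟩] with r hr
          split_ifs with hrO
          · exact agree ⟨hr.1, hrO, hr.2⟩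
          · rfl
    intro t ht
    refine propagate hS.ord (P := fun t => ∃ O : Set ℝ, ∃ γ : ℝ → M, IsOpen O ∧
      (S ∩ O).OrdConnected ∧ 0 ∈ O ∧ γ 0 = x ∧ (∀ t ∈ S ∩ O, IsSolAt S X γ t) ∧ t ∈ O) h0 ht ?_ ?_
    · intro t₁ ht₁
      obtain ⟨δ, hδ, h⟩ := step t₁ ht₁
      filter_upwards [nb isOpen_ball ⟨ht₁, mem_ball_self hδ⟩] with t ht
      exact ⟨h t₁ ⟨ht₁, mem_ball_self hδ⟩ t ht, h t ht t₁ ⟨ht₁, mem_ball_self hδ⟩⟩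
    · obtain ⟨δ, hδ, hu⟩ := hX.exists_uniform hS hC hXC h0
      obtain ⟨γ, h1, h2⟩ := hu x 0 ⟨h0, mem_ball_self hδ⟩
      exact ⟨ball 0 δ, γ, isOpen_ball, ordConnected_inter_ball hS.ord 0 δ, mem_ball_self hδ, h1, h2,
        mem_ball_self hδ⟩
  have : Nonempty M := ⟨x⟩
  choose! O γ hO hOc h0O hγ0 hγ htO using loc
  -- Take at each time t the value of a solution that reaches t. Solutions chosen for different
  -- times share the value at 0, so they coincide where both are defined.
  refine ⟨fun t => γ t t, hγ0 0 h0, fun t ht => ?_⟩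
  refine (hγ t ht t ⟨ht, htO t ht⟩).congr ht ?_
  filter_upwards [nb (hO t ht) ⟨ht, htO t ht⟩] with s hs
  refine hX.eqOn hS ((hO s hs.1).inter (hO t ht)) rfl ?_ (fun τ hτ => hγ s hs.1 τ ⟨hτ.1, hτ.2.1⟩)
    (fun τ hτ => hγ t ht τ ⟨hτ.1, hτ.2.2⟩) (s := 0) ⟨h0, h0O s hs.1, h0O t ht⟩
    ((hγ0 s hs.1).trans (hγ0 t ht).symm) ⟨hs.1, htO s hs.1, hs.2⟩
  rw [inter_inter_distrib_left]
  exact (hOc s hs.1).inter (hOc t ht)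

/-- The flow of a compactly supported time dependent vector field. -/
theorem IsTimeField.exists_flow (hX : IsTimeField S X) (hS : IsInterval S) (h0 : (0 : ℝ) ∈ S)
    {C : Set M} (hC : IsCompact C) (hXC : ∀ t ∈ S, ∀ c, ∀ x ∈ (extChartAt (𝓡 m) c).source, x ∉ C →
      X c t (extChartAt (𝓡 m) c x) = 0) :
    ∃ F : ℝ → M → M, (∀ x, F 0 x = x) ∧
      ContMDiffOn (𝓘(ℝ, ℝ).prod (𝓡 m)) (𝓡 m) ∞ (fun p : ℝ × M => F p.1 p.2) (S ×ˢ univ) ∧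
      ∀ x, ∀ t ∈ S, IsSolAt S X (fun τ => F τ x) t := by
  choose γ hγ0 hγ using hX.exists_globalSol hS h0 hC hXC
  -- Smoothness is checked one order k at a time, because the size of the local flows is allowed to
  -- depend on k.
  refine ⟨fun t x => γ x t, hγ0, contMDiffOn_infty.2 fun k => ?_, hγ⟩
  have nb : ∀ {τ δ : ℝ}, 0 < δ → S ∩ ball τ δ ∈ 𝓝[S] τ := fun hδ =>
    inter_mem self_mem_nhdsWithin (mem_nhdsWithin_of_mem_nhds (ball_mem_nhds _ hδ))
  have key : ∀ x : M, ∀ t ∈ S, ∃ δ > 0, ∃ V : Set M, IsOpen V ∧ x ∈ V ∧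
      ContMDiffOn (𝓘(ℝ, ℝ).prod (𝓡 m)) (𝓡 m) k (fun p : ℝ × M => γ p.2 p.1)
        ((S ∩ ball t δ) ×ˢ V) := by
    intro x t ht
    -- Near t₁ the global flow is the time-s map followed by a local flow started at s, so
    -- regularity of one time-s map near x yields joint regularity at the nearby times.
    have step : ∀ t₁ ∈ S, ∃ δ > 0, ∃ W : Set M, IsOpen W ∧ (∀ t ∈ S ∩ ball t₁ δ, γ x t ∈ W) ∧
        ∀ s ∈ S ∩ ball t₁ δ, ∀ V : Set M, IsOpen V → x ∈ V →
          ContMDiffOn (𝓡 m) (𝓡 m) k (fun z => γ z s) V → ∃ V : Set M, IsOpen V ∧ x ∈ V ∧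
          ContMDiffOn (𝓘(ℝ, ℝ).prod (𝓡 m)) (𝓡 m) k (fun p : ℝ × M => γ p.2 p.1)
            ((S ∩ ball t₁ δ) ×ˢ V) := by
      intro t₁ ht₁
      obtain ⟨δ, hδ, W, hW, hxW, h⟩ := hX.exists_localFlow hS k ht₁ (γ x t₁)
      obtain ⟨δ', hδ', hδ'W⟩ := Metric.mem_nhdsWithin_iff.1
        ((hγ x t₁ ht₁).1.eventually (hW.mem_nhds hxW))
      have isub : S ∩ ball t₁ (min δ δ') ⊆ S ∩ ball t₁ δ :=
        inter_subset_inter_right _ (ball_subset_ball (min_le_left _ _))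
      have hWmem : ∀ t ∈ S ∩ ball t₁ (min δ δ'), γ x t ∈ W := fun t ht =>
        hδ'W ⟨ball_subset_ball (min_le_right _ _) ht.2, ht.1⟩
      refine ⟨min δ δ', lt_min hδ hδ', W, hW, hWmem, fun s hs V hV hxV hVs => ?_⟩
      obtain ⟨Φ, hΦ, hΦ'⟩ := h s (isub hs)
      refine ⟨V ∩ (fun z => γ z s) ⁻¹' W, hVs.continuousOn.isOpen_inter_preimage hV hW,
        ⟨hxV, hWmem s hs⟩, ?_⟩
      have h1 : ContMDiffOn (𝓘(ℝ, ℝ).prod (𝓡 m)) (𝓘(ℝ, ℝ).prod (𝓡 m)) k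
          (fun p : ℝ × M => (p.1, γ p.2 s))
          ((S ∩ ball t₁ (min δ δ')) ×ˢ (V ∩ (fun z => γ z s) ⁻¹' W)) :=
        contMDiffOn_fst.prodMk (hVs.comp contMDiffOn_snd fun p hp => hp.2.1)
      refine (hΦ.comp h1 fun p hp => ⟨isub hp.1, hp.2.2⟩).congr fun p hp => ?_
      exact hX.eqOn hS isOpen_ball rfl (ordConnected_inter_ball hS.ord t₁ (min δ δ'))
        (fun t ht => hγ p.2 t ht.1) (fun t ht => (hΦ' _ hp.2.2).2 t (isub ht)) hs
        (hΦ' _ hp.2.2).1.symm hp.1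
    have slice : ∀ {T : Set ℝ} {V : Set M} {τ : ℝ}, τ ∈ T →
        ContMDiffOn (𝓘(ℝ, ℝ).prod (𝓡 m)) (𝓡 m) k (fun p : ℝ × M => γ p.2 p.1) (T ×ˢ V) →
        ContMDiffOn (𝓡 m) (𝓡 m) k (fun z => γ z τ) V := fun hτ h =>
      h.comp (contMDiffOn_const.prodMk contMDiffOn_id) fun z hz => ⟨hτ, hz⟩
    -- Regularity of the time-t map near x is a locally constant property of t, and at t = 0 the map
    -- is the identity.
    have hP : ∃ V : Set M, IsOpen V ∧ x ∈ V ∧ ContMDiffOn (𝓡 m) (𝓡 m) k (fun z => γ z t) V := by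
      refine propagate hS.ord (P := fun t => ∃ V : Set M, IsOpen V ∧ x ∈ V ∧
        ContMDiffOn (𝓡 m) (𝓡 m) k (fun z => γ z t) V) h0 ht ?_ ?_
      · intro t₁ ht₁
        obtain ⟨δ, hδ, W, hW, hWmem, h⟩ := step t₁ ht₁
        have ht₁' : t₁ ∈ S ∩ ball t₁ δ := ⟨ht₁, mem_ball_self hδ⟩
        filter_upwards [nb hδ] with t ht
        constructor
        · rintro ⟨V, hV, hxV, hVs⟩
          obtain ⟨V', hV', hxV', h'⟩ := h t₁ ht₁' V hV hxV hVs
          exact ⟨V', hV', hxV', slice ht h'⟩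
        · rintro ⟨V, hV, hxV, hVs⟩
          obtain ⟨V', hV', hxV', h'⟩ := h t ht V hV hxV hVs
          exact ⟨V', hV', hxV', slice ht₁' h'⟩
      · refine ⟨univ, isOpen_univ, mem_univ _, ?_⟩
        simp only [hγ0]
        exact contMDiffOn_id
    obtain ⟨V, hV, hxV, hVs⟩ := hP
    obtain ⟨δ, hδ, W, hW, hWmem, h⟩ := step t ht
    exact ⟨δ, hδ, h t ⟨ht, mem_ball_self hδ⟩ V hV hxV hVs⟩
  refine contMDiffOn_of_locally_contMDiffOn ?_
  rintro ⟨t, x⟩ ⟨ht, -⟩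
  obtain ⟨δ, hδ, V, hV, hxV, h⟩ := key x t ht
  exact ⟨ball t δ ×ˢ V, isOpen_ball.prod hV, ⟨mem_ball_self hδ, hxV⟩, by
    rw [prod_inter_prod, univ_inter]; exact h⟩

end Flow

/-! ### Moser's argument in coordinates -/

section MoserLocal

variable {E E' : Type*} [NormedAddCommGroup E] [NormedSpace ℝ E] [NormedAddCommGroup E']
  [NormedSpace ℝ E'] {S T : Set ℝ} {U : Set E} {B : Set E'} {X : ℝ → E → E} {H : ℝ → E' → E}
  {t : ℝ} {z : E'}

lemma IsInterval.inter_open {S O : Set ℝ} (hS : IsInterval S) (hO : IsOpen O) {t : ℝ} (ht : t ∈ S)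
    (htO : t ∈ O) (hc : (S ∩ O).OrdConnected) : IsInterval (S ∩ O) := by
  refine ⟨hc, ?_⟩
  obtain ⟨x, hxO, hxS⟩ := mem_closure_iff.1 (hS.subset_closure_interior ht) O hO htO
  obtain ⟨ε, hε, h⟩ := Metric.isOpen_iff.1 (hO.inter isOpen_interior) x ⟨hxO, hxS⟩
  have h2 : x + ε / 2 ∈ O ∩ interior S := h (by
    rw [mem_ball, Real.dist_eq, add_sub_cancel_left, abs_of_pos (by linarith)]; linarith)
  exact ⟨x, ⟨interior_subset hxS, hxO⟩, x + ε / 2, ⟨interior_subset h2.2, h2.1⟩, by linarith⟩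

/-- The linearized equation for the derivative of a family of solutions. -/
lemma hasDerivWithinAt_fderiv_solution (hT : IsInterval T) (hU : IsOpen U) (hB : IsOpen B)
    (hTS : T ⊆ S) (hX : ContDiffOn ℝ ∞ (fun p : ℝ × E => X p.1 p.2) (S ×ˢ U))
    (hH : ContDiffOn ℝ ∞ (fun p : ℝ × E' => H p.1 p.2) (T ×ˢ B))
    (hHU : ∀ t ∈ T, ∀ z ∈ B, H t z ∈ U)
    (hHd : ∀ t ∈ T, ∀ z ∈ B, HasDerivWithinAt (fun s => H s z) (X t (H t z)) T t)
    (ht : t ∈ T) (hz : z ∈ B) : HasDerivWithinAt (fun s => fderiv ℝ (H s) z)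
      ((fderiv ℝ (X t) (H t z)).comp (fderiv ℝ (H t) z)) T t := by
  have h1 := hasDerivWithinAt_fderiv_family hT hB hH ht hz
  have h2 : tD T H t =ᶠ[𝓝 z] fun z => X t (H t z) := by
    filter_upwards [hB.mem_nhds hz] with z hz
    exact (hHd t ht z hz).derivWithin (hT.uniqueDiffOn t ht)
  have h3 : HasFDerivAt (H t) (fderiv ℝ (H t) z) z :=
    (((contDiffOn_slice hH ht).contDiffAt (hB.mem_nhds hz)).differentiableAt (by simp)).hasFDerivAt
  have h4 : HasFDerivAt (X t) (fderiv ℝ (X t) (H t z)) (H t z) :=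
    (((contDiffOn_slice hX (hTS ht)).contDiffAt (hU.mem_nhds (hHU t ht z hz))).differentiableAt
      (by simp)).hasFDerivAt
  have h5 : HasFDerivAt (fun z => X t (H t z)) _ z := h4.comp z h3
  rwa [h2.fderiv_eq, h5.fderiv] at h1

/-- The kernel of the derivative of a family of solutions is locally constant in time. -/
lemma eventually_fderiv_eq_zero_iff (hT : IsInterval T) (hU : IsOpen U) (hB : IsOpen B)
    (hS : IsInterval S)
    (hTS : T ⊆ S) (hX : ContDiffOn ℝ ∞ (fun p : ℝ × E => X p.1 p.2) (S ×ˢ U))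
    (hH : ContDiffOn ℝ ∞ (fun p : ℝ × E' => H p.1 p.2) (T ×ˢ B))
    (hHU : ∀ t ∈ T, ∀ z ∈ B, H t z ∈ U)
    (hHd : ∀ t ∈ T, ∀ z ∈ B, HasDerivWithinAt (fun s => H s z) (X t (H t z)) T t)
    (ht : t ∈ T) (hz : z ∈ B) :
    ∀ᶠ s in 𝓝[T] t, ∀ v, fderiv ℝ (H t) z v = 0 ↔ fderiv ℝ (H s) z v = 0 := by
  obtain ⟨a, b, htab, hsub, -, δ, hδ, -, hδ'⟩ := exists_Icc_nhd hT.ord ht one_pos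
  have hcont : ContinuousOn (fun s => fderiv ℝ (X s) (H s z)) (Icc a b) := by
    refine (contDiffOn_fderiv_family hS hU hX).continuousOn.comp
      (continuousOn_id.prodMk fun s hs => ?_) fun s hs => ⟨hTS (hsub hs), hHU s (hsub hs) z hz⟩
    exact (hHd s (hsub hs) z hz).continuousWithinAt.mono hsub
  obtain ⟨C, hC⟩ := isCompact_Icc.exists_bound_of_continuousOn hcont
  -- For fixed v the vector DH_s(v) solves a linear equation with bounded coefficients, so it
  -- vanishes at all of these times or at none.
  have key : ∀ s ∈ Icc a b, ∀ τ ∈ Icc a b, ∀ v, fderiv ℝ (H s) z v = 0 → fderiv ℝ (H τ) z v = 0 := by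
    intro s hs τ hτ v hv
    have := gronwall_interval (T := Icc a b) ordConnected_Icc
      (w := fun s => fderiv ℝ (H s) z v) (K := max 1 C) (ε := 0)
      (le_max_left _ _) le_rfl (fun r hr => ((hasDerivWithinAt_fderiv_solution hT hU hB hTS hX hH hHU
        hHd (hsub hr) hz).mono hsub).clm_apply (hasDerivWithinAt_const r _ v))
      (fun r hr => by
        simp only [map_zero, add_zero, ContinuousLinearMap.comp_apply]
        exact ContinuousLinearMap.le_of_opNorm_le _ ((hC r hr).trans (le_max_right _ _)) _) hs hτ
    rw [hv, norm_zero, add_zero, zero_mul] at this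
    exact norm_le_zero_iff.1 this
  filter_upwards [self_mem_nhdsWithin, mem_nhdsWithin_of_mem_nhds (ball_mem_nhds t hδ)] with s hs hs'
  exact fun v => ⟨key t htab s (hδ' ⟨hs, hs'⟩) v, key s (hδ' ⟨hs, hs'⟩) t htab v⟩

variable [FiniteDimensional ℝ E] {g : ℝ → E → E →L[ℝ] E →L[ℝ] ℝ} {J : ℝ → E → E →L[ℝ] E}

/-- The Ricci forms pull back to the same form along the solutions of the Moser equation. -/
lemma IsKahlerFamily.hasDerivWithinAt_pullback_rho (h : IsKahlerFamily S g J U) (hS : IsInterval S)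
    (hU : IsOpen U) (hd : ∀ t ∈ S, ∀ y ∈ U, ∀ u, (∀ v, rho (g t) (J t) y u v = 0) → u = 0)
    (hT : IsInterval T) (hB : IsOpen B) (hTS : T ⊆ S)
    (hH : ContDiffOn ℝ ∞ (fun p : ℝ × E' => H p.1 p.2) (T ×ˢ B))
    (hHU : ∀ t ∈ T, ∀ z ∈ B, H t z ∈ U)
    (hHd : ∀ t ∈ T, ∀ z ∈ B, HasDerivWithinAt (fun s => H s z) (moserField S g J t (H t z)) T t)
    (ht : t ∈ T) (hz : z ∈ B) (v w : E') : HasDerivWithinAt (fun s => rho (g s) (J s) (H s z)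
      (fderiv ℝ (H s) z v) (fderiv ℝ (H s) z w)) 0 T t := by
  have hX := h.contDiffOn_moserField hS hU hd
  have hR := h.contDiffOn_rho hS hU
  set X := moserField S g J with hXdef
  have htS := hTS ht
  have hy := hHU t ht z hz
  have hK := h.kahler t htS
  set R : ℝ → E → E →L[ℝ] E →L[ℝ] ℝ := fun s y => rho (g s) (J s) y with hRdef
  set y := H t z with hydef
  have hRt : HasFDerivAt (R t) (fderiv ℝ (R t) y) y :=
    (((contDiffOn_slice (G := R) hR htS).contDiffAt (hU.mem_nhds hy)).differentiableAt
      (by simp)).hasFDerivAt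
  have hXt : HasFDerivAt (X t) (fderiv ℝ (X t) y) y :=
    (((contDiffOn_slice hX htS).contDiffAt (hU.mem_nhds hy)).differentiableAt
      (by simp)).hasFDerivAt
  have h1 : HasDerivWithinAt (fun s => R s (H s z)) (tD S R t y + fderiv ℝ (R t) y (X t y)) T t := by
    have a1 := ((hR.differentiableOn (by simp)) (t, y) ⟨htS, hy⟩).hasFDerivWithinAt
    have a2 : HasDerivWithinAt (fun s : ℝ => (s, H s z)) ((1 : ℝ), X t y) T t :=
      (hasDerivWithinAt_id t T).prodMk (hHd t ht z hz)
    have a3 := HasFDerivWithinAt.comp_hasDerivWithinAt (t := S ×ˢ U) t a1 a2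
      (fun s hs => ⟨hTS hs, hHU s hs z hz⟩)
    refine a3.congr_deriv ?_
    have e1 := tD_eq (G := R) hS hU hR htS hy
    have e2 := (hasFDerivAt_of_family (G := R) hU hR (by simp) htS hy).fderiv
    rw [e1, e2]
    simp only [ContinuousLinearMap.comp_apply, ContinuousLinearMap.inr_apply]
    rw [← map_add, Prod.mk_add_mk, add_zero, zero_add]
  have h2 := hasDerivWithinAt_fderiv_solution hT hU hB hTS hX hH hHU hHd ht hz
  have h3 := (h1.clm_apply (h2.clm_apply (hasDerivWithinAt_const t T v))).clm_apply
    (h2.clm_apply (hasDerivWithinAt_const t T w))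
  refine h3.congr_deriv ?_
  set a := fderiv ℝ (H t) z v
  set b := fderiv ℝ (H t) z w
  -- Differentiate β = -ρ(X, ·), which defines X. The rest is Cartan's formula: the derivative of
  -- the pull-back is (∂_tρ + L_Xρ)(a, b), and ∂_tρ = dβ = -d(ρ(X, ·)) cancels L_Xρ because ρ is
  -- closed.
  have hβ : ∀ u v : E, fderiv ℝ (fun x => beta S g J t x v) y u =
      -(fderiv ℝ (R t) y u (X t y) v + R t y (fderiv ℝ (X t) y u) v) := by
    intro u v
    have e1 : (fun x => beta S g J t x v) =ᶠ[𝓝 y] fun x => -(R t x (X t x) v) := by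
      filter_upwards [hU.mem_nhds hy] with x hx
      have := (isInvertible_of_nondegenerate (hd t htS x hx)).self_apply_inverse (-beta S g J t x)
      have e : R t x (X t x) = -beta S g J t x := this
      rw [e, neg_apply, neg_neg]
    rw [e1.fderiv_eq, (((hRt.clm_apply hXt).clm_apply (hasFDerivAt_const v y)).fun_neg).fderiv]
    simp [add_comm]
  have htD : tD S R t y a b = fderiv ℝ (fun x => beta S g J t x b) y a
      - fderiv ℝ (fun x => beta S g J t x a) y b := by
    have e1 := ((hasDerivWithinAt_family (G := R) hS hU hR htS hy).clm_apply
      (hasDerivWithinAt_const t S a)).clm_apply (hasDerivWithinAt_const t S b)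
    have := (hS.uniqueDiffOn t htS).eq_deriv _ e1 (h.hasDerivWithinAt_rho hS hU htS hy a b)
    simpa using this
  have hcl : fderiv ℝ (R t) y (X t y) a b + fderiv ℝ (R t) y a b (X t y)
      + fderiv ℝ (R t) y b (X t y) a = 0 := by
    have e : ∀ p q r : E, fderiv ℝ (fun x => rho (g t) (J t) x p q) y r = fderiv ℝ (R t) y r p q := by
      intro p q r
      rw [((hRt.clm_apply (hasFDerivAt_const p y)).clm_apply (hasFDerivAt_const q y)).fderiv]
      simp
    have := hK.rho_closed hy a b (X t y)
    rwa [e, e, e] at this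
  have hsw : ∀ p q r : E, fderiv ℝ (R t) y r p q = -fderiv ℝ (R t) y r q p := by
    intro p q r
    have e1 := ((hRt.clm_apply (hasFDerivAt_const p y)).clm_apply (hasFDerivAt_const q y))
    have e2 := ((hRt.clm_apply (hasFDerivAt_const q y)).clm_apply (hasFDerivAt_const p y)).fun_neg
    have e3 := e2.congr_of_eventuallyEq (f₁ := fun x => R t x p q) (by
      filter_upwards [hU.mem_nhds hy] with x hx using hK.rho_swap hx p q)
    have := congrArg (fun A => A r) (e1.unique e3)
    simpa using this
  have hs2 := hK.rho_swap hy (fderiv ℝ (X t) y b) a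
  have hs3 := hsw b (X t y) a
  rw [hβ, hβ] at htD
  simp only [add_apply, ContinuousLinearMap.comp_apply, map_zero, add_zero]
  change (tD S R t y a b + fderiv ℝ (R t) y (X t y) a b + R t y (fderiv ℝ (X t) y a) b) +
    R t y a (fderiv ℝ (X t) y b) = 0
  change R t y (fderiv ℝ (X t) y b) a = -R t y a (fderiv ℝ (X t) y b) at hs2
  rw [htD]
  linarith

end MoserLocal

/-! ### The derivative of a map in charts -/

section MoserGlobal

lemma vecC_mfderiv {k m : ℕ} {L M : Type*} [TopologicalSpace L]
    [ChartedSpace (EuclideanSpace ℝ (Fin k)) L] [IsManifold (𝓡 k) ∞ L] [TopologicalSpace M]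
    [ChartedSpace (EuclideanSpace ℝ (Fin m)) M] [IsManifold (𝓡 m) ∞ M] {F : L → M} {p a : L} {c : M}
    (hF : MDifferentiableAt (𝓡 k) (𝓡 m) F p) (ha : p ∈ (extChartAt (𝓡 k) a).source)
    (hc : F p ∈ (extChartAt (𝓡 m) c).source) (v : TangentSpace (𝓡 k) p) :
    vecC c (F p) (mfderiv (𝓡 k) (𝓡 m) F p v) =
      fderiv ℝ (fun z => extChartAt (𝓡 m) c (F (chartPt a z))) (extChartAt (𝓡 k) a p)
        (vecC a p v) := by
  have hz := ext_mem ha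
  have e := chartPt_ext ha
  have h0 : MDifferentiableAt (𝓡 k) (𝓡 m) (fun z => F (chartPt a z)) (extChartAt (𝓡 k) a p) :=
    MDifferentiableAt.comp (g := F) (f := fun z => chartPt a z) _ (by rw [e]; exact hF)
      (mdifferentiableAt_chartPt hz)
  have h1 : MDifferentiableAt (𝓡 k) (𝓡 m) (fun z => extChartAt (𝓡 m) c (F (chartPt a z)))
      (extChartAt (𝓡 k) a p) :=
    MDifferentiableAt.comp (g := extChartAt (𝓡 m) c) (f := fun z => F (chartPt a z)) _
      (mdifferentiableAt_ext (by rw [e]; exact hc)) h0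
  have h2 := mfderiv_comp p h1 (mdifferentiableAt_ext ha)
  have h3 : mfderiv (𝓡 k) (𝓡 m) ((fun z => extChartAt (𝓡 m) c (F (chartPt a z))) ∘
      extChartAt (𝓡 k) a) p = mfderiv (𝓡 k) (𝓡 m) (extChartAt (𝓡 m) c ∘ F) p := by
    apply Filter.EventuallyEq.mfderiv_eq
    filter_upwards [(isOpen_extChartAt_source (I := 𝓡 k) a).mem_nhds ha] with z hz
    simp only [Function.comp, chartPt_ext hz]
  rw [h3, mfderiv_comp p (mdifferentiableAt_ext hc) hF, mfderiv_eq_fderiv] at h2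
  exact congrArg (fun T => T v) h2

end MoserGlobal

/-! ### Moser's argument on a manifold, with a cut-off vector field -/

section MoserManifold

lemma contDiffOn_of_contMDiffOn_prod {k m : ℕ}
    {f : ℝ × EuclideanSpace ℝ (Fin k) → EuclideanSpace ℝ (Fin m)} {s : Set (ℝ × _)}
    {r : WithTop ℕ∞} (h : ContMDiffOn (𝓘(ℝ, ℝ).prod (𝓡 k)) (𝓡 m) r f s) : ContDiffOn ℝ r f s := by
  rw [← modelWithCornersSelf_prod, chartedSpaceSelf_prod] at h
  exact contMDiffOn_iff_contDiffOn.1 h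

lemma chartPt_trans {m : ℕ} {M : Type*} [TopologicalSpace M]
    [ChartedSpace (EuclideanSpace ℝ (Fin m)) M] {c d : M} {y : EuclideanSpace ℝ (Fin m)}
    (hy : y ∈ transDom c d) : chartPt d (trans c d y) = chartPt c y := by
  rw [trans, chartPt_ext hy.2]

lemma IsTimeField.smul {m : ℕ} {M : Type*} [TopologicalSpace M]
    [ChartedSpace (EuclideanSpace ℝ (Fin m)) M] [IsManifold (𝓡 m) ∞ M] {S : Set ℝ}
    {X : M → ℝ → EuclideanSpace ℝ (Fin m) → EuclideanSpace ℝ (Fin m)} (hX : IsTimeField S X)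
    {χ : M → ℝ} (hχ : ContMDiff (𝓡 m) 𝓘(ℝ, ℝ) ∞ χ) :
    IsTimeField S (fun c t y => χ (chartPt c y) • X c t y) where
  smooth c := by
    have h1 : ContDiffOn ℝ ∞ (fun y => χ (chartPt c y)) (chartDom m c) := by
      rw [← contMDiffOn_iff_contDiffOn]
      exact hχ.comp_contMDiffOn (contMDiffOn_extChartAt_symm (n := ∞) c)
    exact (h1.comp contDiff_snd.contDiffOn fun p hp => hp.2).smul (hX.smooth c)
  compat t ht c d y hy := by
    rw [chartPt_trans hy, hX.compat t ht c d y hy, map_smul]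

variable {n : ℕ} {M : Type*} [TopologicalSpace M] [ChartedSpace (EuclideanSpace ℝ (Fin (2 * n))) M]
  [IsManifold (𝓡 (2 * n)) ∞ M] {S : Set ℝ} {K : ℝ → KahlerStructure n M}

/-- The Moser vector field of a curve of Kähler structures. -/
def moserX (S : Set ℝ) (K : ℝ → KahlerStructure n M) (c : M) (t : ℝ)
    (y : EuclideanSpace ℝ (Fin (2 * n))) : EuclideanSpace ℝ (Fin (2 * n)) :=
  moserField S (fun t => bC (K t).g c) (fun t => eC (K t).J c) t y

lemma rho_nondegenerate {K : KahlerStructure n M}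
    (hd : ∀ x v, (∀ w, K.ricciForm x v w = 0) → v = 0) {c : M} {y : EuclideanSpace ℝ (Fin (2 * n))}
    (hy : y ∈ chartDom (2 * n) c) (u : EuclideanSpace ℝ (Fin (2 * n)))
    (hu : ∀ v, rho (bC K.g c) (eC K.J c) y u v = 0) : u = 0 := by
  obtain ⟨x, hx, rfl, hs⟩ := exists_vecC hy
  obtain ⟨v, rfl⟩ := hs u
  rw [hd x v fun w => by rw [K.ricciForm_eq hx, hu], map_zero]

/-- The defining equation ρ(X, ·) = -β is tensorial, so its solutions in different charts represent
the same vector. -/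
lemma isTimeField_moserX (hS : IsInterval S) (hK : IsSmoothCurve S K)
    (hd : ∀ t ∈ S, ∀ x v, (∀ w, (K t).ricciForm x v w = 0) → v = 0) :
    IsTimeField S (moserX S K) where
  smooth c := (hK.isKahlerFamily c).contDiffOn_moserField hS (isOpen_chartDom c)
    fun t ht _ hy => rho_nondegenerate (hd t ht) hy
  compat t ht c d _ hy := (moserField_eq hS
    ((hK.isKahlerFamily c).mono (isOpen_transDom c d) inter_subset_left)
    ((hK.isKahlerFamily d).mono (isOpen_transDom d c) inter_subset_left)
    (fun t _ => (K t).isKahlerIso c d) ht hy (rho_nondegenerate (hd t ht) hy.1)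
    (rho_nondegenerate (hd t ht) (trans_mem hy).1)).symm

variable {L : Type*} [TopologicalSpace L] [ChartedSpace (EuclideanSpace ℝ (Fin n)) L]
  [IsManifold (𝓡 n) ∞ L]

/-- The maps `q ↦ G t q` moved by a cut-off Moser field: near a point where the cut-off function is
one, the pull back of the Ricci forms and the kernel of the derivative do not depend on time. -/
lemma eventually_pullback_eq (hS : IsInterval S) (hK : IsSmoothCurve S K)
    (hd : ∀ t ∈ S, ∀ x v, (∀ w, (K t).ricciForm x v w = 0) → v = 0) {χ : M → ℝ}
    {N : Set M} (hN : IsOpen N) (hχN : ∀ x ∈ N, χ x = 1) {G : ℝ → L → M}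
    (hG : ContMDiffOn (𝓘(ℝ, ℝ).prod (𝓡 n)) (𝓡 (2 * n)) ∞ (fun p : ℝ × L => G p.1 p.2) (S ×ˢ univ))
    (hGs : ∀ q, ∀ t ∈ S, IsSolAt S (fun c t y => χ (chartPt c y) • moserX S K c t y)
      (fun τ => G τ q) t) {t₁ : ℝ} (ht₁ : t₁ ∈ S) {p : L} (hp : G t₁ p ∈ N) :
    ∀ᶠ t in 𝓝[S] t₁, ∀ v w : TangentSpace (𝓡 n) p,
      ((K t₁).ricciForm (G t₁ p) (mfderiv (𝓡 n) (𝓡 (2 * n)) (G t₁) p v)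
          (mfderiv (𝓡 n) (𝓡 (2 * n)) (G t₁) p w) =
        (K t).ricciForm (G t p) (mfderiv (𝓡 n) (𝓡 (2 * n)) (G t) p v)
          (mfderiv (𝓡 n) (𝓡 (2 * n)) (G t) p w)) ∧
      (mfderiv (𝓡 n) (𝓡 (2 * n)) (G t₁) p v = 0 ↔ mfderiv (𝓡 n) (𝓡 (2 * n)) (G t) p v = 0) := by
  obtain ⟨c, hc⟩ : ∃ c, G t₁ p = c := ⟨_, rfl⟩
  have hcs := mem_extChartAt_source (I := 𝓡 (2 * n)) c
  have hps := mem_extChartAt_source (I := 𝓡 n) p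
  obtain ⟨z₀, hz₀⟩ : ∃ z₀, extChartAt (𝓡 n) p p = z₀ := ⟨_, rfl⟩
  have hz₀m : z₀ ∈ chartDom n p := hz₀ ▸ ext_mem hps
  have e₀ : chartPt p z₀ = p := hz₀ ▸ chartPt_ext hps
  set H : ℝ → EuclideanSpace ℝ (Fin n) → EuclideanSpace ℝ (Fin (2 * n)) :=
    fun t z => extChartAt (𝓡 (2 * n)) c (G t (chartPt p z)) with hH
  have hmapz : ContMDiffOn (𝓘(ℝ, ℝ).prod (𝓡 n)) (𝓘(ℝ, ℝ).prod (𝓡 n)) ∞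
      (fun q : ℝ × EuclideanSpace ℝ (Fin n) => (q.1, chartPt p q.2)) (S ×ˢ chartDom n p) :=
    contMDiffOn_fst.prodMk ((contMDiffOn_extChartAt_symm (n := ∞) p).comp contMDiffOn_snd
      fun q hq => hq.2)
  have hGz : ContMDiffOn (𝓘(ℝ, ℝ).prod (𝓡 n)) (𝓡 (2 * n)) ∞
      (fun q : ℝ × EuclideanSpace ℝ (Fin n) => G q.1 (chartPt p q.2)) (S ×ˢ chartDom n p) :=
    hG.comp (f := fun q : ℝ × EuclideanSpace ℝ (Fin n) => (q.1, chartPt p q.2)) hmapz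
      fun q hq => ⟨hq.1, mem_univ _⟩
  have hO : IsOpen ((extChartAt (𝓡 (2 * n)) c).source ∩ N) := (isOpen_extChartAt_source c).inter hN
  have hnear : ∀ᶠ q in 𝓝[S ×ˢ chartDom n p] (t₁, z₀),
      G q.1 (chartPt p q.2) ∈ (extChartAt (𝓡 (2 * n)) c).source ∩ N := by
    refine (hGz.continuousOn (t₁, z₀) ⟨ht₁, hz₀m⟩).eventually (hO.mem_nhds ?_)
    simp only [e₀]
    refine ⟨?_, hp⟩
    rw [hc]; exact hcs
  obtain ⟨δ, hδ, hδ'⟩ := Metric.mem_nhdsWithin_iff.1 hnear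
  obtain ⟨r₁, hr₁, hr₁'⟩ := Metric.isOpen_iff.1 (isOpen_chartDom p) z₀ hz₀m
  set r := min δ r₁ with hr
  have hrpos : 0 < r := lt_min hδ hr₁
  set T := S ∩ ball t₁ δ with hT
  set B := ball z₀ r with hB
  have hBd : B ⊆ chartDom n p := (ball_subset_ball (min_le_right _ _)).trans hr₁'
  have hTB : ∀ t ∈ T, ∀ z ∈ B, G t (chartPt p z) ∈ (extChartAt (𝓡 (2 * n)) c).source ∩ N := by
    intro t ht z hz
    have h1 : ((t, z) : ℝ × EuclideanSpace ℝ (Fin n)) ∈ ball (t₁, z₀) δ := by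
      rw [mem_ball, Prod.dist_eq]
      exact max_lt ht.2 ((mem_ball.1 hz).trans_le (min_le_left _ _))
    have h2 : ((t, z) : ℝ × EuclideanSpace ℝ (Fin n)) ∈ S ×ˢ chartDom n p :=
      mk_mem_prod ht.1 (hBd hz)
    exact hδ' (mem_inter h1 h2)
  have hTint : IsInterval T :=
    hS.inter_open isOpen_ball ht₁ (mem_ball_self hδ) (ordConnected_inter_ball hS.ord _ _)
  have ht₁T : t₁ ∈ T := ⟨ht₁, mem_ball_self hδ⟩
  have hz₀B : z₀ ∈ B := mem_ball_self hrpos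
  have hHs : ContDiffOn ℝ ∞ (fun q : ℝ × EuclideanSpace ℝ (Fin n) => H q.1 q.2) (T ×ˢ B) := by
    refine contDiffOn_of_contMDiffOn_prod ?_
    exact (contMDiffOn_extChartAt (n := ∞) (x := c)).comp
      (hGz.mono (prod_mono inter_subset_left hBd))
      fun q hq => by simpa using (hTB q.1 hq.1 q.2 hq.2).1
  have hHU : ∀ t ∈ T, ∀ z ∈ B, H t z ∈ chartDom (2 * n) c := fun t ht z hz =>
    ext_mem (hTB t ht z hz).1
  -- On these neighbourhoods the images stay in N, where the cut-off factor is one, so H solves the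
  -- uncut Moser equation.
  have hHd : ∀ t ∈ T, ∀ z ∈ B, HasDerivWithinAt (fun s => H s z) (moserX S K c t (H t z)) T t := by
    intro t ht z hz
    have h1 := ((hGs (chartPt p z) t ht.1).2 c (hTB t ht z hz).1).mono
      (inter_subset_left : T ⊆ S)
    beta_reduce at h1
    rwa [chartPt_ext (hTB t ht z hz).1, hχN _ (hTB t ht z hz).2, one_smul] at h1
  have hnd : ∀ t ∈ S, ∀ y ∈ chartDom (2 * n) c, ∀ u,
      (∀ v, rho (bC (K t).g c) (eC (K t).J c) y u v = 0) → u = 0 :=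
    fun t ht y hy => rho_nondegenerate (hd t ht) hy
  have hsl : ∀ t ∈ T, MDifferentiableAt (𝓡 n) (𝓡 (2 * n)) (G t) p := by
    intro t ht
    have : ContMDiff (𝓡 n) (𝓡 (2 * n)) ∞ (G t) := contMDiffOn_univ.1
      (hG.comp (f := fun q : L => (t, q)) (contMDiffOn_const.prodMk contMDiffOn_id)
        fun q _ => ⟨ht.1, mem_univ _⟩)
    exact this.contMDiffAt.mdifferentiableAt (by simp)
  have hmem : ∀ t ∈ T, G t p ∈ (extChartAt (𝓡 (2 * n)) c).source := fun t ht => by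
    have := (hTB t ht z₀ hz₀B).1
    rwa [e₀] at this
  have hmf : ∀ t ∈ T, ∀ v : TangentSpace (𝓡 n) p,
      vecC c (G t p) (mfderiv (𝓡 n) (𝓡 (2 * n)) (G t) p v) = fderiv ℝ (H t) z₀ v := by
    intro t ht v
    have := vecC_mfderiv (hsl t ht) hps (hmem t ht) v
    rwa [vecC_self, hz₀] at this
  have hHp : ∀ t, H t z₀ = extChartAt (𝓡 (2 * n)) c (G t p) := fun t => by simp only [hH, e₀]
  have hconst : ∀ t ∈ T, ∀ v w : EuclideanSpace ℝ (Fin n),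
      rho (bC (K t).g c) (eC (K t).J c) (H t z₀) (fderiv ℝ (H t) z₀ v) (fderiv ℝ (H t) z₀ w) =
      rho (bC (K t₁).g c) (eC (K t₁).J c) (H t₁ z₀) (fderiv ℝ (H t₁) z₀ v)
        (fderiv ℝ (H t₁) z₀ w) := by
    intro t ht v w
    have hP := fun t ht => (hK.isKahlerFamily c).hasDerivWithinAt_pullback_rho hS
      (isOpen_chartDom c) hnd hTint isOpen_ball inter_subset_left hHs hHU hHd (t := t) ht hz₀B v w
    have := gronwall_interval hTint.ord (K := 1) (ε := 0) le_rfl le_rfl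
      (fun t ht => (hP t ht).sub_const (rho (bC (K t₁).g c) (eC (K t₁).J c) (H t₁ z₀)
        (fderiv ℝ (H t₁) z₀ v) (fderiv ℝ (H t₁) z₀ w)))
      (fun t _ => by rw [norm_zero]; positivity) ht₁T ht
    rw [sub_self, norm_zero, add_zero, zero_mul] at this
    exact sub_eq_zero.1 (norm_le_zero_iff.1 this)
  have hker := eventually_fderiv_eq_zero_iff hTint (isOpen_chartDom c) isOpen_ball hS
    inter_subset_left ((isTimeField_moserX hS hK hd).smooth c) hHs hHU hHd ht₁T hz₀B
  have hTn : 𝓝[T] t₁ = 𝓝[S] t₁ := nhdsWithin_inter_of_mem' (mem_nhdsWithin_of_mem_nhds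
    (ball_mem_nhds _ hδ))
  rw [hTn] at hker
  have hTm : T ∈ 𝓝[S] t₁ := by rw [← hTn]; exact self_mem_nhdsWithin
  have hz : ∀ t ∈ T, ∀ v : TangentSpace (𝓡 n) p,
      mfderiv (𝓡 n) (𝓡 (2 * n)) (G t) p v = 0 ↔ fderiv ℝ (H t) z₀ v = 0 := fun t ht v => by
    rw [← hmf t ht, ← map_zero (vecC c (G t p)), (vecC_bijective (hmem t ht)).1.eq_iff]
  filter_upwards [hker, hTm] with t hkt ht v w
  refine ⟨?_, (hz t₁ ht₁T v).trans ((hkt v).trans (hz t ht v).symm)⟩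
  rw [(K t₁).ricciForm_eq (hmem t₁ ht₁T), (K t).ricciForm_eq (hmem t ht), hmf t ht, hmf t ht,
    hmf t₁ ht₁T, hmf t₁ ht₁T, ← hHp, ← hHp]
  exact (hconst t ht v w).symm

variable [T2Space M] [SecondCountableTopology M] [CompactSpace L]

/-- Moser's theorem: an immersion that is Lagrangian for the Ricci form extends to a curve of
immersions that are Lagrangian for the Ricci forms of a curve of Kähler structures, as long as
these are non-degenerate. -/
theorem exists_hasLagrangianCurve (hS : IsInterval S) (h0 : (0 : ℝ) ∈ S) (hK : IsSmoothCurve S K)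
    (hd : ∀ t ∈ S, ∀ x v, (∀ w, (K t).ricciForm x v w = 0) → v = 0) {f : L → M}
    (hf : IsSmoothImmersion (n := n) f) (hfl : IsLagrangian (K 0).ricciForm f) :
    ∃ U : Set ℝ, IsOpen U ∧ U.OrdConnected ∧ (0 : ℝ) ∈ U ∧ (CompactSpace M → U = univ) ∧
      HasLagrangianCurve (S ∩ U) (fun t => (K t).ricciForm) f := by
  have : LocallyCompactSpace M := Manifold.locallyCompact_of_finiteDimensional (𝓡 (2 * n))
  -- On a compact M no cut-off is needed, and taking N to be all of M will impose no restriction on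
  -- time. Otherwise χ is one near the compact image of f and vanishes outside a compact set.
  have cut : ∃ (χ : M → ℝ) (C N : Set M), ContMDiff (𝓡 (2 * n)) 𝓘(ℝ, ℝ) ∞ χ ∧ IsCompact C ∧
      (∀ x ∉ C, χ x = 0) ∧ IsOpen N ∧ (∀ x ∈ N, χ x = 1) ∧ range f ⊆ N ∧
      (CompactSpace M → N = univ) := by
    by_cases hM : CompactSpace M
    · exact ⟨fun _ => 1, univ, univ, contMDiff_const, isCompact_univ, by simp, isOpen_univ, by simp,
        subset_univ _, fun _ => rfl⟩
    · obtain ⟨C, hC, hfC⟩ := exists_compact_superset (isCompact_range hf.1.continuous)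
      obtain ⟨χ, h1, h2, -⟩ := exists_contMDiffMap_one_nhds_of_subset_interior (𝓡 (2 * n)) (n := ⊤)
        (isCompact_range hf.1.continuous).isClosed hfC
      obtain ⟨N, hN, hfN, hχN⟩ := mem_nhdsSet_iff_exists.1 h1
      exact ⟨χ, C, N, χ.contMDiff, hC, h2, hN, fun x hx => hχN hx, hfN, fun h => absurd h hM⟩
  obtain ⟨χ, C, N, hχ, hC, hχC, hN, hχN, hfN, hNM⟩ := cut
  obtain ⟨F, hF0, hF, hFs⟩ := ((isTimeField_moserX hS hK hd).smul hχ).exists_flow hS h0 hC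
    (fun t _ c x hx hxC => by simp only [chartPt_ext hx, hχC x hxC, zero_smul])
  set G : ℝ → L → M := fun t q => F t (f q) with hGdef
  have hG : ContMDiffOn (𝓘(ℝ, ℝ).prod (𝓡 n)) (𝓡 (2 * n)) ∞ (fun p : ℝ × L => G p.1 p.2)
      (S ×ˢ univ) :=
    hF.comp (f := fun p : ℝ × L => (p.1, f p.2)) (contMDiffOn_fst.prodMk
      (hf.1.comp_contMDiffOn contMDiffOn_snd)) fun p hp => ⟨hp.1, mem_univ _⟩
  have hG0 : G 0 = f := funext fun q => hF0 (f q)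
  -- In the non-compact case the times are restricted so that the moved image of L remains in N;
  -- compactness of L makes the restriction uniform.
  have hU : ∃ U : Set ℝ, IsOpen U ∧ U.OrdConnected ∧ (0 : ℝ) ∈ U ∧ (CompactSpace M → U = univ) ∧
      ∀ t ∈ S ∩ U, ∀ q, G t q ∈ N := by
    by_cases hM : CompactSpace M
    · exact ⟨univ, isOpen_univ, ordConnected_univ, mem_univ _, fun _ => rfl, fun t _ q => by
        rw [hNM hM]; exact mem_univ _⟩
    · have h1 : ∀ᶠ t in 𝓝 (0 : ℝ), ∀ q ∈ (univ : Set L), t ∈ S → G t q ∈ N := by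
        refine isCompact_univ.eventually_forall_of_forall_eventually fun q _ => ?_
        have h2 := (hG.continuousOn (0, q) ⟨h0, mem_univ _⟩).eventually (hN.mem_nhds
          (show G 0 q ∈ N by rw [hG0]; exact hfN (mem_range_self q)))
        rw [eventually_nhdsWithin_iff] at h2
        filter_upwards [h2] with z hz hzS using hz ⟨hzS, mem_univ _⟩
      obtain ⟨δ, hδ, h⟩ := Metric.eventually_nhds_iff_ball.1 h1
      refine ⟨ball 0 δ, isOpen_ball, ?_, mem_ball_self hδ, fun h => absurd h hM,
        fun t ht q => h t ht.2 q (mem_univ _) ht.1⟩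
      rw [Real.ball_eq_Ioo]; exact ordConnected_Ioo
  obtain ⟨U, hUo, hUc, h0U, hUM, hUN⟩ := hU
  have hSU : (S ∩ U).OrdConnected := hS.ord.inter hUc
  refine ⟨U, hUo, hUc, h0U, hUM, G, hG0, hG.mono (prod_mono inter_subset_left le_rfl),
    fun t ht => ?_⟩
  have key : ∀ p, ∀ t₁ ∈ S ∩ U, ∀ᶠ t in 𝓝[S ∩ U] t₁, _ := fun p t₁ ht₁ =>
    (eventually_pullback_eq hS hK hd hN hχN hG (fun q => hFs (f q)) ht₁.1 (hUN t₁ ht₁ p)).filter_mono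
      (nhdsWithin_mono _ inter_subset_left)
  have h0' : (0 : ℝ) ∈ S ∩ U := ⟨h0, h0U⟩
  refine ⟨⟨?_, fun p => ?_⟩, fun p v w => ?_⟩
  · exact contMDiffOn_univ.1 (hG.comp (f := fun q : L => (t, q))
      (contMDiffOn_const.prodMk contMDiffOn_id) fun q _ => ⟨ht.1, mem_univ _⟩)
  · rw [injective_iff_map_eq_zero]
    intro v hv
    -- A kernel vector at time t is a kernel vector at time 0, where the derivative is injective.
    have := propagate hSU (P := fun t => mfderiv (𝓡 n) (𝓡 (2 * n)) (G t) p v = 0) ht h0'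
      (fun t₁ ht₁ => (key p t₁ ht₁).mono fun t h => (h v v).2) hv
    rw [hG0] at this
    exact (injective_iff_map_eq_zero _).1 (hf.2 p) v this
  · refine propagate hSU (P := fun t => (K t).ricciForm (G t p)
      (mfderiv (𝓡 n) (𝓡 (2 * n)) (G t) p v) (mfderiv (𝓡 n) (𝓡 (2 * n)) (G t) p w) = 0) h0' ht
      (fun t₁ ht₁ => (key p t₁ ht₁).mono fun t h => by rw [(h v w).1]) ?_
    rw [hG0]
    exact hfl p v w

end MoserManifold

open scoped Matrix

/-! ### Totally real maps in coordinates -/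

section ComplexTrace

variable {n : ℕ}

/-- The standard complex structure of `ℝ^n × ℝ^n`. -/
def J0 (n : ℕ) : (EuclideanSpace ℝ (Fin n) × EuclideanSpace ℝ (Fin n)) →L[ℝ]
    (EuclideanSpace ℝ (Fin n) × EuclideanSpace ℝ (Fin n)) :=
  (-ContinuousLinearMap.snd ℝ _ _).prod (ContinuousLinearMap.fst ℝ _ _)

@[simp] lemma J0_apply (q : EuclideanSpace ℝ (Fin n) × EuclideanSpace ℝ (Fin n)) :
    J0 n q = (-q.2, q.1) := rfl

/-- A map commuting with J₀ is complex linear; its real trace is twice the real part of its complex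
trace. -/
lemma trL_eq_sum_of_comm {B : (EuclideanSpace ℝ (Fin n) × EuclideanSpace ℝ (Fin n)) →L[ℝ]
    (EuclideanSpace ℝ (Fin n) × EuclideanSpace ℝ (Fin n))} (hB : B * J0 n = J0 n * B) :
    trL B = 2 * ∑ i, (B (stdVec n i, 0)).1 i := by
  have h1 : ∀ i, B (0, stdVec n i) = J0 n (B (stdVec n i, 0)) := fun i => by
    have := congrArg (fun T => T (stdVec n i, (0 : EuclideanSpace ℝ (Fin n)))) hB
    simpa [clm_mul_apply] using this
  rw [trL_apply, LinearMap.trace_eq_matrix_trace ℝ ((EuclideanSpace.basisFun (Fin n) ℝ).toBasis.prod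
    (EuclideanSpace.basisFun (Fin n) ℝ).toBasis), Matrix.trace, Fintype.sum_sum_type, two_mul]
  congr 1
  · refine Finset.sum_congr rfl fun i _ => ?_
    simp [Matrix.diag, LinearMap.toMatrix_apply, stdVec]
  · refine Finset.sum_congr rfl fun i _ => ?_
    have := congrArg (fun q => q.2 i) (h1 i)
    simpa [Matrix.diag, LinearMap.toMatrix_apply, stdVec] using this

end ComplexTrace

/-! ### Jacobi's formula for the derivative of a determinant -/

section Det

variable {n : ℕ}

/-- Differentiate the Leibniz expansion and group by the differentiated column; each group is a
determinant with one column replaced, which Cramer's rule expresses through the adjugate. -/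
lemma hasDerivAt_det {𝕜 : Type*} [RCLike 𝕜] {H : ℝ → Matrix (Fin n) (Fin n) 𝕜}
    {H' : Matrix (Fin n) (Fin n) 𝕜} {s : ℝ}
    (h : ∀ i j, HasDerivAt (fun s => H s i j) (H' i j) s) :
    HasDerivAt (fun s => (H s).det) ((H s).adjugate * H').trace s := by
  have h1 : HasDerivAt (fun s => (H s).det) (∑ σ : Equiv.Perm (Fin n), Equiv.Perm.sign σ •
      ∑ i, (∏ j ∈ Finset.univ.erase i, H s (σ j) j) • H' (σ i) i) s := by
    simp only [Matrix.det_apply]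
    refine HasDerivAt.fun_sum fun σ _ => ?_
    have := HasDerivAt.fun_finsetProd (u := Finset.univ) (f := fun i s => H s (σ i) i)
      (f' := fun i => H' (σ i) i) (x := s) fun i _ => h (σ i) i
    exact this.const_smul (Equiv.Perm.sign σ)
  refine h1.congr_deriv ?_
  rw [Matrix.trace]
  have h2 : ∀ i, ((H s).adjugate * H').diag i = ((H s).updateCol i fun k => H' k i).det := by
    intro i
    rw [← Matrix.cramer_apply, Matrix.cramer_eq_adjugate_mulVec]
    rfl
  simp only [h2, Matrix.det_apply]
  rw [Finset.sum_comm]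
  refine Finset.sum_congr rfl fun σ _ => ?_
  rw [Finset.smul_sum]
  refine Finset.sum_congr rfl fun i _ => ?_
  rw [← Finset.mul_prod_erase Finset.univ _ (Finset.mem_univ i), Matrix.updateCol_self, smul_eq_mul,
    mul_comm]
  congr 2
  refine Finset.prod_congr rfl fun j hj => ?_
  rw [Matrix.updateCol_ne (Finset.ne_of_mem_erase hj)]

/-- The derivative of a Gram matrix whose frame moves by c has the form cH + Hc*. Working with the
adjugate, no inverse of H is needed. -/
lemma trace_adjugate_mul (H c : Matrix (Fin n) (Fin n) ℂ) :
    (H.adjugate * (c * H + H * cᴴ)).trace = H.det * (2 * (c.trace.re : ℂ)) := by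
  rw [mul_add, Matrix.trace_add, ← mul_assoc, ← mul_assoc, Matrix.adjugate_mul, Matrix.smul_mul,
    one_mul, Matrix.trace_smul, Matrix.trace_mul_comm, ← mul_assoc, Matrix.mul_adjugate,
    Matrix.smul_mul, one_mul, Matrix.trace_smul, Matrix.trace_conjTranspose, ← smul_add,
    smul_eq_mul]
  congr 1
  exact_mod_cast Complex.add_conj c.trace

end Det

/-! ### The hermitian form h = g - iω and its covariant derivative -/

section Hermitian

variable {E : Type*} [NormedAddCommGroup E] [NormedSpace ℝ E] [FiniteDimensional ℝ E]

/-- The hermitian form `h = g - iω`. -/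
def herm (g : E → E →L[ℝ] E →L[ℝ] ℝ) (J : E → E →L[ℝ] E) (y v w : E) : ℂ :=
  (g y v w : ℂ) - Complex.I * (g y (J y v) w : ℂ)

/-- The hermitian Gram matrix of a family of vectors. -/
def gramH {n : ℕ} (g : E → E →L[ℝ] E →L[ℝ] ℝ) (J : E → E →L[ℝ] E) (y : E) (v : Fin n → E) :
    Matrix (Fin n) (Fin n) ℂ := Matrix.of fun i j => herm g J y (v i) (v j)

lemma herm_sum_left {n : ℕ} (g : E → E →L[ℝ] E →L[ℝ] ℝ) (J : E → E →L[ℝ] E) (y w : E)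
    (a : Fin n → ℝ) (v : Fin n → E) :
    herm g J y (∑ k, a k • v k) w = ∑ k, (a k : ℂ) * herm g J y (v k) w := by
  simp only [herm, map_sum, map_smul, sum_apply, smul_apply, smul_eq_mul]
  push_cast
  rw [Finset.mul_sum, ← Finset.sum_sub_distrib]
  exact Finset.sum_congr rfl fun k _ => by ring

lemma herm_sum_right {n : ℕ} (g : E → E →L[ℝ] E →L[ℝ] ℝ) (J : E → E →L[ℝ] E) (y w : E)
    (a : Fin n → ℝ) (v : Fin n → E) :
    herm g J y w (∑ k, a k • v k) = ∑ k, (a k : ℂ) * herm g J y w (v k) := by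
  simp only [herm, map_sum, map_smul, smul_eq_mul]
  push_cast
  rw [Finset.mul_sum, ← Finset.sum_sub_distrib]
  exact Finset.sum_congr rfl fun k _ => by ring

lemma herm_add_left (g : E → E →L[ℝ] E →L[ℝ] ℝ) (J : E → E →L[ℝ] E) (y u v w : E) :
    herm g J y (u + v) w = herm g J y u w + herm g J y v w := by
  simp only [herm, map_add, add_apply]; push_cast; ring

lemma herm_add_right (g : E → E →L[ℝ] E →L[ℝ] ℝ) (J : E → E →L[ℝ] E) (y u v w : E) :
    herm g J y u (v + w) = herm g J y u v + herm g J y u w := by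
  simp only [herm, map_add]; push_cast; ring

namespace IsKahlerOn

variable {g : E → E →L[ℝ] E →L[ℝ] ℝ} {J : E → E →L[ℝ] E} {U : Set E} (h : IsKahlerOn g J U) {y : E}
  (hy : y ∈ U)
include h hy

lemma herm_J_left (v w : E) : herm g J y (J y v) w = Complex.I * herm g J y v w := by
  simp only [herm, h.J_J hy]
  simp only [map_neg, neg_apply]
  push_cast
  linear_combination ((g y (J y v) w : ℂ)) * Complex.I_mul_I

lemma herm_J_right (v w : E) : herm g J y v (J y w) = -Complex.I * herm g J y v w := by
  have h1 : g y v (J y w) = -g y (J y v) w := by rw [h.g_J_skew hy]; ring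
  simp only [herm, h.g_J y hy, h1]
  push_cast
  linear_combination (-(g y (J y v) w : ℂ)) * Complex.I_mul_I

end IsKahlerOn

section

variable {g : E → E →L[ℝ] E →L[ℝ] ℝ} {J : E → E →L[ℝ] E} {U : Set E} (h : IsKahlerOn g J U)
include h

lemma IsKahlerOn.hasDerivAt_g {c v w : ℝ → E} {c' v' w' : E} {s : ℝ} (hs : c s ∈ U)
    (hc : HasDerivAt c c' s) (hv : HasDerivAt v v' s) (hw : HasDerivAt w w' s) :
    HasDerivAt (fun s => g (c s) (v s) (w s)) (g (c s) (v' + lc g (c s) c' (v s)) (w s)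
      + g (c s) (v s) (w' + lc g (c s) c' (w s))) s := by
  refine ((((h.hasFDerivAt hs).comp_hasDerivAt s hc).clm_apply hv).clm_apply hw).congr_deriv ?_
  rw [add_apply, h.parallel hs]
  simp only [map_add, add_apply, Function.comp_apply]
  ring

/-- The product rule with covariant derivatives along the curve c. It applies to g by compatibility,
and to ω because J commutes with covariant differentiation. -/
lemma IsKahlerOn.hasDerivAt_herm {c v w : ℝ → E} {c' v' w' : E} {s : ℝ} (hs : c s ∈ U)
    (hc : HasDerivAt c c' s) (hv : HasDerivAt v v' s) (hw : HasDerivAt w w' s) :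
    HasDerivAt (fun s => herm g J (c s) (v s) (w s)) (herm g J (c s) (v' + lc g (c s) c' (v s)) (w s)
      + herm g J (c s) (v s) (w' + lc g (c s) c' (w s))) s := by
  have h1 := h.hasDerivAt_g hs hc hv hw
  have h2 : HasDerivAt (fun s => J (c s) (v s)) (fderiv ℝ J (c s) c' (v s) + J (c s) v') s :=
    ((h.hasFDerivAt_J hs).comp_hasDerivAt s hc).clm_apply hv
  have h3 := h.hasDerivAt_g hs hc h2 hw
  refine (h1.ofReal_comp.sub (h3.ofReal_comp.const_mul Complex.I)).congr_deriv ?_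
  have e : (fderiv ℝ J (c s) c') (v s) + J (c s) v' + lc g (c s) c' (J (c s) (v s)) =
      J (c s) (v' + lc g (c s) c' (v s)) := by
    rw [h.parallel_J hs]
    simp only [sub_apply, clm_mul_apply, map_add]
    abel
  rw [e]
  simp only [herm]
  push_cast
  ring

end

end Hermitian

/-! ### The complex frame of a totally real map, its connection form and the Maslov form -/

section Frame

variable {n : ℕ} {E : Type*} [NormedAddCommGroup E] [NormedSpace ℝ E] [FiniteDimensional ℝ E]

/-- The frame `∂_iφ, J∂_iφ` along a map `φ`. -/
def cframe (J : E → E →L[ℝ] E) (φ : EuclideanSpace ℝ (Fin n) → E) (z : EuclideanSpace ℝ (Fin n)) :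
    (EuclideanSpace ℝ (Fin n) × EuclideanSpace ℝ (Fin n)) →L[ℝ] E :=
  (fderiv ℝ φ z).coprod ((J (φ z)).comp (fderiv ℝ φ z))

/-- The covariant derivative of the frame along `φ`. -/
def covFrame (g : E → E →L[ℝ] E →L[ℝ] ℝ) (J : E → E →L[ℝ] E) (φ : EuclideanSpace ℝ (Fin n) → E)
    (z : EuclideanSpace ℝ (Fin n)) : EuclideanSpace ℝ (Fin n) →L[ℝ]
      (EuclideanSpace ℝ (Fin n) × EuclideanSpace ℝ (Fin n)) →L[ℝ] E :=
  fderiv ℝ (cframe J φ) z + ((ContinuousLinearMap.compL ℝ _ E E).flip (cframe J φ z)).comp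
    ((lc g (φ z)).comp (fderiv ℝ φ z))

/-- The connection form in the frame along `φ`. -/
def conn (g : E → E →L[ℝ] E →L[ℝ] ℝ) (J : E → E →L[ℝ] E) (φ : EuclideanSpace ℝ (Fin n) → E)
    (z : EuclideanSpace ℝ (Fin n)) : EuclideanSpace ℝ (Fin n) →L[ℝ]
      (EuclideanSpace ℝ (Fin n) × EuclideanSpace ℝ (Fin n)) →L[ℝ]
      (EuclideanSpace ℝ (Fin n) × EuclideanSpace ℝ (Fin n)) :=
  (ContinuousLinearMap.compL ℝ _ E _ (cframe J φ z).inverse).comp (covFrame g J φ z)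

/-- Twice the imaginary part of the complex trace of the connection form, up to sign: the
Maslov form of `φ`. -/
def theta (g : E → E →L[ℝ] E →L[ℝ] ℝ) (J : E → E →L[ℝ] E) (φ : EuclideanSpace ℝ (Fin n) → E)
    (z u : EuclideanSpace ℝ (Fin n)) : ℝ := trL (J0 n * conn g J φ z u)

/-- `φ` is a totally real map in coordinates. -/
structure IsTotRealOn (g : E → E →L[ℝ] E →L[ℝ] ℝ) (J : E → E →L[ℝ] E) (U : Set E)
    (φ : EuclideanSpace ℝ (Fin n) → E) (V : Set (EuclideanSpace ℝ (Fin n))) : Prop where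
  kahler : IsKahlerOn g J U
  isOpen : IsOpen V
  smooth : ContDiffOn ℝ ∞ φ V
  mapsTo : MapsTo φ V U
  invertible : ∀ z ∈ V, (cframe J φ z).IsInvertible

namespace IsTotRealOn

variable {g : E → E →L[ℝ] E →L[ℝ] ℝ} {J : E → E →L[ℝ] E} {U : Set E}
  {φ : EuclideanSpace ℝ (Fin n) → E} {V : Set (EuclideanSpace ℝ (Fin n))}
  (h : IsTotRealOn g J U φ V) {z : EuclideanSpace ℝ (Fin n)} (hz : z ∈ V)
include h hz

lemma contDiffAt : ContDiffAt ℝ ∞ φ z := h.smooth.contDiffAt (h.isOpen.mem_nhds hz)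

lemma contDiffAt_fderiv : ContDiffAt ℝ ∞ (fderiv ℝ φ) z :=
  (h.contDiffAt hz).fderiv_right (m := ∞) le_rfl

lemma contDiffAt_cframe : ContDiffAt ℝ ∞ (cframe J φ) z := by
  have h1 : ContDiffAt ℝ ∞ (fun z => J (φ z)) z :=
    (h.kahler.contDiffAt_J (h.mapsTo hz)).comp z (h.contDiffAt hz)
  have h2 := h.contDiffAt_fderiv hz
  have e : cframe J φ = fun z => (fderiv ℝ φ z).comp (ContinuousLinearMap.fst ℝ _ _) +
      ((J (φ z)).comp (fderiv ℝ φ z)).comp (ContinuousLinearMap.snd ℝ _ _) := by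
    funext z
    ext q <;> simp [cframe]
  rw [e]
  exact (h2.clm_comp contDiffAt_const).add ((h1.clm_comp h2).clm_comp contDiffAt_const)

lemma contDiffAt_covFrame : ContDiffAt ℝ ∞ (covFrame g J φ) z := by
  have h1 := h.contDiffAt_cframe hz
  have h2 := h.contDiffAt_fderiv hz
  have h3 : ContDiffAt ℝ ∞ (fun z => lc g (φ z)) z :=
    (h.kahler.contDiffAt_lc (h.mapsTo hz)).comp z (h.contDiffAt hz)
  refine (h1.fderiv_right (m := ∞) le_rfl).add ?_
  exact ((ContinuousLinearMap.contDiff _).contDiffAt.comp z h1).clm_comp (h3.clm_comp h2)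

lemma contDiffAt_conn : ContDiffAt ℝ ∞ (conn g J φ) z := by
  have h1 : ContDiffAt ℝ ∞ (fun z => (cframe J φ z).inverse) z :=
    (h.invertible z hz).contDiffAt_map_inverse.comp z (h.contDiffAt_cframe hz)
  exact ((ContinuousLinearMap.contDiff _).contDiffAt.comp z h1).clm_comp (h.contDiffAt_covFrame hz)

omit h hz in
lemma cframe_apply (q : EuclideanSpace ℝ (Fin n) × EuclideanSpace ℝ (Fin n)) :
    cframe J φ z q = fderiv ℝ φ z q.1 + J (φ z) (fderiv ℝ φ z q.2) := by
  simp [cframe]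

omit h hz in
lemma covFrame_apply (u : EuclideanSpace ℝ (Fin n))
    (q : EuclideanSpace ℝ (Fin n) × EuclideanSpace ℝ (Fin n)) : covFrame g J φ z u q =
      fderiv ℝ (cframe J φ) z u q + lc g (φ z) (fderiv ℝ φ z u) (cframe J φ z q) := by
  simp [covFrame]

lemma cframe_conn (u : EuclideanSpace ℝ (Fin n))
    (q : EuclideanSpace ℝ (Fin n) × EuclideanSpace ℝ (Fin n)) :
    cframe J φ z (conn g J φ z u q) = covFrame g J φ z u q :=
  (h.invertible z hz).self_apply_inverse _

lemma cframe_J0 (q : EuclideanSpace ℝ (Fin n) × EuclideanSpace ℝ (Fin n)) :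
    cframe J φ z (J0 n q) = J (φ z) (cframe J φ z q) := by
  rw [cframe_apply, cframe_apply, map_add, h.kahler.J_J (h.mapsTo hz)]
  simp [add_comm]

lemma fderiv_cframe_J0 (u : EuclideanSpace ℝ (Fin n))
    (q : EuclideanSpace ℝ (Fin n) × EuclideanSpace ℝ (Fin n)) :
    fderiv ℝ (cframe J φ) z u (J0 n q) = fderiv ℝ J (φ z) (fderiv ℝ φ z u) (cframe J φ z q)
      + J (φ z) (fderiv ℝ (cframe J φ) z u q) := by
  have h1 := ((h.contDiffAt_cframe hz).differentiableAt (by simp)).hasFDerivAt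
  have h2 := ((h.contDiffAt hz).differentiableAt (by simp)).hasFDerivAt
  have h3 : HasFDerivAt (fun z => J (φ z)) _ z :=
    (h.kahler.hasFDerivAt_J (h.mapsTo hz)).comp z h2
  have h4 := h3.clm_apply (h1.clm_apply (hasFDerivAt_const q z))
  have h5 := (h1.clm_apply (hasFDerivAt_const (J0 n q) z)).congr_of_eventuallyEq
    (f₁ := fun z => J (φ z) (cframe J φ z q)) (by
      filter_upwards [h.isOpen.mem_nhds hz] with z hz using (h.cframe_J0 hz q).symm)
  have := congrArg (fun T => T u) (h5.unique h4)
  simpa [add_comm] using this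

/-- The frame intertwines J₀ with J, and J is parallel. -/
lemma conn_comm (u : EuclideanSpace ℝ (Fin n)) :
    conn g J φ z u * J0 n = J0 n * conn g J φ z u := by
  refine ContinuousLinearMap.ext fun q => ?_
  apply (h.invertible z hz).injective
  rw [clm_mul_apply, clm_mul_apply, h.cframe_conn hz, h.cframe_J0 hz, h.cframe_conn hz,
    covFrame_apply, covFrame_apply, h.fderiv_cframe_J0 hz, h.cframe_J0 hz,
    h.kahler.parallel_J (h.mapsTo hz)]
  simp only [sub_apply, clm_mul_apply, map_add]
  abel

/-- The frame trivializes φ*TM and intertwines the two connections, so their curvatures are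
conjugate and traces against the complex structure agree. -/
lemma rho_eq_curv (u v : EuclideanSpace ℝ (Fin n)) :
    rho g J (φ z) (fderiv ℝ φ z u) (fderiv ℝ φ z v) =
      (1 / 2) * trL (J0 n * curv (conn g J φ) z u v) := by
  rw [rho_apply, ← trL_conj (h.invertible z hz) (A := J0 n * curv (conn g J φ) z u v)]
  intro q
  rw [clm_mul_apply, clm_mul_apply, h.cframe_J0 hz]
  congr 1
  refine (curv_frame (h.kahler.differentiableAt_lc (h.mapsTo hz))
    ((h.contDiffAt_conn hz).differentiableAt (by simp)) ((h.contDiffAt hz).of_le two_le_infty)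
    ((h.contDiffAt_cframe hz).of_le two_le_infty) ?_ u v q).symm
  filter_upwards [h.isOpen.mem_nhds hz] with z hz u
  refine ContinuousLinearMap.ext fun q => ?_
  rw [ContinuousLinearMap.comp_apply, h.cframe_conn hz, covFrame_apply]
  rfl

/-- The Ricci form pulls back to half the exterior derivative of the Maslov form. -/
lemma rho_eq_zero (hθ : ∀ z ∈ V, ∀ u, theta g J φ z u = 0) (u v : EuclideanSpace ℝ (Fin n)) :
    rho g J (φ z) (fderiv ℝ φ z u) (fderiv ℝ φ z v) = 0 := by
  rw [h.rho_eq_curv hz]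
  have h1 := ((h.contDiffAt_conn hz).differentiableAt (by simp)).hasFDerivAt
  -- The Maslov form vanishes on the open set V, hence so does its derivative.
  have key : ∀ u v, trL (J0 n * fderiv ℝ (conn g J φ) z u v) = 0 := by
    intro u v
    let ℓ : ((EuclideanSpace ℝ (Fin n) × EuclideanSpace ℝ (Fin n)) →L[ℝ]
        (EuclideanSpace ℝ (Fin n) × EuclideanSpace ℝ (Fin n))) →L[ℝ] ℝ :=
      (trL (E := EuclideanSpace ℝ (Fin n) × EuclideanSpace ℝ (Fin n))).comp
        (ContinuousLinearMap.mul ℝ ((EuclideanSpace ℝ (Fin n) × EuclideanSpace ℝ (Fin n))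
        →L[ℝ] (EuclideanSpace ℝ (Fin n) × EuclideanSpace ℝ (Fin n))) (J0 n))
    have h0 : HasFDerivAt (fun z => conn g J φ z v) _ z := h1.clm_apply (hasFDerivAt_const v z)
    have h2 := ℓ.hasFDerivAt.comp z h0
    have h3 := (hasFDerivAt_const (𝕜 := ℝ) (0 : ℝ) z).congr_of_eventuallyEq
      (f₁ := ℓ ∘ fun z => conn g J φ z v) (by
        filter_upwards [h.isOpen.mem_nhds hz] with z hz using hθ z hz v)
    have := congrArg (fun T => T u) (h2.unique h3)
    simpa [ℓ] using this
  -- The quadratic part of the curvature contributes nothing: the connection form commutes with J₀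
  -- and the trace is cyclic.
  have hc : trL (J0 n * (conn g J φ z u * conn g J φ z v)) =
      trL (J0 n * (conn g J φ z v * conn g J φ z u)) := by
    rw [← mul_assoc, ← h.conn_comm hz, mul_assoc, trL_mul_comm, mul_assoc]
  rw [curv, mul_sub, mul_add, mul_sub, map_sub, map_add, map_sub, key, key, hc]
  simp

end IsTotRealOn

/-- The first variation of the determinant of the hermitian Gram matrix of a totally real map. -/
lemma hasDerivAt_det_gramH {g : E → E →L[ℝ] E →L[ℝ] ℝ} {J : E → E →L[ℝ] E} {U : Set E}
    {V : Set (EuclideanSpace ℝ (Fin n))} {Φ : ℝ → EuclideanSpace ℝ (Fin n) → E}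
    (h : IsTotRealOn g J U (Φ 0) V) {S : Set ℝ} (hS : IsInterval S) (h0 : S ∈ 𝓝 0)
    (hΦ : ContDiffOn ℝ ∞ (fun p : ℝ × EuclideanSpace ℝ (Fin n) => Φ p.1 p.2) (S ×ˢ V))
    {W : EuclideanSpace ℝ (Fin n) → EuclideanSpace ℝ (Fin n)} (hW : ContDiffOn ℝ ∞ W V)
    (hΦ' : ∀ z ∈ V, HasDerivWithinAt (fun s => Φ s z) (J (Φ 0 z) (fderiv ℝ (Φ 0) z (W z))) S 0)
    {z : EuclideanSpace ℝ (Fin n)} (hz : z ∈ V) :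
    HasDerivAt (fun s => (gramH g J (Φ s z) (fun i => fderiv ℝ (Φ s) z (stdVec n i))).det.re)
      (theta g J (Φ 0) z (W z) *
        (gramH g J (Φ 0 z) (fun i => fderiv ℝ (Φ 0) z (stdVec n i))).det.re) 0 := by
  have h0S : (0 : ℝ) ∈ S := mem_of_mem_nhds h0
  set φ := Φ 0 with hφ
  have hy := h.mapsTo hz
  have hD2 := hasFDerivAt_fderiv ((h.contDiffAt hz).of_le two_le_infty)
  have hφ1 := ((h.contDiffAt hz).differentiableAt (by simp)).hasFDerivAt
  have hW1 : HasFDerivAt W (fderiv ℝ W z) z :=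
    ((hW.contDiffAt (h.isOpen.mem_nhds hz)).differentiableAt (by simp)).hasFDerivAt
  have hJφ : HasFDerivAt (fun z => J (φ z)) _ z := (h.kahler.hasFDerivAt_J hy).comp z hφ1
  have hY := hJφ.clm_apply (hD2.clm_apply hW1)
  -- The frame coordinates of the covariant derivative, in the direction e, of the variation field
  -- Jφ_*W. As the connection is torsion free, ∇_e(φ_*W) = ∇_W(φ_*e) + φ_*(dW(e)), where φ_*e is
  -- differentiated with e constant; applying J gives the two summands.
  set C : EuclideanSpace ℝ (Fin n) → EuclideanSpace ℝ (Fin n) × EuclideanSpace ℝ (Fin n) :=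
    fun e => J0 n (conn g J φ z (W z) (e, 0)) + (0, fderiv ℝ W z e) with hC
  set v : Fin n → E := fun i => fderiv ℝ φ z (stdVec n i) with hv
  have hcf : ∀ u e, fderiv ℝ (cframe J φ) z u (e, 0) = fderiv ℝ (fderiv ℝ φ) z u e := by
    intro u e
    have h1 := ((h.contDiffAt_cframe hz).differentiableAt (by simp)).hasFDerivAt.clm_apply
      (hasFDerivAt_const ((e, 0) : EuclideanSpace ℝ (Fin n) × EuclideanSpace ℝ (Fin n)) z)
    have h2 := (hD2.clm_apply (hasFDerivAt_const e z)).congr_of_eventuallyEq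
      (f₁ := fun z => cframe J φ z (e, 0)) (Eventually.of_forall fun z => by
        simp [cframe])
    have := congrArg (fun T => T u) (h1.unique h2)
    simpa using this
  have hnab : ∀ e, fderiv ℝ (tD S Φ 0) z e + lc g (φ z) (J (φ z) (fderiv ℝ φ z (W z)))
      (fderiv ℝ φ z e) = cframe J φ z (C e) := by
    intro e
    have h1 : tD S Φ 0 =ᶠ[𝓝 z] fun z => J (φ z) (fderiv ℝ φ z (W z)) := by
      filter_upwards [h.isOpen.mem_nhds hz] with z hz
      exact (hΦ' z hz).derivWithin (hS.uniqueDiffOn 0 h0S)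
    rw [h1.fderiv_eq, hY.fderiv, hC]
    simp only [map_add]
    rw [h.cframe_J0 hz, h.cframe_conn hz, IsTotRealOn.covFrame_apply, hcf,
      IsTotRealOn.cframe_apply, IsTotRealOn.cframe_apply, h.kahler.lc_symm hy (J (φ z) _)]
    simp only [add_apply, ContinuousLinearMap.comp_apply, ContinuousLinearMap.flip_apply, map_zero,
      add_zero, zero_add, map_add, h.kahler.parallel_J hy, sub_apply, clm_mul_apply]
    rw [fderiv_fderiv_comm ((h.contDiffAt hz).of_le two_le_infty) (W z) e,
      h.kahler.lc_symm hy (fderiv ℝ φ z (W z))]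
    abel
  have hc : HasDerivAt (fun s => Φ s z) (J (φ z) (fderiv ℝ φ z (W z))) 0 :=
    (hΦ' z hz).hasDerivAt h0
  have hvi : ∀ i, HasDerivAt (fun s => fderiv ℝ (Φ s) z (stdVec n i))
      (fderiv ℝ (tD S Φ 0) z (stdVec n i)) 0 := by
    intro i
    have := ((hasDerivWithinAt_fderiv_family hS h.isOpen hΦ h0S hz).hasDerivAt h0).clm_apply
      (hasDerivAt_const (0 : ℝ) (stdVec n i))
    simpa using this
  -- The real coordinates in the frame ∂_iφ, J∂_iφ combined into complex coefficients; the Gram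
  -- matrix then has derivative cm · H + H · cmᴴ.
  set cm : Matrix (Fin n) (Fin n) ℂ := Matrix.of fun i k =>
    ((C (stdVec n i)).1 k : ℂ) + Complex.I * ((C (stdVec n i)).2 k : ℂ) with hcm
  set H := gramH g J (φ z) v with hH
  have hsum : ∀ e, cframe J φ z (C e) =
      ∑ k, (C e).1 k • v k + J (φ z) (∑ k, (C e).2 k • v k) := by
    intro e
    rw [IsTotRealOn.cframe_apply]
    conv_lhs => rw [sum_stdVec (C e).1, sum_stdVec (C e).2]
    simp only [map_sum, map_smul, hv]
  have hleft : ∀ e w, herm g J (φ z) (cframe J φ z (C e)) w =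
      ∑ k, (((C e).1 k : ℂ) + Complex.I * ((C e).2 k : ℂ)) * herm g J (φ z) (v k) w := by
    intro e w
    rw [hsum, herm_add_left, h.kahler.herm_J_left hy, herm_sum_left, herm_sum_left, Finset.mul_sum,
      ← Finset.sum_add_distrib]
    exact Finset.sum_congr rfl fun k _ => by ring
  have hright : ∀ e w, herm g J (φ z) w (cframe J φ z (C e)) =
      ∑ k, herm g J (φ z) w (v k) * (((C e).1 k : ℂ) - Complex.I * ((C e).2 k : ℂ)) := by
    intro e w
    rw [hsum, herm_add_right, h.kahler.herm_J_right hy, herm_sum_right, herm_sum_right,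
      Finset.mul_sum, ← Finset.sum_add_distrib]
    exact Finset.sum_congr rfl fun k _ => by ring
  have hent : ∀ i j, HasDerivAt (fun s => gramH g J (Φ s z) (fun i => fderiv ℝ (Φ s) z (stdVec n i))
      i j) ((cm * H + H * cmᴴ) i j) 0 := by
    intro i j
    refine (h.kahler.hasDerivAt_herm (show Φ 0 z ∈ U from hy) hc (hvi i) (hvi j)).congr_deriv ?_
    rw [← hφ, hnab, hnab, hleft, hright]
    rw [Matrix.add_apply, Matrix.mul_apply, Matrix.mul_apply]
    refine congrArg₂ _ rfl (Finset.sum_congr rfl fun k _ => ?_)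
    simp [hcm, hH, gramH, Matrix.conjTranspose_apply, sub_eq_add_neg]
    left; rfl
  have hdet := hasDerivAt_det hent
  have hre := Complex.reCLM.hasFDerivAt.comp_hasDerivAt (0 : ℝ) hdet
  refine hre.congr_deriv ?_
  -- The derivative of W occurs only in the second, imaginary component, so it does not affect the
  -- real part of the trace and θ depends on W pointwise.
  have htr : theta g J φ z (W z) = 2 * cm.trace.re := by
    rw [theta, trL_eq_sum_of_comm (by rw [mul_assoc, h.conn_comm hz]), Matrix.trace, Complex.re_sum]
    congr 1
    refine Finset.sum_congr rfl fun i _ => ?_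
    simp [hcm, hC, clm_mul_apply]
  rw [trace_adjugate_mul, htr, Complex.reCLM_apply, ← hφ, ← hv]
  rw [show (2 * (cm.trace.re : ℂ)) = ((2 * cm.trace.re : ℝ) : ℂ) by push_cast; rfl,
    Complex.re_mul_ofReal, mul_comm]

end Frame

/-! ### The derivative of the `J`-volume -/

section Integral

open MeasureTheory

variable {m : ℕ} {V C : Set (EuclideanSpace ℝ (Fin m))} {w : EuclideanSpace ℝ (Fin m) → ℝ}

lemma setIntegral_eq_of_compact (hV : IsOpen V) (hCV : C ⊆ V) (hw0 : ∀ y ∈ V, y ∉ C → w y = 0) :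
    ∫ y in V, w y = ∫ y in C, w y :=
  setIntegral_eq_of_subset_of_forall_sdiff_eq_zero hV.measurableSet hCV fun y hy => hw0 y hy.1 hy.2

lemma integrableOn_of_compact (hV : IsOpen V) (hC : IsCompact C) (hCV : C ⊆ V)
    (hw : ContinuousOn w V) (hw0 : ∀ y ∈ V, y ∉ C → w y = 0) : IntegrableOn w V :=
  ((hw.mono hCV).integrableOn_compact hC).of_forall_sdiff_eq_zero hV.measurableSet
    fun y hy => hw0 y hy.1 hy.2

lemma setIntegral_pos (hV : IsOpen V) (hC : IsCompact C) (hCV : C ⊆ V)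
    (hw : ContinuousOn w V) (hw0 : ∀ y ∈ V, y ∉ C → w y = 0) (hnn : ∀ y ∈ V, 0 ≤ w y)
    {y : EuclideanSpace ℝ (Fin m)} (hy : y ∈ V) (hpos : 0 < w y) : 0 < ∫ y in V, w y := by
  rw [setIntegral_pos_iff_support_of_nonneg_ae
    (ae_restrict_of_forall_mem hV.measurableSet fun y hy => hnn y hy)
    (integrableOn_of_compact hV hC hCV hw hw0)]
  have ho := hw.isOpen_inter_preimage hV (isOpen_Ioi (a := (0 : ℝ)))
  exact (ho.measure_pos volume ⟨y, hy, hpos⟩).trans_le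
    (measure_mono fun z hz => ⟨ne_of_gt hz.2, hz.1⟩)

/-- Differentiation under the integral sign. The weight confines the integral to the compact set C,
on which D remains positive for small s, so the derivative of the integrand is uniformly bounded
there. -/
lemma hasDerivAt_integral_sqrt (hV : IsOpen V) (hC : IsCompact C) (hCV : C ⊆ V)
    (hw : ContinuousOn w V) (hw0 : ∀ y ∈ V, y ∉ C → w y = 0)
    {D : ℝ → EuclideanSpace ℝ (Fin m) → ℝ}
    (hD : ContDiffOn ℝ ∞ (fun p : ℝ × EuclideanSpace ℝ (Fin m) => D p.1 p.2) (univ ×ˢ V))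
    (hpos : ∀ y ∈ V, 0 < D 0 y) {d : EuclideanSpace ℝ (Fin m) → ℝ}
    (hd : ∀ y ∈ V, HasDerivAt (fun s => D s y) (d y) 0) :
    ContinuousOn d V ∧ HasDerivAt (fun s => ∫ y in V, w y * √(D s y))
      (∫ y in V, w y * (d y / (2 * √(D 0 y)))) 0 := by
  have hO : IsOpen ((univ : Set ℝ) ×ˢ V) := isOpen_univ.prod hV
  obtain ⟨D', hD'⟩ : ∃ D' : ℝ × EuclideanSpace ℝ (Fin m) → ℝ, D' = fun p =>
    fderiv ℝ (fun p : ℝ × EuclideanSpace ℝ (Fin m) => D p.1 p.2) p (1, 0) := ⟨_, rfl⟩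
  have hD'c : ContinuousOn D' (univ ×ˢ V) := by
    rw [hD']
    exact (hD.continuousOn_fderiv_of_isOpen hO (by simp)).clm_apply continuousOn_const
  have hDd : ∀ s, ∀ y ∈ V, HasDerivAt (fun s => D s y) (D' (s, y)) s := by
    intro s y hy
    have h1 := ((hD.contDiffAt (hO.mem_nhds (show (s, y) ∈ univ ×ˢ V from ⟨mem_univ s, hy⟩))).differentiableAt
      (by simp)).hasFDerivAt
    have h2 : HasDerivAt (fun s : ℝ => (s, y)) ((1 : ℝ), (0 : EuclideanSpace ℝ (Fin m))) s :=
      (hasDerivAt_id s).prodMk (hasDerivAt_const s y)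
    rw [hD']
    exact h1.comp_hasDerivAt s h2
  have hdD : ∀ y ∈ V, d y = D' (0, y) := fun y hy => (hd y hy).unique (hDd 0 y hy)
  have hdc : ContinuousOn d V := by
    refine ContinuousOn.congr (f := fun y => D' (0, y)) ?_ hdD
    exact hD'c.comp (by fun_prop) fun y hy => ⟨mem_univ _, hy⟩
  refine ⟨hdc, ?_⟩
  have hP := hD.continuousOn.isOpen_inter_preimage hO (isOpen_Ioi (a := (0 : ℝ)))
  -- Positivity of D on {0} × C spreads to a product neighbourhood.
  obtain ⟨u, v, hu, -, h0u, hCv, huv⟩ := generalized_tube_lemma (isCompact_singleton (x := (0 : ℝ)))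
    hC hP (fun p hp => ⟨⟨mem_univ _, hCV hp.2⟩, by
      rw [mem_preimage, mem_Ioi, show p.1 = 0 from hp.1]; exact hpos _ (hCV hp.2)⟩)
  obtain ⟨δ, hδ, hδu⟩ := Metric.nhds_basis_closedBall.mem_iff.1 (hu.mem_nhds (h0u rfl))
  have hDpos : ∀ s ∈ closedBall (0 : ℝ) δ, ∀ y ∈ C, 0 < D s y := fun s hs y hy =>
    (huv (⟨hδu hs, hCv hy⟩ : (s, y) ∈ u ×ˢ v)).2
  have hqc : ContinuousOn (fun p : ℝ × EuclideanSpace ℝ (Fin m) =>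
      w p.2 * (D' p / (2 * √(D p.1 p.2)))) (closedBall (0 : ℝ) δ ×ˢ C) := by
    refine ((hw.mono hCV).comp continuousOn_snd fun p hp => hp.2).mul ?_
    have hsub : closedBall (0 : ℝ) δ ×ˢ C ⊆ univ ×ˢ V := fun p hp => ⟨mem_univ _, hCV hp.2⟩
    refine (hD'c.mono hsub).div (continuousOn_const.mul (hD.continuousOn.mono hsub).sqrt) ?_
    intro p hp
    exact (mul_pos two_pos (Real.sqrt_pos.2 (hDpos _ hp.1 _ hp.2))).ne'
  obtain ⟨B, hB⟩ := ((isCompact_closedBall (0 : ℝ) δ).prod hC).exists_bound_of_continuousOn hqc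
  have hDc : ∀ s, ContinuousOn (fun y => w y * √(D s y)) C := fun s =>
    (hw.mono hCV).mul ((hD.continuousOn.comp (f := fun y => (s, y)) (by fun_prop)
      fun y hy => ⟨mem_univ s, hCV hy⟩).sqrt)
  have main := (hasDerivAt_integral_of_dominated_loc_of_deriv_le (μ := volume.restrict C)
    (F := fun s y => w y * √(D s y)) (F' := fun s y => w y * (D' (s, y) / (2 * √(D s y))))
    (bound := fun _ => B) (ball_mem_nhds (0 : ℝ) hδ)
    (Eventually.of_forall fun s => (hDc s).aestronglyMeasurable hC.measurableSet)
    ((hDc 0).integrableOn_compact hC)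
    ((hqc.comp (f := fun y => ((0 : ℝ), y)) (by fun_prop) fun y hy =>
      ⟨mem_closedBall_self hδ.le, hy⟩).aestronglyMeasurable hC.measurableSet)
    (ae_restrict_of_forall_mem hC.measurableSet fun y hy s hs =>
      hB (s, y) ⟨ball_subset_closedBall hs, hy⟩)
    (continuousOn_const.integrableOn_compact hC)
    (ae_restrict_of_forall_mem hC.measurableSet fun y hy s hs =>
      ((hDd s y (hCV hy)).sqrt (hDpos s (ball_subset_closedBall hs) y hy).ne').const_mul
        (w y))).2
  have e1 : ∀ s, ∫ y in V, w y * √(D s y) = ∫ y in C, w y * √(D s y) := fun s =>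
    setIntegral_eq_of_compact hV hCV fun y hy hyC => by rw [hw0 y hy hyC, zero_mul]
  have e2 : ∫ y in V, w y * (d y / (2 * √(D 0 y))) = ∫ y in C, w y * (D' (0, y) / (2 * √(D 0 y))) := by
    rw [setIntegral_eq_of_compact hV hCV fun y hy hyC => by rw [hw0 y hy hyC, zero_mul]]
    exact setIntegral_congr_fun hC.measurableSet fun y hy => by simp only [hdD y (hCV hy)]
  simp only [e1, e2]
  exact main

end Integral

/-! ### Change of frame and positivity of the hermitian Gram determinant -/

section GramMatrix

open scoped ComplexOrder

variable {E : Type*} [NormedAddCommGroup E] [NormedSpace ℝ E] [FiniteDimensional ℝ E] {n : ℕ}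

/-- The Gram matrix becomes P H Pᵀ with P real, so the factor (det P)² passes through the real part.
-/
lemma det_gramH_sum (g : E → E →L[ℝ] E →L[ℝ] ℝ) (J : E → E →L[ℝ] E) (y : E) (v : Fin n → E)
    (P : Matrix (Fin n) (Fin n) ℝ) :
    (gramH g J y fun i => ∑ k, P i k • v k).det.re = P.det ^ 2 * (gramH g J y v).det.re := by
  have h1 : gramH g J y (fun i => ∑ k, P i k • v k) =
      P.map Complex.ofRealHom * gramH g J y v * (P.map Complex.ofRealHom)ᵀ := by
    ext i j
    simp only [gramH, Matrix.of_apply, Matrix.mul_apply, Matrix.map_apply, Matrix.transpose_apply]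
    rw [herm_sum_right]
    refine Finset.sum_congr rfl fun k _ => ?_
    rw [herm_sum_left, mul_comm]
    rfl
  rw [h1, Matrix.det_mul, Matrix.det_mul, Matrix.det_transpose, ← RingHom.mapMatrix_apply,
    ← RingHom.map_det, Complex.ofRealHom_eq_coe, mul_right_comm, ← Complex.ofReal_mul,
    Complex.re_ofReal_mul, sq]

/-- For a complex vector x one has x*Hx = h(X, X) = g(X, X), where X is the combination of the
vectors with coefficients conj(x_k), J acting as i. Independence over ℂ makes X non-zero, so H is
positive definite. -/
lemma IsKahlerOn.det_gramH_pos {g : E → E →L[ℝ] E →L[ℝ] ℝ} {J : E → E →L[ℝ] E} {U : Set E}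
    (h : IsKahlerOn g J U) {y : E} (hy : y ∈ U) {v : Fin n → E}
    (hv : ∀ a b : Fin n → ℝ, ∑ k, a k • v k + J y (∑ k, b k • v k) = 0 → a = 0 ∧ b = 0) :
    0 < (gramH g J y v).det.re := by
  have hconj : ∀ u w, star (herm g J y u w) = herm g J y w u := by
    intro u w
    have e1 : g y (J y u) w = - g y (J y w) u := by rw [h.g_J_skew hy, h.symm y hy]
    simp only [herm, e1, h.symm y hy u w]
    simp [sub_eq_add_neg]
  have hpd : (gramH g J y v).PosDef := by
    refine Matrix.PosDef.of_dotProduct_mulVec_pos ?_ fun x hx => ?_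
    · ext i j
      simp only [Matrix.conjTranspose_apply, gramH, Matrix.of_apply, hconj]
    · set X : E := ∑ k, (x k).re • v k + J y (∑ k, (-(x k).im) • v k) with hX
      have hX0 : X ≠ 0 := fun h0 => hx (by
        obtain ⟨ha, hb⟩ := hv (fun k => (x k).re) (fun k => -(x k).im) h0
        funext k
        exact Complex.ext (congrFun ha k) (by simpa using congrFun hb k))
      have hl : ∀ w, herm g J y X w = ∑ k, star (x k) * herm g J y (v k) w := by
        intro w
        rw [hX, herm_add_left, h.herm_J_left hy, herm_sum_left, herm_sum_left, Finset.mul_sum,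
          ← Finset.sum_add_distrib]
        refine Finset.sum_congr rfl fun k _ => ?_
        rw [← mul_assoc, ← add_mul]
        congr 1
        apply Complex.ext <;> simp
      have hr : ∀ w, herm g J y w X = ∑ k, x k * herm g J y w (v k) := by
        intro w
        rw [← hconj, hl, star_sum]
        refine Finset.sum_congr rfl fun k _ => ?_
        rw [star_mul, star_star, hconj, mul_comm]
      have e : star x ⬝ᵥ (gramH g J y v *ᵥ x) = herm g J y X X := by
        rw [hl]
        refine Finset.sum_congr rfl fun i _ => ?_
        rw [hr]
        simp [Matrix.mulVec, dotProduct, gramH, mul_comm]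
      have hXX : g y (J y X) X = 0 := by
        have := h.g_J_skew hy X X
        rw [h.symm y hy X] at this
        linarith
      rw [e, herm, hXX, Complex.ofReal_zero, mul_zero, sub_zero]
      exact_mod_cast h.pos y hy X hX0
  exact (Complex.pos_iff.1 hpd.det_pos).1

end GramMatrix

/-! ### The squared density of the `J`-volume in charts -/

section JDet

variable {n : ℕ} {M : Type*} [TopologicalSpace M] [ChartedSpace (EuclideanSpace ℝ (Fin (2 * n))) M]
  [IsManifold (𝓡 (2 * n)) ∞ M]
  {L : Type*} [TopologicalSpace L] [ChartedSpace (EuclideanSpace ℝ (Fin n)) L]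
  [IsManifold (𝓡 n) ∞ L]

/-- The square of the density of the `J`-volume. -/
def jDet (K : KahlerStructure n M) (f : L → M) (c : L) (y : EuclideanSpace ℝ (Fin n)) : ℝ :=
  (Matrix.det (Matrix.of fun i j : Fin n =>
    let v := mfderiv (𝓡 n) (𝓡 (2 * n)) f (chartPt c y) (chartVec c y i)
    let w := mfderiv (𝓡 n) (𝓡 (2 * n)) f (chartPt c y) (chartVec c y j)
    ((K.g (f (chartPt c y)) v w : ℂ) - Complex.I * (K.form (f (chartPt c y)) v w : ℂ)))).re

/-- The coordinate expression of a map. -/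
def loc (a : L) (c : M) (f : L → M) (y : EuclideanSpace ℝ (Fin n)) :
    EuclideanSpace ℝ (Fin (2 * n)) := extChartAt (𝓡 (2 * n)) c (f (chartPt a y))

/-- The coordinate expression of `jDet`. -/
def locDet (K : KahlerStructure n M) (c : M) (φ : EuclideanSpace ℝ (Fin n) →
    EuclideanSpace ℝ (Fin (2 * n))) (y : EuclideanSpace ℝ (Fin n)) : ℝ :=
  (gramH (bC K.g c) (eC K.J c) (φ y) fun i => fderiv ℝ φ y (stdVec n i)).det.re

lemma vecC_mfderiv_chartVec {f : L → M} {a : L} {c : M} {y : EuclideanSpace ℝ (Fin n)}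
    (hf : MDifferentiableAt (𝓡 n) (𝓡 (2 * n)) f (chartPt a y)) (hy : y ∈ chartDom n a)
    (hc : f (chartPt a y) ∈ (extChartAt (𝓡 (2 * n)) c).source) (i : Fin n) :
    vecC c (f (chartPt a y)) (mfderiv (𝓡 n) (𝓡 (2 * n)) f (chartPt a y) (chartVec a y i)) =
      fderiv ℝ (loc a c f) y (stdVec n i) := by
  rw [vecC_mfderiv hf (chartPt_mem hy) hc, vecC_chartVec hy, ext_chartPt hy]
  rfl

lemma jDet_eq (K : KahlerStructure n M) {f : L → M} {a : L} {c : M} {y : EuclideanSpace ℝ (Fin n)}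
    (hf : MDifferentiableAt (𝓡 n) (𝓡 (2 * n)) f (chartPt a y)) (hy : y ∈ chartDom n a)
    (hc : f (chartPt a y) ∈ (extChartAt (𝓡 (2 * n)) c).source) :
    jDet K f a y = locDet K c (loc a c f) y := by
  unfold jDet locDet gramH
  congr 3
  ext i j
  simp only [Matrix.of_apply, herm, ← vecC_mfderiv_chartVec hf hy hc, loc]
  rw [eC_apply _ hc, bC_apply _ hc, bC_apply _ hc]
  rfl

lemma mdifferentiableAt_loc {f : L → M} {a : L} {c : M} {y : EuclideanSpace ℝ (Fin n)}
    (hf : MDifferentiableAt (𝓡 n) (𝓡 (2 * n)) f (chartPt a y)) (hy : y ∈ chartDom n a)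
    (hc : f (chartPt a y) ∈ (extChartAt (𝓡 (2 * n)) c).source) :
    DifferentiableAt ℝ (loc a c f) y := by
  have : MDifferentiableAt (𝓡 n) (𝓡 (2 * n)) (loc a c f) y :=
    MDifferentiableAt.comp (g := extChartAt (𝓡 (2 * n)) c) y (mdifferentiableAt_ext hc)
      (MDifferentiableAt.comp (g := f) y hf (mdifferentiableAt_chartPt hy))
  exact this.differentiableAt

/-- `jDet` transforms as the square of a density. -/
lemma jDet_trans (K : KahlerStructure n M) {f : L → M} {a b : L} {y : EuclideanSpace ℝ (Fin n)}
    (hf : MDifferentiableAt (𝓡 n) (𝓡 (2 * n)) f (chartPt b y)) (hy : y ∈ transDom b a) :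
    jDet K f b y = (Matrix.of fun i k => fderiv ℝ (trans b a) y (stdVec n i) k).det ^ 2 *
      jDet K f a (trans b a y) := by
  have e := chartPt_trans hy
  have hc : f (chartPt b y) ∈ (extChartAt (𝓡 (2 * n)) (f (chartPt b y))).source :=
    mem_extChartAt_source _
  set c := f (chartPt b y)
  have hy' := (trans_mem hy).1
  have hf' : MDifferentiableAt (𝓡 n) (𝓡 (2 * n)) f (chartPt a (trans b a y)) := by rwa [e]
  have hc' : f (chartPt a (trans b a y)) ∈ (extChartAt (𝓡 (2 * n)) c).source := by rwa [e]
  rw [jDet_eq K hf hy.1 hc, jDet_eq K hf' hy' hc', locDet, locDet, ← det_gramH_sum]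
  have h1 : loc b c f =ᶠ[𝓝 y] loc a c f ∘ trans b a := by
    filter_upwards [(isOpen_transDom b a).mem_nhds hy] with z hz
    simp only [loc, Function.comp, chartPt_trans hz]
  have h2 : HasFDerivAt (loc a c f ∘ trans b a) _ y := (mdifferentiableAt_loc hf' hy'
    hc').hasFDerivAt.comp y (((contDiffOn_trans b a).contDiffAt
      ((isOpen_transDom b a).mem_nhds hy)).differentiableAt (by simp)).hasFDerivAt
  rw [h1.fderiv_eq, h1.self_of_nhds, h2.fderiv]
  congr 3
  funext i
  simp only [ContinuousLinearMap.comp_apply, Matrix.of_apply]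
  conv_lhs => rw [sum_stdVec (fderiv ℝ (trans b a) y (stdVec n i))]
  simp only [map_sum, map_smul]

/-- Coordinate expressions of totally real immersions. -/
lemma IsTotallyReal.isTotRealOn {K : KahlerStructure n M} {f : L → M} (h : IsTotallyReal K f)
    (a : L) (c : M) : IsTotRealOn (bC K.g c) (eC K.J c) (chartDom (2 * n) c) (loc a c f)
      (chartDom n a ∩ (fun y => f (chartPt a y)) ⁻¹' (extChartAt (𝓡 (2 * n)) c).source) where
  kahler := K.isKahlerOn c
  isOpen := (h.1.1.continuous.comp_continuousOn (continuousOn_extChartAt_symm a)).isOpen_inter_preimage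
    (isOpen_chartDom a) (isOpen_extChartAt_source c)
  smooth := by
    rw [← contMDiffOn_iff_contDiffOn]
    exact (contMDiffOn_extChartAt (n := ∞) (x := c)).comp (h.1.1.comp_contMDiffOn
      ((contMDiffOn_extChartAt_symm (n := ∞) a).mono inter_subset_left))
      (fun y hy => by simpa using hy.2)
  mapsTo y hy := ext_mem hy.2
  invertible y hy := by
    have hf := h.1.1.contMDiffAt (x := chartPt a y) |>.mdifferentiableAt (by simp)
    have hs := (vecC_bijective (chartPt_mem hy.1)).2
    have hv : ∀ v : TangentSpace (𝓡 n) (chartPt a y), fderiv ℝ (loc a c f) y (vecC a (chartPt a y) v)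
        = vecC c (f (chartPt a y)) (mfderiv (𝓡 n) (𝓡 (2 * n)) f (chartPt a y) v) := by
      intro v
      rw [vecC_mfderiv hf (chartPt_mem hy.1) hy.2, ext_chartPt hy.1]
      rfl
    refine isInvertible_of_injective _ (by simp [two_mul]) fun q hq => ?_
    obtain ⟨v, hv1⟩ := hs q.1
    obtain ⟨w, hw1⟩ := hs q.2
    rw [IsTotRealOn.cframe_apply, ← hv1, ← hw1, hv, hv, loc, eC_apply _ hy.2, ← map_add] at hq
    have h0 := (vecC_bijective hy.2).1 (hq.trans (map_zero _).symm)
    have h1 : mfderiv (𝓡 n) (𝓡 (2 * n)) f (chartPt a y) v = 0 := by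
      refine h.2 _ v (-w) ?_
      rw [map_neg, map_neg]
      exact eq_neg_of_add_eq_zero_left h0
    have h2 : mfderiv (𝓡 n) (𝓡 (2 * n)) f (chartPt a y) w = 0 := by
      rw [h1, zero_add] at h0
      have := congrArg (K.J _) h0
      rwa [K.J_sq, map_zero, neg_eq_zero] at this
    have h3 : v = 0 := h.1.2 _ (h1.trans (map_zero _).symm)
    have h4 : w = 0 := h.1.2 _ (h2.trans (map_zero _).symm)
    refine Prod.ext ?_ ?_
    · rw [← hv1, h3, map_zero]; rfl
    · rw [← hw1, h4, map_zero]; rfl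

lemma IsTotallyReal.jDet_pos {K : KahlerStructure n M} {f : L → M} (h : IsTotallyReal K f)
    {a : L} {y : EuclideanSpace ℝ (Fin n)} (hy : y ∈ chartDom n a) : 0 < jDet K f a y := by
  have hc := mem_extChartAt_source (I := 𝓡 (2 * n)) (f (chartPt a y))
  rw [jDet_eq K (h.1.1.contMDiffAt.mdifferentiableAt (by simp)) hy hc, locDet]
  have ht := h.isTotRealOn a (f (chartPt a y))
  refine ht.kahler.det_gramH_pos (ht.mapsTo ⟨hy, hc⟩) fun r s hrs => ?_
  have h1 : cframe (eC K.J (f (chartPt a y))) (loc a (f (chartPt a y)) f) y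
      (∑ k, r k • stdVec n k, ∑ k, s k • stdVec n k) = 0 := by
    rw [IsTotRealOn.cframe_apply]
    simpa only [map_sum, map_smul] using hrs
  have h2 := (ht.invertible y ⟨hy, hc⟩).injective (h1.trans (map_zero _).symm)
  have e : ∀ r : Fin n → ℝ, ∑ k, r k • stdVec n k = 0 → r = 0 := by
    intro r hr
    have := sum_stdVec (WithLp.toLp 2 r)
    funext k
    have h3 := congrArg (fun v : EuclideanSpace ℝ (Fin n) => v k) (this.trans hr)
    exact h3
  exact ⟨e r (congrArg Prod.fst h2), e s (congrArg Prod.snd h2)⟩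

/-- Unlike its square root, the determinant is polynomial in the derivatives of the map, hence
smooth for all parameters, including those at which the map degenerates. -/
lemma contDiffOn_jDet (K : KahlerStructure n M) {F : ℝ → L → M}
    (hF : ContMDiff (𝓘(ℝ, ℝ).prod (𝓡 n)) (𝓡 (2 * n)) ∞ (fun q : ℝ × L => F q.1 q.2)) (a : L) :
    ContDiffOn ℝ ∞ (fun p : ℝ × EuclideanSpace ℝ (Fin n) => jDet K (F p.1) a p.2)
      (univ ×ˢ chartDom n a) := by
  have hc : ContMDiffOn (𝓘(ℝ, ℝ).prod (𝓡 n)) (𝓡 (2 * n)) ∞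
      (fun p : ℝ × EuclideanSpace ℝ (Fin n) => F p.1 (chartPt a p.2)) (univ ×ˢ chartDom n a) :=
    hF.comp_contMDiffOn (f := fun p : ℝ × EuclideanSpace ℝ (Fin n) => (p.1, chartPt a p.2))
      (contMDiffOn_fst.prodMk ((contMDiffOn_extChartAt_symm (n := ∞) a).comp contMDiffOn_snd
        fun p hp => hp.2))
  have hFm : ∀ s p, MDifferentiableAt (𝓡 n) (𝓡 (2 * n)) (F s) p := fun s p =>
    ((hF.comp (f := fun p : L => (s, p)) (contMDiff_const.prodMk contMDiff_id)).contMDiffAt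
      (x := p)).mdifferentiableAt (by simp)
  have hO := (isOpen_univ (X := ℝ)).prod (isOpen_chartDom (M := L) (m := n) a)
  rintro ⟨s₀, y₀⟩ hp
  set c := F s₀ (chartPt a y₀) with hcdef
  have ho := hc.continuousOn.isOpen_inter_preimage hO (isOpen_extChartAt_source (I := 𝓡 (2 * n)) c)
  have hmem : (s₀, y₀) ∈ (univ ×ˢ chartDom n a) ∩ (fun p : ℝ × EuclideanSpace ℝ (Fin n) =>
      F p.1 (chartPt a p.2)) ⁻¹' (extChartAt (𝓡 (2 * n)) c).source :=
    ⟨hp, mem_extChartAt_source (I := 𝓡 (2 * n)) c⟩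
  obtain ⟨δ, hδ, hsub⟩ := Metric.isOpen_iff.1 ho _ hmem
  rw [← ball_prod_same] at hsub
  have hS : IsInterval (ball s₀ δ) := by
    refine ⟨(convex_ball s₀ δ).ordConnected, s₀, mem_ball_self hδ, s₀ + δ / 2, ?_, by linarith⟩
    rw [mem_ball, Real.dist_eq, add_sub_cancel_left, abs_of_pos (by linarith)]; linarith
  have hΦ : ContDiffOn ℝ ∞ (fun p : ℝ × EuclideanSpace ℝ (Fin n) => loc a c (F p.1) p.2)
      (ball s₀ δ ×ˢ ball y₀ δ) := by
    refine contDiffOn_of_contMDiffOn_prod ?_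
    exact (contMDiffOn_extChartAt (n := ∞) (x := c)).comp
      (hc.mono (hsub.trans inter_subset_left)) (fun p hp => by simpa using (hsub hp).2)
  have hmaps : MapsTo (fun p : ℝ × EuclideanSpace ℝ (Fin n) => loc a c (F p.1) p.2)
      (ball s₀ δ ×ˢ ball y₀ δ) (chartDom (2 * n) c) := fun p hp => ext_mem (hsub hp).2
  have hdΦ := contDiffOn_fderiv_family (G := fun s => loc a c (F s)) hS isOpen_ball hΦ
  have hg := (K.isKahlerOn c).smooth.comp hΦ hmaps
  have hJ := (K.isKahlerOn c).smooth_J.comp hΦ hmaps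
  have hv : ∀ i, ContDiffOn ℝ ∞ (fun p : ℝ × EuclideanSpace ℝ (Fin n) =>
      fderiv ℝ (loc a c (F p.1)) p.2 (stdVec n i)) (ball s₀ δ ×ˢ ball y₀ δ) := fun i =>
    hdΦ.clm_apply contDiffOn_const
  have hH : ∀ i j, ContDiffOn ℝ ∞ (fun p : ℝ × EuclideanSpace ℝ (Fin n) =>
      gramH (bC K.g c) (eC K.J c) (loc a c (F p.1) p.2)
        (fun i => fderiv ℝ (loc a c (F p.1)) p.2 (stdVec n i)) i j)
      (ball s₀ δ ×ˢ ball y₀ δ) := by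
    intro i j
    have h1 := (hg.clm_apply (hv i)).clm_apply (hv j)
    have h2 := (hg.clm_apply (hJ.clm_apply (hv i))).clm_apply (hv j)
    exact (Complex.ofRealCLM.contDiff.comp_contDiffOn h1).sub
      (contDiffOn_const.mul (Complex.ofRealCLM.contDiff.comp_contDiffOn h2))
  have hdet : ContDiffOn ℝ ∞ (fun p : ℝ × EuclideanSpace ℝ (Fin n) =>
      locDet K c (loc a c (F p.1)) p.2) (ball s₀ δ ×ˢ ball y₀ δ) := by
    refine Complex.reCLM.contDiff.comp_contDiffOn (f := fun p : ℝ × EuclideanSpace ℝ (Fin n) =>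
      (gramH (bC K.g c) (eC K.J c) (loc a c (F p.1) p.2)
        (fun i => fderiv ℝ (loc a c (F p.1)) p.2 (stdVec n i))).det) ?_
    simp only [Matrix.det_apply]
    refine ContDiffOn.sum fun σ _ => ?_
    exact (contDiffOn_prod fun i _ => hH (σ i) i).const_smul _
  refine ContDiffAt.contDiffWithinAt ?_
  have hn : ball s₀ δ ×ˢ ball y₀ δ ∈ 𝓝 (s₀, y₀) :=
    prod_mem_nhds (ball_mem_nhds _ hδ) (ball_mem_nhds _ hδ)
  refine (hdet.contDiffAt hn).congr_of_eventuallyEq ?_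
  filter_upwards [hn] with p hp
  exact jDet_eq K (hFm _ _) (hsub hp).1.2 (hsub hp).2

end JDet

/-! ### Supports of the partition of unity -/

section ChartPartition

variable {n : ℕ} {L : Type*} [TopologicalSpace L] [T2Space L] [CompactSpace L]
  [ChartedSpace (EuclideanSpace ℝ (Fin n)) L] [IsManifold (𝓡 n) ∞ L]

/-- The set is the coordinate image of the support, which is compact because L is and lies in the
chart by subordination. -/
lemma chartPartition_compact (b : L) : ∃ C : Set (EuclideanSpace ℝ (Fin n)), IsCompact C ∧
    C ⊆ chartDom n b ∧ ∀ y ∈ chartDom n b, y ∉ C → chartPartition n L b (chartPt b y) = 0 := by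
  have hsub : tsupport (chartPartition n L b) ⊆ (extChartAt (𝓡 n) b).source := by
    rw [extChartAt_source]
    exact Classical.choose_spec
      (SmoothPartitionOfUnity.exists_isSubordinate_chartAt_source (𝓡 n) L) b
  refine ⟨extChartAt (𝓡 n) b '' tsupport (chartPartition n L b),
    (isClosed_tsupport _).isCompact.image_of_continuousOn ((continuousOn_extChartAt b).mono hsub),
    ?_, fun y hy hyC => ?_⟩
  · rintro _ ⟨p, hp, rfl⟩
    exact ext_mem (hsub hp)
  · by_contra h
    exact hyC ⟨chartPt b y, subset_tsupport _ h, ext_chartPt hy⟩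

lemma chartPartition_continuousOn (b : L) :
    ContinuousOn (fun y => chartPartition n L b (chartPt b y)) (chartDom n b) :=
  (chartPartition n L b).contMDiff.continuous.comp_continuousOn (continuousOn_extChartAt_symm b)

lemma chartPartition_finite : {b : L | chartPartition n L b ≠ 0}.Finite := by
  refine ((chartPartition n L).locallyFinite.finite_nonempty_of_compact).subset fun b hb => ?_
  rw [mem_ofPred_eq, Function.support_nonempty_iff]
  intro h
  exact hb (by ext p; exact congrFun h p)

end ChartPartition

/-! ### First variation of the `J`-volume and construction of variations -/

section Variation

open MeasureTheory

variable {n : ℕ} {M : Type*} [TopologicalSpace M] [ChartedSpace (EuclideanSpace ℝ (Fin (2 * n))) M]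
  [IsManifold (𝓡 (2 * n)) ∞ M]
  {L : Type*} [TopologicalSpace L] [T2Space L] [CompactSpace L]
  [ChartedSpace (EuclideanSpace ℝ (Fin n)) L] [IsManifold (𝓡 n) ∞ L]

/-- The derivative of the volume is the integral of k/2 against the density of the `J`-volume. A
vanishing integral of a non-negative continuous integrand forces the integrand, and so k, to vanish.
-/
lemma eq_zero_of_variation {K : KahlerStructure n M} {F : ℝ → L → M}
    (hF : ContMDiff (𝓘(ℝ, ℝ).prod (𝓡 n)) (𝓡 (2 * n)) ∞ (fun q : ℝ × L => F q.1 q.2))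
    (hF0 : IsTotallyReal K (F 0)) (hd : HasDerivAt (fun s => jVolume K (F s)) 0 0) {k : L → ℝ}
    (hk : ∀ p, 0 ≤ k p) (hder : ∀ b, ∀ y ∈ chartDom n b, HasDerivAt (fun s => jDet K (F s) b y)
      (k (chartPt b y) * jDet K (F 0) b y) 0) (p : L) : k p = 0 := by
  set I : L → ℝ := fun b => ∫ y in chartDom n b, chartPartition n L b (chartPt b y) *
    (k (chartPt b y) * jDet K (F 0) b y / (2 * √(jDet K (F 0) b y))) with hI
  have hb : ∀ b, ContinuousOn (fun y => k (chartPt b y) * jDet K (F 0) b y) (chartDom n b) ∧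
      HasDerivAt (fun s => ∫ y in chartDom n b, chartPartition n L b (chartPt b y) *
        √(jDet K (F s) b y)) (I b) 0 := by
    intro b
    obtain ⟨C, hC, hCV, h0⟩ := chartPartition_compact (n := n) b
    exact hasDerivAt_integral_sqrt (isOpen_chartDom b) hC hCV (chartPartition_continuousOn b) h0
      (contDiffOn_jDet K hF b) (fun y hy => hF0.jDet_pos hy) (hder b)
  set T := (chartPartition_finite (n := n) (L := L)).toFinset
  have hJ : ∀ s, jVolume K (F s) = ∑ b ∈ T, ∫ y in chartDom n b,
      chartPartition n L b (chartPt b y) * √(jDet K (F s) b y) := by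
    intro s
    refine finsum_eq_sum_of_support_subset _ fun b hb => ?_
    rw [Finite.coe_toFinset, mem_ofPred_eq]
    intro h0
    refine hb ?_
    simp only [h0, ContMDiffMap.coe_zero, Pi.zero_apply, zero_mul, integral_zero]
  have hsum : HasDerivAt (fun s => jVolume K (F s)) (∑ b ∈ T, I b) 0 := by
    simp only [hJ]
    exact HasDerivAt.fun_sum fun b _ => (hb b).2
  have hz : ∑ b ∈ T, I b = 0 := hsum.unique hd
  have hnn : ∀ b, ∀ y ∈ chartDom n b, 0 ≤ chartPartition n L b (chartPt b y) *
      (k (chartPt b y) * jDet K (F 0) b y / (2 * √(jDet K (F 0) b y))) := fun b y hy =>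
    mul_nonneg ((chartPartition n L).nonneg _ _) (div_nonneg (mul_nonneg (hk _)
      (hF0.jDet_pos hy).le) (by positivity))
  rw [Finset.sum_eq_zero_iff_of_nonneg fun b _ =>
    setIntegral_nonneg (isOpen_chartDom b).measurableSet (hnn b)] at hz
  by_contra hkp
  obtain ⟨b, hbp⟩ := (chartPartition n L).exists_pos_of_mem (mem_univ p)
  have hbT : b ∈ T := by
    rw [Finite.mem_toFinset, mem_ofPred_eq]
    intro h0
    rw [h0] at hbp
    exact lt_irrefl _ hbp
  obtain ⟨C, hC, hCV, h0⟩ := chartPartition_compact (n := n) b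
  have hpb : p ∈ (extChartAt (𝓡 n) b).source := by
    have := Classical.choose_spec
      (SmoothPartitionOfUnity.exists_isSubordinate_chartAt_source (𝓡 n) L) b
      (subset_tsupport _ hbp.ne')
    rwa [extChartAt_source]
  have hy := ext_mem hpb
  have hdc : ContinuousOn (fun y => jDet K (F 0) b y) (chartDom n b) :=
    (contDiffOn_jDet K hF b).continuousOn.comp (f := fun y => ((0 : ℝ), y)) (by fun_prop)
      fun y hy => ⟨mem_univ _, hy⟩
  refine (setIntegral_pos (w := fun y => chartPartition n L b (chartPt b y) *
    (k (chartPt b y) * jDet K (F 0) b y / (2 * √(jDet K (F 0) b y))))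
    (isOpen_chartDom b) hC hCV ((chartPartition_continuousOn b).mul
    ((hb b).1.div (continuousOn_const.mul hdc.sqrt) fun y hy => ?_))
    (fun y hy hyC => by rw [h0 y hy hyC, zero_mul]) (hnn b) hy ?_).ne' (hz b hbT)
  · exact (mul_pos two_pos (Real.sqrt_pos.2 (hF0.jDet_pos hy))).ne'
  · rw [chartPt_ext hpb]
    have := hF0.jDet_pos hy
    exact mul_pos hbp (div_pos (mul_pos (lt_of_le_of_ne (hk p) (Ne.symm hkp)) this)
      (mul_pos two_pos (Real.sqrt_pos.2 this)))

/-- The domain of the coordinate expression of a map. -/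
def locDom (n : ℕ) {M : Type*} [TopologicalSpace M]
    [ChartedSpace (EuclideanSpace ℝ (Fin (2 * n))) M] {L : Type*} [TopologicalSpace L]
    [ChartedSpace (EuclideanSpace ℝ (Fin n)) L] (a : L) (c : M) (f : L → M) : Set (EuclideanSpace ℝ (Fin n)) :=
  chartDom n a ∩ (fun y => f (chartPt a y)) ⁻¹' (extChartAt (𝓡 (2 * n)) c).source

/-- Variations of a map with a given compactly supported variation field in a chart. -/
lemma exists_variation {f : L → M} (hf : ContMDiff (𝓡 n) (𝓡 (2 * n)) ∞ f) (a : L) (c : M)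
    {Z : EuclideanSpace ℝ (Fin n) → EuclideanSpace ℝ (Fin (2 * n))} (hZ : ContDiff ℝ ∞ Z)
    {C : Set (EuclideanSpace ℝ (Fin n))} (hC : IsCompact C) (hCV : C ⊆ locDom n a c f)
    (hZC : ∀ z, z ∉ C → Z z = 0) :
    ∃ ε > 0, ∃ F : ℝ → L → M,
      ContMDiff (𝓘(ℝ, ℝ).prod (𝓡 n)) (𝓡 (2 * n)) ∞ (fun q : ℝ × L => F q.1 q.2) ∧ F 0 = f ∧
      (∀ p, ¬(p ∈ (extChartAt (𝓡 n) a).source ∧ f p ∈ (extChartAt (𝓡 (2 * n)) c).source) →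
        ∀ᶠ q in 𝓝 p, ∀ s, F s q = f q) ∧
      ∀ z ∈ locDom n a c f, ∀ s, F s (chartPt a z) ∈ (extChartAt (𝓡 (2 * n)) c).source ∧
        loc a c (F s) z = loc a c f z + (ε * Real.sin s) • Z z := by
  classical
  have hVo : IsOpen (locDom n a c f) :=
    (hf.continuous.comp_continuousOn (continuousOn_extChartAt_symm a)).isOpen_inter_preimage
      (isOpen_chartDom a) (isOpen_extChartAt_source c)
  have hφ : ContDiffOn ℝ ∞ (loc a c f) (locDom n a c f) := by
    rw [← contMDiffOn_iff_contDiffOn]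
    exact (contMDiffOn_extChartAt (n := ∞) (x := c)).comp (hf.comp_contMDiffOn
      ((contMDiffOn_extChartAt_symm (n := ∞) a).mono inter_subset_left))
      (fun y hy => by simpa using hy.2)
  -- The tube lemma over the compact set C keeps the displaced points in the target chart; outside C
  -- nothing moves.
  obtain ⟨ε, hε, hεV⟩ : ∃ ε > 0, ∀ r : ℝ, |r| ≤ ε → ∀ z ∈ locDom n a c f,
      loc a c f z + r • Z z ∈ chartDom (2 * n) c := by
    have hcont : ContinuousOn (fun p : ℝ × EuclideanSpace ℝ (Fin n) => loc a c f p.2 + p.1 • Z p.2)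
        (univ ×ˢ locDom n a c f) :=
      (hφ.continuousOn.comp continuousOn_snd fun p hp => hp.2).add
        (continuousOn_fst.smul (hZ.continuous.comp continuous_snd).continuousOn)
    have ho := hcont.isOpen_inter_preimage (isOpen_univ.prod hVo) (isOpen_chartDom c)
    obtain ⟨u, v, hu, -, h0u, hCv, huv⟩ := generalized_tube_lemma
      (isCompact_singleton (x := (0 : ℝ))) hC ho (fun p hp => ⟨⟨mem_univ _, hCV hp.2⟩, by
        rw [mem_preimage, show p.1 = 0 from hp.1, zero_smul, add_zero]
        exact ext_mem (hCV hp.2).2⟩)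
    obtain ⟨ε, hε, hεu⟩ := Metric.nhds_basis_closedBall.mem_iff.1 (hu.mem_nhds (h0u rfl))
    refine ⟨ε, hε, fun r hr z hz => ?_⟩
    by_cases hzC : z ∈ C
    · exact (huv (⟨hεu (by simpa using hr), hCv hzC⟩ : (r, z) ∈ u ×ˢ v)).2
    · rw [hZC z hzC, smul_zero, add_zero]
      exact ext_mem hz.2
  -- The sine keeps the displacement bounded, so that the variation is defined for every real s, and
  -- it still has derivative one at s = 0.
  have hsin : ∀ s : ℝ, |ε * Real.sin s| ≤ ε := fun s => by
    rw [abs_mul, abs_of_pos hε]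
    exact mul_le_of_le_one_right hε.le (Real.abs_sin_le_one s)
  set O : Set L := (extChartAt (𝓡 n) a).source ∩ f ⁻¹' (extChartAt (𝓡 (2 * n)) c).source with hO
  have hOo : IsOpen O := (isOpen_extChartAt_source a).inter
    ((isOpen_extChartAt_source c).preimage hf.continuous)
  have hOV : ∀ p ∈ O, extChartAt (𝓡 n) a p ∈ locDom n a c f := fun p hp =>
    ⟨ext_mem hp.1, by rw [mem_preimage, chartPt_ext hp.1]; exact hp.2⟩
  have hVO : ∀ z ∈ locDom n a c f, chartPt a z ∈ O := fun z hz => ⟨chartPt_mem hz.1, hz.2⟩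
  set F : ℝ → L → M := fun s p => if p ∈ O then
    chartPt c (loc a c f (extChartAt (𝓡 n) a p) + (ε * Real.sin s) • Z (extChartAt (𝓡 n) a p))
    else f p with hFdef
  have hFO : ∀ p ∈ O, Z (extChartAt (𝓡 n) a p) = 0 → ∀ s, F s p = f p := by
    intro p hp h0 s
    simp only [hFdef, if_pos hp, h0, smul_zero, add_zero, loc]
    rw [chartPt_ext hp.1, chartPt_ext hp.2]
  -- The image of C in L is compact, hence closed, and lies in O; near a point outside O the
  -- variation is therefore constant, which gives smoothness across the boundary of O.
  have hoff : ∀ p, p ∉ O → ∀ᶠ q in 𝓝 p, ∀ s, F s q = f q := by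
    intro p hp
    have hK : IsCompact (chartPt a '' C) := hC.image_of_continuousOn
      ((continuousOn_extChartAt_symm a).mono fun z hz => (hCV hz).1)
    have hpK : p ∉ chartPt a '' C := by
      rintro ⟨z, hz, rfl⟩
      exact hp (hVO z (hCV hz))
    filter_upwards [hK.isClosed.isOpen_compl.mem_nhds hpK] with q hq s
    by_cases hqO : q ∈ O
    · refine hFO q hqO (hZC _ fun hzC => hq ⟨_, hzC, chartPt_ext hqO.1⟩) s
    · simp only [hFdef, if_neg hqO]
  refine ⟨ε, hε, F, ?_, ?_, hoff, ?_⟩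
  · rintro ⟨s, p⟩
    by_cases hp : p ∈ O
    · have hext : ContMDiffOn (𝓘(ℝ, ℝ).prod (𝓡 n)) (𝓡 n) ∞
          (fun q : ℝ × L => extChartAt (𝓡 n) a q.2) (univ ×ˢ O) :=
        (contMDiffOn_extChartAt (n := ∞) (x := a)).comp contMDiffOn_snd
          fun q hq => by simpa using hq.2.1
      have h1 : ContMDiffOn (𝓘(ℝ, ℝ).prod (𝓡 n)) (𝓡 (2 * n)) ∞
          (fun q : ℝ × L => loc a c f (extChartAt (𝓡 n) a q.2)) (univ ×ˢ O) :=
        (contMDiffOn_iff_contDiffOn.2 hφ).comp hext fun q hq => hOV _ hq.2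
      have h2 : ContMDiffOn (𝓘(ℝ, ℝ).prod (𝓡 n)) (𝓡 (2 * n)) ∞
          (fun q : ℝ × L => Z (extChartAt (𝓡 n) a q.2)) (univ ×ˢ O) :=
        hZ.contMDiff.comp_contMDiffOn hext
      have h3 : ContMDiff (𝓘(ℝ, ℝ).prod (𝓡 n)) 𝓘(ℝ, ℝ) ∞ (fun q : ℝ × L => ε * Real.sin q.1) :=
        (contDiff_const.mul Real.contDiff_sin).contMDiff.comp contMDiff_fst
      have h4 := (contMDiffOn_extChartAt_symm (I := 𝓡 (2 * n)) (n := ∞) c).comp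
        (h1.add (h3.contMDiffOn.smul h2)) fun q hq => hεV _ (hsin q.1) _ (hOV _ hq.2)
      have hn : univ ×ˢ O ∈ 𝓝 (s, p) := prod_mem_nhds univ_mem (hOo.mem_nhds hp)
      refine (h4.contMDiffAt hn).congr_of_eventuallyEq ?_
      filter_upwards [hn] with q hq
      simp only [hFdef, if_pos hq.2]
      rfl
    · have h1 : ContMDiffAt (𝓘(ℝ, ℝ).prod (𝓡 n)) (𝓡 (2 * n)) ∞ (fun q : ℝ × L => f q.2) (s, p) :=
        (hf.comp contMDiff_snd).contMDiffAt
      refine h1.congr_of_eventuallyEq ?_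
      filter_upwards [(continuous_snd.tendsto (s, p)).eventually (hoff p hp)] with q hq using hq q.1
  · funext p
    by_cases hp : p ∈ O
    · simp only [hFdef, if_pos hp, Real.sin_zero, mul_zero, zero_smul, add_zero, loc]
      rw [chartPt_ext hp.1, chartPt_ext hp.2]
    · simp only [hFdef, if_neg hp]
  · intro z hz s
    have h1 := hεV _ (hsin s) z hz
    have e : F s (chartPt a z) = chartPt c (loc a c f z + (ε * Real.sin s) • Z z) := by
      simp only [hFdef, if_pos (hVO z hz), ext_chartPt hz.1]
    rw [loc, e]
    exact ⟨chartPt_mem h1, ext_chartPt h1⟩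

end Variation

/-! ### `J`-minimal immersions have vanishing Maslov form -/

section Minimal

variable {n : ℕ} {M : Type*} [TopologicalSpace M] [ChartedSpace (EuclideanSpace ℝ (Fin (2 * n))) M]
  [IsManifold (𝓡 (2 * n)) ∞ M]
  {L : Type*} [TopologicalSpace L] [T2Space L] [CompactSpace L]
  [ChartedSpace (EuclideanSpace ℝ (Fin n)) L] [IsManifold (𝓡 n) ∞ L]

lemma theta_smul {E : Type*} [NormedAddCommGroup E] [NormedSpace ℝ E] [FiniteDimensional ℝ E]
    (g : E → E →L[ℝ] E →L[ℝ] ℝ) (J : E → E →L[ℝ] E) (φ : EuclideanSpace ℝ (Fin n) → E)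
    (z : EuclideanSpace ℝ (Fin n)) (r : ℝ) (u : EuclideanSpace ℝ (Fin n)) :
    theta g J φ z (r • u) = r * theta g J φ z u := by
  rw [theta, theta, map_smul, mul_smul_comm, map_smul, smul_eq_mul]

lemma IsTotRealOn.continuousOn_theta {E : Type*} [NormedAddCommGroup E] [NormedSpace ℝ E]
    [FiniteDimensional ℝ E] {g : E → E →L[ℝ] E →L[ℝ] ℝ} {J : E → E →L[ℝ] E} {U : Set E}
    {φ : EuclideanSpace ℝ (Fin n) → E} {V : Set (EuclideanSpace ℝ (Fin n))}
    (h : IsTotRealOn g J U φ V) (u : EuclideanSpace ℝ (Fin n)) :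
    ContinuousOn (fun z => theta g J φ z u) V := fun z hz => by
  have h1 := (h.contDiffAt_conn hz).continuousAt.clm_apply (continuousAt_const (y := u))
  have h2 : ContinuousAt (fun z => J0 n * conn g J φ z u) z := continuousAt_const.mul h1
  exact (trL.continuous.continuousAt.comp h2).continuousWithinAt

/-- Along a variation in the direction `J f_*(k u)` the density of the `J`-volume changes at the
rate given by the Maslov form. -/
lemma hasDerivAt_jDet {K : KahlerStructure n M} {f : L → M} (hf : IsTotallyReal K f) {a : L} {c : M}
    {F : ℝ → L → M} (hF : ContMDiff (𝓘(ℝ, ℝ).prod (𝓡 n)) (𝓡 (2 * n)) ∞ (fun q : ℝ × L => F q.1 q.2))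
    (hF0 : F 0 = f)
    {W : EuclideanSpace ℝ (Fin n) → EuclideanSpace ℝ (Fin n)} (hW : ContDiff ℝ ∞ W)
    (hFc : ∀ z ∈ locDom n a c f, ∀ s, F s (chartPt a z) ∈ (extChartAt (𝓡 (2 * n)) c).source)
    (hFd : ∀ z ∈ locDom n a c f, HasDerivAt (fun s => loc a c (F s) z)
      (eC K.J c (loc a c f z) (fderiv ℝ (loc a c f) z (W z))) 0)
    {b : L} {y : EuclideanSpace ℝ (Fin n)} (hy : y ∈ chartDom n b)
    (ha : chartPt b y ∈ (extChartAt (𝓡 n) a).source)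
    (hc : f (chartPt b y) ∈ (extChartAt (𝓡 (2 * n)) c).source) :
    HasDerivAt (fun s => jDet K (F s) b y) (theta (bC K.g c) (eC K.J c) (loc a c f)
      (extChartAt (𝓡 n) a (chartPt b y)) (W (extChartAt (𝓡 n) a (chartPt b y))) *
        jDet K f b y) 0 := by
  have hFm : ∀ s p, MDifferentiableAt (𝓡 n) (𝓡 (2 * n)) (F s) p := fun s p =>
    ((hF.comp (f := fun p : L => (s, p)) (contMDiff_const.prodMk contMDiff_id)).contMDiffAt
      (x := p)).mdifferentiableAt (by simp)
  have hyt : y ∈ transDom b a := ⟨hy, ha⟩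
  set z := extChartAt (𝓡 n) a (chartPt b y) with hzdef
  have hzt : trans b a y = z := rfl
  have hz : z ∈ locDom n a c f := ⟨ext_mem ha, by rw [mem_preimage, chartPt_ext ha]; exact hc⟩
  have hT := hf.isTotRealOn a c
  have hΦ : ContDiffOn ℝ ∞ (fun p : ℝ × EuclideanSpace ℝ (Fin n) => loc a c (F p.1) p.2)
      (univ ×ˢ locDom n a c f) := by
    refine contDiffOn_of_contMDiffOn_prod ?_
    exact (contMDiffOn_extChartAt (n := ∞) (x := c)).comp
      (hF.comp_contMDiffOn (f := fun p : ℝ × EuclideanSpace ℝ (Fin n) => (p.1, chartPt a p.2))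
        (contMDiffOn_fst.prodMk ((contMDiffOn_extChartAt_symm (n := ∞) a).comp contMDiffOn_snd
          fun p hp => hp.2.1))) (fun p hp => by simpa using hFc _ hp.2 p.1)
  have key := hasDerivAt_det_gramH (Φ := fun s => loc a c (F s)) (S := univ) (W := W)
    (h := by rw [hF0]; exact hT) ⟨ordConnected_univ, nontrivial_univ⟩ univ_mem hΦ hW.contDiffOn
    (fun z hz => by rw [hF0]; exact (hFd z hz).hasDerivWithinAt) hz
  have e : ∀ s, jDet K (F s) b y = (Matrix.of fun i k =>
      fderiv ℝ (trans b a) y (stdVec n i) k).det ^ 2 * locDet K c (loc a c (F s)) z := by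
    intro s
    rw [jDet_trans K (hFm s _) hyt, hzt, jDet_eq K (hFm s _) hz.1 (hFc z hz s)]
  rw [← hF0, e]
  simp only [e]
  refine (key.const_mul _).congr_deriv ?_
  simp only [locDet]
  ring

lemma jDet_congr (K : KahlerStructure n M) {f f' : L → M} {b : L} {y : EuclideanSpace ℝ (Fin n)}
    (hf : MDifferentiableAt (𝓡 n) (𝓡 (2 * n)) f (chartPt b y)) (hy : y ∈ chartDom n b)
    (h : f' =ᶠ[𝓝 (chartPt b y)] f) : jDet K f' b y = jDet K f b y := by
  have hc := mem_extChartAt_source (I := 𝓡 (2 * n)) (f (chartPt b y))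
  rw [jDet_eq K (hf.congr_of_eventuallyEq h) hy (by rw [h.self_of_nhds]; exact hc),
    jDet_eq K hf hy hc]
  have h1 : loc b (f (chartPt b y)) f' =ᶠ[𝓝 y] loc b (f (chartPt b y)) f := by
    filter_upwards [(mdifferentiableAt_chartPt hy).continuousAt.eventually h] with z hz
    simp only [loc, hz]
  rw [locDet, locDet, h1.fderiv_eq, h1.self_of_nhds]

/-- `J`-minimal immersions are Lagrangian for the Ricci form. -/
theorem IsJMinimal.isLagrangian {K : KahlerStructure n M} {f : L → M} (h : IsJMinimal K f) :
    IsLagrangian K.ricciForm f := by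
  classical
  obtain ⟨ht, hvar⟩ := h
  intro p v w
  obtain ⟨c, hc⟩ : ∃ c, c = f p := ⟨_, rfl⟩
  have hT := ht.isTotRealOn p c
  have hp := mem_extChartAt_source (I := 𝓡 n) p
  have hpc : f p ∈ (extChartAt (𝓡 (2 * n)) c).source := by
    rw [hc]; exact mem_extChartAt_source _
  have hf := ht.1.1.contMDiffAt (x := p) |>.mdifferentiableAt (by simp)
  have hz : extChartAt (𝓡 n) p p ∈ locDom n p c f :=
    ⟨ext_mem hp, by rw [mem_preimage, chartPt_ext hp]; exact hpc⟩
  -- If θ(u) were positive at z₁, take a bump function χ supported where it is positive and vary in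
  -- the direction J f_*(εχu). The rate of change of the squared density would be non-negative
  -- everywhere and positive at z₁, contradicting criticality.
  have hle : ∀ u, ∀ z ∈ locDom n p c f, ¬ 0 < theta (bC K.g c) (eC K.J c) (loc p c f) z u := by
    intro u z₁ hz₁ hpos
    have hV := (hT.continuousOn_theta u).isOpen_inter_preimage hT.isOpen (isOpen_Ioi (a := (0 : ℝ)))
    obtain ⟨χ, hχs, hχc, hχ, hχr, hχ1⟩ := exists_contDiff_tsupport_subset (n := ⊤)
      (hV.mem_nhds ⟨hz₁, hpos⟩)
    have hχ0 : ∀ z, 0 ≤ χ z := fun z => (hχr ⟨z, rfl⟩).1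
    have hZ : ContDiff ℝ ∞ fun z => eC K.J c (loc p c f z) (fderiv ℝ (loc p c f) z (χ z • u)) := by
      rw [contDiff_iff_contDiffAt]
      intro z
      by_cases hz : z ∈ tsupport χ
      · have hzV := (hχs hz).1
        exact ((hT.kahler.contDiffAt_J (hT.mapsTo hzV)).comp z (hT.contDiffAt hzV)).clm_apply
          ((hT.contDiffAt_fderiv hzV).clm_apply (hχ.contDiffAt.smul contDiffAt_const))
      · refine (contDiffAt_const (c := 0)).congr_of_eventuallyEq ?_
        filter_upwards [(isClosed_tsupport χ).isOpen_compl.mem_nhds hz] with z' hz'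
        rw [image_eq_zero_of_notMem_tsupport hz', zero_smul, map_zero, map_zero]
    obtain ⟨ε, hε, F, hF, hF0, hoff, hin⟩ := exists_variation ht.1.1 p c hZ hχc
      (fun z hz => (hχs hz).1) (fun z hz => by
        rw [image_eq_zero_of_notMem_tsupport hz, zero_smul, map_zero, map_zero])
    have hFd : ∀ z ∈ locDom n p c f, HasDerivAt (fun s => loc p c (F s) z)
        (eC K.J c (loc p c f z) (fderiv ℝ (loc p c f) z ((ε * χ z) • u))) 0 := by
      intro z hz
      simp only [fun s => (hin z hz s).2]
      refine ((((Real.hasDerivAt_sin 0).const_mul ε).smul_const _).const_add _).congr_deriv ?_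
      simp only [Real.cos_zero, mul_one, mul_smul, map_smul]
    set k : L → ℝ := fun q => if q ∈ (extChartAt (𝓡 n) p).source ∧
      f q ∈ (extChartAt (𝓡 (2 * n)) c).source then
      theta (bC K.g c) (eC K.J c) (loc p c f) (extChartAt (𝓡 n) p q)
        ((ε * χ (extChartAt (𝓡 n) p q)) • u) else 0 with hk
    have hk0 : ∀ q, 0 ≤ k q := by
      intro q
      simp only [hk]
      split_ifs
      · rw [theta_smul]
        by_cases hq : extChartAt (𝓡 n) p q ∈ tsupport χ
        · exact mul_nonneg (mul_nonneg hε.le (hχ0 _)) (le_of_lt (hχs hq).2)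
        · rw [image_eq_zero_of_notMem_tsupport hq, mul_zero, zero_mul]
      · exact le_rfl
    have hz1 := eq_zero_of_variation (K := K) hF (by rw [hF0]; exact ht) (hvar F hF hF0) hk0
      (fun b y hy => by
        by_cases hq : chartPt b y ∈ (extChartAt (𝓡 n) p).source ∧
          f (chartPt b y) ∈ (extChartAt (𝓡 (2 * n)) c).source
        · simp only [hk, if_pos hq, hF0]
          exact hasDerivAt_jDet ht hF hF0 (W := fun z => (ε * χ z) • u)
            ((contDiff_const.mul hχ).smul contDiff_const) (fun z hz s => (hin z hz s).1) hFd hy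
            hq.1 hq.2
        · simp only [hk, if_neg hq, zero_mul]
          have : (fun s => jDet K (F s) b y) = fun _ => jDet K f b y := by
            funext s
            exact jDet_congr K (ht.1.1.contMDiffAt.mdifferentiableAt (by simp)) hy
              ((hoff _ hq).mono fun q hq => hq s)
          rw [this]
          exact hasDerivAt_const _ _) (chartPt p z₁)
    simp only [hk, if_pos (show chartPt p z₁ ∈ (extChartAt (𝓡 n) p).source ∧
      f (chartPt p z₁) ∈ (extChartAt (𝓡 (2 * n)) c).source from ⟨chartPt_mem hz₁.1, hz₁.2⟩)] at hz1
    rw [ext_chartPt hz₁.1, theta_smul, hχ1, mul_one] at hz1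
    exact (mul_pos hε hpos).ne' hz1
  -- The opposite inequality comes from replacing u by -u.
  have hθ : ∀ z ∈ locDom n p c f, ∀ u, theta (bC K.g c) (eC K.J c) (loc p c f) z u = 0 := by
    intro z hz u
    refine le_antisymm (not_lt.1 (hle u z hz)) ?_
    have := not_lt.1 (hle ((-1 : ℝ) • u) z hz)
    rw [theta_smul] at this
    linarith
  have h1 := hT.rho_eq_zero hz hθ (vecC p p v) (vecC p p w)
  rw [K.ricciForm_eq hpc, vecC_mfderiv hf hp hpc, vecC_mfderiv hf hp hpc]
  have e : loc p c f (extChartAt (𝓡 n) p p) = extChartAt (𝓡 (2 * n)) c (f p) := by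
    rw [loc, chartPt_ext hp]
  rw [e] at h1
  exact h1

end Minimal

/-! ### Integrals of divergences and of one-parameter families -/

section ParametricIntegral

open MeasureTheory

variable {E F : Type*} [NormedAddCommGroup E] [NormedSpace ℝ E] [FiniteDimensional ℝ E]
  [NormedAddCommGroup F] [NormedSpace ℝ F] [CompleteSpace F]
  {S : Set ℝ} {U : Set E} {G : ℝ → E → F} {a b : ℝ}

lemma continuousOn_intervalIntegral (hU : IsOpen U) (hab : uIcc a b ⊆ S)
    (hG : ContinuousOn (fun p : ℝ × E => G p.1 p.2) (S ×ˢ U)) :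
    ContinuousOn (fun y => ∫ t in a..b, G t y) U := by
  intro y hy
  obtain ⟨r, hr, hrU⟩ := Metric.nhds_basis_closedBall.mem_iff.1 (hU.mem_nhds hy)
  obtain ⟨B, hB⟩ := (isCompact_uIcc.prod (isCompact_closedBall y r)).exists_bound_of_continuousOn
    (hG.mono (prod_mono hab hrU))
  have hsl : ∀ z ∈ U, ContinuousOn (fun t => G t z) (uIcc a b) := fun z hz =>
    hG.comp (f := fun t => (t, z)) (by fun_prop) fun t ht => ⟨hab ht, hz⟩
  refine (intervalIntegral.continuousAt_of_dominated_interval (bound := fun _ => B) ?_ ?_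
    intervalIntegrable_const ?_).continuousWithinAt
  · filter_upwards [hU.mem_nhds hy] with z hz
    exact ((hsl z hz).mono uIoc_subset_uIcc).aestronglyMeasurable measurableSet_uIoc
  · filter_upwards [closedBall_mem_nhds y hr] with z hz
    exact Eventually.of_forall fun t ht => hB (t, z) ⟨uIoc_subset_uIcc ht, hz⟩
  · refine Eventually.of_forall fun t ht => ?_
    exact (hG.comp (f := fun z => (t, z)) (by fun_prop) fun z hz =>
      ⟨hab (uIoc_subset_uIcc ht), hz⟩).continuousAt (hU.mem_nhds hy)

lemma hasFDerivAt_intervalIntegral (hS : IsInterval S) (hU : IsOpen U) (hab : uIcc a b ⊆ S)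
    (hG : ContDiffOn ℝ ∞ (fun p : ℝ × E => G p.1 p.2) (S ×ˢ U)) {y : E} (hy : y ∈ U) :
    HasFDerivAt (fun y => ∫ t in a..b, G t y) (∫ t in a..b, fderiv ℝ (G t) y) y := by
  have hG' := contDiffOn_fderiv_family hS hU hG
  obtain ⟨r, hr, hrU⟩ := Metric.nhds_basis_closedBall.mem_iff.1 (hU.mem_nhds hy)
  obtain ⟨B, hB⟩ := (isCompact_uIcc.prod (isCompact_closedBall y r)).exists_bound_of_continuousOn
    (hG'.continuousOn.mono (prod_mono hab hrU))
  have hsl : ∀ z ∈ U, ContinuousOn (fun t => G t z) (uIcc a b) := fun z hz =>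
    hG.continuousOn.comp (f := fun t => (t, z)) (by fun_prop) fun t ht => ⟨hab ht, hz⟩
  have hsl' : ContinuousOn (fun t => fderiv ℝ (G t) y) (uIcc a b) :=
    hG'.continuousOn.comp (f := fun t => (t, y)) (by fun_prop) fun t ht => ⟨hab ht, hy⟩
  refine intervalIntegral.hasFDerivAt_integral_of_dominated_of_fderiv_le
    (F := fun z t => G t z) (F' := fun z t => fderiv ℝ (G t) z) (bound := fun _ => B)
    (closedBall_mem_nhds y hr) ?_ (hsl y hy).intervalIntegrable
    ((hsl'.mono uIoc_subset_uIcc).aestronglyMeasurable measurableSet_uIoc) ?_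
    intervalIntegrable_const ?_
  · filter_upwards [hU.mem_nhds hy] with z hz
    exact ((hsl z hz).mono uIoc_subset_uIcc).aestronglyMeasurable measurableSet_uIoc
  · exact Eventually.of_forall fun t ht z hz => hB (t, z) ⟨uIoc_subset_uIcc ht, hz⟩
  · refine Eventually.of_forall fun t ht z hz => ?_
    exact (((contDiffOn_slice hG (hab (uIoc_subset_uIcc ht))).contDiffAt
      (hU.mem_nhds (hrU hz))).differentiableAt (by simp)).hasFDerivAt

/-- Order one is all that the divergence theorem below requires of the averaged one-form. -/
lemma contDiffOn_intervalIntegral (hS : IsInterval S) (hU : IsOpen U) (hab : uIcc a b ⊆ S)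
    (hG : ContDiffOn ℝ ∞ (fun p : ℝ × E => G p.1 p.2) (S ×ˢ U)) :
    ContDiffOn ℝ 1 (fun y => ∫ t in a..b, G t y) U := by
  have h1 : ∀ y ∈ U, _ := fun y hy => hasFDerivAt_intervalIntegral hS hU hab hG hy
  rw [show (1 : WithTop ℕ∞) = 0 + 1 from (zero_add 1).symm, contDiffOn_succ_iff_fderiv_of_isOpen hU]
  refine ⟨fun y hy => (h1 y hy).differentiableAt.differentiableWithinAt, by simp, ?_⟩
  rw [contDiffOn_zero]
  exact (continuousOn_intervalIntegral hU hab
    (contDiffOn_fderiv_family hS hU hG).continuousOn).congr fun y hy => (h1 y hy).fderiv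

end ParametricIntegral

/-! ### The divergence theorem for compactly supported fields on ℝ^m -/

section Divergence

open MeasureTheory

variable {m : ℕ}

/-- Integration by parts against the constant function one. -/
lemma integral_fderiv_eq_zero {g : EuclideanSpace ℝ (Fin m) → ℝ} (hg : ContDiff ℝ 1 g)
    (hc : HasCompactSupport g) (v : EuclideanSpace ℝ (Fin m)) : ∫ y, fderiv ℝ g y v = 0 := by
  have h1 : Integrable (fun y => fderiv ℝ g y v) :=
    ((hg.continuous_fderiv (by simp)).clm_apply continuous_const).integrable_of_hasCompactSupport
      (hc.fderiv_apply ℝ v)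
  have h2 : Integrable g := hg.continuous.integrable_of_hasCompactSupport hc
  have := integral_mul_fderiv_eq_neg_fderiv_mul_of_integrable (𝕜 := ℝ) (μ := volume)
    (f := fun _ : EuclideanSpace ℝ (Fin m) => (1 : ℝ)) (g := g) (v := v)
    (by simp) (by simpa using h1) (by simpa using h2)
    (fun _ _ => differentiableAt_const _) fun y _ => hg.differentiable (by simp) y
  simpa using this

lemma integral_divergence_eq_zero {V C : Set (EuclideanSpace ℝ (Fin m))} (hV : IsOpen V)
    (hC : IsCompact C) (hCV : C ⊆ V) {X : EuclideanSpace ℝ (Fin m) → EuclideanSpace ℝ (Fin m)}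
    (hX : ContDiffOn ℝ 1 X V) (hX0 : ∀ y ∈ V, y ∉ C → X y = 0) :
    ∫ y in V, trL (fderiv ℝ X y) = 0 := by
  -- Extension by zero is C¹ on the whole space, because X already vanishes on V outside the compact
  -- set C.
  set Y := V.indicator X with hY
  have hYX : ∀ y ∈ V, Y =ᶠ[𝓝 y] X := fun y hy => by
    filter_upwards [hV.mem_nhds hy] with z hz using indicator_of_mem hz X
  have hY0 : ∀ y, y ∉ C → Y y = 0 := fun y hy => by
    by_cases hyV : y ∈ V
    · rw [hY, indicator_of_mem hyV, hX0 y hyV hy]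
    · rw [hY, indicator_of_notMem hyV]
  have hYs : ContDiff ℝ 1 Y := by
    rw [contDiff_iff_contDiffAt]
    intro y
    by_cases hy : y ∈ V
    · exact (hX.contDiffAt (hV.mem_nhds hy)).congr_of_eventuallyEq (hYX y hy)
    · refine (contDiffAt_const (c := 0)).congr_of_eventuallyEq ?_
      filter_upwards [hC.isClosed.isOpen_compl.mem_nhds fun h => hy (hCV h)] with z hz using hY0 z hz
  have hi : ∀ i, ContDiff ℝ 1 fun y => Y y i := fun i => (coordL i).contDiff.comp hYs
  have hic : ∀ i, HasCompactSupport fun y => Y y i := fun i =>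
    HasCompactSupport.intro hC fun y hy => by rw [hY0 y hy]; rfl
  have hd : ∀ i y, fderiv ℝ (fun y => Y y i) y (stdVec m i) = fderiv ℝ Y y (stdVec m i) i := by
    intro i y
    have : HasFDerivAt (fun y => Y y i) _ y :=
      (coordL i).hasFDerivAt.comp y (hYs.differentiable (by simp) y).hasFDerivAt
    rw [this.fderiv]
    rfl
  have e1 : ∫ y in V, trL (fderiv ℝ X y) = ∫ y in V, trL (fderiv ℝ Y y) :=
    setIntegral_congr_fun hV.measurableSet fun y hy => by simp only [(hYX y hy).fderiv_eq]
  have e2 : ∫ y in V, trL (fderiv ℝ Y y) = ∫ y, trL (fderiv ℝ Y y) := by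
    refine setIntegral_eq_integral_of_forall_compl_eq_zero fun y hy => ?_
    have : Y =ᶠ[𝓝 y] fun _ => 0 := by
      filter_upwards [hC.isClosed.isOpen_compl.mem_nhds fun h => hy (hCV h)] with z hz using hY0 z hz
    rw [this.fderiv_eq]
    simp
  rw [e1, e2]
  simp only [trL_eq_sum, ← hd]
  rw [integral_finsetSum _ fun i _ => (((hi i).continuous_fderiv (by simp)).clm_apply
    continuous_const).integrable_of_hasCompactSupport ((hic i).fderiv_apply ℝ (stdVec m i))]
  exact Finset.sum_eq_zero fun i _ => integral_fderiv_eq_zero (hi i) (hic i) _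

end Divergence

/-! ### Densities and the divergence theorem on a compact manifold -/

section ManifoldDivergence

open MeasureTheory

variable {m : ℕ} {M : Type*} [TopologicalSpace M] [ChartedSpace (EuclideanSpace ℝ (Fin m)) M]

lemma trL_smulRight {E : Type*} [NormedAddCommGroup E] [NormedSpace ℝ E] [FiniteDimensional ℝ E]
    (f : E →L[ℝ] ℝ) (w : E) : trL (f.smulRight w) = f w := by
  rw [trL_apply]
  exact LinearMap.trace_smulRight (f : E →ₗ[ℝ] ℝ) w

/-- Positive densities, in charts. -/
structure IsDensity (σ : M → EuclideanSpace ℝ (Fin m) → ℝ) : Prop where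
  smooth : ∀ c, ContDiffOn ℝ 1 (σ c) (chartDom m c)
  pos : ∀ c, ∀ y ∈ chartDom m c, 0 < σ c y
  compat : ∀ c d, ∀ y ∈ transDom c d,
    σ c y = |(fderiv ℝ (trans c d) y).det| * σ d (trans c d y)

variable [IsManifold (𝓡 m) ∞ M] {σ : M → EuclideanSpace ℝ (Fin m) → ℝ}

/-- A function supported in both chart domains may be integrated in either one: this is the change
of variables formula, with the Jacobian absorbed by the density. -/
lemma IsDensity.integral_eq (hσ : IsDensity σ) {h : M → ℝ} {b c : M}
    (h0 : ∀ x, ¬(x ∈ (extChartAt (𝓡 m) b).source ∧ x ∈ (extChartAt (𝓡 m) c).source) → h x = 0) :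
    ∫ y in chartDom m b, h (chartPt b y) * σ b y = ∫ y in chartDom m c, h (chartPt c y) * σ c y := by
  have hr : ∀ b c : M, (∀ x, ¬(x ∈ (extChartAt (𝓡 m) b).source ∧
      x ∈ (extChartAt (𝓡 m) c).source) → h x = 0) →
      ∫ y in chartDom m b, h (chartPt b y) * σ b y =
        ∫ y in transDom b c, h (chartPt b y) * σ b y := fun b c h0 =>
    setIntegral_eq_of_subset_of_forall_sdiff_eq_zero (isOpen_chartDom b).measurableSet
      inter_subset_left fun y hy => by rw [h0 _ fun hx => hy.2 ⟨hy.1, hx.2⟩, zero_mul]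
  rw [hr b c h0, hr c b fun x hx => h0 x fun hx' => hx hx'.symm]
  have hi : trans b c '' transDom (m := m) b c = transDom c b := by
    refine Subset.antisymm ?_ fun z hz => ⟨trans c b z, trans_mem hz, trans_trans hz⟩
    rintro _ ⟨y, hy, rfl⟩
    exact trans_mem hy
  rw [← hi, integral_image_eq_integral_abs_det_fderiv_smul volume (isOpen_transDom b c).measurableSet
    (fun y hy => (((contDiffOn_trans b c).contDiffAt
      ((isOpen_transDom b c).mem_nhds hy)).differentiableAt (by simp)).hasFDerivAt.hasFDerivWithinAt)
    fun y hy z hz e => by rw [← trans_trans hy, e, trans_trans hz]]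
  refine setIntegral_congr_fun (isOpen_transDom b c).measurableSet fun y hy => ?_
  simp only [smul_eq_mul]
  rw [chartPt_trans hy, hσ.compat b c y hy]
  ring

variable {W : M → EuclideanSpace ℝ (Fin m) → EuclideanSpace ℝ (Fin m)}

/-- The derivative of a function along a vector field. -/
def dirD (W : M → EuclideanSpace ℝ (Fin m) → EuclideanSpace ℝ (Fin m)) (χ : M → ℝ) (x : M) : ℝ :=
  fderiv ℝ (fun y => χ (chartPt x y)) (extChartAt (𝓡 m) x x) (W x (extChartAt (𝓡 m) x x))

lemma contDiffOn_chartPt {χ : M → ℝ} (hχ : ContMDiff (𝓡 m) 𝓘(ℝ, ℝ) ∞ χ) (c : M) :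
    ContDiffOn ℝ ∞ (fun y => χ (chartPt c y)) (chartDom m c) := by
  rw [← contMDiffOn_iff_contDiffOn]
  exact hχ.comp_contMDiffOn (contMDiffOn_extChartAt_symm c)

lemma dirD_eq (hW : ∀ c d : M, ∀ y ∈ transDom c d,
      W d (trans c d y) = fderiv ℝ (trans c d) y (W c y)) {χ : M → ℝ}
    (hχ : ContMDiff (𝓡 m) 𝓘(ℝ, ℝ) ∞ χ) {c x : M} (hx : x ∈ (extChartAt (𝓡 m) c).source) :
    dirD W χ x = fderiv ℝ (fun y => χ (chartPt c y)) (extChartAt (𝓡 m) c x)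
      (W c (extChartAt (𝓡 m) c x)) := by
  have hx' := mem_extChartAt_source (I := 𝓡 m) x
  have hy := ext_mem_transDom hx' hx
  have h1 : (fun y => χ (chartPt x y)) =ᶠ[𝓝 (extChartAt (𝓡 m) x x)]
      (fun y => χ (chartPt c y)) ∘ trans x c := by
    filter_upwards [(isOpen_transDom x c).mem_nhds hy] with z hz
    simp only [Function.comp, chartPt_trans hz]
  have h2 : DifferentiableAt ℝ (fun y => χ (chartPt c y)) (trans x c (extChartAt (𝓡 m) x x)) :=
    ((contDiffOn_chartPt hχ c).contDiffAt ((isOpen_chartDom c).mem_nhds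
      (trans_mem hy).1)).differentiableAt (by simp)
  have h3 := h2.hasFDerivAt.comp _ (((contDiffOn_trans x c).contDiffAt
      ((isOpen_transDom x c).mem_nhds hy)).differentiableAt (by simp)).hasFDerivAt
  rw [dirD, h1.fderiv_eq, h3.fderiv, ContinuousLinearMap.comp_apply, ← hW x c _ hy, trans_ext hx']

variable [T2Space M] [CompactSpace M]

/-- On a compact manifold a vector field with constant divergence has divergence zero. -/
theorem divergence_eq_zero [Nonempty M] (hσ : IsDensity σ)
    (hW : ∀ c, ContDiffOn ℝ 1 (W c) (chartDom m c))
    (hWc : ∀ c d : M, ∀ y ∈ transDom c d, W d (trans c d y) = fderiv ℝ (trans c d) y (W c y)) {κ : ℝ}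
    (hdiv : ∀ c, ∀ y ∈ chartDom m c,
      σ c y * trL (fderiv ℝ (W c) y) + fderiv ℝ (σ c) y (W c y) = κ * σ c y) : κ = 0 := by
  set χ : M → M → ℝ := fun c => chartPartition m M c with hχdef
  have hχ : ∀ c, ContMDiff (𝓡 m) 𝓘(ℝ, ℝ) ∞ (χ c) := fun c => (chartPartition m M c).contMDiff
  have hsub : ∀ c, tsupport (χ c) ⊆ (extChartAt (𝓡 m) c).source := fun c => by
    rw [extChartAt_source]
    exact Classical.choose_spec
      (SmoothPartitionOfUnity.exists_isSubordinate_chartAt_source (𝓡 m) M) c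
  set T := (chartPartition_finite (n := m) (L := M)).toFinset with hT
  have hsum : ∀ x, ∑ c ∈ T, χ c x = 1 := by
    intro x
    have h1 := (chartPartition m M).sum_eq_one (mem_univ x)
    rw [finsum_eq_sum_of_support_subset (s := T) _ fun c hc => ?_] at h1
    · exact h1
    · rw [hT, Finite.coe_toFinset, mem_ofPred_eq]
      intro h0
      exact hc (by simp only [h0, ContMDiffMap.coe_zero, Pi.zero_apply])
  -- In every chart σ H_c is the divergence of χ_c σ W. Summing over the partition of unity leaves
  -- κ, since the derivatives of the χ_c add up to zero.
  set H : M → M → ℝ := fun c x => χ c x * κ + dirD W (χ c) x with hH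
  have hH0 : ∀ c x, x ∉ (extChartAt (𝓡 m) c).source → H c x = 0 := by
    intro c x hx
    have hxs : x ∉ tsupport (χ c) := fun h => hx (hsub c h)
    have h1 : (fun y => χ c (chartPt x y)) =ᶠ[𝓝 (extChartAt (𝓡 m) x x)] fun _ => 0 := by
      have hcont := (mdifferentiableAt_chartPt
        (ext_mem (mem_extChartAt_source (I := 𝓡 m) x))).continuousAt
      filter_upwards [hcont.preimage_mem_nhds ((isClosed_tsupport (χ c)).isOpen_compl.mem_nhds (by
        rw [chartPt_ext (mem_extChartAt_source x)]; exact hxs))] with y hy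
      exact image_eq_zero_of_notMem_tsupport hy
    simp only [hH, dirD, h1.fderiv_eq, image_eq_zero_of_notMem_tsupport hxs]
    simp
  have hHsum : ∀ x, ∑ c ∈ T, H c x = κ := by
    intro x
    simp only [hH]
    rw [Finset.sum_add_distrib, ← Finset.sum_mul, hsum, one_mul, add_eq_left]
    simp only [dirD]
    have hy := ext_mem (mem_extChartAt_source (I := 𝓡 m) x)
    have h1 : HasFDerivAt (fun y => ∑ c ∈ T, χ c (chartPt x y)) _ (extChartAt (𝓡 m) x x) :=
      HasFDerivAt.fun_sum fun c _ => (((contDiffOn_chartPt (hχ c) x).contDiffAt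
        ((isOpen_chartDom x).mem_nhds hy)).differentiableAt (by simp)).hasFDerivAt
    simp only [hsum] at h1
    have h2 := congrArg (fun A => A (W x (extChartAt (𝓡 m) x x)))
      (h1.unique (hasFDerivAt_const (1 : ℝ) _))
    simpa using h2
  have hHb : ∀ b c, ContinuousOn (fun y => H c (chartPt b y)) (chartDom m b) := by
    intro b c
    have h1 := contDiffOn_chartPt (hχ c) b
    refine ContinuousOn.congr (f := fun y => χ c (chartPt b y) * κ +
      fderiv ℝ (fun y => χ c (chartPt b y)) y (W b y)) ((h1.continuousOn.mul continuousOn_const).add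
      ((h1.continuousOn_fderiv_of_isOpen (isOpen_chartDom b) (by simp)).clm_apply
        (hW b).continuousOn)) fun y hy => ?_
    simp only [hH]
    rw [dirD_eq hWc (hχ c) (chartPt_mem hy), ext_chartPt hy]
  have hI : ∀ b (h : M → ℝ), ContinuousOn (fun y => h (chartPt b y)) (chartDom m b) →
      IntegrableOn (fun y => χ b (chartPt b y) * h (chartPt b y) * σ b y) (chartDom m b) := by
    intro b h hh
    obtain ⟨C, hC, hCV, h0⟩ := chartPartition_compact (n := m) b
    exact integrableOn_of_compact (isOpen_chartDom b) hC hCV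
      (((chartPartition_continuousOn b).mul hh).mul (hσ.smooth b).continuousOn)
      fun y hy hyC => by
        have : χ b (chartPt b y) = 0 := h0 y hy hyC
        rw [this, zero_mul, zero_mul]
  -- The integral, in the chart at c, of the divergence of a field with compact support.
  have hdiv0 : ∀ c, ∫ y in chartDom m c, H c (chartPt c y) * σ c y = 0 := by
    intro c
    obtain ⟨C, hC, hCV, h0⟩ := chartPartition_compact (n := m) c
    have h1 := (contDiffOn_chartPt (hχ c) c).of_le (show (1 : WithTop ℕ∞) ≤ ∞ by simp)
    have h2 := (h1.mul (hσ.smooth c)).smul (hW c)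
    rw [← integral_divergence_eq_zero (isOpen_chartDom c) hC hCV h2 fun y hy hyC => by
      have : χ c (chartPt c y) = 0 := h0 y hy hyC
      simp only [Pi.mul_apply, Pi.smul_apply', this, zero_mul, zero_smul]]
    refine setIntegral_congr_fun (isOpen_chartDom c).measurableSet fun y hy => ?_
    have hn := (isOpen_chartDom c).mem_nhds hy
    have d1 := ((h1.contDiffAt hn).differentiableAt (by simp)).hasFDerivAt
    have d2 := (((hσ.smooth c).contDiffAt hn).differentiableAt (by simp)).hasFDerivAt
    have d3 := (((hW c).contDiffAt hn).differentiableAt (by simp)).hasFDerivAt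
    have d4 : HasFDerivAt ((fun x => χ c (chartPt c x) * σ c x) • W c) _ y := (d1.mul d2).smul d3
    simp only [d4.fderiv, hH]
    rw [dirD_eq hWc (hχ c) (chartPt_mem hy), ext_chartPt hy, map_add, map_smul, trL_smulRight]
    simp only [add_apply, smul_apply, smul_eq_mul, Pi.mul_apply]
    linear_combination (- χ c (chartPt c y)) * hdiv c y hy
  -- Each product χ_b H_c is supported in both charts, so its integral can be moved to the chart at
  -- c, where the χ_b add up to one.
  have hbc : ∀ c, ∑ b ∈ T, ∫ y in chartDom m b, χ b (chartPt b y) * H c (chartPt b y) * σ b y = 0 := by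
    intro c
    have e : ∀ b ∈ T, ∫ y in chartDom m b, χ b (chartPt b y) * H c (chartPt b y) * σ b y =
        ∫ y in chartDom m c, χ b (chartPt c y) * H c (chartPt c y) * σ c y := fun b _ =>
      hσ.integral_eq (h := fun x => χ b x * H c x) fun x hx => by
        by_cases hxc : x ∈ (extChartAt (𝓡 m) c).source
        · have : x ∉ (extChartAt (𝓡 m) b).source := fun h => hx ⟨h, hxc⟩
          rw [image_eq_zero_of_notMem_tsupport fun h => this (hsub b h), zero_mul]
        · rw [hH0 c x hxc, mul_zero]
    rw [Finset.sum_congr rfl e, ← integral_finsetSum _ fun b _ => ?_, ← hdiv0 c]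
    · refine setIntegral_congr_fun (isOpen_chartDom c).measurableSet fun y hy => ?_
      simp only [mul_assoc]
      rw [← Finset.sum_mul, hsum, one_mul]
    · obtain ⟨C, hC, hCV, h0⟩ := chartPartition_compact (n := m) c
      refine integrableOn_of_compact (isOpen_chartDom c) hC hCV
        (((contDiffOn_chartPt (hχ b) c).continuousOn.mul (hHb c c)).mul (hσ.smooth c).continuousOn)
        fun y hy hyC => ?_
      have h1 : H c (chartPt c y) = 0 := by
        have hz : (fun y => χ c (chartPt c y)) =ᶠ[𝓝 y] fun _ => 0 := by
          filter_upwards [(isOpen_chartDom c).mem_nhds hy, hC.isClosed.isOpen_compl.mem_nhds hyC]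
            with z hz hzC using h0 z hz hzC
        simp only [hH]
        rw [dirD_eq hWc (hχ c) (chartPt_mem hy), ext_chartPt hy, hz.fderiv_eq]
        have : χ c (chartPt c y) = 0 := hz.self_of_nhds
        simp [this]
      rw [h1, mul_zero, zero_mul]
  -- Exchanging the two sums gives κ times the total mass of the density, and that mass is positive.
  have htot : κ * ∑ b ∈ T, ∫ y in chartDom m b, χ b (chartPt b y) * σ b y = 0 := by
    have h1 : ∑ c ∈ T, ∑ b ∈ T,
        ∫ y in chartDom m b, χ b (chartPt b y) * H c (chartPt b y) * σ b y = 0 :=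
      Finset.sum_eq_zero fun c _ => hbc c
    rw [Finset.sum_comm] at h1
    rw [← h1, Finset.mul_sum]
    refine Finset.sum_congr rfl fun b _ => ?_
    rw [← integral_finsetSum _ fun c _ => hI b (H c) (hHb b c), ← integral_const_mul]
    refine setIntegral_congr_fun (isOpen_chartDom b).measurableSet fun y hy => ?_
    rw [← Finset.sum_mul, ← Finset.mul_sum, hHsum]
    ring
  refine (mul_eq_zero.1 htot).resolve_right (ne_of_gt ?_)
  obtain ⟨p⟩ := ‹Nonempty M›
  obtain ⟨b, hbp⟩ := (chartPartition m M).exists_pos_of_mem (mem_univ p)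
  have hbT : b ∈ T := by
    rw [hT, Finite.mem_toFinset, mem_ofPred_eq]
    intro h0
    rw [h0] at hbp
    exact lt_irrefl _ hbp
  have hnn : ∀ b, ∀ y ∈ chartDom m b, 0 ≤ χ b (chartPt b y) * σ b y := fun b y hy =>
    mul_nonneg ((chartPartition m M).nonneg _ _) (hσ.pos b y hy).le
  refine Finset.sum_pos' (fun b _ => setIntegral_nonneg (isOpen_chartDom b).measurableSet (hnn b))
    ⟨b, hbT, ?_⟩
  obtain ⟨C, hC, hCV, h0⟩ := chartPartition_compact (n := m) b
  have hpb : p ∈ (extChartAt (𝓡 m) b).source := hsub b (subset_tsupport _ hbp.ne')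
  refine setIntegral_pos (w := fun y => χ b (chartPt b y) * σ b y) (isOpen_chartDom b) hC hCV
    ((chartPartition_continuousOn b).mul (hσ.smooth b).continuousOn)
    (fun y hy hyC => by
      have : χ b (chartPt b y) = 0 := h0 y hy hyC
      rw [this, zero_mul]) (hnn b) (ext_mem hpb) ?_
  rw [chartPt_ext hpb]
  exact mul_pos hbp (hσ.pos b _ (ext_mem hpb))

end ManifoldDivergence

/-! ### Symplectic forms on compact manifolds are not exact -/

section FormMatrix

variable {m : ℕ}

/-- The matrix of a bilinear form. -/
def formMat (B : EuclideanSpace ℝ (Fin m) →L[ℝ] EuclideanSpace ℝ (Fin m) →L[ℝ] ℝ) :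
    Matrix (Fin m) (Fin m) ℝ := Matrix.of fun i j => B (stdVec m i) (stdVec m j)

/-- The matrix of an endomorphism. -/
def endMat (A : EuclideanSpace ℝ (Fin m) →L[ℝ] EuclideanSpace ℝ (Fin m)) :
    Matrix (Fin m) (Fin m) ℝ := Matrix.of fun k i => A (stdVec m i) k

variable (A : EuclideanSpace ℝ (Fin m) →L[ℝ] EuclideanSpace ℝ (Fin m))
  (B : EuclideanSpace ℝ (Fin m) →L[ℝ] EuclideanSpace ℝ (Fin m) →L[ℝ] ℝ)

lemma det_endMat : (endMat A).det = A.det := by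
  have : endMat A = LinearMap.toMatrix (EuclideanSpace.basisFun (Fin m) ℝ).toBasis
      (EuclideanSpace.basisFun (Fin m) ℝ).toBasis (A : _ →ₗ[ℝ] _) := by
    ext i j
    simp [endMat, LinearMap.toMatrix_apply, stdVec]
  rw [this, LinearMap.det_toMatrix]

lemma trace_endMat : (endMat A).trace = trL A := by
  rw [trL_eq_sum]
  rfl

lemma transpose_endMat_mul (i j : Fin m) :
    ((endMat A)ᵀ * formMat B) i j = B (A (stdVec m i)) (stdVec m j) := by
  conv_rhs => rw [sum_stdVec (A (stdVec m i))]
  simp only [map_sum, map_smul, sum_apply, smul_apply, smul_eq_mul, Matrix.mul_apply,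
    Matrix.transpose_apply, endMat, formMat, Matrix.of_apply]

lemma mul_endMat (i j : Fin m) :
    (formMat B * endMat A) i j = B (stdVec m i) (A (stdVec m j)) := by
  conv_rhs => rw [sum_stdVec (A (stdVec m j))]
  simp only [map_sum, map_smul, smul_eq_mul, Matrix.mul_apply, endMat, formMat, Matrix.of_apply,
    mul_comm]

lemma det_formMat_comp {B' : EuclideanSpace ℝ (Fin m) →L[ℝ] EuclideanSpace ℝ (Fin m) →L[ℝ] ℝ}
    (h : ∀ u v, B' u v = B (A u) (A v)) : (formMat B').det = A.det ^ 2 * (formMat B).det := by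
  have : formMat B' = (endMat A)ᵀ * formMat B * endMat A := by
    ext i j
    rw [mul_assoc, Matrix.mul_apply]
    simp only [mul_endMat, Matrix.transpose_apply]
    rw [formMat, Matrix.of_apply, h]
    conv_lhs => rw [sum_stdVec (A (stdVec m i))]
    simp only [map_sum, map_smul, sum_apply, smul_apply, smul_eq_mul, endMat, Matrix.of_apply]
  rw [this, Matrix.det_mul, Matrix.det_mul, Matrix.det_transpose, det_endMat]
  ring

lemma det_formMat_ne_zero (h : ∀ u, (∀ v, B u v = 0) → u = 0) : (formMat B).det ≠ 0 := by
  intro h0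
  obtain ⟨a, ha, ha0⟩ := Matrix.exists_vecMul_eq_zero_iff.2 h0
  refine ha ?_
  have h1 : (WithLp.toLp 2 a : EuclideanSpace ℝ (Fin m)) = 0 := by
    refine h _ fun v => ?_
    have h2 : ∀ j, B (WithLp.toLp 2 a) (stdVec m j) = 0 := by
      intro j
      rw [sum_stdVec (WithLp.toLp 2 a)]
      simpa [Matrix.vecMul, dotProduct, formMat] using congrFun ha0 j
    rw [sum_stdVec v, map_sum]
    exact Finset.sum_eq_zero fun j _ => by rw [map_smul, h2, smul_zero]
  funext k
  exact congrArg (fun v : EuclideanSpace ℝ (Fin m) => v k) h1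

/-- The density `|det B|^{1/2}` of a bilinear form. -/
def formDensity : ℝ := √|(formMat B).det|

variable {B} {η : EuclideanSpace ℝ (Fin m) →
    EuclideanSpace ℝ (Fin m) →L[ℝ] EuclideanSpace ℝ (Fin m) →L[ℝ] ℝ} {y w : EuclideanSpace ℝ (Fin m)}

lemma contDiffAt_formDensity (hη : ContDiffAt ℝ ∞ η y) (hd : ∀ u, (∀ v, η y u v = 0) → u = 0) :
    ContDiffAt ℝ ∞ (fun y => formDensity (η y)) y := by
  have h1 : ContDiffAt ℝ ∞ (fun y => (formMat (η y)).det) y := by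
    simp only [Matrix.det_apply]
    refine ContDiffAt.sum fun σ _ => ?_
    exact (contDiffAt_prod fun i _ => ((hη.clm_apply contDiffAt_const).clm_apply
      contDiffAt_const)).const_smul _
  have h0 := det_formMat_ne_zero _ hd
  exact ContDiffAt.sqrt (h1.abs h0) (abs_ne_zero.2 h0)

/-- The derivative of the density along a conformal vector field. -/
lemma fderiv_formDensity (hη : ContDiffAt ℝ ∞ η y) (hd : ∀ u, (∀ v, η y u v = 0) → u = 0) {κ : ℝ}
    (h : ∀ u v, fderiv ℝ η y w u v + η y (A u) v + η y u (A v) = κ * η y u v) :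
    formDensity (η y) * trL A + fderiv ℝ (fun y => formDensity (η y)) y w =
      (κ * m / 2) * formDensity (η y) := by
  have hl : HasDerivAt (fun s : ℝ => y + s • w) w 0 := by
    simpa using ((hasDerivAt_id (0 : ℝ)).smul_const w).const_add y
  have hl0 : y + (0 : ℝ) • w = y := by simp
  have h1 : HasDerivAt (fun s : ℝ => η (y + s • w)) (fderiv ℝ η y w) 0 := by
    have h2 : HasFDerivAt η (fderiv ℝ η y) (y + (0 : ℝ) • w) := by
      rw [hl0]; exact (hη.differentiableAt (by simp)).hasFDerivAt
    exact h2.comp_hasDerivAt 0 hl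
  have h2 : HasDerivAt (fun s : ℝ => formDensity (η (y + s • w)))
      (fderiv ℝ (fun y => formDensity (η y)) y w) 0 := by
    have h3 : HasFDerivAt (fun y => formDensity (η y)) (fderiv ℝ (fun y => formDensity (η y)) y)
        (y + (0 : ℝ) • w) := by
      rw [hl0]
      exact ((contDiffAt_formDensity hη hd).differentiableAt (by simp)).hasFDerivAt
    exact h3.comp_hasDerivAt 0 hl
  set Ω := formMat (η y) with hΩ
  have h0 : Ω.det ≠ 0 := det_formMat_ne_zero _ hd
  -- By the conformal relation `h` this is the derivative of the matrix of the form along w.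
  set D := κ • Ω - (endMat A)ᵀ * Ω - Ω * endMat A with hD
  have h3 : ∀ i j, HasDerivAt (fun s : ℝ => formMat (η (y + s • w)) i j) (D i j) 0 := by
    intro i j
    have := (h1.clm_apply (hasDerivAt_const (0 : ℝ) (stdVec m i))).clm_apply
      (hasDerivAt_const (0 : ℝ) (stdVec m j))
    refine this.congr_deriv ?_
    rw [hD, Matrix.sub_apply, Matrix.sub_apply, transpose_endMat_mul, mul_endMat, Matrix.smul_apply,
      hΩ, formMat, Matrix.of_apply, smul_eq_mul, ← h]
    simp
    ring
  have h4 := hasDerivAt_det h3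
  -- The two products with A have the same trace against the adjugate; this accounts for 2 tr A,
  -- which becomes tr A after the square root.
  have h5 : ((formMat (η (y + (0 : ℝ) • w))).adjugate * D).trace = Ω.det * (κ * m - 2 * trL A) := by
    rw [hl0, ← hΩ, hD, mul_sub, mul_sub, Matrix.trace_sub, Matrix.trace_sub, Matrix.mul_smul,
      ← mul_assoc Ω.adjugate Ω, Matrix.adjugate_mul, Matrix.trace_smul, Matrix.trace_smul,
      Matrix.trace_one, Matrix.smul_mul, one_mul, Matrix.trace_smul, trace_endMat,
      Matrix.trace_mul_comm, mul_assoc, Matrix.mul_adjugate, Matrix.mul_smul, mul_one,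
      Matrix.trace_smul, Matrix.trace_transpose, trace_endMat]
    simp only [smul_eq_mul, Fintype.card_fin]
    ring
  rw [h5] at h4
  have h6 : HasDerivAt (fun s : ℝ => formDensity (η (y + s • w)))
      (|Ω.det| * (κ * m - 2 * trL A) / (2 * √|Ω.det|)) 0 := by
    have hne : (formMat (η (y + (0 : ℝ) • w))).det ≠ 0 := by rwa [hl0]
    have h8 : HasDerivAt (fun s : ℝ => |(formMat (η (y + s • w))).det|) _ 0 :=
      HasDerivAt.comp (h₂ := fun x : ℝ => |x|) (0 : ℝ) (hasDerivAt_abs hne) h4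
    have h7 := h8.sqrt (abs_ne_zero.2 hne)
    refine h7.congr_deriv ?_
    rw [hl0, ← hΩ, ← mul_assoc, sign_mul_self]
  rw [h2.unique h6, formDensity]
  have hpos : 0 < √|Ω.det| := Real.sqrt_pos.2 (abs_pos.2 h0)
  have hsq : |Ω.det| = √|Ω.det| ^ 2 := (Real.sq_sqrt (abs_nonneg _)).symm
  rw [← hΩ]
  set r := √|Ω.det|
  rw [hsq]
  field_simp
  ring

end FormMatrix

/-! ### Kähler forms on compact manifolds are not exact -/

section Exact

/-- If `γ` is a primitive of `κ` times a symplectic form `η`, the vector field `X` with `η(X, ·) = γ`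
is conformally symplectic. -/
lemma fderiv_form_of_primitive {E : Type*} [NormedAddCommGroup E] [NormedSpace ℝ E]
    [FiniteDimensional ℝ E] {U : Set E} (hU : IsOpen U) {η : E → E →L[ℝ] E →L[ℝ] ℝ}
    (hη : ContDiffOn ℝ ∞ η U) (hskew : ∀ y ∈ U, ∀ u v, η y u v = -η y v u)
    (hcl : ∀ y ∈ U, ∀ u v w, fderiv ℝ η y u v w + fderiv ℝ η y v w u + fderiv ℝ η y w u v = 0)
    {γ : E → E →L[ℝ] ℝ} {X : E → E} (hX : ContDiffOn ℝ 1 X U) (hγX : ∀ y ∈ U, η y (X y) = γ y)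
    {κ : ℝ} (hγ : ∀ y ∈ U, ∀ u v, fderiv ℝ γ y u v - fderiv ℝ γ y v u = κ * η y u v) {y : E}
    (hy : y ∈ U) (u v : E) :
    fderiv ℝ η y (X y) u v + η y (fderiv ℝ X y u) v + η y u (fderiv ℝ X y v) = κ * η y u v := by
  have hn := hU.mem_nhds hy
  have h1 := ((hη.contDiffAt hn).differentiableAt (by simp)).hasFDerivAt
  have h2 := ((hX.contDiffAt hn).differentiableAt (by simp)).hasFDerivAt
  have h3 := (h1.clm_apply h2).congr_of_eventuallyEq (f₁ := γ) (by
    filter_upwards [hn] with z hz using (hγX z hz).symm)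
  have sk : ∀ w u v, fderiv ℝ η y w u v = -fderiv ℝ η y w v u := by
    intro w u v
    have a1 := (h1.clm_apply (hasFDerivAt_const u y)).clm_apply (hasFDerivAt_const v y)
    have a2 := ((h1.clm_apply (hasFDerivAt_const v y)).clm_apply
      (hasFDerivAt_const u y)).neg.congr_of_eventuallyEq (f₁ := fun z => η z u v) (by
        filter_upwards [hn] with z hz using hskew z hz u v)
    have := congrArg (fun T => T w) (a1.unique a2)
    simpa using this
  -- Cartan's formula for a closed form: dγ = d(η(X, ·)) = L_Xη.
  have h4 := hγ y hy u v
  rw [h3.fderiv] at h4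
  simp only [add_apply, ContinuousLinearMap.comp_apply, ContinuousLinearMap.flip_apply] at h4
  have h5 := hcl y hy u (X y) v
  rw [sk v u (X y)] at h5
  rw [hskew y hy (fderiv ℝ X y v) u, sk u (X y) v] at h4
  rw [sk u (X y) v, sk (X y) v u] at h5
  linarith

variable {n : ℕ} {M : Type*} [TopologicalSpace M] [ChartedSpace (EuclideanSpace ℝ (Fin (2 * n))) M]
  [IsManifold (𝓡 (2 * n)) ∞ M]

/-- The coordinate expression of the Kähler form. -/
def formC (K : KahlerStructure n M) (c : M) (y : EuclideanSpace ℝ (Fin (2 * n))) :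
    EuclideanSpace ℝ (Fin (2 * n)) →L[ℝ] EuclideanSpace ℝ (Fin (2 * n)) →L[ℝ] ℝ :=
  (bC K.g c y).comp (eC K.J c y)

namespace KahlerStructure

variable (K : KahlerStructure n M) (c : M) {y : EuclideanSpace ℝ (Fin (2 * n))}

lemma contDiffOn_formC : ContDiffOn ℝ ∞ (formC K c) (chartDom (2 * n) c) :=
  (contDiffOn_bC K.smooth_g c).clm_comp (contDiffOn_eC K.smooth_J c)

variable {c}

lemma formC_skew (hy : y ∈ chartDom (2 * n) c) (u v : EuclideanSpace ℝ (Fin (2 * n))) :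
    formC K c y u v = -formC K c y v u := by
  have h := K.isKahlerOn c
  simp only [formC, ContinuousLinearMap.comp_apply]
  rw [h.g_J_skew hy, h.symm y hy]

lemma formC_nondegenerate (hy : y ∈ chartDom (2 * n) c) (u : EuclideanSpace ℝ (Fin (2 * n)))
    (hu : ∀ v, formC K c y u v = 0) : u = 0 := by
  have h := K.isKahlerOn c
  have h1 : eC K.J c y u = 0 := h.nondeg hy _ hu
  have h2 := h.J_J hy u
  rw [h1, map_zero] at h2
  exact neg_eq_zero.1 h2.symm

lemma formC_trans {d : M} (hy : y ∈ transDom c d) (u v : EuclideanSpace ℝ (Fin (2 * n))) :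
    formC K c y u v = formC K d (trans c d y) (fderiv ℝ (trans c d) y u)
      (fderiv ℝ (trans c d) y v) := by
  have h := K.isKahlerIso c d
  simp only [formC, ContinuousLinearMap.comp_apply]
  rw [h.g_eq y hy, h.J_eq y hy]

/-- A change of chart multiplies the determinant of the form by the square of the Jacobian, so its
square root acquires the absolute value. Densities make a choice of orientation unnecessary. -/
lemma isDensity : IsDensity fun (c : M) y => formDensity (formC K c y) where
  smooth c y hy := ((contDiffAt_formDensity ((K.contDiffOn_formC c).contDiffAt
    ((isOpen_chartDom c).mem_nhds hy)) (K.formC_nondegenerate hy)).of_le (by simp)).contDiffWithinAt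
  pos c y hy := Real.sqrt_pos.2 (abs_pos.2 (det_formMat_ne_zero _ (K.formC_nondegenerate hy)))
  compat c d y hy := by
    rw [formDensity, formDensity, det_formMat_comp _ _ (K.formC_trans hy), abs_mul, abs_pow,
      Real.sqrt_mul (by positivity), Real.sqrt_sq (abs_nonneg _)]

/-- Non-zero multiples of Kähler forms on compact manifolds are not exact. -/
theorem eq_zero_of_primitive [T2Space M] [CompactSpace M] [Nonempty M] (hn : 0 < n)
    {γ : M → EuclideanSpace ℝ (Fin (2 * n)) → EuclideanSpace ℝ (Fin (2 * n)) →L[ℝ] ℝ}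
    (hγ : ∀ c, ContDiffOn ℝ 1 (γ c) (chartDom (2 * n) c))
    (hγc : ∀ c d : M, ∀ y ∈ transDom c d, ∀ v,
      γ c y v = γ d (trans c d y) (fderiv ℝ (trans c d) y v)) {κ : ℝ}
    (hκ : ∀ c, ∀ y ∈ chartDom (2 * n) c, ∀ u v,
      fderiv ℝ (γ c) y u v - fderiv ℝ (γ c) y v u = κ * formC K c y u v) : κ = 0 := by
  have hinv : ∀ c, ∀ y ∈ chartDom (2 * n) c, (formC K c y).IsInvertible := fun c y hy =>
    isInvertible_of_nondegenerate (K.formC_nondegenerate hy)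
  set X : M → EuclideanSpace ℝ (Fin (2 * n)) → EuclideanSpace ℝ (Fin (2 * n)) := fun c y =>
    (formC K c y).inverse (γ c y) with hXdef
  have hXγ : ∀ c, ∀ y ∈ chartDom (2 * n) c, formC K c y (X c y) = γ c y := fun c y hy =>
    (hinv c y hy).self_apply_inverse _
  have hX : ∀ c, ContDiffOn ℝ 1 (X c) (chartDom (2 * n) c) := fun c => by
    refine ContDiffOn.clm_apply (fun y hy => ?_) (hγ c)
    exact (((hinv c y hy).contDiffAt_map_inverse (n := ∞)).comp y ((K.contDiffOn_formC c).contDiffAt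
      ((isOpen_chartDom c).mem_nhds hy))).of_le (by simp) |>.contDiffWithinAt
  -- The dual field scales the form by κ in dimension 2n, so it scales the density |det|^{1/2} by κ
  -- · 2n / 2, which must therefore vanish.
  have h := divergence_eq_zero (κ := κ * (2 * n : ℕ) / 2) K.isDensity hX (fun c d y hy => ?_)
    fun c y hy => fderiv_formDensity _ ((K.contDiffOn_formC c).contDiffAt
      ((isOpen_chartDom c).mem_nhds hy)) (K.formC_nondegenerate hy)
      (fderiv_form_of_primitive (isOpen_chartDom c) (K.contDiffOn_formC c)
        (fun y hy => K.formC_skew hy) (fun y hy u v w => (K.isKahlerOn c).closed y hy u v w)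
        (hX c) (hXγ c) (hκ c) hy)
  · have h2 : ((2 * n : ℕ) : ℝ) ≠ 0 := by positivity
    have h3 : κ * ((2 * n : ℕ) : ℝ) = 0 := by linarith
    exact (mul_eq_zero.1 h3).resolve_right h2
  · refine ext_of_nondegenerate (K.formC_nondegenerate (trans_mem hy).1) fun w => ?_
    obtain ⟨v, rfl⟩ := (fderiv_trans_isInvertible hy).surjective w
    rw [← K.formC_trans hy, hXγ c y hy.1, hXγ d _ (trans_mem hy).1, hγc c d y hy]

end KahlerStructure

end Exact

/-! ### Einstein constants along curves of Kähler–Einstein structures -/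

section Einstein

open MeasureTheory

variable {n : ℕ} {M : Type*} [TopologicalSpace M] [ChartedSpace (EuclideanSpace ℝ (Fin (2 * n))) M]
  [IsManifold (𝓡 (2 * n)) ∞ M] {S : Set ℝ} {K : ℝ → KahlerStructure n M}

/-- In a smooth curve of Kähler structures the Ricci forms differ by an exact form. -/
lemma exists_primitive_rho (hS : IsInterval S) (hK : IsSmoothCurve S K) {a b : ℝ} (ha : a ∈ S)
    (hb : b ∈ S) :
    ∃ γ : M → EuclideanSpace ℝ (Fin (2 * n)) → EuclideanSpace ℝ (Fin (2 * n)) →L[ℝ] ℝ,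
      (∀ c, ContDiffOn ℝ 1 (γ c) (chartDom (2 * n) c)) ∧
      (∀ c d : M, ∀ y ∈ transDom c d, ∀ v,
        γ c y v = γ d (trans c d y) (fderiv ℝ (trans c d) y v)) ∧
      ∀ c, ∀ y ∈ chartDom (2 * n) c, ∀ u v, fderiv ℝ (γ c) y u v - fderiv ℝ (γ c) y v u =
        rho (bC (K b).g c) (eC (K b).J c) y u v - rho (bC (K a).g c) (eC (K a).J c) y u v := by
  have hab : uIcc a b ⊆ S := hS.ord.uIcc_subset ha hb
  set β : M → ℝ → EuclideanSpace ℝ (Fin (2 * n)) → EuclideanSpace ℝ (Fin (2 * n)) →L[ℝ] ℝ :=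
    fun c => beta S (fun t => bC (K t).g c) (fun t => eC (K t).J c) with hβ
  have hβs : ∀ c, ContDiffOn ℝ ∞ (fun p : ℝ × EuclideanSpace ℝ (Fin (2 * n)) => β c p.1 p.2)
      (S ×ˢ chartDom (2 * n) c) := fun c =>
    (hK.isKahlerFamily c).contDiffOn_beta hS (isOpen_chartDom c)
  have hint : ∀ c, ∀ y ∈ chartDom (2 * n) c, IntervalIntegrable (fun t => β c t y) volume a b :=
    fun c y hy => ContinuousOn.intervalIntegrable ((hβs c).continuousOn.comp (f := fun t => (t, y))
      (by fun_prop) fun t ht => ⟨hab ht, hy⟩)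
  -- The primitive is the integral of β_t over time: exterior differentiation passes under the
  -- integral, and the fundamental theorem of calculus applies to ∂_tρ_t = dβ_t.
  refine ⟨fun c y => ∫ t in a..b, β c t y, fun c => contDiffOn_intervalIntegral hS
    (isOpen_chartDom c) hab (hβs c), fun c d y hy v => ?_, fun c y hy u v => ?_⟩
  · change (∫ t in a..b, β c t y) v =
      (∫ t in a..b, β d t (trans c d y)) (fderiv ℝ (trans c d) y v)
    rw [ContinuousLinearMap.intervalIntegral_apply (hint c y hy.1),
      ContinuousLinearMap.intervalIntegral_apply (hint d _ (trans_mem hy).1)]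
    refine intervalIntegral.integral_congr fun t ht => ?_
    exact beta_eq hS ((hK.isKahlerFamily c).mono (isOpen_transDom c d) inter_subset_left)
      ((hK.isKahlerFamily d).mono (isOpen_transDom d c) inter_subset_left)
      (fun t _ => (K t).isKahlerIso c d) (hab ht) hy v
  · have hβ' := contDiffOn_fderiv_family hS (isOpen_chartDom c) (hβs c)
    have hc1 : ContinuousOn (fun t => fderiv ℝ (β c t) y) (uIcc a b) :=
      hβ'.continuousOn.comp (f := fun t => (t, y)) (by fun_prop) fun t ht => ⟨hab ht, hy⟩
    have hc2 : ∀ u v, ContinuousOn (fun t => fderiv ℝ (β c t) y u v) (uIcc a b) := fun u v =>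
      (hc1.clm_apply continuousOn_const).clm_apply continuousOn_const
    rw [(hasFDerivAt_intervalIntegral hS (isOpen_chartDom c) hab (hβs c) hy).fderiv]
    have happ : ∀ u v, (∫ t in a..b, fderiv ℝ (β c t) y) u v =
        ∫ t in a..b, fderiv ℝ (β c t) y u v := fun u v => by
      rw [ContinuousLinearMap.intervalIntegral_apply hc1.intervalIntegrable,
        ContinuousLinearMap.intervalIntegral_apply
          (hc1.clm_apply continuousOn_const).intervalIntegrable]
    rw [happ, happ, ← intervalIntegral.integral_sub (hc2 u v).intervalIntegrable
      (hc2 v u).intervalIntegrable]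
    have hd : ∀ t ∈ S, HasDerivWithinAt (fun s => rho (bC (K s).g c) (eC (K s).J c) y u v)
        (fderiv ℝ (β c t) y u v - fderiv ℝ (β c t) y v u) S t := by
      intro t ht
      have hF := (((contDiffOn_slice (hβs c) ht).contDiffAt
        ((isOpen_chartDom c).mem_nhds hy)).differentiableAt (by simp)).hasFDerivAt
      have e : ∀ w, fderiv ℝ (fun z => β c t z w) y = (fderiv ℝ (β c t) y).flip w := fun w => by
        have := hF.clm_apply (hasFDerivAt_const w y)
        rw [this.fderiv]
        ext x
        simp
      have := (hK.isKahlerFamily c).hasDerivWithinAt_rho hS (isOpen_chartDom c) ht hy u v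
      refine this.congr_deriv ?_
      have e1 := congrArg (fun T => T u) (e v)
      have e2 := congrArg (fun T => T v) (e u)
      exact congrArg₂ (· - ·) e1 e2
    refine intervalIntegral.integral_eq_sub_of_hasDeriv_right
      (f := fun s => rho (bC (K s).g c) (eC (K s).J c) y u v)
      (fun t ht => ((hd t (hab ht)).continuousWithinAt).mono hab) (fun t ht => ?_)
      ((hc2 u v).sub (hc2 v u)).intervalIntegrable
    have hn : S ∈ 𝓝 t := mem_of_superset (Icc_mem_nhds ht.1 ht.2) hab
    exact ((hd t (mem_of_mem_nhds hn)).hasDerivAt hn).hasDerivWithinAt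

lemma rho_eq_of_einstein {K : KahlerStructure n M} {lam : ℝ}
    (h : ∀ x v w, K.ricciForm x v w = lam * K.form x v w) (c : M)
    {y : EuclideanSpace ℝ (Fin (2 * n))} (hy : y ∈ chartDom (2 * n) c)
    (u v : EuclideanSpace ℝ (Fin (2 * n))) :
    rho (bC K.g c) (eC K.J c) y u v = lam * formC K c y u v := by
  obtain ⟨x, hx, rfl, hs⟩ := exists_vecC hy
  obtain ⟨u, rfl⟩ := hs u
  obtain ⟨v, rfl⟩ := hs v
  rw [← K.ricciForm_eq hx, h, formC, K.bC_form_apply c hx]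

/-- On a compact manifold the Einstein constant of a curve of Kähler–Einstein structures cannot
become zero. -/
theorem einstein_ne_zero [T2Space M] [CompactSpace M] [Nonempty M] (hn : 0 < n) (hS : IsInterval S)
    (hK : IsSmoothCurve S K) {lam : ℝ → ℝ}
    (h : ∀ t ∈ S, ∀ x v w, (K t).ricciForm x v w = lam t * (K t).form x v w) {a b : ℝ} (ha : a ∈ S)
    (hb : b ∈ S) (hla : lam a ≠ 0) : lam b ≠ 0 := by
  intro hlb
  obtain ⟨γ, h1, h2, h3⟩ := exists_primitive_rho hS hK ha hb
  -- With λ_b = 0 the difference of the Ricci forms is -λ_a ω_a, and γ is a primitive of it.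
  refine hla (neg_eq_zero.1 ((K a).eq_zero_of_primitive hn h1 h2 (κ := -lam a) fun c y hy u v => ?_))
  rw [h3 c y hy, rho_eq_of_einstein (h b hb) c hy, rho_eq_of_einstein (h a ha) c hy, hlb]
  ring

/-- The Einstein constant of a curve of Kähler–Einstein structures stays non-zero for a short
time. -/
lemma einstein_eventually_ne_zero [Nonempty M] (hn : 0 < n) (hS : IsInterval S)
    (hK : IsSmoothCurve S K) {lam : ℝ → ℝ}
    (h : ∀ t ∈ S, ∀ x v w, (K t).ricciForm x v w = lam t * (K t).form x v w) {a : ℝ} (ha : a ∈ S)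
    (hla : lam a ≠ 0) : ∀ᶠ t in 𝓝[S] a, lam t ≠ 0 := by
  obtain ⟨c⟩ := ‹Nonempty M›
  have hy := ext_mem (mem_extChartAt_source (I := 𝓡 (2 * n)) c)
  set y := extChartAt (𝓡 (2 * n)) c c
  have hu : stdVec (2 * n) ⟨0, by omega⟩ ≠ 0 := fun h0 => by
    have := congrArg (fun v : EuclideanSpace ℝ (Fin (2 * n)) => v ⟨0, by omega⟩) h0
    simp [stdVec_apply] at this
  -- Continuity in t is available for ρ_t but is not assumed for λ_t, so ρ_t is evaluated at one
  -- point on one pair of vectors with ω_a ≠ 0.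
  obtain ⟨v, hv⟩ : ∃ v, formC (K a) c y (stdVec (2 * n) ⟨0, by omega⟩) v ≠ 0 := by
    by_contra! h0
    exact hu ((K a).formC_nondegenerate hy _ h0)
  have hcont : ContinuousWithinAt (fun t => rho (bC (K t).g c) (eC (K t).J c) y
      (stdVec (2 * n) ⟨0, by omega⟩) v) S a := by
    have h1 := ((hK.isKahlerFamily c).contDiffOn_rho hS (isOpen_chartDom c)).continuousOn.comp
      (f := fun t => (t, y)) (by fun_prop) (fun t (ht : t ∈ S) => ⟨ht, hy⟩)
    exact ((h1.clm_apply continuousOn_const).clm_apply continuousOn_const) a ha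
  have hne : rho (bC (K a).g c) (eC (K a).J c) y (stdVec (2 * n) ⟨0, by omega⟩) v ≠ 0 := by
    rw [rho_eq_of_einstein (h a ha) c hy]
    exact mul_ne_zero hla hv
  filter_upwards [hcont.eventually_ne hne, self_mem_nhdsWithin] with t ht htS h0
  exact ht (by rw [rho_eq_of_einstein (h t htS) c hy, h0, zero_mul])

lemma einstein_nondegenerate {K : KahlerStructure n M} {lam : ℝ} (hl : lam ≠ 0)
    (h : ∀ x v w, K.ricciForm x v w = lam * K.form x v w) (x : M) (v : TangentSpace (𝓡 (2 * n)) x)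
    (hv : ∀ w, K.ricciForm x v w = 0) : v = 0 := by
  have hx := mem_extChartAt_source (I := 𝓡 (2 * n)) x
  apply (vecC_bijective hx).1
  rw [map_zero]
  refine K.formC_nondegenerate (ext_mem hx) _ fun w => ?_
  obtain ⟨w, rfl⟩ := (vecC_bijective hx).2 w
  rw [formC, K.bC_form_apply x hx]
  exact (mul_eq_zero.1 ((h x v w).symm.trans (hv w))).resolve_left hl

end Einstein

/-! ### Assembling the Kähler–Einstein case -/

section Final

variable {n : ℕ} {M : Type*} [TopologicalSpace M] [ChartedSpace (EuclideanSpace ℝ (Fin (2 * n))) M]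
  {L : Type*} [TopologicalSpace L] [ChartedSpace (EuclideanSpace ℝ (Fin n)) L]

lemma hasLagrangianCurve_const {S : Set ℝ} (hS : ∀ t ∈ S, t = 0)
    {B : ℝ → ∀ x : M, TangentSpace (𝓡 (2 * n)) x → TangentSpace (𝓡 (2 * n)) x → ℝ} {f : L → M}
    (hf : IsSmoothImmersion (n := n) f) (hB : IsLagrangian (B 0) f) : HasLagrangianCurve S B f :=
  ⟨fun _ => f, rfl, (hf.1.comp contMDiff_snd).contMDiffOn, fun t ht => ⟨hf, by rwa [hS t ht]⟩⟩

lemma HasLagrangianCurve.congr {S : Set ℝ}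
    {B B' : ℝ → ∀ x : M, TangentSpace (𝓡 (2 * n)) x → TangentSpace (𝓡 (2 * n)) x → ℝ} {f : L → M}
    (h : HasLagrangianCurve S B f)
    (hB : ∀ t ∈ S, ∀ x v w, B t x v w = 0 → B' t x v w = 0) : HasLagrangianCurve S B' f := by
  obtain ⟨F, h0, hs, hF⟩ := h
  exact ⟨F, h0, hs, fun t ht => ⟨(hF t ht).1, fun p v w => hB t ht _ _ _ ((hF t ht).2 p v w)⟩⟩

/-- The parameter set may be the single point 0, where derivatives within it carry no information;
the constant curve serves in that case. -/
lemma OrdConnected.isInterval_or {S : Set ℝ} (hS : S.OrdConnected) (h0 : (0 : ℝ) ∈ S) :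
    IsInterval S ∨ ∀ t ∈ S, t = 0 := by
  rcases S.subsingleton_or_nontrivial with h | h
  · exact Or.inr fun t ht => h ht h0
  · exact Or.inl ⟨hS, h⟩

lemma form_eq_zero_of_ricciForm {K : KahlerStructure n M} {lam : ℝ} (hl : lam ≠ 0)
    (h : ∀ x v w, K.ricciForm x v w = lam * K.form x v w) {x : M} {v w : TangentSpace (𝓡 (2 * n)) x}
    (hv : K.ricciForm x v w = 0) : K.form x v w = 0 :=
  (mul_eq_zero.1 ((h x v w).symm.trans hv)).resolve_left hl

variable [IsManifold (𝓡 (2 * n)) ∞ M] [T2Space M] [SecondCountableTopology M]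
  [CompactSpace L] [IsManifold (𝓡 n) ∞ L] {S : Set ℝ} {K : ℝ → KahlerStructure n M}

/-- Positive dimension and non-emptiness supply a non-zero tangent vector, which a zero constant
would place in the kernel of ρ. -/
lemma einstein_ne_zero_of_definite [Nonempty M] (hn : 0 < n) {K : KahlerStructure n M}
    (hK : K.HasDefiniteRicci) {lam : ℝ} (h : ∀ x v w, K.ricciForm x v w = lam * K.form x v w) :
    lam ≠ 0 := by
  intro h0
  obtain ⟨c⟩ := ‹Nonempty M›
  have hx := mem_extChartAt_source (I := 𝓡 (2 * n)) c
  obtain ⟨v, hv⟩ := (vecC_bijective hx).2 (stdVec (2 * n) ⟨0, by omega⟩)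
  have hv0 := hK.nondegenerate c v fun w => by rw [h, h0, zero_mul]
  rw [hv0, map_zero] at hv
  have := congrArg (fun v : EuclideanSpace ℝ (Fin (2 * n)) => v ⟨0, by omega⟩) hv
  simp [stdVec_apply] at this

/-- Deforming Lagrangian immersions along curves of Kähler–Einstein structures. -/
theorem exists_hasLagrangianCurve_einstein (hS : S.OrdConnected) (h0 : (0 : ℝ) ∈ S)
    (hK : IsSmoothCurve S K) (hd : (K 0).HasDefiniteRicci)
    (hE : ∀ t ∈ S, (K t).IsKahlerEinstein) {f : L → M} (hf : IsSmoothImmersion (n := n) f)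
    (hfl : IsLagrangian (K 0).ricciForm f) :
    ∃ U : Set ℝ, IsOpen U ∧ U.OrdConnected ∧ (0 : ℝ) ∈ U ∧ (CompactSpace M → U = univ) ∧
      HasLagrangianCurve (S ∩ U) (fun t x v w => (K t).form x v w) f := by
  choose! lam hlam using hE
  -- In dimension zero all tangent vectors vanish, so definiteness says nothing about λ, but every
  -- form is zero and the constant curve works.
  rcases eq_or_ne n 0 with rfl | hn
  · have hz : ∀ (x : M) (v : TangentSpace (𝓡 (2 * 0)) x), v = 0 := fun x v => by
      have : Subsingleton (EuclideanSpace ℝ (Fin (2 * 0))) :=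
        inferInstanceAs (Subsingleton (EuclideanSpace ℝ (Fin 0)))
      exact this.elim v 0
    refine ⟨univ, isOpen_univ, ordConnected_univ, mem_univ _, fun _ => rfl, fun _ => f, rfl,
      (hf.1.comp contMDiff_snd).contMDiffOn, fun t _ => ⟨hf, fun p v w => ?_⟩⟩
    change (K t).form (f p) (mfderiv (𝓡 0) (𝓡 (2 * 0)) f p v) _ = 0
    rw [hz _ (mfderiv (𝓡 0) (𝓡 (2 * 0)) f p v), map_zero]
    rfl
  have hn := Nat.pos_of_ne_zero hn
  -- On an empty M the Einstein constant is arbitrary as well; L is then empty too, and there is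
  -- nothing to check.
  rcases isEmpty_or_nonempty M with hM | hM
  · exact ⟨univ, isOpen_univ, ordConnected_univ, mem_univ _, fun _ => rfl, fun _ => f, rfl,
      (hf.1.comp contMDiff_snd).contMDiffOn, fun t _ => ⟨hf, fun p => (hM.false (f p)).elim⟩⟩
  have hl0 := einstein_ne_zero_of_definite hn hd (hlam 0 h0)
  rcases OrdConnected.isInterval_or hS h0 with hI | hI
  -- The set named `ε` is an open interval of times on which λ does not vanish: everything if M is
  -- compact, a ball around 0 otherwise.
  · obtain ⟨ε, hε, hne, hcomp⟩ : ∃ O : Set ℝ, (IsOpen O ∧ O.OrdConnected ∧ (0 : ℝ) ∈ O) ∧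
        (∀ t ∈ S ∩ O, lam t ≠ 0) ∧ (CompactSpace M → O = univ) := by
      by_cases hc : CompactSpace M
      · exact ⟨univ, ⟨isOpen_univ, ordConnected_univ, mem_univ _⟩, fun t ht =>
          einstein_ne_zero hn hI hK hlam h0 ht.1 hl0, fun _ => rfl⟩
      · obtain ⟨δ, hδ, hball⟩ := Metric.mem_nhdsWithin_iff.1
          (einstein_eventually_ne_zero hn hI hK hlam h0 hl0)
        exact ⟨ball 0 δ, ⟨isOpen_ball, (convex_ball (0 : ℝ) δ).ordConnected, mem_ball_self hδ⟩,
          fun t ht => hball ht.symm, fun h => (hc h).elim⟩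
    have hI' : IsInterval (S ∩ ε) := hI.inter_open hε.1 h0 hε.2.2 (hS.inter hε.2.1)
    have hK' : IsSmoothCurve (S ∩ ε) K := fun c i j =>
      ⟨(hK c i j).1.mono (prod_mono_left inter_subset_left),
        (hK c i j).2.mono (prod_mono_left inter_subset_left)⟩
    obtain ⟨U, hUo, hUc, h0U, hU, hcurve⟩ := exists_hasLagrangianCurve hI' ⟨h0, hε.2.2⟩ hK'
      (fun t ht => einstein_nondegenerate (hne t ht) (hlam t ht.1)) hf hfl
    refine ⟨ε ∩ U, hε.1.inter hUo, hε.2.1.inter hUc, ⟨hε.2.2, h0U⟩, fun hc => ?_, ?_⟩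
    · rw [hcomp hc, hU hc, univ_inter]
    · rw [← inter_assoc]
      exact hcurve.congr fun t ht x v w =>
        form_eq_zero_of_ricciForm (hne t ht.1) (hlam t ht.1.1)
  · exact ⟨univ, isOpen_univ, ordConnected_univ, mem_univ _, fun _ => rfl,
      hasLagrangianCurve_const (fun t ht => hI t ht.1) hf fun p v w =>
        form_eq_zero_of_ricciForm hl0 (hlam 0 h0) (hfl p v w)⟩

end Final

end JMin

end

theorem mainTheorem9 (n : ℕ)
    {M : Type*} [TopologicalSpace M] [T2Space M] [SecondCountableTopology M]
    [ChartedSpace (EuclideanSpace ℝ (Fin (2 * n))) M] [IsManifold (𝓡 (2 * n)) ∞ M]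
    {L : Type*} [TopologicalSpace L] [T2Space L] [CompactSpace L]
    [ChartedSpace (EuclideanSpace ℝ (Fin n)) L] [IsManifold (𝓡 n) ∞ L]
    (K : JMin.KahlerStructure n M) (hK : K.HasDefiniteRicci)
    (f : L → M) (hf : JMin.IsJMinimal K f)
    (I : Set ℝ) (hI : I.OrdConnected) (h0 : (0 : ℝ) ∈ I)
    (Kt : ℝ → JMin.KahlerStructure n M) (hKt : JMin.IsSmoothCurve I Kt) (hKt0 : Kt 0 = K) :
    ((∀ t ∈ I, (Kt t).IsKahlerEinstein) →
      ∃ U : Set ℝ, IsOpen U ∧ U.OrdConnected ∧ (0 : ℝ) ∈ U ∧ (CompactSpace M → U = Set.univ) ∧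
        JMin.HasLagrangianCurve (I ∩ U) (fun t x v w => (Kt t).form x v w) f) ∧
    ((∀ t ∈ I, (Kt t).J = K.J) →
      (∀ t ∈ I, JMin.Cohomologous K.form (Kt t).form) →
      (∀ t ∈ I, (Kt t).HasDefiniteRicci) →
      ∃ U : Set ℝ, IsOpen U ∧ U.OrdConnected ∧ (0 : ℝ) ∈ U ∧ (CompactSpace M → U = Set.univ) ∧
        JMin.HasLagrangianCurve (I ∩ U) (fun t x v w => (Kt t).ricciForm x v w) f) := by
  -- From here on minimality enters only through the vanishing of the pulled back Ricci form.
  have hfl := hf.isLagrangian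
  have hfi := hf.1.1
  subst hKt0
  refine ⟨fun hE => JMin.exists_hasLagrangianCurve_einstein hI h0 hKt hK hE hfi hfl,
    fun _ _ hd => ?_⟩
  rcases JMin.OrdConnected.isInterval_or hI h0 with hS | hS
  · exact JMin.exists_hasLagrangianCurve hS h0 hKt (fun t ht => (hd t ht).nondegenerate) hfi hfl
  · exact ⟨Set.univ, isOpen_univ, Set.ordConnected_univ, Set.mem_univ _, fun _ => rfl,
      JMin.hasLagrangianCurve_const (fun t ht => hS t ht.1) hfi hfl⟩
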